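/- Let $k$ be a field of characteristic different from $2$, let $f=y_1^3+y_1^2y_3-y_2^2y_3$ and $R=k[y_1,y_2,y_3]/(f)$ with its standard grading, the affine cone over the nodal cubic $V(f)\subset\mathbb P^2_k$ with node $s=(0:0:1)$, and let $V(f)_{\mathrm{reg}}=V(f)(k)\setminus\{s\}$. A graded MCM $R$-module $M$ is called locally free if $M_{\mathfrak p}$ is free over $R_{\mathfrak p}$ for every homogeneous prime $\mathfrak p\not\supseteq(y_1,y_2,y_3)$, i.e. if its sheafification on $\operatorname{Proj}R$ is a vector bundle. For $m\ge 1$ put $$\alpha^m_{\psi1}=\begin{pmatrix}0&y_1&y_2&y_3^m&-y_3^m\\ y_1&y_2&0&-y_3^m&y_3^m\\ y_3&0&-y_1-y_3&y_3^m&0\\ 0&0&0&y_1^2+y_1y_3&-y_2y_3\\ 0&0&0&-y_2&y_1\end{pmatrix},\quad \alpha^m_{\psi2}=\begin{pmatrix}0&y_1&y_2&y_3^m&y_3^m\\ y_1&y_2&0&y_3^m&y_3^m\\ y_3&0&-y_1-y_3&-y_3^m&0\\ 0&0&0&y_1^2+y_1y_3&-y_2y_3\\ 0&0&0&-y_2&y_1\end{pmatrix},$$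 $$\alpha^m_{\varphi1}=\begin{pmatrix}0&y_1&y_2&y_3^m&y_3^{m+1}\\ y_1&y_2&0&-y_3^m&-y_3^{m+1}\\ y_3&0&-y_1-y_3&0&y_3^{m+1}\\ 0&0&0&y_1&y_2y_3\\ 0&0&0&y_2&y_1^2+y_1y_3\end{pmatrix},\quad \alpha^m_{\varphi2}=\begin{pmatrix}0&y_1&y_2&y_3^m&-y_3^{m+1}\\ y_1&y_2&0&y_3^m&-y_3^{m+1}\\ y_3&0&-y_1-y_3&0&y_3^{m+1}\\ 0&0&0&y_1&y_2y_3\\ 0&0&0&y_2&y_1^2+y_1y_3\end{pmatrix},$$ for $\lambda=(a:b:1)\in V(f)_{\mathrm{reg}}$ put $$\alpha^\lambda_\psi=\begin{pmatrix}0&y_1&y_2&by_3&-ay_3\\ y_1&y_2&0&-(a+a^2)y_3&by_3\\ y_3&0&-y_1-y_3&ay_3&0\\ 0&0&0&y_1^2+(a+1)y_1y_3+(a^2+a)y_3^2&-y_2y_3-by_3^2\\ 0&0&0&-y_2+by_3&y_1-ay_3\end{pmatrix},$$ and for $\lambda=(0:1:0)$ $$\alpha^\lambda_\psi=\begin{pmatrix}0&y_1&y_2&0&0\\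 y_1&y_2&0&y_2&-y_2\\ y_3&0&-y_1-y_3&0&y_2\\ 0&0&0&y_1^2&-y_2^2\\ 0&0&0&-y_3&y_1+y_3\end{pmatrix}.$$ Regard these matrices as graded maps $\bigoplus_j R(-c_j)\to\bigoplus_i R(-r_i)$ with $r=(1,1,1,m-1,m)$, $c=(2,2,2,m+1,m+1)$ for $\alpha^m_{\psi1},\alpha^m_{\psi2}$; $r=(1,1,1,m,m)$, $c=(2,2,2,m+1,m+2)$ for $\alpha^m_{\varphi1},\alpha^m_{\varphi2}$; and $r=(1,1,1,0,1)$, $c=(2,2,2,2,2)$ for $\alpha^\lambda_\psi$; and their transposes as the dual maps $\bigoplus_i R(r_i)\to\bigoplus_j R(c_j)$. **Theorem.** The cokernels of the matrices $\alpha^m_{\psi1},\alpha^m_{\psi2},\alpha^m_{\varphi1},\alpha^m_{\varphi2}$ ($m\ge1$), $\alpha^\lambda_\psi$ ($\lambda\in V(f)_{\mathrm{reg}}$) and of their transposes are graded, indecomposable, rank-two, non-locally-free MCM $R$-modules with exactly $5$ minimal generators, and each of them is a graded extension of one rank-one graded MCM $R$-module by another. Conversely, every graded, indecomposable, rank-two,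 non-locally-free MCM $R$-module with exactly $5$ minimal generators is isomorphic, as a graded module and up to a shift of the degrees, to one of these cokernels. -/

import Mathlib

open MvPolynomial

universe u v

namespace NodalCone

noncomputable section

section Ring

variable (k : Type u) [Field k]

/-- The equation `f = y₁³ + y₁²y₃ - y₂²y₃` of the nodal cubic (`y₁, y₂, y₃` are
`X 0, X 1, X 2`). -/
def nodePoly : MvPolynomial (Fin 3) k := X 0 ^ 3 + X 0 ^ 2 * X 2 - X 1 ^ 2 * X 2

/-- The affine cone `R = k[y₁, y₂, y₃] / (f)`. -/
abbrev Cone : Type u := MvPolynomial (Fin 3) k ⧸ Ideal.span {nodePoly k}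

/-- The quotient map `k[y₁, y₂, y₃] → R`. -/
abbrev toCone : MvPolynomial (Fin 3) k →+* Cone k := Ideal.Quotient.mk (Ideal.span {nodePoly k})

/-- The homogeneous polynomials of degree `d : ℤ` (only `0` if `d < 0`). -/
def polyDeg (d : ℤ) : AddSubgroup (MvPolynomial (Fin 3) k) :=
  (weightedHomogeneousSubmodule k (fun _ : Fin 3 => (1 : ℤ)) d).toAddSubgroup

/-- The standard grading of `R`: the degree `d` part is the image of the forms of degree `d`. -/
def coneDeg (d : ℤ) : AddSubgroup (Cone k) :=
  (polyDeg k d).map (toCone k).toAddMonoidHom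

/-- The graded maximal ideal `(y₁, y₂, y₃)` of `R`. -/
def irrelevant : Ideal (Cone k) :=
  Ideal.span (Set.range fun i : Fin 3 => toCone k (X i))

end Ring

section Modules

variable {k : Type u} [Field k] {M : Type v} [AddCommGroup M] [Module (Cone k) M]

/-- `𝓜` makes `M` a `ℤ`-graded `R`-module. -/
structure IsGradedModule (𝓜 : ℤ → AddSubgroup M) : Prop where
  smul_mem : ∀ (d n : ℤ) (r : Cone k) (x : M), r ∈ coneDeg k d → x ∈ 𝓜 n → r • x ∈ 𝓜 (d + n)
  isInternal : DirectSum.IsInternal 𝓜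

/-- A submodule is homogeneous if it is generated by homogeneous elements. -/
def IsHomogeneousSubmodule (𝓜 : ℤ → AddSubgroup M) (N : Submodule (Cone k) M) : Prop :=
  N = Submodule.span (Cone k) {x | x ∈ N ∧ ∃ n, x ∈ 𝓜 n}

/-- The grading that a submodule inherits. -/
def subGrading (𝓜 : ℤ → AddSubgroup M) (N : Submodule (Cone k) M) : ℤ → AddSubgroup N :=
  fun n => (𝓜 n).comap N.subtype.toAddMonoidHom

/-- The grading that a quotient inherits. -/
def quotGrading (𝓜 : ℤ → AddSubgroup M) (N : Submodule (Cone k) M) : ℤ → AddSubgroup (M ⧸ N) :=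
  fun n => (𝓜 n).map N.mkQ.toAddMonoidHom

variable (k M) in
/-- `M` is finitely generated and its depth is the Krull dimension of `R`: the graded maximal
ideal contains an `M`-regular sequence of length `dim R` (a longer one never exists). -/
def IsMCM : Prop :=
  Module.Finite (Cone k) M ∧
    ∃ rs : List (Cone k), (∀ r ∈ rs, r ∈ irrelevant k) ∧ RingTheory.Sequence.IsRegular M rs ∧
      (rs.length : WithBot ℕ∞) = ringKrullDim (Cone k)

variable (k) in
/-- `M`, with the grading `𝓜`, is a graded maximal Cohen-Macaulay `R`-module. -/
def IsGradedMCM (𝓜 : ℤ → AddSubgroup M) : Prop :=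
  IsGradedModule (k := k) 𝓜 ∧ IsMCM k M

variable (k) in
/-- `M` is nonzero and not the direct sum of two nonzero graded submodules. -/
def IsIndecomposable (𝓜 : ℤ → AddSubgroup M) : Prop :=
  Nontrivial M ∧ ∀ N P : Submodule (Cone k) M, IsHomogeneousSubmodule 𝓜 N →
    IsHomogeneousSubmodule 𝓜 P → IsCompl N P → N = ⊥ ∨ P = ⊥

variable (k M) in
/-- `M` is free at every point of `Proj R`, that is, at every homogeneous prime ideal of `R` which
does not contain the graded maximal ideal. -/
def IsLocallyFree : Prop :=
  ∀ (p : Ideal (Cone k)) [p.IsPrime], IsHomogeneousSubmodule (coneDeg k) p →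
    ¬ irrelevant k ≤ p → Module.Free (Localization.AtPrime p) (LocalizedModule p.primeCompl M)

variable (k) in
/-- The graded, indecomposable, rank two, non-locally free MCM `R`-modules with exactly five minimal
generators. -/
structure IsTarget (𝓜 : ℤ → AddSubgroup M) : Prop where
  gradedMCM : IsGradedMCM k 𝓜
  indecomposable : IsIndecomposable k 𝓜
  rank_eq : Module.finrank (Cone k) M = 2
  not_locallyFree : ¬ IsLocallyFree k M
  minGenerators : (⊤ : Submodule (Cone k) M).spanFinrank = 5

variable (k) in
/-- `M` is a graded extension `0 → N → M → M / N → 0` of two graded MCM modules of rank one. -/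
def IsExtensionOfRankOne (𝓜 : ℤ → AddSubgroup M) : Prop :=
  ∃ N : Submodule (Cone k) M,
    IsGradedMCM k (subGrading 𝓜 N) ∧ Module.finrank (Cone k) N = 1 ∧
    IsGradedMCM k (quotGrading 𝓜 N) ∧ Module.finrank (Cone k) (M ⧸ N) = 1

variable (k) in
/-- Graded isomorphism up to a shift of the degrees. -/
def IsIsoUpToShift {M' : Type*} [AddCommGroup M'] [Module (Cone k) M']
    (𝓜 : ℤ → AddSubgroup M) (𝓜' : ℤ → AddSubgroup M') : Prop :=
  ∃ (s : ℤ) (e : M ≃ₗ[Cone k] M'), ∀ n, (𝓜 n).map e.toLinearMap.toAddMonoidHom = 𝓜' (n + s)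

end Modules

section Matrices

/-- A `5 × 5` matrix together with the degrees of a graded map
`⨁ⱼ R(-colDeg j) → ⨁ᵢ R(-rowDeg i)`. -/
structure DegMatrix (k : Type u) [Field k] where
  rowDeg : Fin 5 → ℤ
  colDeg : Fin 5 → ℤ
  mat : Matrix (Fin 5) (Fin 5) (MvPolynomial (Fin 3) k)

namespace DegMatrix

variable {k : Type u} [Field k]

/-- The matrix does define a graded map: the entry `(i, j)` is a form of degree
`colDeg j - rowDeg i`. -/
def IsHomogeneous (A : DegMatrix k) : Prop :=
  ∀ i j, A.mat i j ∈ polyDeg k (A.colDeg j - A.rowDeg i)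

/-- The transposed matrix, as the dual graded map `⨁ᵢ R(rowDeg i) → ⨁ⱼ R(colDeg j)`. -/
def transpose (A : DegMatrix k) : DegMatrix k where
  rowDeg := fun j => -A.colDeg j
  colDeg := fun i => -A.rowDeg i
  mat := A.mat.transpose

/-- The cokernel of `R⁵ → R⁵`, `v ↦ A v`. -/
abbrev Coker (A : DegMatrix k) : Type u :=
  (Fin 5 → Cone k) ⧸ LinearMap.range (A.mat.map (toCone k)).mulVecLin

/-- The grading of the cokernel as a quotient of `⨁ᵢ R(-rowDeg i)`. -/
def cokerGrading (A : DegMatrix k) : ℤ → AddSubgroup A.Coker :=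
  quotGrading (fun n => AddSubgroup.pi Set.univ fun i => coneDeg k (n - A.rowDeg i))
    (LinearMap.range (A.mat.map (toCone k)).mulVecLin)

end DegMatrix

variable (k : Type u) [Field k]

local notation "y₁" => (X 0 : MvPolynomial (Fin 3) _)
local notation "y₂" => (X 1 : MvPolynomial (Fin 3) _)
local notation "y₃" => (X 2 : MvPolynomial (Fin 3) _)

/-- The matrix `α^m_{ψ1}`. -/
def alphaPsi1 (m : ℕ) : DegMatrix k where
  rowDeg := ![1, 1, 1, m - 1, m]
  colDeg := ![2, 2, 2, m + 1, m + 1]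
  mat := !![0,  y₁, y₂,        y₃ ^ m,            -y₃ ^ m;
            y₁, y₂, 0,         -y₃ ^ m,           y₃ ^ m;
            y₃, 0,  -y₁ - y₃,  y₃ ^ m,            0;
            0,  0,  0,         y₁ ^ 2 + y₁ * y₃,  -(y₂ * y₃);
            0,  0,  0,         -y₂,               y₁]

/-- The matrix `α^m_{ψ2}`. -/
def alphaPsi2 (m : ℕ) : DegMatrix k where
  rowDeg := ![1, 1, 1, m - 1, m]
  colDeg := ![2, 2, 2, m + 1, m + 1]
  mat := !![0,  y₁, y₂,        y₃ ^ m,            y₃ ^ m;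
            y₁, y₂, 0,         y₃ ^ m,            y₃ ^ m;
            y₃, 0,  -y₁ - y₃,  -y₃ ^ m,           0;
            0,  0,  0,         y₁ ^ 2 + y₁ * y₃,  -(y₂ * y₃);
            0,  0,  0,         -y₂,               y₁]

/-- The matrix `α^m_{φ1}`. -/
def alphaPhi1 (m : ℕ) : DegMatrix k where
  rowDeg := ![1, 1, 1, m, m]
  colDeg := ![2, 2, 2, m + 1, m + 2]
  mat := !![0,  y₁, y₂,        y₃ ^ m,   y₃ ^ (m + 1);
            y₁, y₂, 0,         -y₃ ^ m,  -y₃ ^ (m + 1);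
            y₃, 0,  -y₁ - y₃,  0,        y₃ ^ (m + 1);
            0,  0,  0,         y₁,       y₂ * y₃;
            0,  0,  0,         y₂,       y₁ ^ 2 + y₁ * y₃]

/-- The matrix `α^m_{φ2}`. -/
def alphaPhi2 (m : ℕ) : DegMatrix k where
  rowDeg := ![1, 1, 1, m, m]
  colDeg := ![2, 2, 2, m + 1, m + 2]
  mat := !![0,  y₁, y₂,        y₃ ^ m,   -y₃ ^ (m + 1);
            y₁, y₂, 0,         y₃ ^ m,   -y₃ ^ (m + 1);
            y₃, 0,  -y₁ - y₃,  0,        y₃ ^ (m + 1);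
            0,  0,  0,         y₁,       y₂ * y₃;
            0,  0,  0,         y₂,       y₁ ^ 2 + y₁ * y₃]

/-- The matrix `α_ψ^λ` for `λ = (a : b : 1)`. -/
def alphaPsiAffine (a b : k) : DegMatrix k where
  rowDeg := ![1, 1, 1, 0, 1]
  colDeg := ![2, 2, 2, 2, 2]
  mat := !![0,  y₁, y₂,        C b * y₃,               -(C a * y₃);
            y₁, y₂, 0,         -(C (a + a ^ 2) * y₃),  C b * y₃;
            y₃, 0,  -y₁ - y₃,  C a * y₃,               0;
            0,  0,  0,         y₁ ^ 2 + C (a + 1) * y₁ * y₃ + C (a ^ 2 + a) * y₃ ^ 2,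
                                                       -(y₂ * y₃) - C b * y₃ ^ 2;
            0,  0,  0,         -y₂ + C b * y₃,         y₁ - C a * y₃]

/-- The matrix `α_ψ^λ` for `λ = (0 : 1 : 0)`. -/
def alphaPsiInfinity : DegMatrix k where
  rowDeg := ![1, 1, 1, 0, 1]
  colDeg := ![2, 2, 2, 2, 2]
  mat := !![0,  y₁, y₂,        0,       0;
            y₁, y₂, 0,         y₂,      -y₂;
            y₃, 0,  -y₁ - y₃,  0,       y₂;
            0,  0,  0,         y₁ ^ 2,  -y₂ ^ 2;
            0,  0,  0,         -y₃,     y₁ + y₃]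

variable {k} in
/-- The listed matrices. The points `λ` run over the regular points of the curve `V(f)`: these are
the `(a : b : 1)` with `a³ + a² = b²` other than the node `(0 : 0 : 1)`, and `(0 : 1 : 0)`. -/
inductive IsListed : DegMatrix k → Prop
  | psi1 (m : ℕ) (hm : 1 ≤ m) : IsListed (alphaPsi1 k m)
  | psi2 (m : ℕ) (hm : 1 ≤ m) : IsListed (alphaPsi2 k m)
  | phi1 (m : ℕ) (hm : 1 ≤ m) : IsListed (alphaPhi1 k m)
  | phi2 (m : ℕ) (hm : 1 ≤ m) : IsListed (alphaPhi2 k m)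
  | affinePoint (a b : k) (hab : a ^ 3 + a ^ 2 - b ^ 2 = 0) (hreg : (a, b) ≠ (0, 0)) :
      IsListed (alphaPsiAffine k a b)
  | infinitePoint : IsListed (alphaPsiInfinity k)

variable {k} in
/-- The listed matrices and their transposes. -/
def IsListedOrTranspose (A : DegMatrix k) : Prop :=
  IsListed A ∨ ∃ B : DegMatrix k, IsListed B ∧ A = B.transpose

end Matrices

end

end NodalCone

namespace NodalCone

noncomputable section

open MvPolynomial

variable {k : Type u} [Field k]

local notation "𝕥" => (Polynomial.X : Polynomial _)
local notation "𝐂" => (LaurentPolynomial.C : Polynomial _ →+* LaurentPolynomial (Polynomial _))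
local notation "𝐓" => (LaurentPolynomial.T : ℤ → LaurentPolynomial (Polynomial _))

/-! ### The parametrization of the nodal cubic -/

/-! Everything is computed on the normalization of the nodal curve. The substitution y₁ = (t²-1)T,
y₂ = t(t²-1)T, y₃ = T embeds R into k[t][T,T⁻¹]. The degree d part of R becomes the space of
polynomials in t of degree at most 3d with equal values at 1 and -1, the two points over the node;
they are distinct because 2 ≠ 0. A torsion-free graded module of rank two becomes a family of
subspaces F n of k[t]² (`Realizes`), and the proof is linear algebra with such families.

The central objects are the strings (`IsString`): pairs (v₁, v₂) with deg vᵢ ≤ 3n + dᵢ and the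
single gluing condition v₁(ε) = v₂(-ε), where ε = ±1. A string is MCM of rank two, and one of its
coordinates presents it as an extension of rank-one MCM modules. Its graded endomorphisms are a
scalar plus a nilpotent matrix, so it is indecomposable. Its fibre at the node has dimension three,
so it is not locally free. The direct part of the theorem therefore reduces to showing that the
listed cokernels are strings. For this each matrix A is completed to a factorization AB = f·1 in
which B splits over k[t] into two matrices of rank one; this identifies the relations between
explicit generators (`Factorization.ker_le_range`), and polynomial division shows that these vectors
generate the whole string. The cokernels of all α^λ_ψ realize the string with ε = 1 and d₁ = d₂ = 0,
which is also that of α^1_{ψ1}; hence the points λ do not enter the converse.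

For the converse, depth two makes a graded MCM module torsion-free, by way of the subring k[y₂, y₃]
(`IsGradedMCM.eq_zero_of_smul`), so a module of rank two embeds into k[t][T,T⁻¹]². The largest
subfamily stable under multiplication by t (`core`) is a vector bundle on the projective line and
splits (`IsBundle.exists_splitting`). Since t²-1 carries the module into this bundle, the module is
recovered from two degree bounds and a subspace W of k² × k² of admissible values at 1 and -1, on
which both projections to k² are injective (`IsGradedMCM.exists_gluedSet`). If dim W = 0 the module
decomposes. If dim W = 2, W is the graph of an isomorphism and the module is locally free. If dim W
= 1, automorphisms of the bundle bring the line W to a normal form, which is either decomposable or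
a string.

Finally generators are counted. With d₂ ≤ d₁, the residues of d₁ and d₂ modulo 3 decide: some pairs
allow at most four generators, one forces at least six, and the four remaining pairs are the strings
of the ψ- and φ-matrices and of their transposes. -/

/-- The polynomials in one variable of degree at most `d : ℤ` (only `0` if `d < 0`). -/
def polyLE (k : Type u) [Field k] (d : ℤ) : Submodule k (Polynomial k) where
  carrier := {p | ∀ i : ℕ, d < i → p.coeff i = 0}
  add_mem' := by
    intro p q hp hq i hi
    simp [hp i hi, hq i hi]
  zero_mem' := by simp
  smul_mem' := by
    intro c p hp i hi
    simp [hp i hi]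

lemma mem_polyLE_iff_natDegree {d : ℤ} {p : Polynomial k} (hp : p ≠ 0) :
    p ∈ polyLE k d ↔ (p.natDegree : ℤ) ≤ d := by
  constructor
  · intro h
    by_contra! hd
    exact hp (Polynomial.leadingCoeff_eq_zero.1 (h _ hd))
  · intro h i hi
    exact Polynomial.coeff_eq_zero_of_natDegree_lt (by omega)

lemma mem_polyLE_natDegree (p : Polynomial k) : p ∈ polyLE k p.natDegree := by
  intro i hi
  exact Polynomial.coeff_eq_zero_of_natDegree_lt (by omega)

lemma mem_polyLE_of_natDegree_le {d : ℤ} {p : Polynomial k} (h : (p.natDegree : ℤ) ≤ d) :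
    p ∈ polyLE k d := by
  intro i hi
  exact Polynomial.coeff_eq_zero_of_natDegree_lt (by omega)

lemma polyLE_mono {d e : ℤ} (h : d ≤ e) : polyLE k d ≤ polyLE k e :=
  fun _ hp i hi => hp i (by omega)

lemma eq_zero_of_mem_polyLE_neg {d : ℤ} {p : Polynomial k} (hp : p ∈ polyLE k d) (hd : d < 0) :
    p = 0 := by
  ext i
  exact hp i (by omega)

lemma mul_mem_polyLE {a b : ℤ} {p q : Polynomial k} (hp : p ∈ polyLE k a) (hq : q ∈ polyLE k b) :
    p * q ∈ polyLE k (a + b) := by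
  by_cases h0 : p = 0
  · simp [h0]
  by_cases h1 : q = 0
  · simp [h1]
  rw [mem_polyLE_iff_natDegree (mul_ne_zero h0 h1), Polynomial.natDegree_mul h0 h1]
  rw [mem_polyLE_iff_natDegree h0] at hp
  rw [mem_polyLE_iff_natDegree h1] at hq
  push_cast
  omega

lemma mul_mem_polyLE' {a b c : ℤ} {p q : Polynomial k} (hp : p ∈ polyLE k a) (hq : q ∈ polyLE k b)
    (h : a + b ≤ c) : p * q ∈ polyLE k c :=
  polyLE_mono h (mul_mem_polyLE hp hq)

lemma mem_polyLE_of_mul_mem {d e : ℤ} {p q : Polynomial k} (hq : q ≠ 0) (hqe : e ≤ q.natDegree)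
    (h : q * p ∈ polyLE k (d + e)) : p ∈ polyLE k d := by
  by_cases h0 : p = 0
  · simp [h0]
  rw [mem_polyLE_iff_natDegree h0]
  rw [mem_polyLE_iff_natDegree (mul_ne_zero hq h0), Polynomial.natDegree_mul hq h0] at h
  push_cast at h
  omega

lemma C_mem_polyLE (c : k) {d : ℤ} (hd : 0 ≤ d) : Polynomial.C c ∈ polyLE k d :=
  mem_polyLE_of_natDegree_le (by simpa using hd)

lemma one_mem_polyLE {d : ℤ} (hd : 0 ≤ d) : (1 : Polynomial k) ∈ polyLE k d :=
  mem_polyLE_of_natDegree_le (by simpa using hd)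

lemma X_mem_polyLE {d : ℤ} (hd : 1 ≤ d) : (𝕥 : Polynomial k) ∈ polyLE k d :=
  mem_polyLE_of_natDegree_le (by simpa using hd)

lemma X_pow_mem_polyLE (n : ℕ) {d : ℤ} (hd : n ≤ d) : (𝕥 ^ n : Polynomial k) ∈ polyLE k d :=
  mem_polyLE_of_natDegree_le (by simpa using hd)

/-- The polynomial `t² - 1`, whose zeros are the two preimages of the node. -/
def zz (k : Type u) [Field k] : Polynomial k := 𝕥 ^ 2 - 1

lemma natDegree_zz : (zz k).natDegree = 2 := by
  have : zz k = 𝕥 ^ 2 - Polynomial.C 1 := by simp [zz]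
  rw [this, Polynomial.natDegree_X_pow_sub_C]

lemma zz_monic : (zz k).Monic := by
  have : zz k = 𝕥 ^ 2 - Polynomial.C 1 := by simp [zz]
  rw [this]
  exact Polynomial.monic_X_pow_sub_C _ (by norm_num)

lemma zz_ne_zero : zz k ≠ 0 := zz_monic.ne_zero

lemma zz_mem_polyLE {d : ℤ} (hd : 2 ≤ d) : zz k ∈ polyLE k d :=
  mem_polyLE_of_natDegree_le (by rw [natDegree_zz]; exact hd)

@[simp] lemma eval_one_zz : (zz k).eval 1 = 0 := by simp [zz]
@[simp] lemma eval_neg_one_zz : (zz k).eval (-1) = 0 := by simp [zz]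

/-- The ring `k[t][T, T⁻¹]`, into which the affine cone over the nodal cubic embeds. -/
abbrev Param (k : Type u) [Field k] : Type u := LaurentPolynomial (Polynomial k)

/-- The substitution `y₁ = t² - 1`, `y₂ = t (t² - 1)`, `y₃ = 1`. -/
def dehom (k : Type u) [Field k] : MvPolynomial (Fin 3) k →ₐ[k] Polynomial k :=
  aeval ![zz k, 𝕥 * zz k, 1]

/-- The graded substitution `y₁ = (t² - 1) T`, `y₂ = t (t² - 1) T`, `y₃ = T`. -/
def polyParam (k : Type u) [Field k] : MvPolynomial (Fin 3) k →ₐ[k] Param k :=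
  aeval ![𝐂 (zz k) * 𝐓 1, 𝐂 (𝕥 * zz k) * 𝐓 1, 𝐓 1]

@[simp] lemma dehom_X0 : dehom k (X 0) = zz k := by simp [dehom]
@[simp] lemma dehom_X1 : dehom k (X 1) = 𝕥 * zz k := by simp [dehom]
@[simp] lemma dehom_X2 : dehom k (X 2) = 1 := by simp [dehom]
@[simp] lemma dehom_C (c : k) : dehom k (C c) = Polynomial.C c := by
  simp [dehom]
@[simp] lemma polyParam_X0 : polyParam k (X 0) = 𝐂 (zz k) * 𝐓 1 := by simp [polyParam]
@[simp] lemma polyParam_X1 : polyParam k (X 1) = 𝐂 (𝕥 * zz k) * 𝐓 1 := by simp [polyParam]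
@[simp] lemma polyParam_X2 : polyParam k (X 2) = 𝐓 1 := by simp [polyParam]
@[simp] lemma polyParam_C (c : k) : polyParam k (C c) = 𝐂 (Polynomial.C c) := by
  simp only [polyParam, algHom_C]
  rfl

lemma polyParam_nodePoly : polyParam k (nodePoly k) = 0 := by
  have h : zz k ^ 3 + zz k ^ 2 - (𝕥 * zz k) ^ 2 = 0 := by simp only [zz]; ring
  have h' : 𝐂 (zz k) ^ 3 + 𝐂 (zz k) ^ 2 - (𝐂 (𝕥 * zz k)) ^ 2 = 0 := by
    simp only [← map_pow, ← map_add, ← map_sub, h, map_zero]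
  simp only [nodePoly, map_sub, map_add, map_mul, map_pow, polyParam_X0, polyParam_X1,
    polyParam_X2] at h' ⊢
  linear_combination h' * (𝐓 1) ^ 3

/-- The embedding of the cone into `k[t][T, T⁻¹]`. -/
def toParam (k : Type u) [Field k] : Cone k →+* Param k :=
  Ideal.Quotient.lift _ (polyParam k).toRingHom (by
    intro a ha
    obtain ⟨b, rfl⟩ := Ideal.mem_span_singleton'.1 ha
    simp [polyParam_nodePoly])

@[simp] lemma toParam_toCone (F : MvPolynomial (Fin 3) k) :
    toParam k (toCone k F) = polyParam k F := by
  simp [toParam]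

instance : Algebra (Cone k) (Param k) := (toParam k).toAlgebra

lemma cone_smul_def (r : Cone k) (x : Param k) : r • x = toParam k r * x := rfl

/-- A form contributes a single power of T, so identities between forms can be checked on their
dehomogenizations in k[t]. -/
lemma polyParam_of_mem_polyDeg {d : ℤ} {F : MvPolynomial (Fin 3) k} (hF : F ∈ polyDeg k d) :
    polyParam k F = 𝐂 (dehom k F) * 𝐓 d := by
  have hF' : IsWeightedHomogeneous (fun _ : Fin 3 => (1 : ℤ)) F d := hF
  rw [polyParam, dehom, aeval_def, aeval_def, eval₂_eq', eval₂_eq', map_sum, Finset.sum_mul]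
  refine Finset.sum_congr rfl fun m hm => ?_
  have hw := hF' (mem_support_iff.1 hm)
  rw [Finsupp.weight_apply, Finsupp.sum_fintype _ _ (by simp)] at hw
  simp only [Fin.sum_univ_three, nsmul_eq_mul, mul_one] at hw
  rw [← hw]
  simp only [Fin.prod_univ_three, LaurentPolynomial.T_add, map_mul, map_pow]
  simp only [Matrix.cons_val_zero, Matrix.cons_val_one, Matrix.cons_val, mul_pow,
    LaurentPolynomial.T_pow, map_one, one_pow, mul_one]
  have : (algebraMap k (Param k)) (coeff m F) = 𝐂 ((algebraMap k (Polynomial k)) (coeff m F)) := rfl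
  rw [this, map_mul, mul_pow]
  ring

/-! ### The graded pieces of the cone as spaces of polynomials. -/

/-- The polynomials of degree at most `3 d` with the same value at `1` and `-1`: the degree `d` part
of the cone. -/
def nodeLE (k : Type u) [Field k] (d : ℤ) : Submodule k (Polynomial k) where
  carrier := {p | p ∈ polyLE k (3 * d) ∧ p.eval 1 = p.eval (-1)}
  add_mem' := by
    rintro p q ⟨hp, hp'⟩ ⟨hq, hq'⟩
    exact ⟨add_mem hp hq, by simp [hp', hq']⟩
  zero_mem' := ⟨zero_mem _, by simp⟩
  smul_mem' := by
    rintro c p ⟨hp, hp'⟩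
    exact ⟨Submodule.smul_mem _ _ hp, by simp [hp']⟩

lemma dehom_mem_nodeLE {d : ℤ} {F : MvPolynomial (Fin 3) k} (hF : F ∈ polyDeg k d) :
    dehom k F ∈ nodeLE k d := by
  have hF' : IsWeightedHomogeneous (fun _ : Fin 3 => (1 : ℤ)) F d := hF
  rw [dehom, aeval_def, eval₂_eq']
  refine Submodule.sum_mem _ fun m hm => ?_
  have hw := hF' (mem_support_iff.1 hm)
  rw [Finsupp.weight_apply, Finsupp.sum_fintype _ _ (by simp)] at hw
  simp only [Fin.sum_univ_three, nsmul_eq_mul, mul_one] at hw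
  simp only [Fin.prod_univ_three, Matrix.cons_val_zero, Matrix.cons_val_one, Matrix.cons_val,
    one_pow, mul_one, Polynomial.algebraMap_eq]
  rw [← Polynomial.smul_eq_C_mul]
  refine Submodule.smul_mem _ _ ⟨mem_polyLE_of_natDegree_le ?_, ?_⟩
  -- The monomial y₁^a y₂^b y₃^c has degree 2a + 3b ≤ 3(a + b + c) in t. Its values at 1 and -1
  -- agree because t² - 1 vanishes at both.
  · have h1 : (zz k ^ m 0 * (𝕥 * zz k) ^ m 1).natDegree ≤ m 0 * 2 + m 1 * 3 := by
      refine Polynomial.natDegree_mul_le_of_le ?_ ?_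
      · exact Polynomial.natDegree_pow_le_of_le _ natDegree_zz.le
      · refine Polynomial.natDegree_pow_le_of_le _ ?_
        exact (Polynomial.natDegree_mul_le_of_le Polynomial.natDegree_X_le natDegree_zz.le)
    omega
  · simp only [Polynomial.eval_mul, Polynomial.eval_pow, eval_one_zz, eval_neg_one_zz, mul_zero]

lemma toParam_of_mem_coneDeg {d : ℤ} {r : Cone k} (hr : r ∈ coneDeg k d) :
    ∃ p ∈ nodeLE k d, toParam k r = 𝐂 p * 𝐓 d := by
  obtain ⟨F, hF, rfl⟩ := hr
  exact ⟨dehom k F, dehom_mem_nodeLE hF,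
    (toParam_toCone F).trans (polyParam_of_mem_polyDeg hF)⟩

lemma mul_mem_coneDeg {a b : ℤ} {r s : Cone k} (hr : r ∈ coneDeg k a) (hs : s ∈ coneDeg k b) :
    r * s ∈ coneDeg k (a + b) := by
  obtain ⟨F, hF, rfl⟩ := hr
  obtain ⟨G, hG, rfl⟩ := hs
  refine ⟨F * G, ?_, map_mul (toCone k) F G⟩
  exact IsWeightedHomogeneous.mul (w := fun _ : Fin 3 => (1 : ℤ)) hF hG

lemma X_mem_polyDeg (i : Fin 3) : (X i : MvPolynomial (Fin 3) k) ∈ polyDeg k 1 :=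
  isWeightedHomogeneous_X k (fun _ : Fin 3 => (1 : ℤ)) i

lemma C_mem_polyDeg (c : k) : (C c : MvPolynomial (Fin 3) k) ∈ polyDeg k 0 :=
  isWeightedHomogeneous_C (fun _ : Fin 3 => (1 : ℤ)) c

lemma X_mem_coneDeg (i : Fin 3) : toCone k (X i) ∈ coneDeg k 1 := ⟨X i, X_mem_polyDeg i, rfl⟩

lemma C_mem_coneDeg (c : k) : toCone k (C c) ∈ coneDeg k 0 := ⟨C c, C_mem_polyDeg c, rfl⟩

lemma one_mem_coneDeg : (1 : Cone k) ∈ coneDeg k 0 := by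
  simpa using C_mem_coneDeg (1 : k)

lemma pow_mem_coneDeg {a : ℤ} {r : Cone k} (hr : r ∈ coneDeg k a) (n : ℕ) :
    r ^ n ∈ coneDeg k (n * a) := by
  induction n with
  | zero => simpa using one_mem_coneDeg
  | succ n ih =>
    rw [pow_succ]
    have := mul_mem_coneDeg ih hr
    convert this using 1
    push_cast
    ring_nf

/-- Every form of degree at most `3 d - 2`, multiplied by `t² - 1`, lies in the cone. -/
lemma exists_coneDeg_zz_mul (n : ℕ) (w : Polynomial k) (hw : w ∈ polyLE k (3 * n + 1)) :
    ∃ r ∈ coneDeg k (n + 1), toParam k r = 𝐂 (zz k * w) * 𝐓 (n + 1) := by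
  classical
  -- the set of admissible `w` is closed under addition and multiplication by constants
  have hadd : ∀ (n : ℕ) (w₁ w₂ : Polynomial k),
      (∃ r ∈ coneDeg k (n + 1), toParam k r = 𝐂 (zz k * w₁) * 𝐓 (n + 1)) →
      (∃ r ∈ coneDeg k (n + 1), toParam k r = 𝐂 (zz k * w₂) * 𝐓 (n + 1)) →
      (∃ r ∈ coneDeg k (n + 1), toParam k r = 𝐂 (zz k * (w₁ + w₂)) * 𝐓 (n + 1)) := by
    rintro n w₁ w₂ ⟨r, hr, hr'⟩ ⟨s, hs, hs'⟩
    exact ⟨r + s, add_mem hr hs, by rw [map_add, hr', hs', mul_add, map_add, add_mul]⟩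
  have hsmul : ∀ (n : ℕ) (c : k) (w : Polynomial k),
      (∃ r ∈ coneDeg k (n + 1), toParam k r = 𝐂 (zz k * w) * 𝐓 (n + 1)) →
      (∃ r ∈ coneDeg k (n + 1), toParam k r = 𝐂 (zz k * (Polynomial.C c * w)) * 𝐓 (n + 1)) := by
    rintro n c w ⟨r, hr, hr'⟩
    refine ⟨toCone k (C c) * r, by simpa using mul_mem_coneDeg (C_mem_coneDeg c) hr, ?_⟩
    rw [map_mul, hr', toParam_toCone, polyParam_C]
    simp only [map_mul]
    ring
  have hmul : ∀ (n : ℕ) (s : Cone k) (q w w' : Polynomial k), s ∈ coneDeg k 1 →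
      toParam k s = 𝐂 q * 𝐓 1 → w' = q * w →
      (∃ r ∈ coneDeg k (n + 1), toParam k r = 𝐂 (zz k * w) * 𝐓 (n + 1)) →
      (∃ r ∈ coneDeg k ((n + 1 : ℕ) + 1), toParam k r =
        𝐂 (zz k * w') * 𝐓 ((n + 1 : ℕ) + 1)) := by
    rintro n s q w _ hs hq rfl ⟨r, hr, hr'⟩
    refine ⟨r * s, by simpa using mul_mem_coneDeg hr hs, ?_⟩
    rw [map_mul, hr', hq]
    simp only [map_mul, LaurentPolynomial.T_add, Nat.cast_add, Nat.cast_one]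
    ring
  have h3 : ∀ (n : ℕ) (w : Polynomial k), (∃ r ∈ coneDeg k (n + 1), toParam k r = 𝐂 (zz k * w) * 𝐓 (n + 1)) →
      (∃ r ∈ coneDeg k ((n + 1 : ℕ) + 1), toParam k r =
        𝐂 (zz k * w) * 𝐓 ((n + 1 : ℕ) + 1)) := fun n w =>
    hmul n (toCone k (X 2)) 1 w w (X_mem_coneDeg 2) (by simp) (by simp)
  have key : ∀ (n j : ℕ), j ≤ 3 * n + 1 →
      ∃ r ∈ coneDeg k (n + 1), toParam k r = 𝐂 (zz k * 𝕥 ^ j) * 𝐓 (n + 1) := by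
    intro n
    induction n with
    | zero =>
      intro j hj
      interval_cases j
      · exact ⟨toCone k (X 0), by simpa using X_mem_coneDeg 0, by rw [toParam_toCone]; simp⟩
      · exact ⟨toCone k (X 1), by simpa using X_mem_coneDeg 1, by
          rw [toParam_toCone, polyParam_X1, mul_comm 𝕥]; simp⟩
    | succ n ih =>
      intro j hj
      by_cases hj1 : j ≤ 3 * n + 1
      · exact h3 n _ (ih j hj1)
      -- multiplication by `y₁` and by `y₂` raises the degree
      have h1 : ∀ i, i ≤ 3 * n + 1 → (∃ r ∈ coneDeg k ((n + 1 : ℕ) + 1), toParam k r =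
          𝐂 (zz k * 𝕥 ^ i) * 𝐓 ((n + 1 : ℕ) + 1)) →
          ∃ r ∈ coneDeg k ((n + 1 : ℕ) + 1), toParam k r =
          𝐂 (zz k * 𝕥 ^ (i + 2)) * 𝐓 ((n + 1 : ℕ) + 1) := by
        intro i hi h
        have := hadd _ _ _ (hmul n (toCone k (X 0)) (zz k) (𝕥 ^ i) _ (X_mem_coneDeg 0) (by simp) rfl
          (ih i hi)) h
        convert this using 6
        simp only [zz]
        ring
      -- Only three exponents are new in this degree. The first two come from y₁ and y₃; the last
      -- one needs y₂, through t^(3n+4) = t(t²-1)·t^(3n+1) + t^(3n+2).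
      obtain rfl | rfl | rfl : j = 3 * n + 2 ∨ j = 3 * n + 3 ∨ j = 3 * n + 4 := by omega
      · exact h1 (3 * n) (by omega) (h3 n _ (ih (3 * n) (by omega)))
      · exact h1 (3 * n + 1) (by omega) (h3 n _ (ih (3 * n + 1) (by omega)))
      · have h2 := hmul n (toCone k (X 1)) (𝕥 * zz k) (𝕥 ^ (3 * n + 1)) _ (X_mem_coneDeg 1) (by simp)
          rfl (ih _ le_rfl)
        have := hadd _ _ _ h2 (h1 (3 * n) (by omega) (h3 n _ (ih (3 * n) (by omega))))
        convert this using 6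
        simp only [zz]
        ring_nf
  rw [w.as_sum_range_C_mul_X_pow]
  have : ∀ N : ℕ, ∃ r ∈ coneDeg k (n + 1), toParam k r =
      𝐂 (zz k * ∑ i ∈ Finset.range N, Polynomial.C (w.coeff i) * 𝕥 ^ i) * 𝐓 (n + 1) := by
    intro N
    induction N with
    | zero => exact ⟨0, zero_mem _, by simp⟩
    | succ N ih =>
      rw [Finset.sum_range_succ]
      refine hadd _ _ _ ih ?_
      by_cases hN : N ≤ 3 * n + 1
      · exact hsmul _ _ _ (key n N hN)
      · rw [hw N (by omega)]
        exact ⟨0, zero_mem _, by simp⟩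
  exact this _

/-- Characteristic different from 2 enters here: the points 1 and -1 over the node are distinct, so
a polynomial that vanishes at both is divisible by t² - 1. -/
lemma exists_eq_add_zz_mul (hk : (2 : k) ≠ 0) (p : Polynomial k) (hp : p.eval 1 = p.eval (-1)) :
    ∃ w, p = Polynomial.C (p.eval 1) + zz k * w := by
  have h1 : (p - Polynomial.C (p.eval 1)).IsRoot 1 := by simp
  obtain ⟨q, hq⟩ := Polynomial.dvd_iff_isRoot.2 h1
  have h2 : q.eval (-1) = 0 := by
    have := congrArg (Polynomial.eval (-1)) hq
    simp only [Polynomial.eval_sub, Polynomial.eval_C, Polynomial.eval_mul, Polynomial.eval_X, hp,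
      sub_self] at this
    have h3 : (-1 - 1 : k) ≠ 0 := by
      intro h
      apply hk
      linear_combination -h
    exact (mul_eq_zero.1 this.symm).resolve_left h3
  obtain ⟨w, hw⟩ := Polynomial.dvd_iff_isRoot.2 h2
  refine ⟨w, ?_⟩
  rw [hw] at hq
  simp only [map_one, map_neg] at hq
  simp only [zz]
  linear_combination hq

/-- The common value at the two points is supplied by a multiple of y₃^d. What remains is divisible
by t² - 1, and all such multiples of the allowed degree lie in the cone. Together with
`dehom_mem_nodeLE` this makes `nodeLE` an exact description of the graded pieces. -/
lemma exists_coneDeg_of_mem_nodeLE (hk : (2 : k) ≠ 0) {d : ℤ} {p : Polynomial k}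
    (hp : p ∈ nodeLE k d) : ∃ r ∈ coneDeg k d, toParam k r = 𝐂 p * 𝐓 d := by
  rcases lt_trichotomy d 0 with hd | rfl | hd
  · rw [eq_zero_of_mem_polyLE_neg hp.1 (by omega)]
    exact ⟨0, zero_mem _, by simp⟩
  · refine ⟨toCone k (C (p.coeff 0)), C_mem_coneDeg _, ?_⟩
    have : p = Polynomial.C (p.coeff 0) := by
      ext i
      rcases i with _ | i
      · simp
      · rw [Polynomial.coeff_C_succ]
        exact hp.1 _ (by push_cast; omega)
    rw [toParam_toCone, polyParam_C, ← this]
    simp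
  · obtain ⟨n, rfl⟩ : ∃ n : ℕ, d = n + 1 := ⟨(d - 1).toNat, by omega⟩
    obtain ⟨w, hw⟩ := exists_eq_add_zz_mul hk p hp.2
    have hw' : w ∈ polyLE k (3 * n + 1) := by
      refine mem_polyLE_of_mul_mem (q := zz k) (e := 2) zz_ne_zero (by simp [natDegree_zz]) ?_
      have : zz k * w = p - Polynomial.C (p.eval 1) := by linear_combination -hw
      rw [this]
      refine sub_mem (polyLE_mono (by omega) hp.1) (C_mem_polyLE _ (by omega))
    obtain ⟨r, hr, hr'⟩ := exists_coneDeg_zz_mul n w hw'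
    refine ⟨toCone k (C (p.eval 1)) * toCone k (X 2) ^ (n + 1) + r, add_mem ?_ hr, ?_⟩
    · have := mul_mem_coneDeg (C_mem_coneDeg (p.eval 1)) (pow_mem_coneDeg (X_mem_coneDeg 2) (n + 1))
      simpa using this
    · rw [map_add, hr', map_mul, map_pow, toParam_toCone, toParam_toCone, polyParam_C, polyParam_X2,
        LaurentPolynomial.T_pow]
      have := congrArg (fun q => 𝐂 q * 𝐓 (n + 1)) hw
      simp only [map_add, add_mul] at this
      rw [this]
      simp

section

/-! ### The cone as a graded domain -/

lemma toCone_X0_pow_three :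
    toCone k (X 0) ^ 3 = toCone k (X 1) ^ 2 * toCone k (X 2) - toCone k (X 0) ^ 2 * toCone k (X 2) := by
  have h : toCone k (nodePoly k) = 0 :=
    Ideal.Quotient.eq_zero_iff_mem.2 (Ideal.mem_span_singleton_self _)
  simp only [nodePoly, map_sub, map_add, map_mul, map_pow] at h
  linear_combination h

/-- Every element of the cone is represented by a polynomial of degree at most two in `y₁`. -/
lemma exists_reduced (F : MvPolynomial (Fin 3) k) :
    ∃ G : MvPolynomial (Fin 3) k, (∀ m ∈ G.support, m 0 ≤ 2) ∧ toCone k F = toCone k G := by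
  classical
  have hadd : ∀ F₁ F₂ : MvPolynomial (Fin 3) k,
      (∃ G : MvPolynomial (Fin 3) k, (∀ m ∈ G.support, m 0 ≤ 2) ∧ toCone k F₁ = toCone k G) →
      (∃ G : MvPolynomial (Fin 3) k, (∀ m ∈ G.support, m 0 ≤ 2) ∧ toCone k F₂ = toCone k G) →
      (∃ G : MvPolynomial (Fin 3) k, (∀ m ∈ G.support, m 0 ≤ 2) ∧
        toCone k (F₁ + F₂) = toCone k G) := by
    rintro F₁ F₂ ⟨G₁, h₁, e₁⟩ ⟨G₂, h₂, e₂⟩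
    refine ⟨G₁ + G₂, fun m hm => ?_, by rw [map_add, map_add, e₁, e₂]⟩
    rcases Finset.mem_union.1 (support_add hm) with h | h
    exacts [h₁ m h, h₂ m h]
  have key : ∀ (a b c : ℕ) (r : k), ∃ G : MvPolynomial (Fin 3) k, (∀ m ∈ G.support, m 0 ≤ 2) ∧
      toCone k (C r * (X 0 ^ a * X 1 ^ b * X 2 ^ c)) = toCone k G := by
    intro a
    induction a using Nat.strong_induction_on with
    | _ a ih =>
      intro b c r
      by_cases ha : a ≤ 2
      · refine ⟨_, fun m hm => ?_, rfl⟩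
        have : (C r * (X 0 ^ a * X 1 ^ b * X 2 ^ c) : MvPolynomial (Fin 3) k) =
            monomial (Finsupp.single 0 a + Finsupp.single 1 b + Finsupp.single 2 c) r := by
          simp only [X_pow_eq_monomial, monomial_mul, C_mul_monomial, mul_one]
        rw [this] at hm
        have := Finset.mem_singleton.1 (support_monomial_subset hm)
        subst this
        simpa using ha
      · obtain ⟨a', rfl⟩ : ∃ a', a = a' + 3 := ⟨a - 3, by omega⟩
        have := hadd _ _ (ih a' (by omega) (b + 2) (c + 1) r) (ih (a' + 2) (by omega) b (c + 1) (-r))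
        obtain ⟨G, hG, e⟩ := this
        refine ⟨G, hG, e ▸ ?_⟩
        simp only [map_mul, map_add, map_pow, map_neg]
        linear_combination (toCone k (C r) * toCone k (X 0) ^ a' * toCone k (X 1) ^ b *
          toCone k (X 2) ^ c) * toCone_X0_pow_three (k := k)
  induction F using MvPolynomial.induction_on' with
  | monomial m r =>
    have := key (m 0) (m 1) (m 2) r
    convert this using 5
    rw [monomial_eq, Finsupp.prod_fintype _ _ (by simp), Fin.prod_univ_three]
  | add p q hp hq => exact hadd p q hp hq

lemma polyParam_monomial (m : Fin 3 →₀ ℕ) (r : k) :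
    polyParam k (monomial m r) = 𝐂 (Polynomial.C r * (zz k ^ m 0 * (𝕥 * zz k) ^ m 1)) *
      𝐓 (m 0 + m 1 + m 2) := by
  rw [monomial_eq, Finsupp.prod_fintype _ _ (by simp), Fin.prod_univ_three]
  simp only [map_mul, map_pow, polyParam_C, polyParam_X0, polyParam_X1, polyParam_X2, mul_pow,
    LaurentPolynomial.T_add, LaurentPolynomial.T_pow, mul_one]
  ring

lemma coeff_C_mul_T (p : Polynomial k) (m n : ℤ) :
    (𝐂 p * 𝐓 m : Param k).coeff n = if m = n then p else 0 := by
  rw [← LaurentPolynomial.single_eq_C_mul_T, AddMonoidAlgebra.coeff_single, Finsupp.single_apply]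

/-- A monomial y₁^a y₂^b y₃^c goes to a monic polynomial of degree 2a + 3b times T^(a+b+c). For a ≤
2 the number 2a + 3b determines a and b, and the power of T then determines c. A monomial with 2a +
3b maximal therefore cannot be cancelled by the others. -/
lemma polyParam_ne_zero_of_reduced {G : MvPolynomial (Fin 3) k} (hG : ∀ m ∈ G.support, m 0 ≤ 2)
    (h0 : G ≠ 0) : polyParam k G ≠ 0 := by
  classical
  obtain ⟨m₀, hm₀, hmax⟩ := Finset.exists_max_image G.support (fun m => 2 * m 0 + 3 * m 1)
    (support_nonempty.2 h0)
  intro hzero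
  have h1 : ((polyParam k G).coeff (m₀ 0 + m₀ 1 + m₀ 2)).coeff (2 * m₀ 0 + 3 * m₀ 1) = 0 := by
    rw [hzero]; simp
  rw [G.as_sum, map_sum] at h1
  simp only [polyParam_monomial, AddMonoidAlgebra.coeff_sum, Finsupp.finsetSum_apply, Polynomial.finsetSum_coeff] at h1
  have hdeg : ∀ m : Fin 3 →₀ ℕ, (zz k ^ m 0 * (𝕥 * zz k) ^ m 1).Monic ∧
      (zz k ^ m 0 * (𝕥 * zz k) ^ m 1).natDegree = 2 * m 0 + 3 * m 1 := by
    intro m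
    have e1 : (zz k ^ m 0).Monic := zz_monic.pow _
    have e2 : (𝕥 * zz k).Monic := Polynomial.monic_X.mul zz_monic
    refine ⟨e1.mul (e2.pow _), ?_⟩
    rw [e1.natDegree_mul (e2.pow _), zz_monic.natDegree_pow, e2.natDegree_pow,
      Polynomial.monic_X.natDegree_mul zz_monic, natDegree_zz, Polynomial.natDegree_X]
    ring
  rw [Finset.sum_eq_single m₀] at h1
  · rw [coeff_C_mul_T, if_pos rfl, Polynomial.coeff_C_mul, ← (hdeg m₀).2,
      Polynomial.coeff_natDegree, (hdeg m₀).1] at h1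
    exact mem_support_iff.1 hm₀ (by simpa using h1)
  · intro m hm hne
    rw [coeff_C_mul_T]
    split_ifs with hT
    · rw [Polynomial.coeff_C_mul, Polynomial.coeff_eq_zero_of_natDegree_lt, mul_zero]
      rw [(hdeg m).2]
      refine lt_of_le_of_ne (hmax m hm) fun h => hne ?_
      have a1 := hG m hm
      have a2 := hG m₀ hm₀
      ext i
      fin_cases i <;> simp <;> omega
    · simp
  · intro h
    exact absurd hm₀ h

/-- Representatives reduced in y₁ are detected by the parametrization. In particular the cone is a
subring of a domain, which is how its integrality is obtained. -/
lemma toParam_injective : Function.Injective (toParam k) := by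
  rw [injective_iff_map_eq_zero]
  intro r hr
  obtain ⟨F, rfl⟩ := Ideal.Quotient.mk_surjective r
  obtain ⟨G, hG, e⟩ := exists_reduced F
  rw [e] at hr ⊢
  by_contra h0
  refine polyParam_ne_zero_of_reduced hG (fun h => h0 (by simp [h])) ?_
  rwa [toParam_toCone] at hr

instance : IsDomain (Cone k) := toParam_injective.isDomain (toParam k)

@[simp] lemma toParam_eq_zero {r : Cone k} : toParam k r = 0 ↔ r = 0 :=
  map_eq_zero_iff _ toParam_injective

lemma Param.ext {x y : Param k} (h : ∀ n, x.coeff n = y.coeff n) : x = y :=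
  LaurentPolynomial.ext h

/-! ### Internal gradings -/

section Grading

variable {M : Type v} [AddCommGroup M]

lemma mem_iSup_addSubgroup_of_sum {𝓜 : ℤ → AddSubgroup M} (s : Finset ℤ) (f : ℤ → M)
    (hf : ∀ n, f n ∈ 𝓜 n) : ∑ n ∈ s, f n ∈ ⨆ n, 𝓜 n :=
  sum_mem fun n _ => AddSubgroup.mem_iSup_of_mem n (hf n)

/-- A criterion for a family of subgroups to be a grading. -/
lemma isInternal_of_components {X : Type*} [AddCommGroup X] {𝓜 : ℤ → AddSubgroup M}
    (π : ℤ → M →+ X) (hπ : ∀ m n x, x ∈ 𝓜 m → m ≠ n → π n x = 0)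
    (hinj : ∀ x, (∀ n, π n x = 0) → x = 0) (htop : ∀ x, x ∈ ⨆ n, 𝓜 n) :
    DirectSum.IsInternal 𝓜 := by
  classical
  constructor
  · rw [injective_iff_map_eq_zero]
    intro y hy
    have key : ∀ n, π n (y n) = 0 := by
      intro n
      have : π n (DirectSum.coeAddMonoidHom 𝓜 y) = π n (y n) := by
        rw [DirectSum.coeAddMonoidHom_eq_dfinsuppSum, DFinsupp.sum, map_sum]
        by_cases hn : n ∈ y.support
        · rw [Finset.sum_eq_single n]
          · intro m _ hmn
            exact hπ m n _ (y m).2 hmn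
          · exact fun h => absurd hn h
        · rw [Finset.sum_eq_zero]
          · rw [DFinsupp.notMem_support_iff.1 hn]; simp
          · intro m hm
            exact hπ m n _ (y m).2 (fun h => hn (h ▸ hm))
      rw [← this, hy, map_zero]
    ext n
    have : ((y n : 𝓜 n) : M) = 0 := by
      apply hinj
      intro m
      by_cases h : n = m
      · subst h; exact key n
      · exact hπ n m _ (y n).2 h
    simpa using this
  · intro x
    have h : ⨆ n, 𝓜 n ≤ (DirectSum.coeAddMonoidHom 𝓜).range :=
      iSup_le fun n y hy => ⟨DirectSum.of (fun i => 𝓜 i) n ⟨y, hy⟩, by simp⟩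
    exact h (htop x)

variable {𝓜 : ℤ → AddSubgroup M}

/-- The projection to the degree `n` part. -/
def comp (h : DirectSum.IsInternal 𝓜) (n : ℤ) : M →+ M :=
  ((𝓜 n).subtype.comp (DFinsupp.evalAddMonoidHom n)).comp
    (AddEquiv.ofBijective (DirectSum.coeAddMonoidHom 𝓜) h).symm.toAddMonoidHom

lemma comp_mem (h : DirectSum.IsInternal 𝓜) (n : ℤ) (x : M) : comp h n x ∈ 𝓜 n := by
  simp [comp]

lemma comp_coe (h : DirectSum.IsInternal 𝓜) (n : ℤ) (y : DirectSum ℤ fun i => 𝓜 i) :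
    comp h n (DirectSum.coeAddMonoidHom 𝓜 y) = y n := by
  have : (AddEquiv.ofBijective (DirectSum.coeAddMonoidHom 𝓜) h).symm
      (DirectSum.coeAddMonoidHom 𝓜 y) = y :=
    (AddEquiv.ofBijective (DirectSum.coeAddMonoidHom 𝓜) h).symm_apply_apply y
  simp only [comp, AddMonoidHom.comp_apply]
  erw [this]
  rfl

lemma comp_of_mem (h : DirectSum.IsInternal 𝓜) {n : ℤ} {x : M} (hx : x ∈ 𝓜 n) :
    comp h n x = x := by
  have := comp_coe h n (DirectSum.of (fun i => 𝓜 i) n ⟨x, hx⟩)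
  simpa using this

lemma comp_of_mem_ne (h : DirectSum.IsInternal 𝓜) {m n : ℤ} {x : M} (hx : x ∈ 𝓜 m) (hmn : m ≠ n) :
    comp h n x = 0 := by
  have := comp_coe h n (DirectSum.of (fun i => 𝓜 i) m ⟨x, hx⟩)
  rw [DirectSum.of_eq_of_ne _ _ _ hmn.symm] at this
  simpa using this

lemma exists_sum_comp (h : DirectSum.IsInternal 𝓜) (x : M) :
    ∃ s : Finset ℤ, x = ∑ n ∈ s, comp h n x ∧ ∀ n ∉ s, comp h n x = 0 := by
  classical
  obtain ⟨y, rfl⟩ := h.2 x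
  refine ⟨y.support, ?_, ?_⟩
  · simp only [comp_coe]
    rw [DirectSum.coeAddMonoidHom_eq_dfinsuppSum, DFinsupp.sum]
  · intro n hn
    rw [comp_coe, DFinsupp.notMem_support_iff.1 hn]
    rfl

lemma eq_zero_of_comp (h : DirectSum.IsInternal 𝓜) {x : M} (hx : ∀ n, comp h n x = 0) : x = 0 := by
  obtain ⟨s, hs, -⟩ := exists_sum_comp h x
  rw [hs]
  exact Finset.sum_eq_zero fun n _ => hx n

lemma mem_iSup_of_isInternal (h : DirectSum.IsInternal 𝓜) (x : M) : x ∈ ⨆ n, 𝓜 n := by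
  obtain ⟨s, hs, -⟩ := exists_sum_comp h x
  rw [hs]
  exact mem_iSup_addSubgroup_of_sum s _ fun n => comp_mem h n x

variable [Module (Cone k) M]

lemma comp_smul (h : IsGradedModule (k := k) 𝓜) {d : ℤ} {r : Cone k} (hr : r ∈ coneDeg k d) (n : ℤ)
    (x : M) : comp h.isInternal (d + n) (r • x) = r • comp h.isInternal n x := by
  have h' := h.isInternal
  obtain ⟨s, hs, hs'⟩ := exists_sum_comp h.isInternal x
  conv_lhs => rw [hs, Finset.smul_sum, map_sum]
  by_cases hn : n ∈ s
  · rw [Finset.sum_eq_single n]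
    · exact comp_of_mem _ (h.smul_mem d n r _ hr (comp_mem _ n x))
    · intro m _ hmn
      exact comp_of_mem_ne _ (h.smul_mem d m r _ hr (comp_mem _ m x)) (by omega)
    · exact fun h => absurd hn h
  · rw [hs' n hn, smul_zero]
    refine Finset.sum_eq_zero fun m hm => ?_
    refine comp_of_mem_ne _ (h.smul_mem d m r _ hr (comp_mem _ m x)) ?_
    intro e
    exact hn ((by omega : m = n) ▸ hm)

lemma comp_smul' (h : IsGradedModule (k := k) 𝓜) {d : ℤ} {r : Cone k} (hr : r ∈ coneDeg k d) (n : ℤ)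
    (x : M) : comp h.isInternal n (r • x) = r • comp h.isInternal (n - d) x := by
  rw [← comp_smul h hr]
  congr 2
  omega

end Grading

lemma mem_iSup_coneDeg (r : Cone k) : r ∈ ⨆ n, coneDeg k n := by
  obtain ⟨F, rfl⟩ := Ideal.Quotient.mk_surjective r
  induction F using MvPolynomial.induction_on' with
  | monomial m c =>
    refine AddSubgroup.mem_iSup_of_mem (m.weight (fun _ : Fin 3 => (1 : ℤ))) ⟨monomial m c, ?_, rfl⟩
    exact isWeightedHomogeneous_monomial _ _ _ rfl
  | add p q hp hq =>
    rw [map_add]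
    exact add_mem hp hq

/-- The coefficient of `T ^ n`. -/
def coeffHom (k : Type u) [Field k] (n : ℤ) : Param k →+ Polynomial k where
  toFun x := x.coeff n
  map_zero' := by simp
  map_add' := by simp

@[simp] lemma coeffHom_apply (n : ℤ) (x : Param k) : coeffHom k n x = x.coeff n := rfl

lemma coneDeg_isInternal : DirectSum.IsInternal (coneDeg k) := by
  refine isInternal_of_components (fun n => (coeffHom k n).comp (toParam k).toAddMonoidHom) ?_ ?_
    mem_iSup_coneDeg
  · intro m n x hx hmn
    obtain ⟨p, -, e⟩ := toParam_of_mem_coneDeg hx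
    show (toParam k x).coeff n = 0
    rw [e, coeff_C_mul_T, if_neg hmn]
  · intro x hx
    rw [← toParam_eq_zero]
    exact Param.ext fun n => by simpa using hx n

end

section

/-! ### The Krull dimension of the cone -/

/-- The evaluation of the coefficients of a Laurent polynomial at `c`. -/
def evalAt (c : k) : Param k →+* LaurentPolynomial k :=
  AddMonoidAlgebra.mapRingHom ℤ (Polynomial.evalRingHom c)

@[simp] lemma evalAt_C_mul_T (c : k) (p : Polynomial k) (n : ℤ) :
    evalAt c (𝐂 p * 𝐓 n) = LaurentPolynomial.C (p.eval c) * LaurentPolynomial.T n := by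
  rw [← LaurentPolynomial.single_eq_C_mul_T, ← LaurentPolynomial.single_eq_C_mul_T]
  exact AddMonoidAlgebra.mapRingHom_single ..

@[simp] lemma evalAt_C (c : k) (p : Polynomial k) :
    evalAt c (𝐂 p) = LaurentPolynomial.C (p.eval c) := by
  simpa using evalAt_C_mul_T c p 0

@[simp] lemma evalAt_T (c : k) (n : ℤ) : evalAt c (𝐓 n) = LaurentPolynomial.T n := by
  simpa using evalAt_C_mul_T c 1 n

/-- The restriction to the line over the node. -/
def nodeEval (k : Type u) [Field k] : Cone k →+* LaurentPolynomial k :=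
  (evalAt 1).comp (toParam k)

@[simp] lemma nodeEval_X2 : nodeEval k (toCone k (X 2)) = LaurentPolynomial.T 1 := by
  simp [nodeEval]

@[simp] lemma nodeEval_X1 : nodeEval k (toCone k (X 1)) = 0 := by
  simp only [nodeEval, RingHom.comp_apply, toParam_toCone, polyParam_X1, evalAt_C_mul_T]
  simp

@[simp] lemma nodeEval_X0 : nodeEval k (toCone k (X 0)) = 0 := by
  simp only [nodeEval, RingHom.comp_apply, toParam_toCone, polyParam_X0, evalAt_C_mul_T]
  simp

/-- Both 1 and -1 lie over the node, so they restrict elements of the cone to the same line; this is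
visible on the variables. -/
lemma evalAt_toParam {c : k} (hc : c = 1 ∨ c = -1) (r : Cone k) :
    evalAt c (toParam k r) = nodeEval k r := by
  obtain ⟨F, rfl⟩ := Ideal.Quotient.mk_surjective r
  simp only [nodeEval, RingHom.comp_apply, toParam_toCone]
  induction F using MvPolynomial.induction_on with
  | C a => simp
  | add p q hp hq => simp [hp, hq]
  | mul_X p i hp =>
    rw [map_mul, map_mul, map_mul, hp]
    congr 1
    fin_cases i <;> rcases hc with rfl | rfl <;> simp

/-- The prime ideal of the node. -/
def nodePrime (k : Type u) [Field k] : Ideal (Cone k) := RingHom.ker (nodeEval k)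

instance : (nodePrime k).IsPrime := RingHom.ker_isPrime _

lemma mem_nodePrime {r : Cone k} : r ∈ nodePrime k ↔ nodeEval k r = 0 := Iff.rfl

/-- The residue map at the vertex. -/
def residue (k : Type u) [Field k] : Cone k →+* k :=
  Ideal.Quotient.lift _ constantCoeff (by
    intro a ha
    obtain ⟨b, rfl⟩ := Ideal.mem_span_singleton'.1 ha
    simp [nodePoly])

@[simp] lemma residue_toCone (F : MvPolynomial (Fin 3) k) :
    residue k (toCone k F) = constantCoeff F := by
  simp [residue]

/-- On the line over the node an element is F(0, 0, y₃), and its residue at the vertex is the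
constant term of that polynomial. This places the node prime inside the vertex ideal. -/
lemma residue_eq_zero_of_nodeEval {r : Cone k} (hr : nodeEval k r = 0) : residue k r = 0 := by
  obtain ⟨F, rfl⟩ := Ideal.Quotient.mk_surjective r
  have h : ∀ F, nodeEval k (toCone k F) = Polynomial.toLaurent (aeval ![0, 0, 𝕥] F) ∧
      constantCoeff F = (aeval ![0, 0, 𝕥] F : Polynomial k).eval 0 := by
    intro F
    induction F using MvPolynomial.induction_on with
    | C a => simp [nodeEval]
    | add p q hp hq => simp only [map_add, hp.1, hq.1, hp.2, hq.2, Polynomial.eval_add, and_self]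
    | mul_X p i hp =>
      rw [map_mul, map_mul, map_mul, map_mul, map_mul, hp.1, hp.2, Polynomial.eval_mul]
      fin_cases i <;> simp
  rw [(h F).1, map_eq_zero_iff _ Polynomial.toLaurent_injective] at hr
  rw [residue_toCone, (h F).2, hr, Polynomial.eval_zero]

lemma toCone_X_mem_irrelevant (i : Fin 3) : toCone k (X i) ∈ irrelevant k :=
  Ideal.subset_span ⟨i, rfl⟩

lemma isWeaklyRegular_pair_iff {R : Type*} {M : Type*} [CommRing R] [AddCommGroup M] [Module R M]
    (a b : R) : RingTheory.Sequence.IsWeaklyRegular M [a, b] ↔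
      (∀ x : M, a • x = 0 → x = 0) ∧ ∀ x y : M, b • x = a • y → ∃ z, x = a • z := by
  rw [RingTheory.Sequence.isWeaklyRegular_cons_iff, RingTheory.Sequence.isWeaklyRegular_singleton_iff,
    isSMulRegular_iff_right_eq_zero_of_smul, isSMulRegular_quotient_iff_mem_of_smul_mem]
  refine and_congr Iff.rfl ⟨fun h x y hxy => ?_, fun h x hx => ?_⟩
  · obtain ⟨z, -, hz⟩ := (Submodule.mem_smul_pointwise_iff_exists _ _ _).1
      (h x ((Submodule.mem_smul_pointwise_iff_exists _ _ _).2 ⟨y, trivial, hxy.symm⟩))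
    exact ⟨z, hz.symm⟩
  · obtain ⟨y, -, hy⟩ := (Submodule.mem_smul_pointwise_iff_exists _ _ _).1 hx
    obtain ⟨z, hz⟩ := h x y hy.symm
    exact (Submodule.mem_smul_pointwise_iff_exists _ _ _).2 ⟨z, trivial, hz.symm⟩

lemma mem_ofList_pair_smul_top {R : Type*} {M : Type*} [CommRing R] [AddCommGroup M] [Module R M]
    {a b : R} {x : M} (hx : x ∈ Ideal.ofList [a, b] • (⊤ : Submodule R M)) :
    ∃ y z, x = a • y + b • z := by
  rw [Ideal.ofList_cons, Ideal.ofList_singleton, Submodule.sup_smul, Submodule.mem_sup] at hx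
  obtain ⟨y, hy, z, hz, rfl⟩ := hx
  rw [Submodule.ideal_span_singleton_smul, Submodule.mem_smul_pointwise_iff_exists] at hy hz
  obtain ⟨y, -, rfl⟩ := hy
  obtain ⟨z, -, rfl⟩ := hz
  exact ⟨y, z, rfl⟩

lemma nodePoly_ne_zero : nodePoly k ≠ 0 := by
  intro h
  have h1 := congrArg (eval (fun i : Fin 3 => if i = 0 then 1 else 0)) h
  simp [nodePoly] at h1

/-- Dividing the three-dimensional polynomial ring by the nonzero divisor f lowers the dimension by
at least one; the chain 0 ⊂ node ⊂ vertex gives the opposite bound. -/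
lemma ringKrullDim_cone : ringKrullDim (Cone k) = 2 := by
  apply le_antisymm
  · have h := ringKrullDim_quotient_succ_le_of_nonZeroDivisor
      (mem_nonZeroDivisors_of_ne_zero (nodePoly_ne_zero (k := k)))
    rw [MvPolynomial.ringKrullDim_of_isNoetherianRing, ringKrullDim_eq_zero_of_field] at h
    change ringKrullDim (Cone k) + 1 ≤ _ at h
    generalize ringKrullDim (Cone k) = d at h ⊢
    have e : (0 : WithBot ℕ∞) + (Nat.card (Fin 3) : WithBot ℕ∞) = 2 + 1 := by
      simp
      norm_num
    rw [e] at h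
    induction d with
    | bot => exact bot_le
    | coe d =>
      have h' : d + 1 ≤ 2 + 1 := WithBot.coe_le_coe.1 h
      have : d ≤ 2 := (ENat.add_le_add_iff_right ENat.one_ne_top).1 h'
      exact WithBot.coe_le_coe.2 this
  · let p₀ : PrimeSpectrum (Cone k) := ⟨⊥, Ideal.isPrime_bot⟩
    let p₁ : PrimeSpectrum (Cone k) := ⟨nodePrime k, inferInstance⟩
    let p₂ : PrimeSpectrum (Cone k) := ⟨RingHom.ker (residue k), RingHom.ker_isPrime _⟩
    have h₁ : p₀ < p₁ := by
      refine lt_of_le_of_ne (bot_le : (⊥ : Ideal (Cone k)) ≤ nodePrime k) fun h => ?_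
      have h' : (⊥ : Ideal (Cone k)) = nodePrime k := congrArg PrimeSpectrum.asIdeal h
      have : toCone k (X 0) ∈ (⊥ : Ideal (Cone k)) := by
        rw [h', mem_nodePrime, nodeEval_X0]
      rw [Ideal.mem_bot, ← toParam_eq_zero, toParam_toCone, polyParam_X0] at this
      have := congrArg (fun x => x.coeff 1) this
      simp [coeff_C_mul_T, zz_ne_zero] at this
    have h₂ : p₁ < p₂ := by
      refine lt_of_le_of_ne (?_ : nodePrime k ≤ RingHom.ker (residue k)) fun h => ?_
      · intro r hr
        rw [RingHom.mem_ker, residue_eq_zero_of_nodeEval hr]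
      · have h' : nodePrime k = RingHom.ker (residue k) := congrArg PrimeSpectrum.asIdeal h
        have : toCone k (X 2) ∈ nodePrime k := by
          rw [h', RingHom.mem_ker, residue_toCone]
          simp
        rw [mem_nodePrime, nodeEval_X2] at this
        have := congrArg (fun x => x.coeff 1) this
        simp at this
    have := Order.LTSeries.length_le_krullDim (((RelSeries.singleton _ p₀).snoc p₁ (by simpa using h₁)).snoc
      p₂ (by simpa using h₂))
    rw [ringKrullDim]
    simpa using this

/-! ### Realizations of graded modules by vectors of polynomials -/

variable {M : Type v} [AddCommGroup M] [Module (Cone k) M]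

/-- The homogeneous vector of degree `n` with the coefficients `v`. -/
def emb (n : ℤ) (v : Polynomial k × Polynomial k) : Param k × Param k := (𝐂 v.1 * 𝐓 n, 𝐂 v.2 * 𝐓 n)

/-- The coefficients of `T ^ n`. -/
def cf (n : ℤ) (x : Param k × Param k) : Polynomial k × Polynomial k := (x.1.coeff n, x.2.coeff n)

lemma emb_add (n : ℤ) (v w : Polynomial k × Polynomial k) : emb n (v + w) = emb n v + emb n w := by
  simp [emb, add_mul]

@[simp] lemma emb_zero (n : ℤ) : emb n (0 : Polynomial k × Polynomial k) = 0 := by simp [emb]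

lemma emb_sum {ι : Type*} (s : Finset ι) (n : ℤ) (v : ι → Polynomial k × Polynomial k) :
    emb n (∑ i ∈ s, v i) = ∑ i ∈ s, emb n (v i) := by
  classical
  induction s using Finset.induction_on with
  | empty => simp
  | insert a s ha ih => rw [Finset.sum_insert ha, Finset.sum_insert ha, emb_add, ih]

@[simp] lemma cf_emb (n : ℤ) (v : Polynomial k × Polynomial k) : cf n (emb n v) = v := by
  simp [cf, emb, coeff_C_mul_T]

lemma cf_emb_ne {m n : ℤ} (h : m ≠ n) (v : Polynomial k × Polynomial k) : cf n (emb m v) = 0 := by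
  simp [cf, emb, coeff_C_mul_T, h]

lemma emb_injective (n : ℤ) : Function.Injective (emb n : Polynomial k × Polynomial k → _) :=
  fun v w h => by rw [← cf_emb n v, h, cf_emb]

lemma cf_ext {x y : Param k × Param k} (h : ∀ n, cf n x = cf n y) : x = y :=
  Prod.ext (Param.ext fun n => congrArg Prod.fst (h n)) (Param.ext fun n => congrArg Prod.snd (h n))

@[simp] lemma cf_zero (n : ℤ) : cf n (0 : Param k × Param k) = 0 := by simp [cf]

lemma cf_add (n : ℤ) (x y : Param k × Param k) : cf n (x + y) = cf n x + cf n y := by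
  simp [cf]

/-- `cf` as a homomorphism. -/
def cfHom (k : Type u) [Field k] (n : ℤ) : Param k × Param k →+ Polynomial k × Polynomial k where
  toFun := cf n
  map_zero' := cf_zero n
  map_add' := cf_add n

lemma smul_emb {r : Cone k} {p : Polynomial k} {d : ℤ} (hr : toParam k r = 𝐂 p * 𝐓 d) (n : ℤ)
    (v : Polynomial k × Polynomial k) : r • emb n v = emb (d + n) (p • v) := by
  ext1 <;> simp only [emb, Prod.smul_fst, Prod.smul_snd, cone_smul_def, hr, LaurentPolynomial.T_add,
    smul_eq_mul, map_mul] <;> ring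

/-- `Φ` identifies the graded module `M` with the family `F` of spaces of vectors of
polynomials. -/
structure Realizes (𝓜 : ℤ → AddSubgroup M) (Φ : M →ₗ[Cone k] Param k × Param k)
    (F : ℤ → Submodule k (Polynomial k × Polynomial k)) : Prop where
  injective : Function.Injective Φ
  map_mem : ∀ n, ∀ x ∈ 𝓜 n, ∃ v ∈ F n, Φ x = emb n v
  exists_of_mem : ∀ n, ∀ v ∈ F n, ∃ x ∈ 𝓜 n, Φ x = emb n v

section Realizes

variable {𝓜 : ℤ → AddSubgroup M} {Φ : M →ₗ[Cone k] Param k × Param k}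
  {F : ℤ → Submodule k (Polynomial k × Polynomial k)}

lemma isInternal_of_graded_injective (hΦ : Function.Injective Φ)
    (hmap : ∀ n, ∀ x ∈ 𝓜 n, ∃ v, Φ x = emb n v) (htop : ∀ x, x ∈ ⨆ n, 𝓜 n) :
    DirectSum.IsInternal 𝓜 := by
  refine isInternal_of_components (fun n => (cfHom k n).comp Φ.toAddMonoidHom) ?_ ?_ htop
  · intro m n x hx hmn
    obtain ⟨v, e⟩ := hmap m x hx
    show cf n (Φ x) = 0
    rw [e, cf_emb_ne hmn]
  · intro x hx
    apply hΦ
    rw [map_zero]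
    exact cf_ext fun n => (hx n).trans (cf_zero n).symm

lemma Realizes.cf_mem (h : Realizes 𝓜 Φ F) (h𝓜 : DirectSum.IsInternal 𝓜) (n : ℤ) (x : M) :
    cf n (Φ x) ∈ F n := by
  have : x ∈ ⨆ n, 𝓜 n := mem_iSup_of_isInternal h𝓜 x
  induction this using AddSubgroup.iSup_induction' with
  | hp m x hx =>
    obtain ⟨v, hv, e⟩ := h.map_mem m x hx
    rw [e]
    by_cases hmn : m = n
    · subst hmn; simpa using hv
    · rw [cf_emb_ne hmn]; exact zero_mem _
  | h1 => simp
  | hadd x y _ _ hx hy =>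
    rw [map_add, cf_add]
    exact add_mem hx hy

lemma Realizes.mem_iff (h : Realizes 𝓜 Φ F) {n : ℤ} {x : M} : x ∈ 𝓜 n ↔ ∃ v ∈ F n, Φ x = emb n v := by
  refine ⟨h.map_mem n x, ?_⟩
  rintro ⟨v, hv, e⟩
  obtain ⟨y, hy, e'⟩ := h.exists_of_mem n v hv
  rw [h.injective (e.trans e'.symm)]
  exact hy

lemma Realizes.exists_of_forall_cf (h : Realizes 𝓜 Φ F) (y : Param k × Param k)
    (hy : ∀ n, cf n y ∈ F n) : ∃ x, Φ x = y := by
  classical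
  choose x hx e using fun n => h.exists_of_mem n (cf n y) (hy n)
  refine ⟨∑ n ∈ y.1.coeff.support ∪ y.2.coeff.support, x n, cf_ext fun n => ?_⟩
  have hc : ∀ s : Finset ℤ, cf n (∑ m ∈ s, emb m (cf m y)) = if n ∈ s then cf n y else 0 := by
    intro s
    induction s using Finset.induction_on with
    | empty => simp
    | insert a s ha ih =>
      rw [Finset.sum_insert ha, cf_add, ih]
      by_cases hn : a = n
      · subst hn; simp [ha]
      · rw [cf_emb_ne hn]
        simp [Ne.symm hn]
  rw [map_sum, Finset.sum_congr rfl fun m _ => e m, hc]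
  split_ifs with hn
  · rfl
  · simp only [Finset.mem_union, Finsupp.mem_support_iff, not_or, not_not] at hn
    simp only [cf, hn.1, hn.2]
    rfl

lemma Realizes.smul_mem (h : Realizes 𝓜 Φ F) (hk : (2 : k) ≠ 0) (hg : IsGradedModule (k := k) 𝓜)
    {d n : ℤ} {p : Polynomial k} {v : Polynomial k × Polynomial k} (hp : p ∈ nodeLE k d)
    (hv : v ∈ F n) : p • v ∈ F (d + n) := by
  obtain ⟨r, hr, e⟩ := exists_coneDeg_of_mem_nodeLE hk hp
  obtain ⟨x, hx, e'⟩ := h.exists_of_mem n v hv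
  obtain ⟨w, hw, e''⟩ := h.map_mem _ _ (hg.smul_mem d n r x hr hx)
  rw [map_smul, e', smul_emb e] at e''
  rwa [emb_injective _ e'']

/-- A graded module realized by `F` is maximal Cohen-Macaulay if `F` is bounded below and `y₃, y₂`
is a regular sequence for it. -/
lemma Realizes.isMCM (h : Realizes 𝓜 Φ F) (h𝓜 : IsGradedModule (k := k) 𝓜)
    [Module.Finite (Cone k) M]
    (hF : ∀ n v, v ∈ F n → (𝕥 * zz k) • v ∈ F n → v ∈ F (n - 1))
    (n₀ : ℤ) (hlow : ∀ n < n₀, F n = ⊥) (hne : F n₀ ≠ ⊥) : IsMCM k M := by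
  have e2 : toParam k (toCone k (X 2)) = 𝐂 1 * 𝐓 1 := by simp
  have e1 : toParam k (toCone k (X 1)) = 𝐂 (𝕥 * zz k) * 𝐓 1 := by simp
  have hcf : ∀ (n : ℤ) (p : Polynomial k) (r : Cone k) (x : M), toParam k r = 𝐂 p * 𝐓 1 →
      cf n (Φ (r • x)) = p • cf (n - 1) (Φ x) := by
    intro n p r x hr
    have hx := mem_iSup_of_isInternal h𝓜.isInternal x
    induction hx using AddSubgroup.iSup_induction' with
    | hp m x hx =>
      obtain ⟨v, hv, e⟩ := h.map_mem m x hx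
      rw [map_smul, e, smul_emb hr]
      by_cases hmn : 1 + m = n
      · obtain rfl : m = n - 1 := by omega
        rw [hmn]
        simp
      · rw [cf_emb_ne hmn, cf_emb_ne (by omega), smul_zero]
    | h1 => simp
    | hadd x y _ _ hx hy => simp only [smul_add, map_add, cf_add, hx, hy]
  refine ⟨inferInstance, [toCone k (X 2), toCone k (X 1)], ?_, ?_, ?_⟩
  · intro r hr
    simp only [List.mem_cons, List.not_mem_nil, or_false] at hr
    rcases hr with rfl | rfl <;> exact toCone_X_mem_irrelevant _
  · have hreg : IsSMulRegular M (toCone k (X 2)) := by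
      intro x y hxy
      apply h.injective
      refine cf_ext fun n => ?_
      have a := hcf (n + 1) 1 _ x e2
      have b := hcf (n + 1) 1 _ y e2
      simp only at hxy
      rw [hxy, b] at a
      simpa using a.symm
    refine ⟨(isWeaklyRegular_pair_iff _ _).2 ⟨fun x hx => hreg (by simpa using hx), ?_⟩, ?_⟩
    · intro x y hxy
      -- Dividing by y₃ means multiplying by T⁻¹. The hypothesis `hF`, applied in each degree, says
      -- that the shifted vector still belongs to the module.
      obtain ⟨x', hx'⟩ := h.exists_of_forall_cf ((𝐓 (-1) * (Φ x).1, 𝐓 (-1) * (Φ x).2)) (by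
        intro n
        have a := hcf (n + 2) _ _ x e1
        rw [hxy, hcf _ _ _ _ e2] at a
        have hx := h.cf_mem h𝓜.isInternal (n + 1) x
        have := hF (n + 1) _ hx (by
          have hy := h.cf_mem h𝓜.isInternal (n + 1) y
          have e : n + 2 - 1 = n + 1 := by omega
          rw [e, one_smul] at a
          rw [← a]
          exact hy)
        have e : n + 1 - 1 = n := by omega
        rw [e] at this
        convert this using 1
        have e : ∀ x : Param k, (𝐓 (-1) * x).coeff n = x.coeff (n + 1) := by
          intro x
          rw [LaurentPolynomial.T_mul]
          rw [LaurentPolynomial.T, AddMonoidAlgebra.coeff_mul_single_eq_coeff_mul (n + 1)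
            (fun m _ => by omega), mul_one]
        simp only [cf, e])
      refine ⟨x', h.injective ?_⟩
      rw [map_smul, hx']
      ext1 <;> simp only [Prod.smul_mk, cone_smul_def, e2, map_one, one_mul, ← mul_assoc,
        ← LaurentPolynomial.T_add] <;> simp
    -- In the lowest nonzero degree n₀ nothing can be of the form y₃ y + y₂ z, since y and z would
    -- need components in degree n₀ - 1.
    · intro htop
      apply hne
      rw [eq_bot_iff]
      intro v hv
      obtain ⟨x, hx, e⟩ := h.exists_of_mem _ v hv
      have hx' : x ∈ (⊤ : Submodule (Cone k) M) := trivial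
      rw [htop] at hx'
      obtain ⟨y, z, rfl⟩ := mem_ofList_pair_smul_top hx'
      have a := congrArg (cf n₀) e
      have hz : ∀ x : M, cf (n₀ - 1) (Φ x) = 0 := fun x => by
        have := h.cf_mem h𝓜.isInternal (n₀ - 1) x
        rwa [hlow _ (by omega), Submodule.mem_bot] at this
      rw [map_add, cf_add, hcf _ _ _ _ e2, hcf _ _ _ _ e1, hz, hz] at a
      simpa using a.symm
  · rw [ringKrullDim_cone]; rfl

end Realizes

end

section

/-! ### Ranks -/

/-- The quotient by the span of v is torsion and so has rank zero; additivity of the rank does the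
rest. -/
lemma finrank_eq_of_linearIndependent {R : Type*} {M : Type*} [CommRing R] [IsDomain R]
    [AddCommGroup M] [Module R M] [Module.Finite R M] {n : ℕ} (v : Fin n → M)
    (hv : LinearIndependent R v) (h : ∀ x, ∃ r : R, r ≠ 0 ∧ r • x ∈ Submodule.span R (Set.range v)) :
    Module.finrank R M = n := by
  rw [← Submodule.finrank_quotient_add_finrank (Submodule.span R (Set.range v)),
    finrank_span_eq_card hv, Fintype.card_fin]
  have : Module.finrank R (M ⧸ Submodule.span R (Set.range v)) = 0 := by
    rw [Module.finrank, rank_eq_zero_iff.2, map_zero]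
    intro x
    obtain ⟨x, rfl⟩ := Submodule.Quotient.mk_surjective _ x
    obtain ⟨r, hr, hr'⟩ := h x
    exact ⟨r, hr, by rwa [← Submodule.Quotient.mk_smul, Submodule.Quotient.mk_eq_zero]⟩
  omega

/-- The conductor: multiplication by `t² - 1` and by a power of `T` maps into the cone. -/
lemma exists_conductor (hk : (2 : k) ≠ 0) (f : Param k) :
    ∃ K : ℕ, ∀ n : ℕ, K ≤ n → ∃ s, toParam k s = 𝐂 (zz k) * f * 𝐓 n := by
  induction f using LaurentPolynomial.induction_on' with
  | add p q hp hq =>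
    obtain ⟨K₁, h₁⟩ := hp
    obtain ⟨K₂, h₂⟩ := hq
    refine ⟨max K₁ K₂, fun n hn => ?_⟩
    obtain ⟨s, hs⟩ := h₁ n (le_trans (le_max_left _ _) hn)
    obtain ⟨t, ht⟩ := h₂ n (le_trans (le_max_right _ _) hn)
    exact ⟨s + t, by rw [map_add, hs, ht]; ring⟩
  | C_mul_T m p =>
    refine ⟨(2 + p.natDegree - m).toNat, fun n hn => ?_⟩
    obtain ⟨r, -, hr⟩ := exists_coneDeg_of_mem_nodeLE hk (d := m + n) (p := zz k * p)
      ⟨mul_mem_polyLE' (zz_mem_polyLE le_rfl) (mem_polyLE_natDegree p) (by omega), by simp⟩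
    refine ⟨r, hr.trans ?_⟩
    rw [LaurentPolynomial.T_add, map_mul]
    ring

variable {M : Type v} [AddCommGroup M] [Module (Cone k) M] {𝓜 : ℤ → AddSubgroup M}
  {Φ : M →ₗ[Cone k] Param k × Param k} {F : ℤ → Submodule k (Polynomial k × Polynomial k)}

lemma C_mul_T_ne_zero {p : Polynomial k} (hp : p ≠ 0) (n : ℤ) : (𝐂 p * 𝐓 n : Param k) ≠ 0 := by
  intro h
  have := congrArg (fun x => x.coeff n) h
  simp [coeff_C_mul_T, hp] at this

lemma Realizes.finrank_eq_two (h : Realizes 𝓜 Φ F) (hk : (2 : k) ≠ 0) [Module.Finite (Cone k) M]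
    {n₁ n₂ : ℤ} {g₁ g₂ : Polynomial k} (hg₁ : g₁ ≠ 0) (hg₂ : g₂ ≠ 0) (h₁ : (g₁, 0) ∈ F n₁)
    (h₂ : (0, g₂) ∈ F n₂) : Module.finrank (Cone k) M = 2 := by
  obtain ⟨x₁, -, e₁⟩ := h.exists_of_mem _ _ h₁
  obtain ⟨x₂, -, e₂⟩ := h.exists_of_mem _ _ h₂
  refine finrank_eq_of_linearIndependent ![x₁, x₂] ?_ fun x => ?_
  · rw [LinearIndependent.pair_iff]
    intro s t hst
    have := congrArg Φ hst
    rw [map_add, map_smul, map_smul, e₁, e₂, map_zero] at this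
    have a := congrArg Prod.fst this
    have b := congrArg Prod.snd this
    simp only [emb, Prod.fst_add, Prod.smul_fst, cone_smul_def, Prod.snd_add, Prod.smul_snd, map_zero,
      zero_mul, mul_zero, add_zero, zero_add, Prod.fst_zero, Prod.snd_zero] at a b
    exact ⟨by simpa using (mul_eq_zero.1 a).resolve_right (C_mul_T_ne_zero hg₁ _),
      by simpa using (mul_eq_zero.1 b).resolve_right (C_mul_T_ne_zero hg₂ _)⟩
  -- The multiplier is (t²-1) g₁ g₂ times a power of T: the factor t² - 1 and a large common
  -- exponent bring it and both coefficients into the cone.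
  · obtain ⟨K, hK⟩ := exists_conductor hk (𝐂 (g₁ * g₂))
    obtain ⟨K₁, hK₁⟩ := exists_conductor hk ((Φ x).1 * 𝐂 g₂ * 𝐓 (-n₁))
    obtain ⟨K₂, hK₂⟩ := exists_conductor hk ((Φ x).2 * 𝐂 g₁ * 𝐓 (-n₂))
    obtain ⟨r, hr⟩ := hK (K + K₁ + K₂) (by omega)
    obtain ⟨s, hs⟩ := hK₁ (K + K₁ + K₂) (by omega)
    obtain ⟨t, ht⟩ := hK₂ (K + K₁ + K₂) (by omega)
    refine ⟨r, ?_, ?_⟩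
    · rintro rfl
      rw [map_zero, ← map_mul] at hr
      exact C_mul_T_ne_zero (mul_ne_zero zz_ne_zero (mul_ne_zero hg₁ hg₂)) _ hr.symm
    · have : r • x = s • x₁ + t • x₂ := by
        apply h.injective
        rw [map_add, map_smul, map_smul, map_smul, e₁, e₂]
        have hT : ∀ n : ℤ, 𝐓 (-n) * 𝐓 n = (1 : Param k) := fun n => by
          rw [← LaurentPolynomial.T_add]; simp
        ext1
        · simp only [emb, Prod.fst_add, Prod.smul_fst, cone_smul_def, hr, hs, ht, map_mul, map_zero]
          linear_combination -(𝐂 (zz k) * (Φ x).1 * 𝐂 g₂ * 𝐓 (K + K₁ + K₂ : ℕ) * 𝐂 g₁) * hT n₁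
        · simp only [emb, Prod.snd_add, Prod.smul_snd, cone_smul_def, hr, hs, ht, map_mul, map_zero]
          linear_combination -(𝐂 (zz k) * (Φ x).2 * 𝐂 g₂ * 𝐓 (K + K₁ + K₂ : ℕ) * 𝐂 g₁) * hT n₂
      rw [this]
      exact add_mem (Submodule.smul_mem _ _ (Submodule.subset_span ⟨0, rfl⟩))
        (Submodule.smul_mem _ _ (Submodule.subset_span ⟨1, rfl⟩))

lemma Realizes.finrank_eq_one (h : Realizes 𝓜 Φ F) (hk : (2 : k) ≠ 0) [Module.Finite (Cone k) M]
    (hsnd : ∀ x, (Φ x).2 = 0) {n₁ : ℤ} {g₁ : Polynomial k} (hg₁ : g₁ ≠ 0) (h₁ : (g₁, 0) ∈ F n₁) :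
    Module.finrank (Cone k) M = 1 := by
  obtain ⟨x₁, -, e₁⟩ := h.exists_of_mem _ _ h₁
  refine finrank_eq_of_linearIndependent ![x₁] ?_ fun x => ?_
  · rw [Fintype.linearIndependent_iff]
    intro s hs i
    rw [Subsingleton.elim i 0]
    have := congrArg Φ hs
    rw [Fin.sum_univ_one, Matrix.cons_val_zero, map_smul, e₁, map_zero] at this
    have a := congrArg Prod.fst this
    simp only [emb, Prod.smul_fst, cone_smul_def, Prod.fst_zero] at a
    simpa using (mul_eq_zero.1 a).resolve_right (C_mul_T_ne_zero hg₁ _)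
  · obtain ⟨K, hK⟩ := exists_conductor hk (𝐂 g₁)
    obtain ⟨K₁, hK₁⟩ := exists_conductor hk ((Φ x).1 * 𝐓 (-n₁))
    obtain ⟨r, hr⟩ := hK (K + K₁) (by omega)
    obtain ⟨s, hs⟩ := hK₁ (K + K₁) (by omega)
    refine ⟨r, ?_, ?_⟩
    · rintro rfl
      rw [map_zero, ← map_mul] at hr
      exact C_mul_T_ne_zero (mul_ne_zero zz_ne_zero hg₁) _ hr.symm
    · have : r • x = s • x₁ := by
        apply h.injective
        rw [map_smul, map_smul, e₁]
        have hT : ∀ n : ℤ, 𝐓 (-n) * 𝐓 n = (1 : Param k) := fun n => by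
          rw [← LaurentPolynomial.T_add]; simp
        ext1
        · simp only [emb, Prod.smul_fst, cone_smul_def, hr, hs]
          linear_combination -(𝐂 (zz k) * (Φ x).1 * 𝐓 (K + K₁ : ℕ) * 𝐂 g₁) * hT n₁
        · simp [emb, hsnd, cone_smul_def]
      rw [this]
      exact Submodule.smul_mem _ _ (Submodule.subset_span ⟨0, rfl⟩)

/-! ### Isomorphisms, submodules and quotients of realized modules -/

/-- Multiplication by a Laurent polynomial, as an endomorphism of the pairs. -/
def mulLeft (c : Param k) : Param k × Param k →ₗ[Cone k] Param k × Param k where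
  toFun x := (c * x.1, c * x.2)
  map_add' x y := by ext1 <;> simp [mul_add]
  map_smul' r x := by ext1 <;> simp only [Prod.smul_fst, Prod.smul_snd, cone_smul_def,
    RingHom.id_apply] <;> ring

/-- Modules that are realized by the same family, up to a shift, are isomorphic up to a shift. -/
lemma Realizes.isIsoUpToShift {M' : Type*} [AddCommGroup M'] [Module (Cone k) M']
    {𝓜' : ℤ → AddSubgroup M'} {Φ' : M' →ₗ[Cone k] Param k × Param k}
    {F' : ℤ → Submodule k (Polynomial k × Polynomial k)} (h : Realizes 𝓜 Φ F)
    (h' : Realizes 𝓜' Φ' F') (hg : DirectSum.IsInternal 𝓜) (hg' : DirectSum.IsInternal 𝓜') (s : ℤ)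
    (hF : ∀ n, F n = F' (n + s)) : IsIsoUpToShift k 𝓜 𝓜' := by
  let Ψ : M' →ₗ[Cone k] Param k × Param k := (mulLeft (𝐓 (-s))).comp Φ'
  have hT : 𝐓 s * 𝐓 (-s) = (1 : Param k) := by
    rw [← LaurentPolynomial.T_add]; simp
  have hΨ : ∀ n (v : Polynomial k × Polynomial k) x, Φ' x = emb (n + s) v ↔ Ψ x = emb n v := by
    intro n v x
    have e1 : ∀ p, (𝐂 p * 𝐓 (n + s) : Param k) * 𝐓 (-s) = 𝐂 p * 𝐓 n := fun p => by
      rw [LaurentPolynomial.T_add]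
      linear_combination 𝐂 p * 𝐓 n * hT
    constructor
    · intro e
      show mulLeft (𝐓 (-s)) (Φ' x) = _
      rw [e]
      ext1 <;> simp only [mulLeft, emb, LinearMap.coe_mk, AddHom.coe_mk, ← e1] <;> ring
    · intro e
      have e : mulLeft (𝐓 (-s)) (Φ' x) = _ := e
      have a := congrArg Prod.fst e
      have b := congrArg Prod.snd e
      simp only [mulLeft, emb, LinearMap.coe_mk, AddHom.coe_mk, ← e1] at a b
      ext1
      · simp only [emb]
        linear_combination 𝐓 s * a + (𝐂 v.1 * 𝐓 (n + s) - (Φ' x).1) * hT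
      · simp only [emb]
        linear_combination 𝐓 s * b + (𝐂 v.2 * 𝐓 (n + s) - (Φ' x).2) * hT
  have hinj : Function.Injective Ψ := by
    rw [injective_iff_map_eq_zero]
    intro x hx
    have := (hΨ 0 0 x).2 (by rw [hx, emb_zero])
    rw [emb_zero] at this
    exact (map_eq_zero_iff _ h'.injective).1 this
  have hrange : LinearMap.range Φ = LinearMap.range Ψ := by
    apply le_antisymm
    · rintro _ ⟨x, rfl⟩
      have hx := mem_iSup_of_isInternal hg x
      induction hx using AddSubgroup.iSup_induction' with
      | hp m x hx =>
        obtain ⟨v, hv, e⟩ := h.map_mem m x hx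
        rw [hF] at hv
        obtain ⟨y, -, e'⟩ := h'.exists_of_mem _ v hv
        exact ⟨y, by rw [e, (hΨ _ _ _).1 e']⟩
      | h1 => simp
      | hadd x y _ _ hx hy => rw [map_add]; exact add_mem hx hy
    · rintro _ ⟨x, rfl⟩
      have hx := mem_iSup_of_isInternal hg' x
      induction hx using AddSubgroup.iSup_induction' with
      | hp m x hx =>
        obtain ⟨v, hv, e⟩ := h'.map_mem m x hx
        have hm : m = (m - s) + s := by omega
        rw [hm] at hv e
        rw [← hF] at hv
        obtain ⟨y, -, e'⟩ := h.exists_of_mem _ v hv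
        exact ⟨y, by rw [e', (hΨ _ _ _).1 e]⟩
      | h1 => simp
      | hadd x y _ _ hx hy => rw [map_add]; exact add_mem hx hy
  let e := (LinearEquiv.ofInjective Φ h.injective).trans
    ((LinearEquiv.ofEq _ _ hrange).trans (LinearEquiv.ofInjective Ψ hinj).symm)
  have he : ∀ x, Ψ (e x) = Φ x := by
    intro x
    have := (LinearEquiv.ofInjective Ψ hinj).apply_symm_apply
      (LinearEquiv.ofEq _ _ hrange (LinearEquiv.ofInjective Φ h.injective x))
    exact congrArg Subtype.val this
  refine ⟨s, e, fun n => ?_⟩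
  ext y
  constructor
  · rintro ⟨x, hx, rfl⟩
    obtain ⟨v, hv, e1⟩ := h.map_mem n x hx
    refine h'.mem_iff.2 ⟨v, hF n ▸ hv, (hΨ _ _ _).2 ?_⟩
    exact (he x).trans e1
  · intro hy
    obtain ⟨v, hv, e1⟩ := h'.map_mem _ y hy
    rw [← hF] at hv
    obtain ⟨x, hx, e2⟩ := h.exists_of_mem _ v hv
    refine ⟨x, hx, hinj ?_⟩
    exact ((he x).trans e2).trans ((hΨ _ _ _).1 e1).symm

lemma Realizes.map_comp (h : Realizes 𝓜 Φ F) (hg : DirectSum.IsInternal 𝓜) (n : ℤ) (x : M) :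
    Φ (comp hg n x) = emb n (cf n (Φ x)) := by
  have hx := mem_iSup_of_isInternal hg x
  induction hx using AddSubgroup.iSup_induction' with
  | hp m x hx =>
    obtain ⟨v, hv, e⟩ := h.map_mem m x hx
    by_cases hmn : m = n
    · subst hmn
      rw [comp_of_mem hg hx, e, cf_emb]
    · rw [comp_of_mem_ne hg hx hmn, e, cf_emb_ne hmn, map_zero, emb_zero]
  | h1 => simp
  | hadd x y _ _ hx hy => rw [map_add, map_add, map_add, cf_add, emb_add, hx, hy]

/-- The submodule of the elements whose second coordinate vanishes. -/
def kerSnd (Φ : M →ₗ[Cone k] Param k × Param k) : Submodule (Cone k) M :=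
  LinearMap.ker ((LinearMap.snd (Cone k) (Param k) (Param k)).comp Φ)

lemma mem_kerSnd {x : M} : x ∈ kerSnd Φ ↔ (Φ x).2 = 0 := Iff.rfl

lemma Realizes.comp_mem_kerSnd (h : Realizes 𝓜 Φ F) (hg : DirectSum.IsInternal 𝓜) (n : ℤ) {x : M}
    (hx : x ∈ kerSnd Φ) : comp hg n x ∈ kerSnd Φ := by
  rw [mem_kerSnd, h.map_comp hg]
  simp [emb, cf, mem_kerSnd.1 hx]

lemma Realizes.kerSnd_realizes (h : Realizes 𝓜 Φ F) :
    Realizes (subGrading 𝓜 (kerSnd Φ)) (Φ.comp (kerSnd Φ).subtype)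
      (fun n => F n ⊓ LinearMap.ker (LinearMap.snd k (Polynomial k) (Polynomial k))) where
  injective := h.injective.comp Subtype.val_injective
  map_mem n x hx := by
    obtain ⟨v, hv, e⟩ := h.map_mem n x hx
    refine ⟨v, ⟨hv, ?_⟩, e⟩
    have h1 := congrArg (fun y => (cf n y).2) e
    have h2 : (Φ x).2 = 0 := x.2
    simp only [cf_emb] at h1
    simpa [cf, h2] using h1.symm
  exists_of_mem n v hv := by
    obtain ⟨x, hx, e⟩ := h.exists_of_mem n v hv.1
    have h2 : v.2 = 0 := hv.2
    exact ⟨⟨x, mem_kerSnd.2 (by simp [e, emb, h2])⟩, hx, e⟩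

lemma Realizes.isGradedModule_kerSnd (h : Realizes 𝓜 Φ F) (hg : IsGradedModule (k := k) 𝓜) :
    IsGradedModule (k := k) (subGrading 𝓜 (kerSnd Φ)) where
  smul_mem d n r x hr hx := hg.smul_mem d n r x hr hx
  isInternal := by
    refine isInternal_of_graded_injective h.kerSnd_realizes.injective
      (fun n x hx => (h.kerSnd_realizes.map_mem n x hx).imp fun v hv => hv.2) ?_
    intro x
    obtain ⟨s, hs, -⟩ := exists_sum_comp hg.isInternal (x : M)
    have : x = ∑ n ∈ s, ⟨comp hg.isInternal n x, h.comp_mem_kerSnd hg.isInternal n x.2⟩ := by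
      ext
      rw [AddSubmonoidClass.coe_finsetSum]
      exact hs
    rw [this]
    exact mem_iSup_addSubgroup_of_sum s _ fun n => comp_mem _ n (x : M)

/-- The second coordinate, on the quotient by its kernel. -/
def sndQuot (Φ : M →ₗ[Cone k] Param k × Param k) : (M ⧸ kerSnd Φ) →ₗ[Cone k] Param k × Param k :=
  (LinearMap.inl (Cone k) (Param k) (Param k)).comp
    ((kerSnd Φ).liftQ ((LinearMap.snd (Cone k) (Param k) (Param k)).comp Φ) le_rfl)

lemma sndQuot_mk (x : M) : sndQuot Φ (Submodule.Quotient.mk x) = ((Φ x).2, 0) := rfl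

/-- The pairs `(v₂, 0)`, where `v` runs over the space `V`. -/
def sndSpace (V : Submodule k (Polynomial k × Polynomial k)) :
    Submodule k (Polynomial k × Polynomial k) :=
  V.map ((LinearMap.inl k (Polynomial k) (Polynomial k)).comp
    (LinearMap.snd k (Polynomial k) (Polynomial k)))

lemma Realizes.quot_realizes (h : Realizes 𝓜 Φ F) :
    Realizes (quotGrading 𝓜 (kerSnd Φ)) (sndQuot Φ) (fun n => sndSpace (F n)) where
  injective := by
    rw [injective_iff_map_eq_zero]
    intro x hx
    obtain ⟨x, rfl⟩ := Submodule.Quotient.mk_surjective _ x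
    rw [sndQuot_mk] at hx
    rw [Submodule.Quotient.mk_eq_zero, mem_kerSnd]
    exact congrArg Prod.fst hx
  map_mem n x hx := by
    obtain ⟨x, hx, rfl⟩ := hx
    obtain ⟨v, hv, e⟩ := h.map_mem n x hx
    refine ⟨(v.2, 0), ⟨v, hv, rfl⟩, ?_⟩
    show sndQuot Φ (Submodule.Quotient.mk x) = _
    rw [sndQuot_mk, e]
    simp [emb]
  exists_of_mem n v hv := by
    obtain ⟨v, hv, rfl⟩ := hv
    obtain ⟨x, hx, e⟩ := h.exists_of_mem n v hv
    refine ⟨Submodule.Quotient.mk x, ⟨x, hx, rfl⟩, ?_⟩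
    rw [sndQuot_mk, e]
    simp [emb]

lemma isGradedModule_quotGrading {N : Submodule (Cone k) M} (hg : IsGradedModule (k := k) 𝓜)
    {Ψ : (M ⧸ N) →ₗ[Cone k] Param k × Param k}
    {G : ℤ → Submodule k (Polynomial k × Polynomial k)} (hΨ : Realizes (quotGrading 𝓜 N) Ψ G) :
    IsGradedModule (k := k) (quotGrading 𝓜 N) where
  smul_mem := by
    rintro d n r _ hr ⟨x, hx, rfl⟩
    exact ⟨r • x, hg.smul_mem d n r x hr hx, rfl⟩
  isInternal := by
    refine isInternal_of_graded_injective hΨ.injective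
      (fun n x hx => (hΨ.map_mem n x hx).imp fun v hv => hv.2) ?_
    intro x
    obtain ⟨x, rfl⟩ := Submodule.Quotient.mk_surjective _ x
    obtain ⟨s, hs, -⟩ := exists_sum_comp hg.isInternal x
    have : (Submodule.Quotient.mk x : M ⧸ N) = ∑ n ∈ s, N.mkQ (comp hg.isInternal n x) := by
      rw [← map_sum, ← hs]
      rfl
    rw [this]
    exact mem_iSup_addSubgroup_of_sum s _ fun n => ⟨_, comp_mem _ n (x : M), rfl⟩

end

section

/-! ### String modules -/

/-- The pairs of polynomials of degrees at most `3 n + d₁` and `3 n + d₂`, glued at the points `ε`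
and `-ε`. -/
def stringSet (ε : k) (d₁ d₂ n : ℤ) : Submodule k (Polynomial k × Polynomial k) where
  carrier := {v | v.1 ∈ polyLE k (3 * n + d₁) ∧ v.2 ∈ polyLE k (3 * n + d₂) ∧
    v.1.eval ε = v.2.eval (-ε)}
  add_mem' := by
    rintro v w ⟨h₁, h₂, h₃⟩ ⟨h₁', h₂', h₃'⟩
    exact ⟨add_mem h₁ h₁', add_mem h₂ h₂', by simp [h₃, h₃']⟩
  zero_mem' := ⟨zero_mem _, zero_mem _, by simp⟩
  smul_mem' := by
    rintro c v ⟨h₁, h₂, h₃⟩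
    exact ⟨Submodule.smul_mem _ _ h₁, Submodule.smul_mem _ _ h₂, by simp [h₃]⟩

lemma mem_stringSet {ε : k} {d₁ d₂ n : ℤ} {v : Polynomial k × Polynomial k} :
    v ∈ stringSet ε d₁ d₂ n ↔ v.1 ∈ polyLE k (3 * n + d₁) ∧ v.2 ∈ polyLE k (3 * n + d₂) ∧
      v.1.eval ε = v.2.eval (-ε) := Iff.rfl

lemma mul_mem_stringSet {ε : k} (hε : ε = 1 ∨ ε = -1) {d₁ d₂ d n : ℤ} {p : Polynomial k}
    {v : Polynomial k × Polynomial k} (hp : p ∈ nodeLE k d) (hv : v ∈ stringSet ε d₁ d₂ n) :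
    p • v ∈ stringSet ε d₁ d₂ (d + n) := by
  refine ⟨mul_mem_polyLE' hp.1 hv.1 (by omega), mul_mem_polyLE' hp.1 hv.2.1 (by omega), ?_⟩
  have : p.eval ε = p.eval (-ε) := by
    rcases hε with rfl | rfl
    · exact hp.2
    · rw [neg_neg]; exact hp.2.symm
  simp [this, hv.2.2]

variable {M : Type v} [AddCommGroup M] [Module (Cone k) M] {𝓜 : ℤ → AddSubgroup M}

/-- `M` is the graded module of the pairs of forms that are glued at the two points over the
node. -/
structure IsString (𝓜 : ℤ → AddSubgroup M) (ε : k) (d₁ d₂ : ℤ) : Prop where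
  graded : IsGradedModule (k := k) 𝓜
  exists_realizes : ∃ Φ : M →ₗ[Cone k] Param k × Param k, Realizes 𝓜 Φ (stringSet ε d₁ d₂)

lemma Realizes.isMCM_of_bounded {Φ : M →ₗ[Cone k] Param k × Param k}
    {F : ℤ → Submodule k (Polynomial k × Polynomial k)} (h : Realizes 𝓜 Φ F)
    (h𝓜 : IsGradedModule (k := k) 𝓜) [Module.Finite (Cone k) M]
    (hF : ∀ n v, v ∈ F n → (𝕥 * zz k) • v ∈ F n → v ∈ F (n - 1))
    {N : ℤ} (hlow : ∀ n < N, F n = ⊥) (hne : ∃ n, F n ≠ ⊥) : IsMCM k M := by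
  obtain ⟨n₀, h₀, h₁⟩ := Int.exists_least_of_bdd (P := fun n => F n ≠ ⊥)
    ⟨N, fun n hn => not_lt.1 fun h => hn (hlow n h)⟩ hne
  exact h.isMCM h𝓜 hF n₀ (fun n hn => not_not.1 fun h => not_lt.2 (h₁ n h) hn) h₀

lemma natDegree_X_mul_zz : (𝕥 * zz k).natDegree = 3 := by
  rw [Polynomial.monic_X.natDegree_mul zz_monic, natDegree_zz, Polynomial.natDegree_X]

lemma X_mul_zz_ne_zero : 𝕥 * zz k ≠ 0 := mul_ne_zero Polynomial.X_ne_zero zz_ne_zero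

lemma mem_polyLE_of_X_mul_zz_mul_mem {d n : ℤ} {p : Polynomial k}
    (h : 𝕥 * zz k * p ∈ polyLE k (3 * n + d)) : p ∈ polyLE k (3 * (n - 1) + d) :=
  mem_polyLE_of_mul_mem (e := 3) X_mul_zz_ne_zero (by simp [natDegree_X_mul_zz])
    (polyLE_mono (by omega) h)

lemma stringSet_eq_bot {ε : k} {d₁ d₂ n : ℤ} (h₁ : 3 * n + d₁ < 0) (h₂ : 3 * n + d₂ < 0) :
    stringSet ε d₁ d₂ n = ⊥ := by
  rw [eq_bot_iff]
  intro v hv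
  exact Prod.ext (eq_zero_of_mem_polyLE_neg hv.1 h₁) (eq_zero_of_mem_polyLE_neg hv.2.1 h₂)

lemma X_sub_C_mem_polyLE (c : k) {d : ℤ} (hd : 1 ≤ d) : 𝕥 - Polynomial.C c ∈ polyLE k d :=
  sub_mem (X_mem_polyLE hd) (C_mem_polyLE c (by omega))

section

variable {ε : k} {d₁ d₂ : ℤ}

lemma fst_mem_stringSet {n : ℤ} {g : Polynomial k} (hg : g ∈ polyLE k (3 * n + d₁))
    (hε : g.eval ε = 0) : (g, 0) ∈ stringSet ε d₁ d₂ n :=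
  ⟨hg, zero_mem _, by simpa using hε⟩

lemma snd_mem_stringSet {n : ℤ} {g : Polynomial k} (hg : g ∈ polyLE k (3 * n + d₂))
    (hε : g.eval (-ε) = 0) : (0, g) ∈ stringSet ε d₁ d₂ n :=
  ⟨zero_mem _, hg, by simpa using hε.symm⟩

lemma one_ne_neg_one (hk : (2 : k) ≠ 0) : (1 : k) ≠ -1 := by
  intro h
  apply hk
  linear_combination h

lemma ne_neg (hk : (2 : k) ≠ 0) (hε : ε = 1 ∨ ε = -1) : ε ≠ -ε := by
  rcases hε with rfl | rfl
  · exact one_ne_neg_one hk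
  · rw [neg_neg]; exact (one_ne_neg_one hk).symm

/-- Multiplication by y₂ is multiplication by t(t²-1), which raises degrees by exactly 3. If y₂ v
satisfies the bounds of degree n, then v satisfies those of degree n - 1, and the gluing condition
does not involve n. This is the regularity of y₂ modulo y₃. -/
lemma IsString.isMCM (h : IsString 𝓜 ε d₁ d₂) [Module.Finite (Cone k) M] : IsMCM k M := by
  obtain ⟨Φ, hΦ⟩ := h.exists_realizes
  refine hΦ.isMCM_of_bounded h.graded ?_ (N := -(|d₁| + |d₂|))
    (fun n hn => stringSet_eq_bot ?_ ?_) ⟨|d₁| + 1, fun h0 => ?_⟩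
  · intro n v hv hv'
    exact ⟨mem_polyLE_of_X_mul_zz_mul_mem hv'.1, mem_polyLE_of_X_mul_zz_mul_mem hv'.2.1, hv.2.2⟩
  · have := le_abs_self d₁; have := abs_nonneg d₁; have := abs_nonneg d₂; omega
  · have := le_abs_self d₂; have := abs_nonneg d₁; have := abs_nonneg d₂; omega
  · have : (𝕥 - Polynomial.C ε, 0) ∈ stringSet ε d₁ d₂ (|d₁| + 1) :=
      fst_mem_stringSet (X_sub_C_mem_polyLE _ (by have := neg_abs_le d₁; have := abs_nonneg d₁; omega))
        (by simp)
    rw [h0, Submodule.mem_bot] at this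
    exact Polynomial.X_sub_C_ne_zero ε (congrArg Prod.fst this)

lemma IsString.finrank_eq (h : IsString 𝓜 ε d₁ d₂) (hk : (2 : k) ≠ 0) [Module.Finite (Cone k) M] :
    Module.finrank (Cone k) M = 2 := by
  obtain ⟨Φ, hΦ⟩ := h.exists_realizes
  refine hΦ.finrank_eq_two hk (n₁ := |d₁| + 1) (n₂ := |d₂| + 1) (Polynomial.X_sub_C_ne_zero ε)
    (Polynomial.X_sub_C_ne_zero (-ε)) (fst_mem_stringSet (X_sub_C_mem_polyLE _ ?_) (by simp))
    (snd_mem_stringSet (X_sub_C_mem_polyLE _ ?_) (by simp))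
  · have := neg_abs_le d₁; have := abs_nonneg d₁; omega
  · have := neg_abs_le d₂; have := abs_nonneg d₂; omega

lemma IsString.swap (h : IsString 𝓜 ε d₁ d₂) : IsString 𝓜 (-ε) d₂ d₁ := by
  obtain ⟨Φ, hΦ⟩ := h.exists_realizes
  let σ : (Param k × Param k) →ₗ[Cone k] Param k × Param k :=
    (LinearMap.snd (Cone k) (Param k) (Param k)).prod (LinearMap.fst (Cone k) (Param k) (Param k))
  have hσ : ∀ y, σ y = y.swap := fun y => rfl
  refine ⟨h.graded, σ.comp Φ, ⟨?_, ?_, ?_⟩⟩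
  · intro x y hxy
    exact hΦ.injective (Prod.swap_injective hxy)
  · intro n x hx
    obtain ⟨v, hv, e⟩ := hΦ.map_mem n x hx
    refine ⟨v.swap, ⟨hv.2.1, hv.1, ?_⟩, ?_⟩
    · simpa using hv.2.2.symm
    · rw [LinearMap.comp_apply, e]
      rfl
  · intro n v hv
    obtain ⟨x, hx, e⟩ := hΦ.exists_of_mem n v.swap ⟨hv.2.1, hv.1, by simpa using hv.2.2.symm⟩
    refine ⟨x, hx, ?_⟩
    rw [LinearMap.comp_apply, e]
    rfl

/-- The submodule is v₂ = 0, and the quotient is read off from v₂. Whenever v₂ may be nonzero, the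
hypothesis `hd` permits a constant v₁, and a constant suffices to satisfy the gluing; hence the
quotient consists of all v₂ within the degree bound. -/
lemma IsString.isExtension_of_le (h : IsString 𝓜 ε d₁ d₂) (hk : (2 : k) ≠ 0)
    [Module.Finite (Cone k) M] (hd : ∀ n, 0 ≤ 3 * n + d₂ → 0 ≤ 3 * n + d₁) :
    IsExtensionOfRankOne k 𝓜 := by
  obtain ⟨Φ, hΦ⟩ := h.exists_realizes
  have hsub := hΦ.kerSnd_realizes
  have hquot := hΦ.quot_realizes
  have hgs := hΦ.isGradedModule_kerSnd h.graded
  have hgq := isGradedModule_quotGrading h.graded hquot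
  have hlift : ∀ n (p : Polynomial k), p ∈ polyLE k (3 * n + d₂) →
      (p, 0) ∈ sndSpace (stringSet ε d₁ d₂ n) := by
    intro n p hp
    by_cases h0 : 0 ≤ 3 * n + d₂
    · exact ⟨(Polynomial.C (p.eval (-ε)), p), ⟨C_mem_polyLE _ (hd n h0), hp, by simp⟩, rfl⟩
    · rw [eq_zero_of_mem_polyLE_neg hp (not_le.1 h0)]
      exact zero_mem _
  have hlift' : ∀ n (v : Polynomial k × Polynomial k), v ∈ sndSpace (stringSet ε d₁ d₂ n) →
      v.1 ∈ polyLE k (3 * n + d₂) ∧ v.2 = 0 := by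
    rintro n _ ⟨v, hv, rfl⟩
    exact ⟨hv.2.1, rfl⟩
  have hab₁ := neg_abs_le d₁
  have hab₁' := abs_nonneg d₁
  have hab₁'' := le_abs_self d₁
  have hab₂ := neg_abs_le d₂
  have hab₂' := abs_nonneg d₂
  have hab₂'' := le_abs_self d₂
  have hfst : ∀ n, 1 ≤ 3 * n + d₁ → (𝕥 - Polynomial.C ε, (0 : Polynomial k)) ∈
      stringSet ε d₁ d₂ n ⊓ LinearMap.ker (LinearMap.snd k (Polynomial k) (Polynomial k)) :=
    fun n hn => ⟨fst_mem_stringSet (X_sub_C_mem_polyLE _ hn) (by simp), rfl⟩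
  refine ⟨kerSnd Φ, ⟨hgs, ?_⟩, ?_, ⟨hgq, ?_⟩, ?_⟩
  · refine hsub.isMCM_of_bounded hgs ?_ (N := -(|d₁| + |d₂|)) (fun n hn => ?_)
      ⟨|d₁| + 1, fun h0 => ?_⟩
    · rintro n v ⟨hv, hv'⟩ ⟨hw, -⟩
      exact ⟨⟨mem_polyLE_of_X_mul_zz_mul_mem hw.1, mem_polyLE_of_X_mul_zz_mul_mem hw.2.1, hv.2.2⟩, hv'⟩
    · rw [stringSet_eq_bot (by omega) (by omega), bot_inf_eq]
    · have := hfst (|d₁| + 1) (by omega)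
      rw [h0, Submodule.mem_bot] at this
      exact Polynomial.X_sub_C_ne_zero ε (congrArg Prod.fst this)
  · exact hsub.finrank_eq_one hk (fun x => x.2) (Polynomial.X_sub_C_ne_zero ε)
      (hfst (|d₁| + 1) (by omega))
  · refine hquot.isMCM_of_bounded hgq ?_ (N := -(|d₁| + |d₂|)) (fun n hn => ?_)
      ⟨|d₂| + 1, fun h0 => ?_⟩
    · intro n v hv hv'
      have h1 := hlift' n v hv
      have h2 := hlift _ _ (mem_polyLE_of_X_mul_zz_mul_mem (hlift' n _ hv').1)
      rwa [← h1.2] at h2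
    · rw [stringSet_eq_bot (by omega) (by omega), sndSpace, Submodule.map_bot]
    · have := hlift (|d₂| + 1) 1 (one_mem_polyLE (by omega))
      rw [h0, Submodule.mem_bot] at this
      exact one_ne_zero (congrArg Prod.fst this)
  · refine hquot.finrank_eq_one hk ?_ one_ne_zero (hlift (|d₂| + 1) 1 (one_mem_polyLE (by omega)))
    intro x
    obtain ⟨x, rfl⟩ := Submodule.Quotient.mk_surjective _ x
    rfl

lemma IsString.isExtensionOfRankOne (h : IsString 𝓜 ε d₁ d₂) (hk : (2 : k) ≠ 0)
    [Module.Finite (Cone k) M] : IsExtensionOfRankOne k 𝓜 := by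
  by_cases hd : ∀ n, 0 ≤ 3 * n + d₂ → 0 ≤ 3 * n + d₁
  · exact h.isExtension_of_le hk hd
  -- Failure of the condition forces d₁ < d₂, and then the condition holds with the coordinates
  -- exchanged.
  · push Not at hd
    obtain ⟨m, h₁, h₂⟩ := hd
    exact h.swap.isExtension_of_le hk fun n hn => by omega

/-! ### String modules are indecomposable -/

lemma exists_zz_mul_eq (hk : (2 : k) ≠ 0) {p : Polynomial k} (h₁ : p.eval 1 = 0)
    (h₂ : p.eval (-1) = 0) : ∃ w, p = zz k * w := by
  obtain ⟨w, hw⟩ := exists_eq_add_zz_mul hk p (h₁.trans h₂.symm)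
  exact ⟨w, by rw [hw, h₁]; simp⟩

lemma exists_zz_mul_eq' (hk : (2 : k) ≠ 0) (hε : ε = 1 ∨ ε = -1) {p : Polynomial k}
    (h₁ : p.eval ε = 0) (h₂ : p.eval (-ε) = 0) : ∃ w, p = zz k * w := by
  rcases hε with rfl | rfl
  · exact exists_zz_mul_eq hk h₁ h₂
  · exact exists_zz_mul_eq hk (by simpa using h₂) h₁

lemma IsHomogeneousSubmodule.comp_mem {N : Submodule (Cone k) M} (hN : IsHomogeneousSubmodule 𝓜 N)
    (hg : IsGradedModule (k := k) 𝓜) (n : ℤ) {x : M} (hx : x ∈ N) : comp hg.isInternal n x ∈ N := by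
  have hx' := hx
  rw [hN] at hx'
  clear hx
  induction hx' using Submodule.span_induction generalizing n with
  | mem x hx =>
    obtain ⟨hx, m, hm⟩ := hx
    by_cases hmn : m = n
    · subst hmn; rwa [comp_of_mem _ hm]
    · rw [comp_of_mem_ne _ hm hmn]; exact zero_mem _
  | zero => simp
  | add x y _ _ hx hy => rw [map_add]; exact add_mem (hx n) (hy n)
  | smul r x _ hx =>
    have hr := mem_iSup_coneDeg r
    induction hr using AddSubgroup.iSup_induction' with
    | hp d r hr => rw [comp_smul' hg hr]; exact Submodule.smul_mem _ _ (hx _)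
    | h1 =>
      have e : comp hg.isInternal n ((0 : Cone k) • x) = 0 := by
        have h0 : (0 : Cone k) • x = 0 := zero_smul (Cone k) x
        rw [h0, map_zero]
      exact (congrArg (· ∈ N) e).mpr N.zero_mem
    | hadd r s _ _ hr hs => rw [add_smul, map_add]; exact add_mem hr hs

lemma IsHomogeneousSubmodule.eq_bot {N : Submodule (Cone k) M} (hN : IsHomogeneousSubmodule 𝓜 N)
    (h : ∀ n, ∀ x ∈ 𝓜 n, x ∈ N → x = 0) : N = ⊥ := by
  rw [hN, Submodule.span_eq_bot]
  rintro x ⟨hx, n, hn⟩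
  exact h n x hn hx

/-- A graded endomorphism of a string module is given by a matrix of polynomials. -/
lemma Realizes.exists_matrix_of_endomorphism {Φ : M →ₗ[Cone k] Param k × Param k}
    (h : Realizes 𝓜 Φ (stringSet ε d₁ d₂)) (hk : (2 : k) ≠ 0) (hε : ε = 1 ∨ ε = -1)
    (π : M →ₗ[Cone k] M) (hπ : ∀ n, ∀ x ∈ 𝓜 n, π x ∈ 𝓜 n) :
    ∃ (a : k) (B C : Polynomial k), (B = 0 ∨ C = 0) ∧ ∀ n x v, x ∈ 𝓜 n → Φ x = emb n v →
      Φ (π x) = emb n (a • v.1 + C * v.2, B * v.1 + a • v.2) := by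
  set N : ℕ := (|d₁| + |d₂|).toNat + 1 with hN
  have hab₁ := neg_abs_le d₁
  have hab₁' := abs_nonneg d₁
  have hab₂ := neg_abs_le d₂
  have hab₂' := abs_nonneg d₂
  obtain ⟨x₁, hx₁, e₁⟩ := h.exists_of_mem N (zz k, 0)
    (fst_mem_stringSet (zz_mem_polyLE (by omega)) (by rcases hε with rfl | rfl <;> simp))
  obtain ⟨x₂, hx₂, e₂⟩ := h.exists_of_mem N (0, zz k)
    (snd_mem_stringSet (zz_mem_polyLE (by omega)) (by rcases hε with rfl | rfl <;> simp))
  obtain ⟨⟨α, β⟩, hαβ, e₁'⟩ := h.map_mem _ _ (hπ _ _ hx₁)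
  obtain ⟨⟨γ, δ⟩, hγδ, e₂'⟩ := h.map_mem _ _ (hπ _ _ hx₂)
  -- A multiple of x by (t²-1)² T^K is a combination of x₁ and x₂ over the cone, so the images of
  -- these two determine π. Cancelling one factor t² - 1 leaves the stated identities.
  have key : ∀ n x (v w : Polynomial k × Polynomial k), Φ x = emb n v → Φ (π x) = emb n w →
      zz k * w.1 = v.1 * α + v.2 * γ ∧ zz k * w.2 = v.1 * β + v.2 * δ := by
    intro n x v w ev ew
    set K : ℕ := (4 + v.1.natDegree + v.2.natDegree + |n| + N).toNat with hK
    have hn := neg_abs_le n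
    have hn' := abs_nonneg n
    obtain ⟨r, -, hr⟩ := exists_coneDeg_of_mem_nodeLE hk (d := K) (p := zz k * zz k)
      ⟨mul_mem_polyLE' (zz_mem_polyLE le_rfl) (zz_mem_polyLE le_rfl) (by omega), by simp⟩
    obtain ⟨s, -, hs⟩ := exists_coneDeg_of_mem_nodeLE hk (d := K + n - N) (p := zz k * v.1)
      ⟨mul_mem_polyLE' (zz_mem_polyLE le_rfl) (mem_polyLE_natDegree _) (by omega), by simp⟩
    obtain ⟨t, -, ht⟩ := exists_coneDeg_of_mem_nodeLE hk (d := K + n - N) (p := zz k * v.2)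
      ⟨mul_mem_polyLE' (zz_mem_polyLE le_rfl) (mem_polyLE_natDegree _) (by omega), by simp⟩
    have e : r • x = s • x₁ + t • x₂ := by
      apply h.injective
      rw [map_add, map_smul, map_smul, map_smul, ev, e₁, e₂, smul_emb hr, smul_emb hs, smul_emb ht]
      have : (K + n - N + N : ℤ) = K + n := by omega
      rw [this, ← emb_add]
      congr 1
      ext1 <;> simp <;> ring
    have e' := congrArg (fun y => Φ (π y)) e
    simp only [map_add, map_smul] at e'
    rw [ew, e₁', e₂', smul_emb hr, smul_emb hs, smul_emb ht] at e'
    have : (K + n - N + N : ℤ) = K + n := by omega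
    rw [this, ← emb_add] at e'
    have e'' := emb_injective _ e'
    have a1 := congrArg Prod.fst e''
    have a2 := congrArg Prod.snd e''
    simp only [Prod.smul_fst, Prod.smul_snd, smul_eq_mul, Prod.fst_add, Prod.snd_add] at a1 a2
    constructor
    · refine mul_left_cancel₀ (zz_ne_zero (k := k)) ?_
      linear_combination a1
    · refine mul_left_cancel₀ (zz_ne_zero (k := k)) ?_
      linear_combination a2
  have key' : ∀ n (v : Polynomial k × Polynomial k), v ∈ stringSet ε d₁ d₂ n →
      ∃ w ∈ stringSet ε d₁ d₂ n,
      zz k * w.1 = v.1 * α + v.2 * γ ∧ zz k * w.2 = v.1 * β + v.2 * δ := by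
    intro n v hv
    obtain ⟨x, hx, ev⟩ := h.exists_of_mem n v hv
    obtain ⟨w, hw, ew⟩ := h.map_mem n _ (hπ n x hx)
    exact ⟨w, hw, key n x v w ev ew⟩
  have hz : (zz k).eval ε = 0 ∧ (zz k).eval (-ε) = 0 := by rcases hε with rfl | rfl <;> simp
  have hne := ne_neg hk hε
  have hne₁ : -ε - ε ≠ 0 := fun h => hne (by linear_combination -h)
  have hne₂ : ε - -ε ≠ 0 := fun h => hne (by linear_combination h)
  have ev₁ : ∀ {p q : Polynomial k}, zz k * p = q → q.eval ε = 0 ∧ q.eval (-ε) = 0 := by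
    rintro p q rfl
    simp [hz.1, hz.2]
  -- the entries of the matrix are divisible by `t² - 1`
  obtain ⟨w₁, hw₁, f₁, f₁'⟩ := key' N (𝕥 - Polynomial.C ε, 0)
    (fst_mem_stringSet (X_sub_C_mem_polyLE _ (by omega)) (by simp))
  obtain ⟨w₂, hw₂, f₂, f₂'⟩ := key' N (0, 𝕥 - Polynomial.C (-ε))
    (snd_mem_stringSet (X_sub_C_mem_polyLE _ (by omega)) (by simp))
  obtain ⟨w₃, hw₃, f₃, f₃'⟩ := key' N (1, 1)
    ⟨one_mem_polyLE (by omega), one_mem_polyLE (by omega), by simp⟩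
  have a₁ : α.eval (-ε) = 0 := by simpa [hne₁] using (ev₁ f₁).2
  have b₁ : β.eval (-ε) = 0 := by simpa [hne₁] using (ev₁ f₁').2
  have c₁ : γ.eval ε = 0 := by simpa [hne₂, -sub_neg_eq_add, -map_neg] using (ev₁ f₂).1
  have d₁' : δ.eval ε = 0 := by simpa [hne₂, -sub_neg_eq_add, -map_neg] using (ev₁ f₂').1
  have a₂ : α.eval ε = 0 := by simpa [c₁] using (ev₁ f₃).1
  have b₂ : β.eval ε = 0 := by simpa [d₁'] using (ev₁ f₃').1
  have c₂ : γ.eval (-ε) = 0 := by simpa [a₁] using (ev₁ f₃).2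
  have d₂' : δ.eval (-ε) = 0 := by simpa [b₁] using (ev₁ f₃').2
  obtain ⟨A, rfl⟩ := exists_zz_mul_eq' hk hε a₂ a₁
  obtain ⟨B, rfl⟩ := exists_zz_mul_eq' hk hε b₂ b₁
  obtain ⟨C, rfl⟩ := exists_zz_mul_eq' hk hε c₁ c₂
  obtain ⟨D, rfl⟩ := exists_zz_mul_eq' hk hε d₁' d₂'
  have cancel : ∀ {w : Polynomial k × Polynomial k} {g h : Polynomial k},
      zz k * w.1 = g * (zz k * A) + h * (zz k * C) → zz k * w.2 = g * (zz k * B) + h * (zz k * D) →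
      w = (A * g + C * h, B * g + D * h) := by
    intro w g h h₁ h₂
    ext1
    · refine mul_left_cancel₀ (zz_ne_zero (k := k)) ?_
      linear_combination h₁
    · refine mul_left_cancel₀ (zz_ne_zero (k := k)) ?_
      linear_combination h₂
  have key₂ : ∀ n (v : Polynomial k × Polynomial k), v ∈ stringSet ε d₁ d₂ n →
      (A * v.1 + C * v.2, B * v.1 + D * v.2) ∈ stringSet ε d₁ d₂ n := by
    intro n v hv
    obtain ⟨w, hw, g₁, g₂⟩ := key' n v hv
    rwa [← cancel g₁ g₂]
  -- gluing
  have gB : B.eval (-ε) = 0 ∧ C.eval ε = 0 ∧ A.eval ε = D.eval (-ε) := by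
    have g₁ := (key₂ N (𝕥 - Polynomial.C ε, 0)
      (fst_mem_stringSet (X_sub_C_mem_polyLE _ (by omega)) (by simp))).2.2
    have g₂ := (key₂ N (0, 𝕥 - Polynomial.C (-ε))
      (snd_mem_stringSet (X_sub_C_mem_polyLE _ (by omega)) (by simp))).2.2
    have g₃ := (key₂ N (1, 1)
      ⟨one_mem_polyLE (by omega), one_mem_polyLE (by omega), by simp⟩).2.2
    have hB : B.eval (-ε) = 0 := by simpa [hne₁] using g₁.symm
    have hC : C.eval ε = 0 := by simpa [hne₂, -sub_neg_eq_add, -map_neg] using g₂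
    exact ⟨hB, hC, by simpa [hB, hC] using g₃⟩
  -- degrees
  have hdeg₁ : A ∈ polyLE k 0 ∧ B ∈ polyLE k (d₂ - d₁) := by
    -- The test vector has the largest degree 3N + d₁ allowed in degree N, so the bounds on its
    -- image become bounds on A and B.
    set e : ℕ := (3 * N + d₁ - 1).toNat with he
    have g := key₂ N ((𝕥 - Polynomial.C ε) * 𝕥 ^ e, 0) (fst_mem_stringSet
      (mul_mem_polyLE' (X_sub_C_mem_polyLE _ le_rfl) (X_pow_mem_polyLE e le_rfl) (by omega)) (by simp))
    have hm : ((𝕥 - Polynomial.C ε) * 𝕥 ^ e : Polynomial k).natDegree = 1 + e := by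
      rw [(Polynomial.monic_X_sub_C ε).natDegree_mul (Polynomial.monic_X_pow e),
        Polynomial.natDegree_X_sub_C, Polynomial.natDegree_X_pow]
    have hm0 : ((𝕥 - Polynomial.C ε) * 𝕥 ^ e : Polynomial k) ≠ 0 :=
      ((Polynomial.monic_X_sub_C ε).mul (Polynomial.monic_X_pow e)).ne_zero
    have ga := g.1
    have gb := g.2.1
    simp only [mul_zero, add_zero] at ga gb
    rw [mul_comm A] at ga
    rw [mul_comm B] at gb
    exact ⟨mem_polyLE_of_mul_mem (e := 1 + e) hm0 (by rw [hm]; push_cast; rfl) (polyLE_mono (by omega) ga),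
      mem_polyLE_of_mul_mem (e := 1 + e) hm0 (by rw [hm]; push_cast; rfl) (polyLE_mono (by omega) gb)⟩
  have hdeg₂ : D ∈ polyLE k 0 ∧ C ∈ polyLE k (d₁ - d₂) := by
    set e : ℕ := (3 * N + d₂ - 1).toNat with he
    have g := key₂ N (0, (𝕥 - Polynomial.C (-ε)) * 𝕥 ^ e) (snd_mem_stringSet
      (mul_mem_polyLE' (X_sub_C_mem_polyLE _ le_rfl) (X_pow_mem_polyLE e le_rfl) (by omega)) (by simp))
    have hm : ((𝕥 - Polynomial.C (-ε)) * 𝕥 ^ e : Polynomial k).natDegree = 1 + e := by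
      rw [(Polynomial.monic_X_sub_C (-ε)).natDegree_mul (Polynomial.monic_X_pow e),
        Polynomial.natDegree_X_sub_C, Polynomial.natDegree_X_pow]
    have hm0 : ((𝕥 - Polynomial.C (-ε)) * 𝕥 ^ e : Polynomial k) ≠ 0 :=
      ((Polynomial.monic_X_sub_C (-ε)).mul (Polynomial.monic_X_pow e)).ne_zero
    have ga := g.1
    have gb := g.2.1
    simp only [mul_zero, zero_add] at ga gb
    rw [mul_comm C] at ga
    rw [mul_comm D] at gb
    exact ⟨mem_polyLE_of_mul_mem (e := 1 + e) hm0 (by rw [hm]; push_cast; rfl) (polyLE_mono (by omega) gb),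
      mem_polyLE_of_mul_mem (e := 1 + e) hm0 (by rw [hm]; push_cast; rfl) (polyLE_mono (by omega) ga)⟩
  have hconst : ∀ {p : Polynomial k}, p ∈ polyLE k 0 → p = Polynomial.C (p.coeff 0) := by
    intro p hp
    ext i
    rcases i with _ | i
    · simp
    · rw [Polynomial.coeff_C_succ]
      exact hp _ (by push_cast; omega)
  have hAD : A = D := by
    have h₃ := gB.2.2
    rw [hconst hdeg₁.1, hconst hdeg₂.1, Polynomial.eval_C, Polynomial.eval_C] at h₃
    rw [hconst hdeg₁.1, hconst hdeg₂.1, h₃]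
  refine ⟨A.coeff 0, B, C, ?_, ?_⟩
  -- B has degree at most d₂ - d₁ and C at most d₁ - d₂, so one of them vanishes when d₁ ≠ d₂. When
  -- d₁ = d₂, B is a constant with a zero at -ε.
  · rcases lt_trichotomy d₁ d₂ with hd | hd | hd
    · exact Or.inr (eq_zero_of_mem_polyLE_neg hdeg₂.2 (by omega))
    · left
      have hB := hdeg₁.2
      rw [hd, sub_self] at hB
      have := gB.1
      rw [hconst hB, Polynomial.eval_C] at this
      rw [hconst hB, this, map_zero]
    · exact Or.inl (eq_zero_of_mem_polyLE_neg hdeg₁.2 (by omega))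
  · intro n x v hx ev
    obtain ⟨w, -, ew⟩ := h.map_mem n _ (hπ n x hx)
    obtain ⟨k₁, k₂⟩ := key n x v w ev ew
    rw [ew, cancel k₁ k₂, ← hAD]
    have e := hconst hdeg₁.1
    rw [Polynomial.smul_eq_C_mul, Polynomial.smul_eq_C_mul, ← e]

/-- The projection of a graded decomposition has a matrix a·1 plus a triangular nilpotent one. If a
= 1 it is injective, so P = 0; if a ≠ 1 it fixes no nonzero vector, so N = 0. -/
lemma IsString.isIndecomposable (h : IsString 𝓜 ε d₁ d₂) (hk : (2 : k) ≠ 0)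
    (hε : ε = 1 ∨ ε = -1) [Module.Finite (Cone k) M] : IsIndecomposable k 𝓜 := by
  constructor
  · by_contra hn
    rw [not_nontrivial_iff_subsingleton] at hn
    have := h.finrank_eq hk
    rw [Module.finrank_zero_of_subsingleton] at this
    omega
  intro N P hN hP hNP
  obtain ⟨Φ, hΦ⟩ := h.exists_realizes
  have hg := h.graded
  obtain ⟨a, B, C, hBC, hπ⟩ := hΦ.exists_matrix_of_endomorphism hk hε (N.projection P hNP) (by
    intro n x hx
    -- The projection preserves degrees because N and P contain the homogeneous components of their
    -- elements.
    have e : N.projection P hNP x = comp hg.isInternal n (N.projection P hNP x) := by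
      have e₁ := congrArg (comp hg.isInternal n) (Submodule.projection_add_projection_eq_self hNP x)
      rw [comp_of_mem _ hx, map_add] at e₁
      have e₂ := congrArg (N.projection P hNP) e₁
      rw [map_add, Submodule.projection_apply_of_mem_left hNP (hN.comp_mem hg n
        (Submodule.projection_apply_mem _ _)), (Submodule.projection_apply_eq_zero_iff hNP).2
        (hP.comp_mem hg n (Submodule.projection_apply_mem _ _)), add_zero] at e₂
      exact e₂.symm
    rw [e]
    exact comp_mem _ _ _)
  by_cases ha : a = 1
  · right
    refine hP.eq_bot fun n x hx hxP => ?_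
    obtain ⟨v, -, ev⟩ := hΦ.map_mem n x hx
    have e := hπ n x v hx ev
    rw [(Submodule.projection_apply_eq_zero_iff hNP).2 hxP, map_zero, ← emb_zero n] at e
    have e := emb_injective n e
    have e₁ := congrArg Prod.fst e
    have e₂ := congrArg Prod.snd e
    simp only [ha, one_smul, Prod.fst_zero, Prod.snd_zero] at e₁ e₂
    have : v = 0 := by
      rcases hBC with rfl | rfl
      · have h2 : v.2 = 0 := by simpa using e₂.symm
        exact Prod.ext (by simpa [h2] using e₁.symm) h2
      · have h1 : v.1 = 0 := by simpa using e₁.symm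
        exact Prod.ext h1 (by simpa [h1] using e₂.symm)
    apply hΦ.injective
    rw [ev, this, emb_zero, map_zero]
  · left
    refine hN.eq_bot fun n x hx hxN => ?_
    obtain ⟨v, -, ev⟩ := hΦ.map_mem n x hx
    have e := hπ n x v hx ev
    rw [Submodule.projection_apply_of_mem_left hNP hxN, ev] at e
    have e := emb_injective n e
    have e₁ := congrArg Prod.fst e
    have e₂ := congrArg Prod.snd e
    simp only at e₁ e₂
    have hs : ∀ p : Polynomial k, p = a • p → p = 0 := by
      intro p hp
      have : (1 - a) • p = 0 := by rw [sub_smul, one_smul, ← hp, sub_self]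
      exact (smul_eq_zero.1 this).resolve_left (sub_ne_zero.2 (Ne.symm ha))
    have : v = 0 := by
      rcases hBC with rfl | rfl
      · have h2 : v.2 = 0 := hs _ (by simpa using e₂)
        exact Prod.ext (hs _ (by simpa [h2] using e₁)) h2
      · have h1 : v.1 = 0 := hs _ (by simpa using e₁)
        exact Prod.ext h1 (hs _ (by simpa [h1] using e₂))
    apply hΦ.injective
    rw [ev, this, emb_zero, map_zero]

end

end

section

/-! ### Local freeness -/

section

variable {R : Type*} {M : Type*} [CommRing R] [AddCommGroup M] [Module R M]

/-- After localization r becomes a unit, so the independent family w becomes a basis. -/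
lemma free_localizedModule_of_span (p : Ideal R) [p.IsPrime] {n : ℕ} (w : Fin n → M)
    (hw : LinearIndependent R w) {r : R} (hr : r ∉ p)
    (hspan : ∀ x, r • x ∈ Submodule.span R (Set.range w)) :
    Module.Free (Localization.AtPrime p) (LocalizedModule p.primeCompl M) := by
  let f := LocalizedModule.mkLinearMap p.primeCompl M
  have hli : LinearIndependent (Localization.AtPrime p) (fun i => f (w i)) :=
    hw.of_isLocalizedModule (Localization.AtPrime p) p.primeCompl f
  refine Module.Free.of_basis (Module.Basis.mk hli ?_)
  rintro y -
  obtain ⟨⟨x, s⟩, rfl⟩ := IsLocalizedModule.mk'_surjective p.primeCompl f y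
  let S := Submodule.span (Localization.AtPrime p) (Set.range fun i => f (w i))
  have h1 : ∀ z ∈ Submodule.span R (Set.range w), f z ∈ S := by
    intro z hz
    induction hz using Submodule.span_induction with
    | mem z hz =>
      obtain ⟨i, rfl⟩ := hz
      exact Submodule.subset_span ⟨i, rfl⟩
    | zero => rw [map_zero]; exact zero_mem _
    | add a b _ _ ha hb => rw [map_add]; exact add_mem ha hb
    | smul c a _ ha =>
      rw [map_smul, ← algebraMap_smul (Localization.AtPrime p)]
      exact Submodule.smul_mem _ _ ha
  have h2 := h1 _ (hspan x)
  have h3 : IsLocalizedModule.mk' f x s =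
      (Localization.mk 1 (s * ⟨r, hr⟩) : Localization.AtPrime p) • f (r • x) := by
    have hsr : ((s * ⟨r, hr⟩ : p.primeCompl) : R) = s * r := rfl
    have : (algebraMap R (Localization.AtPrime p) (s * r)) •
        (Localization.mk 1 (s * ⟨r, hr⟩) : Localization.AtPrime p) • f (r • x) = f (r • x) := by
      rw [smul_smul, ← hsr, Localization.mk_eq_mk'_apply]
      rw [IsLocalization.mul_mk'_eq_mk'_of_mul, mul_one, IsLocalization.mk'_self', one_smul]
    have hinj := IsLocalizedModule.smul_injective f (s * ⟨r, hr⟩)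
    apply hinj
    change ((s * ⟨r, hr⟩ : p.primeCompl) : R) • IsLocalizedModule.mk' f x s =
      ((s * ⟨r, hr⟩ : p.primeCompl) : R) •
        (Localization.mk 1 (s * ⟨r, hr⟩) : Localization.AtPrime p) • f (r • x)
    rw [hsr, ← algebraMap_smul (Localization.AtPrime p) (s * r) (_ • f (r • x)), this, mul_comm,
      mul_smul, map_smul]
    congr 1
    exact IsLocalizedModule.mk'_cancel' f x s
  change IsLocalizedModule.mk' f x s ∈ S
  rw [h3]
  exact Submodule.smul_mem _ _ h2

/-- Clearing denominators in a basis of the localization gives elements of M; their number is the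
rank of M because localizing a module over a domain preserves the rank. -/
lemma exists_span_of_free_localizedModule [IsDomain R] [Module.Finite R M] (p : Ideal R) [p.IsPrime]
    {n : ℕ} (hn : Module.finrank R M = n)
    (hfree : Module.Free (Localization.AtPrime p) (LocalizedModule p.primeCompl M)) :
    ∃ w : Fin n → M, ∀ x, ∃ r ∉ p, r • x ∈ Submodule.span R (Set.range w) := by
  let f := LocalizedModule.mkLinearMap p.primeCompl M
  have hp : p.primeCompl ≤ nonZeroDivisors R := p.primeCompl_le_nonZeroDivisors
  have hfin : Module.Finite (Localization.AtPrime p) (LocalizedModule p.primeCompl M) :=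
    Module.Finite.of_isLocalizedModule p.primeCompl f
  have hrank : Module.finrank (Localization.AtPrime p) (LocalizedModule p.primeCompl M) = n := by
    rw [IsLocalization.finrank_eq (Localization.AtPrime p) p.primeCompl hp,
      IsLocalizedModule.finrank_eq p.primeCompl f hp, hn]
  let b := Module.finBasisOfFinrankEq _ _ hrank
  choose w hw using fun i => IsLocalizedModule.mk'_surjective p.primeCompl f (b i)
  refine ⟨fun i => (w i).1, fun x => ?_⟩
  have hx : f x ∈ Submodule.span (Localization.AtPrime p)
      (f '' Set.range fun i => (w i).1) := by
    have h1 : f x ∈ Submodule.span (Localization.AtPrime p) (Set.range b) := by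
      rw [b.span_eq]; trivial
    refine Submodule.span_le.2 ?_ h1
    rintro _ ⟨i, rfl⟩
    have : b i = (Localization.mk 1 (w i).2 : Localization.AtPrime p) • f (w i).1 := by
      rw [← hw i]
      apply IsLocalizedModule.smul_injective f (w i).2
      change ((w i).2 : R) • IsLocalizedModule.mk' f (w i).1 (w i).2 =
        ((w i).2 : R) • (Localization.mk 1 (w i).2 : Localization.AtPrime p) • f (w i).1
      rw [← algebraMap_smul (Localization.AtPrime p) ((w i).2 : R) (_ • f (w i).1), smul_smul,
        Localization.mk_eq_mk'_apply, IsLocalization.mul_mk'_eq_mk'_of_mul, mul_one,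
        IsLocalization.mk'_self', one_smul]
      exact IsLocalizedModule.mk'_cancel' f (w i).1 (w i).2
    rw [this]
    exact Submodule.smul_mem _ _ (Submodule.subset_span ⟨_, ⟨i, rfl⟩, rfl⟩)
  rw [← Submodule.localized'_span (Localization.AtPrime p) p.primeCompl f,
    Submodule.mem_localized'] at hx
  obtain ⟨m, hm, s, hs⟩ := hx
  rw [IsLocalizedModule.mk'_eq_iff] at hs
  have hs' : f m = f ((s : R) • x) := by rw [map_smul]; exact hs
  rw [IsLocalizedModule.eq_iff_exists p.primeCompl f] at hs'
  obtain ⟨c, hc⟩ := hs'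
  refine ⟨c * s, (c * s).2, ?_⟩
  have : ((c : R) * s) • x = (c : R) • m := by rw [mul_smul]; exact hc.symm
  rw [this]
  exact Submodule.smul_mem _ _ hm

end

lemma coeff_C_mul_T' (c : k) (m n : ℤ) :
    (LaurentPolynomial.C c * LaurentPolynomial.T m).coeff n = if m = n then c else 0 := by
  rw [← LaurentPolynomial.single_eq_C_mul_T, AddMonoidAlgebra.coeff_single, Finsupp.single_apply]

lemma nodeEval_comp (n : ℤ) (r : Cone k) : nodeEval k (comp coneDeg_isInternal n r) =
    LaurentPolynomial.C ((nodeEval k r).coeff n) * LaurentPolynomial.T n := by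
  have hr := mem_iSup_coneDeg r
  induction hr using AddSubgroup.iSup_induction' with
  | hp d r hr =>
    obtain ⟨p, -, e⟩ := toParam_of_mem_coneDeg hr
    have e' : nodeEval k r = LaurentPolynomial.C (p.eval 1) * LaurentPolynomial.T d := by
      rw [nodeEval, RingHom.comp_apply, e, evalAt_C_mul_T]
    by_cases hd : d = n
    · subst hd
      rw [comp_of_mem _ hr, e', coeff_C_mul_T', if_pos rfl]
    · rw [comp_of_mem_ne _ hr hd, e', coeff_C_mul_T', if_neg hd, map_zero, map_zero, zero_mul]
  | h1 => simp
  | hadd x y _ _ hx hy =>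
    rw [map_add, map_add, map_add, hx, hy]
    simp only [AddMonoidAlgebra.coeff_add, Finsupp.add_apply, map_add, add_mul]

lemma nodePrime_homogeneous : IsHomogeneousSubmodule (coneDeg k) (nodePrime k) := by
  apply le_antisymm
  · intro r hr
    obtain ⟨s, hs, -⟩ := exists_sum_comp coneDeg_isInternal r
    rw [hs]
    refine Submodule.sum_mem _ fun n _ => Submodule.subset_span ⟨?_, n, comp_mem _ n r⟩
    rw [mem_nodePrime, nodeEval_comp, mem_nodePrime.1 hr]
    simp
  · rw [Submodule.span_le]
    exact fun x hx => hx.1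

lemma not_irrelevant_le_nodePrime : ¬ irrelevant k ≤ nodePrime k := by
  intro h
  have := h (toCone_X_mem_irrelevant 2)
  rw [mem_nodePrime, nodeEval_X2] at this
  have := congrArg (fun x => x.coeff 1) this
  simp at this

variable {M : Type v} [AddCommGroup M] [Module (Cone k) M] {𝓜 : ℤ → AddSubgroup M}
  {ε : k} {d₁ d₂ : ℤ}

/-- The values v₁(ε), v₁(-ε), v₂(ε) are three independent functionals on the fibre at the node; the
fourth value v₂(-ε) equals the first. A locally free module of rank two would be generated there by
two elements, which contradicts the nonvanishing of a 3 × 3 determinant. -/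
lemma IsString.not_isLocallyFree (h : IsString 𝓜 ε d₁ d₂) (hk : (2 : k) ≠ 0)
    (hε : ε = 1 ∨ ε = -1) [Module.Finite (Cone k) M] : ¬ IsLocallyFree k M := by
  intro hfree
  obtain ⟨w, hw⟩ := exists_span_of_free_localizedModule (nodePrime k) (h.finrank_eq hk)
    (hfree (nodePrime k) nodePrime_homogeneous not_irrelevant_le_nodePrime)
  obtain ⟨Φ, hΦ⟩ := h.exists_realizes
  have hne₂ : ε + ε ≠ 0 := fun h => ne_neg hk hε (by linear_combination h)
  set N : ℤ := |d₁| + |d₂| + 1 with hN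
  have hab₁ := neg_abs_le d₁
  have hab₁' := abs_nonneg d₁
  have hab₂ := neg_abs_le d₂
  have hab₂' := abs_nonneg d₂
  have hε' : -ε = 1 ∨ -ε = -1 := by rcases hε with rfl | rfl <;> simp
  -- the three functionals
  let e : Fin 3 → M → LaurentPolynomial k :=
    ![fun x => evalAt ε (Φ x).1, fun x => evalAt (-ε) (Φ x).1, fun x => evalAt ε (Φ x).2]
  have he_add : ∀ j x y, e j (x + y) = e j x + e j y := by
    intro j x y
    fin_cases j <;> simp [e]
  have he_smul : ∀ j (r : Cone k) x, e j (r • x) = nodeEval k r * e j x := by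
    intro j r x
    fin_cases j <;> simp [e, cone_smul_def, evalAt_toParam hε, evalAt_toParam hε']
  -- The three vectors are dual to the three functionals up to nonzero scalars: each functional is
  -- nonzero on exactly one of them.
  obtain ⟨x₁, -, f₁⟩ := hΦ.exists_of_mem N (𝕥 + Polynomial.C ε, Polynomial.C ε - 𝕥)
    ⟨add_mem (X_mem_polyLE (by omega)) (C_mem_polyLE _ (by omega)),
      sub_mem (C_mem_polyLE _ (by omega)) (X_mem_polyLE (by omega)), by simp⟩
  obtain ⟨x₂, -, f₂⟩ := hΦ.exists_of_mem N (𝕥 - Polynomial.C ε, 0)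
    (fst_mem_stringSet (X_sub_C_mem_polyLE _ (by omega)) (by simp))
  obtain ⟨x₃, -, f₃⟩ := hΦ.exists_of_mem N (0, 𝕥 + Polynomial.C ε)
    (snd_mem_stringSet (add_mem (X_mem_polyLE (by omega)) (C_mem_polyLE _ (by omega))) (by simp))
  have hspan : ∀ x, ∃ r ∉ nodePrime k, ∃ a b : Cone k, r • x = a • w 0 + b • w 1 := by
    intro x
    obtain ⟨r, hr, hx⟩ := hw x
    have hrange : Set.range w = {w 0, w 1} := by
      ext y
      simp [Fin.exists_fin_two, eq_comm]
    rw [hrange, Submodule.mem_span_pair] at hx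
    obtain ⟨a, b, hab⟩ := hx
    exact ⟨r, hr, a, b, hab.symm⟩
  obtain ⟨r₁, hr₁, a₁, b₁, g₁⟩ := hspan x₁
  obtain ⟨r₂, hr₂, a₂, b₂, g₂⟩ := hspan x₂
  obtain ⟨r₃, hr₃, a₃, b₃, g₃⟩ := hspan x₃
  have E : ∀ j r x a b, r • x = a • w 0 + b • w 1 →
      nodeEval k r * e j x = nodeEval k a * e j (w 0) + nodeEval k b * e j (w 1) := by
    intro j r x a b hx
    rw [← he_smul, hx, he_add, he_smul, he_smul]
  have hCT : ∀ {c : k}, c ≠ 0 → LaurentPolynomial.C c * LaurentPolynomial.T N ≠ 0 := by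
    intro c hc h0
    have := congrArg (fun x => x.coeff N) h0
    simp only [coeff_C_mul_T', if_true] at this
    exact hc this
  have z12 : e 0 x₂ = 0 ∧ e 0 x₃ = 0 ∧ e 1 x₁ = 0 ∧ e 1 x₃ = 0 ∧ e 2 x₁ = 0 ∧ e 2 x₂ = 0 := by
    refine ⟨?_, ?_, ?_, ?_, ?_, ?_⟩ <;>
      simp [e, f₁, f₂, f₃, emb, -map_add, -map_sub]
  have d1 : e 0 x₁ ≠ 0 := by
    have : e 0 x₁ = LaurentPolynomial.C (ε + ε) * LaurentPolynomial.T N := by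
      simp [e, f₁, emb, -map_add, -map_sub]
    rw [this]; exact hCT hne₂
  have d2 : e 1 x₂ ≠ 0 := by
    have : e 1 x₂ = LaurentPolynomial.C (-(ε + ε)) * LaurentPolynomial.T N := by
      simp [e, f₂, emb, -map_add, -map_sub, -map_neg, sub_eq_add_neg]
    rw [this]; exact hCT (neg_ne_zero.2 hne₂)
  have d3 : e 2 x₃ ≠ 0 := by
    have : e 2 x₃ = LaurentPolynomial.C (ε + ε) * LaurentPolynomial.T N := by
      simp [e, f₃, emb, -map_add, -map_sub]
    rw [this]; exact hCT hne₂
  obtain ⟨z1, z2, z3, z4, z5, z6⟩ := z12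
  have h11 := E 0 _ _ _ _ g₁
  have h12 := E 1 _ _ _ _ g₁
  have h13 := E 2 _ _ _ _ g₁
  have h21 := E 0 _ _ _ _ g₂
  have h22 := E 1 _ _ _ _ g₂
  have h23 := E 2 _ _ _ _ g₂
  have h31 := E 0 _ _ _ _ g₃
  have h32 := E 1 _ _ _ _ g₃
  have h33 := E 2 _ _ _ _ g₃
  rw [z1, mul_zero] at h21
  rw [z2, mul_zero] at h31
  rw [z3, mul_zero] at h12
  rw [z4, mul_zero] at h32
  rw [z5, mul_zero] at h13
  rw [z6, mul_zero] at h23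
  -- The determinant of a product of a 3 × 2 and a 2 × 3 matrix is zero.
  have minor : ∀ a₁ b₁ a₂ b₂ a₃ b₃ p₁ q₁ p₂ q₂ p₃ q₃ : LaurentPolynomial k,
      (a₁ * p₁ + b₁ * q₁) * ((a₂ * p₂ + b₂ * q₂) * (a₃ * p₃ + b₃ * q₃) -
        (a₂ * p₃ + b₂ * q₃) * (a₃ * p₂ + b₃ * q₂)) -
      (a₁ * p₂ + b₁ * q₂) * ((a₂ * p₁ + b₂ * q₁) * (a₃ * p₃ + b₃ * q₃) -
        (a₂ * p₃ + b₂ * q₃) * (a₃ * p₁ + b₃ * q₁)) +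
      (a₁ * p₃ + b₁ * q₃) * ((a₂ * p₁ + b₂ * q₁) * (a₃ * p₂ + b₃ * q₂) -
        (a₂ * p₂ + b₂ * q₂) * (a₃ * p₁ + b₃ * q₁)) = 0 := by intros; ring
  have hdet := minor (nodeEval k a₁) (nodeEval k b₁) (nodeEval k a₂) (nodeEval k b₂)
    (nodeEval k a₃) (nodeEval k b₃) (e 0 (w 0)) (e 0 (w 1)) (e 1 (w 0)) (e 1 (w 1))
    (e 2 (w 0)) (e 2 (w 1))
  rw [← h11, ← h12, ← h13, ← h21, ← h22, ← h23, ← h31, ← h32, ← h33] at hdet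
  have hm : ∀ {r : Cone k}, r ∉ nodePrime k → nodeEval k r ≠ 0 := fun hr h => hr h
  have : (nodeEval k r₁ * e 0 x₁) * ((nodeEval k r₂ * e 1 x₂) * (nodeEval k r₃ * e 2 x₃)) = 0 := by
    simpa using hdet
  exact mul_ne_zero (mul_ne_zero (hm hr₁) d1) (mul_ne_zero (mul_ne_zero (hm hr₂) d2)
    (mul_ne_zero (hm hr₃) d3)) this

end

section

/-! ### Cokernels -/

lemma nodePoly_mul_cancel {F G : MvPolynomial (Fin 3) k} (h : nodePoly k * F = nodePoly k * G) :
    F = G :=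
  mul_left_cancel₀ nodePoly_ne_zero h

/-- The determinant of A is nonzero because that of AB is, so A can be cancelled on the left from
A(BA - f·1) = 0. -/
lemma mul_comm_of_mul_eq_smul_one {n : ℕ} {S : Type*} [CommRing S] [IsDomain S]
    {A B : Matrix (Fin n) (Fin n) S} {f : S} (hf : f ≠ 0) (h : A * B = f • (1 : Matrix _ _ S)) :
    B * A = f • (1 : Matrix _ _ S) := by
  have hdet : A.det ≠ 0 := by
    intro h0
    have := congrArg Matrix.det h
    rw [Matrix.det_mul, h0, zero_mul, Matrix.det_smul, Matrix.det_one, mul_one] at this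
    exact pow_ne_zero _ hf this.symm
  have h1 : A * (B * A - f • (1 : Matrix _ _ S)) = 0 := by
    rw [mul_sub, ← mul_assoc, h]
    simp
  have h2 := congrArg (A.adjugate * ·) h1
  simp only [← mul_assoc, Matrix.adjugate_mul, mul_zero, Matrix.smul_mul, one_mul] at h2
  rw [← sub_eq_zero]
  ext i j
  have := congrFun (congrFun h2 i) j
  simp only [Matrix.smul_apply, Matrix.zero_apply, smul_eq_mul] at this
  simpa using (mul_eq_zero.1 this).resolve_left hdet

/-- A matrix factorization `(A, B)` of the equation of the cone, up to the scalar `μ`, such that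
`B` splits over the parametrization into a sum of two matrices of rank one. -/
structure Factorization (A : DegMatrix k) (ε μ : k) (G H : Fin 5 → Polynomial k × Polynomial k)
    (B : Matrix (Fin 5) (Fin 5) (MvPolynomial (Fin 3) k)) : Prop where
  hom : A.IsHomogeneous
  hom' : ∀ i j, B i j ∈ polyDeg k (3 + A.rowDeg j - A.colDeg i)
  mul_eq : A.mat * B = nodePoly k • (1 : Matrix _ _ _)
  scalar_ne_zero : μ ≠ 0
  relG : ∀ j, ∑ i, dehom k (A.mat i j) • G i = 0
  relH : ∀ i, ∑ j, dehom k (A.mat i j) • H j = 0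
  dehom_eq : ∀ i j, Polynomial.C μ * dehom k (B i j) =
    (𝕥 + Polynomial.C ε) * (H i).1 * (G j).1 - (𝕥 - Polynomial.C ε) * (H i).2 * (G j).2

section

variable {A : DegMatrix k} {ε μ : k} {G H : Fin 5 → Polynomial k × Polynomial k}
  {B : Matrix (Fin 5) (Fin 5) (MvPolynomial (Fin 3) k)}

/-- The splitting of B is symmetric in the generators G and the cogenerators H, so the dual matrix
needs no separate computation. -/
lemma Factorization.transpose (h : Factorization A ε μ G H B) :
    Factorization A.transpose ε μ H G B.transpose where
  hom i j := by
    have := h.hom j i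
    simp only [DegMatrix.transpose, Matrix.transpose_apply]
    convert this using 1
    congr 1
    omega
  hom' i j := by
    have := h.hom' j i
    simp only [DegMatrix.transpose, Matrix.transpose_apply]
    convert this using 1
    congr 1
    omega
  mul_eq := by
    rw [DegMatrix.transpose, ← Matrix.transpose_mul,
      mul_comm_of_mul_eq_smul_one nodePoly_ne_zero h.mul_eq]
    simp
  scalar_ne_zero := h.scalar_ne_zero
  relG := h.relH
  relH := h.relG
  dehom_eq i j := by
    rw [Matrix.transpose_apply, h.dehom_eq]
    ring

/-- The map given by generators with their degrees. -/
def genMap (r : Fin 5 → ℤ) (G : Fin 5 → Polynomial k × Polynomial k) :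
    (Fin 5 → Cone k) →ₗ[Cone k] Param k × Param k :=
  Fintype.linearCombination (Cone k) fun i => emb (r i) (G i)

lemma genMap_apply (r : Fin 5 → ℤ) (G : Fin 5 → Polynomial k × Polynomial k) (v : Fin 5 → Cone k) :
    genMap r G v = ∑ i, v i • emb (r i) (G i) := Fintype.linearCombination_apply _ _ _

lemma toParam_toCone_of_mem {d : ℤ} {F : MvPolynomial (Fin 3) k} (hF : F ∈ polyDeg k d) :
    toParam k (toCone k F) = 𝐂 (dehom k F) * 𝐓 d := by
  rw [toParam_toCone, polyParam_of_mem_polyDeg hF]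

lemma sum_sum_mul_smul_eq_zero {ι R N : Type*} [Fintype ι] [CommRing R] [AddCommGroup N] [Module R N]
    (a : ι → ι → R) (w : ι → R) (e : ι → N) (h : ∀ j, ∑ i, a i j • e i = 0) :
    ∑ i, (∑ j, a i j * w j) • e i = 0 := by
  simp_rw [Finset.sum_smul]
  rw [Finset.sum_comm]
  refine Finset.sum_eq_zero fun j _ => ?_
  rw [← smul_zero (w j), ← h j, Finset.smul_sum]
  refine Finset.sum_congr rfl fun i _ => ?_
  rw [smul_smul, mul_comm]

lemma Factorization.range_le_ker (h : Factorization A ε μ G H B) :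
    LinearMap.range (A.mat.map (toCone k)).mulVecLin ≤ LinearMap.ker (genMap A.rowDeg G) := by
  rintro _ ⟨w, rfl⟩
  have h1 : ∀ j, ∑ i, toCone k (A.mat i j) • emb (A.rowDeg i) (G i) = 0 := by
    intro j
    have : ∀ i, toCone k (A.mat i j) • emb (A.rowDeg i) (G i) =
        emb (A.colDeg j) (dehom k (A.mat i j) • G i) := by
      intro i
      rw [smul_emb (toParam_toCone_of_mem (h.hom i j))]
      congr 1
      omega
    rw [Finset.sum_congr rfl fun i _ => this i, ← emb_sum, h.relG, emb_zero]
  rw [LinearMap.mem_ker, genMap_apply]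
  exact sum_sum_mul_smul_eq_zero (fun i j => toCone k (A.mat i j)) w _ h1

/-- If Σ vⱼ Gⱼ = 0, the splitting of B into pieces built from the two coordinates of G gives Bv = 0
in the cone. Lifted to polynomials this reads BV = fW; hence fV = ABV = f·AW and V = AW. -/
lemma Factorization.ker_le_range (h : Factorization A ε μ G H B) :
    LinearMap.ker (genMap A.rowDeg G) ≤ LinearMap.range (A.mat.map (toCone k)).mulVecLin := by
  intro v hv
  rw [LinearMap.mem_ker, genMap_apply] at hv
  have hv1 := congrArg Prod.fst hv
  have hv2 := congrArg Prod.snd hv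
  simp only [Prod.fst_sum, Prod.snd_sum, Prod.smul_fst, Prod.smul_snd, cone_smul_def, emb,
    Prod.fst_zero, Prod.snd_zero] at hv1 hv2
  have hB : ∀ i, ∑ j, toCone k (B i j) * v j = 0 := by
    intro i
    rw [← toParam_eq_zero]
    have hμ : (𝐂 (Polynomial.C μ) : Param k) ≠ 0 := by
      have := C_mul_T_ne_zero (Polynomial.C_ne_zero.2 h.scalar_ne_zero) 0
      simpa using this
    apply (mul_eq_zero.1 ?_).resolve_left hμ
    have e1 : ∀ j, 𝐂 (Polynomial.C μ) * (toParam k (toCone k (B i j)) * toParam k (v j)) =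
        𝐂 ((𝕥 + Polynomial.C ε) * (H i).1) * 𝐓 (3 - A.colDeg i) *
          (toParam k (v j) * (𝐂 (G j).1 * 𝐓 (A.rowDeg j))) -
        𝐂 ((𝕥 - Polynomial.C ε) * (H i).2) * 𝐓 (3 - A.colDeg i) *
          (toParam k (v j) * (𝐂 (G j).2 * 𝐓 (A.rowDeg j))) := by
      intro j
      rw [toParam_toCone_of_mem (h.hom' i j), ← mul_assoc, ← mul_assoc, ← map_mul, h.dehom_eq,
        show 3 + A.rowDeg j - A.colDeg i = 3 - A.colDeg i + A.rowDeg j by ring,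
        LaurentPolynomial.T_add, map_sub, map_mul, map_mul 𝐂 (_ * (H i).2)]
      ring
    simp only [map_sum, map_mul, Finset.mul_sum]
    simp only [map_mul] at e1
    rw [Finset.sum_congr rfl fun j _ => e1 j, Finset.sum_sub_distrib, ← Finset.mul_sum,
      ← Finset.mul_sum, hv1, hv2]
    simp
  choose V hV using fun i => Ideal.Quotient.mk_surjective (I := Ideal.span {nodePoly k}) (v i)
  have hBV : ∀ i, ∃ W, B.mulVec V i = nodePoly k * W := by
    intro i
    have h1 : toCone k (B.mulVec V i) = 0 := by
      rw [← hB i, Matrix.mulVec, dotProduct, map_sum]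
      refine Finset.sum_congr rfl fun j _ => ?_
      rw [map_mul]
      congr 1
      exact hV j
    rw [Ideal.Quotient.eq_zero_iff_mem, Ideal.mem_span_singleton] at h1
    exact h1
  choose W hW using hBV
  have hAW : A.mat.mulVec W = V := by
    ext1 i
    apply nodePoly_mul_cancel
    have h1 : B.mulVec V = nodePoly k • W := funext hW
    have h2 : A.mat.mulVec (B.mulVec V) = nodePoly k • V := by
      rw [Matrix.mulVec_mulVec, h.mul_eq, Matrix.smul_mulVec, Matrix.one_mulVec]
    rw [h1, Matrix.mulVec_smul] at h2
    exact congrFun h2 i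
  refine ⟨fun i => toCone k (W i), ?_⟩
  ext1 i
  rw [Matrix.mulVecLin_apply, ← hV i, ← hAW, Matrix.mulVec, Matrix.mulVec, dotProduct, dotProduct,
    map_sum]
  simp

lemma mk_mem_iSup_cokerGrading (A : DegMatrix k) (x : A.Coker) : x ∈ ⨆ n, A.cokerGrading n := by
  obtain ⟨v, rfl⟩ := Submodule.mkQ_surjective _ x
  have h1 : ∀ i (r : Cone k), Submodule.mkQ (LinearMap.range (A.mat.map (toCone k)).mulVecLin)
      (Pi.single i r) ∈ ⨆ n, A.cokerGrading n := by
    intro i r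
    have hr := mem_iSup_coneDeg r
    induction hr using AddSubgroup.iSup_induction' with
    | hp d r hr =>
      refine AddSubgroup.mem_iSup_of_mem (d + A.rowDeg i) ⟨Pi.single i r, ?_, rfl⟩
      intro j _
      by_cases hj : j = i
      · subst hj
        simpa using hr
      · rw [Pi.single_eq_of_ne hj]
        exact zero_mem (coneDeg k _)
    | h1 => rw [Pi.single_zero, map_zero]; exact zero_mem _
    | hadd x y _ _ hx hy =>
      rw [Pi.single_add, map_add]
      exact add_mem hx hy
  rw [← Finset.univ_sum_single v, map_sum]
  exact sum_mem fun i _ => h1 i _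

/-- The polynomial vectors of degree `n` generated by `G`. -/
def generated (r : Fin 5 → ℤ) (G : Fin 5 → Polynomial k × Polynomial k) (n : ℤ)
    (v : Polynomial k × Polynomial k) : Prop :=
  ∃ p : Fin 5 → Polynomial k, (∀ i, p i ∈ nodeLE k (n - r i)) ∧ v = ∑ i, p i • G i

/-- The factorization makes the map from the cokernel injective. Its image lies in the string
because the gluing is stable under the cone, and it is the whole string by `hgen`. -/
lemma Factorization.isString (h : Factorization A ε μ G H B) (hk : (2 : k) ≠ 0)
    (hε : ε = 1 ∨ ε = -1) {d₁ d₂ : ℤ} (hG : ∀ i, G i ∈ stringSet ε d₁ d₂ (A.rowDeg i))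
    (hgen : ∀ n, ∀ v ∈ stringSet ε d₁ d₂ n, generated A.rowDeg G n v) :
    IsString A.cokerGrading ε d₁ d₂ := by
  let Φ : A.Coker →ₗ[Cone k] Param k × Param k :=
    Submodule.liftQ _ (genMap A.rowDeg G) h.range_le_ker
  have hΦ : ∀ v, Φ (Submodule.mkQ _ v) = genMap A.rowDeg G v := fun v => rfl
  have hinj : Function.Injective Φ := by
    rw [← LinearMap.ker_eq_bot]
    exact Submodule.ker_liftQ_eq_bot _ _ _ h.ker_le_range
  have hmap : ∀ n, ∀ x ∈ A.cokerGrading n, ∃ v ∈ stringSet ε d₁ d₂ n, Φ x = emb n v := by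
    rintro n _ ⟨v, hv, rfl⟩
    have hv' : ∀ i, v i ∈ coneDeg k (n - A.rowDeg i) := fun i => hv i trivial
    choose p hp e using fun i => toParam_of_mem_coneDeg (hv' i)
    refine ⟨∑ i, p i • G i, Submodule.sum_mem _ fun i _ => ?_, ?_⟩
    · have := mul_mem_stringSet hε (hp i) (hG i)
      rwa [sub_add_cancel] at this
    · refine (genMap_apply A.rowDeg G v).trans ?_
      rw [emb_sum]
      refine Finset.sum_congr rfl fun i _ => ?_
      rw [smul_emb (e i), sub_add_cancel]
  refine ⟨⟨?_, ?_⟩, Φ, hinj, hmap, ?_⟩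
  · rintro d n r _ hr ⟨v, hv, rfl⟩
    refine ⟨r • v, fun i hi => ?_, rfl⟩
    have := mul_mem_coneDeg hr (hv i hi)
    rwa [← add_sub_assoc] at this
  · exact isInternal_of_graded_injective hinj
      (fun n x hx => (hmap n x hx).imp fun v hv => hv.2) (mk_mem_iSup_cokerGrading A)
  · intro n v hv
    obtain ⟨p, hp, rfl⟩ := hgen n v hv
    choose w hw e using fun i => exists_coneDeg_of_mem_nodeLE hk (hp i)
    refine ⟨Submodule.mkQ _ w, ⟨w, fun i _ => hw i, rfl⟩, ?_⟩
    rw [hΦ, genMap_apply, emb_sum]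
    refine Finset.sum_congr rfl fun i _ => ?_
    rw [smul_emb (e i), sub_add_cancel]

end

/-! ### The number of generators -/

/-- Since scalars act through the residue field at the vertex, a generating set of M maps to a
spanning set of kⁿ. -/
lemma le_spanFinrank_of_residue {M : Type*} [AddCommGroup M] [Module (Cone k) M]
    [Module.Finite (Cone k) M] {n : ℕ} (ρ : M →+ (Fin n → k))
    (hρs : ∀ (r : Cone k) x, ρ (r • x) = residue k r • ρ x) (hρ : Function.Surjective ρ) :
    n ≤ (⊤ : Submodule (Cone k) M).spanFinrank := by
  classical
  obtain ⟨s, hs, hspan⟩ := (Module.Finite.fg_top (R := Cone k)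
    (M := M)).exists_span_finset_card_eq_spanFinrank
  have h2 : Submodule.span k ((s.image ρ : Finset (Fin n → k)) : Set (Fin n → k)) = ⊤ := by
    rw [eq_top_iff]
    rintro c -
    obtain ⟨x, rfl⟩ := hρ c
    have hx : x ∈ Submodule.span (Cone k) (s : Set M) := by rw [hspan]; trivial
    induction hx using Submodule.span_induction with
    | mem x hx =>
      exact Submodule.subset_span (Finset.mem_coe.2 (Finset.mem_image_of_mem _ hx))
    | zero => rw [map_zero]; exact zero_mem _
    | add x y _ _ hx hy => rw [map_add]; exact add_mem hx hy
    | smul r x _ hx => rw [hρs]; exact Submodule.smul_mem _ _ hx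
  have h3 := finrank_span_finset_le_card (R := k) (s.image ρ)
  rw [Set.finrank, h2, finrank_top, Module.finrank_fin_fun] at h3
  exact h3.trans (Finset.card_image_le.trans hs.le)

lemma spanFinrank_le_of_span_range {M : Type*} [AddCommGroup M] [Module (Cone k) M] {n : ℕ}
    (w : Fin n → M) (hw : Submodule.span (Cone k) (Set.range w) = ⊤) :
    (⊤ : Submodule (Cone k) M).spanFinrank ≤ n := by
  rw [← hw]
  refine (Submodule.spanFinrank_span_le_ncard_of_finite (Set.finite_range _)).trans ?_
  rw [← Set.image_univ]
  refine (Set.ncard_image_le Set.finite_univ).trans ?_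
  simp [Set.ncard_univ]

/-- Entries without constant term make the presentation minimal: reduction at the vertex sends the
cokernel onto k⁵. -/
lemma spanFinrank_coker (A : DegMatrix k) (hA : ∀ i j, constantCoeff (A.mat i j) = 0) :
    (⊤ : Submodule (Cone k) A.Coker).spanFinrank = 5 := by
  apply le_antisymm
  · have h1 : (⊤ : Submodule (Cone k) A.Coker) = Submodule.span (Cone k)
        (Set.range fun i : Fin 5 => Submodule.mkQ (LinearMap.range
          (A.mat.map (toCone k)).mulVecLin) (Pi.single i 1)) := by
      rw [Set.range_comp' , ← Submodule.map_span]
      have := (Pi.basisFun (Cone k) (Fin 5)).span_eq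
      have e : Set.range (Pi.basisFun (Cone k) (Fin 5)) =
          Set.range fun i : Fin 5 => (Pi.single i 1 : Fin 5 → Cone k) := by
        congr 1
        ext1 i
        simp
      rw [e] at this
      rw [this, Submodule.map_top, Submodule.range_mkQ]
    exact spanFinrank_le_of_span_range _ h1.symm
  · let ρ : A.Coker →+ (Fin 5 → k) := QuotientAddGroup.lift _
      { toFun := fun v i => residue k (v i)
        map_zero' := by ext; simp
        map_add' := by intros; ext; simp } (by
        rintro _ ⟨w, rfl⟩
        ext i
        simp [Matrix.mulVec, dotProduct, hA])
    have hρ : ∀ v : Fin 5 → Cone k, ρ (Submodule.Quotient.mk v) = fun i => residue k (v i) :=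
      fun v => rfl
    have hρs : ∀ (r : Cone k) x, ρ (r • x) = residue k r • ρ x := by
      intro r x
      obtain ⟨v, rfl⟩ := Submodule.mkQ_surjective _ x
      rw [Submodule.mkQ_apply, ← Submodule.Quotient.mk_smul, hρ, hρ]
      ext i
      simp
    refine le_spanFinrank_of_residue ρ hρs fun c =>
      ⟨Submodule.Quotient.mk fun i => toCone k (C (c i)), ?_⟩
    rw [hρ]
    simp

end

/-! ### Generation of spaces of polynomials -/

lemma exists_divMod {q w : Polynomial k} (hq : q.Monic) {d : ℤ} (hw : w ∈ polyLE k d) :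
    ∃ u r, w = r + q * u ∧ u ∈ polyLE k (d - q.natDegree) ∧ r ∈ polyLE k (q.natDegree - 1) ∧
      r ∈ polyLE k d := by
  have h1 := Polynomial.modByMonic_add_div w q
  have hu : w /ₘ q ∈ polyLE k (d - q.natDegree) := by
    by_cases h0 : w = 0
    · simp [h0]
    by_cases h : w.degree < q.degree
    · rw [(Polynomial.divByMonic_eq_zero_iff hq).2 h]
      exact zero_mem _
    · have h2 := Polynomial.natDegree_le_natDegree (not_lt.1 h)
      rw [mem_polyLE_iff_natDegree h0] at hw
      apply mem_polyLE_of_natDegree_le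
      rw [Polynomial.natDegree_divByMonic w hq]
      omega
  refine ⟨w /ₘ q, w %ₘ q, h1.symm, hu, ?_, ?_⟩
  · intro i hi
    apply Polynomial.coeff_eq_zero_of_degree_lt
    refine (Polynomial.degree_modByMonic_lt w hq).trans_le ?_
    rw [Polynomial.degree_eq_natDegree hq.ne_zero]
    exact_mod_cast by omega
  · rw [eq_sub_of_add_eq h1]
    exact sub_mem hw (mul_mem_polyLE' (mem_polyLE_natDegree q) hu (by omega))

lemma eq_C_of_mem_polyLE {w : Polynomial k} (hw : w ∈ polyLE k 0) : w = Polynomial.C (w.coeff 0) := by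
  ext i
  rw [Polynomial.coeff_C]
  split_ifs with h
  · rw [h]
  · exact hw i (by omega)

lemma eq_linear_of_mem_polyLE {w : Polynomial k} (hw : w ∈ polyLE k 1) :
    w = Polynomial.C (w.coeff 0) + Polynomial.C (w.coeff 1) * 𝕥 := by
  ext i
  rcases i with _ | _ | i
  · simp
  · simp
  · rw [hw _ (by push_cast; omega)]
    simp

lemma exists_linear_add_zz_mul {w : Polynomial k} {d : ℤ} (hw : w ∈ polyLE k d) :
    ∃ α β u, w = Polynomial.C α + Polynomial.C β * 𝕥 + zz k * u ∧ u ∈ polyLE k (d - 2) ∧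
      (d < 1 → β = 0) ∧ (d < 0 → α = 0) := by
  obtain ⟨u, r, e, hu, hr, hr'⟩ := exists_divMod zz_monic hw
  rw [natDegree_zz] at hu hr
  refine ⟨r.coeff 0, r.coeff 1, u, ?_, hu, fun h => hr' 1 (by push_cast; omega),
    fun h => hr' 0 (by push_cast; omega)⟩
  rw [← eq_linear_of_mem_polyLE hr]
  exact e

lemma exists_C_add_X_mul {w : Polynomial k} {d : ℤ} (hw : w ∈ polyLE k d) :
    ∃ α u, w = Polynomial.C α + 𝕥 * u ∧ u ∈ polyLE k (d - 1) ∧ (d < 0 → α = 0) := by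
  obtain ⟨u, r, e, hu, hr, hr'⟩ := exists_divMod Polynomial.monic_X hw
  rw [Polynomial.natDegree_X] at hu hr
  refine ⟨r.coeff 0, u, ?_, hu, fun h => hr' 0 (by push_cast; omega)⟩
  rw [← eq_C_of_mem_polyLE hr]
  exact e

lemma nodeLE_mono {d e : ℤ} (h : d ≤ e) : nodeLE k d ≤ nodeLE k e :=
  fun _ hp => ⟨polyLE_mono (by omega) hp.1, hp.2⟩

lemma C_mem_nodeLE (c : k) {d : ℤ} (hd : 0 ≤ d ∨ c = 0) : Polynomial.C c ∈ nodeLE k d := by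
  rcases hd with hd | rfl
  · exact ⟨C_mem_polyLE c (by omega), by simp⟩
  · simp

lemma zz_mul_mem_nodeLE {w : Polynomial k} {d : ℤ} (hw : w ∈ polyLE k (3 * d - 2)) :
    zz k * w ∈ nodeLE k d :=
  ⟨mul_mem_polyLE' (zz_mem_polyLE le_rfl) hw (by omega), by simp⟩

lemma C_mul_mem_nodeLE (c : k) {p : Polynomial k} {d : ℤ} (hp : p ∈ nodeLE k d) :
    Polynomial.C c * p ∈ nodeLE k d := by
  rw [← Polynomial.smul_eq_C_mul]
  exact Submodule.smul_mem _ _ hp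

lemma C_mul_mem_polyLE (c : k) {p : Polynomial k} {d : ℤ} (hp : p ∈ polyLE k d) :
    Polynomial.C c * p ∈ polyLE k d := by
  rw [← Polynomial.smul_eq_C_mul]
  exact Submodule.smul_mem _ _ hp

/-- The twists of the normalization are rank-one modules over the cone, and division by t² - 1 finds
their generators. For the bound 3N they are 1 in degree 0 and t in degree 1; for 3N + 1 they are 1
and t in degree 0; for 3N + 2 they are 1, t and t² in degree 0. These counts govern the number of
generators of a string. -/
lemma exists_generation_zero {w : Polynomial k} {N : ℤ} (hw : w ∈ polyLE k (3 * N)) :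
    ∃ p ∈ nodeLE k N, ∃ q ∈ nodeLE k (N - 1), w = p + 𝕥 * q := by
  obtain ⟨α, β, u, rfl, hu, hβ, hα⟩ := exists_linear_add_zz_mul hw
  refine ⟨Polynomial.C α + zz k * u, add_mem (C_mem_nodeLE _ ?_) (zz_mul_mem_nodeLE hu),
    Polynomial.C β, C_mem_nodeLE _ ?_, by ring⟩
  · by_cases h : 0 ≤ N
    · exact Or.inl h
    · exact Or.inr (hα (by omega))
  · by_cases h : 0 ≤ N - 1
    · exact Or.inl h
    · exact Or.inr (hβ (by omega))

lemma exists_generation_one {w : Polynomial k} {N : ℤ} (hw : w ∈ polyLE k (3 * N + 1)) :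
    ∃ p ∈ nodeLE k N, ∃ q ∈ nodeLE k N, w = p + 𝕥 * q := by
  obtain ⟨α, β, u, rfl, hu, hβ, hα⟩ := exists_linear_add_zz_mul hw
  obtain ⟨γ, u', rfl, hu', hγ⟩ := exists_C_add_X_mul hu
  refine ⟨Polynomial.C α + zz k * Polynomial.C γ, add_mem (C_mem_nodeLE _ ?_)
      (zz_mul_mem_nodeLE ?_),
    Polynomial.C β + zz k * u', add_mem (C_mem_nodeLE _ ?_) (zz_mul_mem_nodeLE
      (polyLE_mono (by omega) hu')), by ring⟩
  · by_cases h : 0 ≤ N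
    · exact Or.inl h
    · exact Or.inr (hα (by omega))
  · by_cases h : 1 ≤ N
    · exact C_mem_polyLE _ (by omega)
    · rw [hγ (by omega), map_zero]; exact zero_mem _
  · by_cases h : 0 ≤ N
    · exact Or.inl h
    · exact Or.inr (hβ (by omega))

lemma exists_generation_two {w : Polynomial k} {N : ℤ} (hw : w ∈ polyLE k (3 * N + 2)) :
    ∃ p ∈ nodeLE k N, ∃ q ∈ nodeLE k N, ∃ r ∈ nodeLE k N, w = p + 𝕥 * q + 𝕥 ^ 2 * r := by
  obtain ⟨α, β, u, rfl, hu, hβ, hα⟩ := exists_linear_add_zz_mul hw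
  obtain ⟨α', β', u', rfl, hu', hβ', hα'⟩ := exists_linear_add_zz_mul hu
  have h0 : ∀ c : k, (3 * N + 2 - 2 < 0 → c = 0) → 0 ≤ N ∨ c = 0 := fun c hc => by
    by_cases h : 0 ≤ N
    · exact Or.inl h
    · exact Or.inr (hc (by omega))
  have m1 : zz k * u' ∈ nodeLE k N := zz_mul_mem_nodeLE (polyLE_mono (by omega) hu')
  have m2 := C_mem_nodeLE α' (h0 _ hα')
  refine ⟨Polynomial.C α - (Polynomial.C α' + zz k * u'), sub_mem (C_mem_nodeLE _ ?_)
    (add_mem m2 m1), Polynomial.C β + zz k * Polynomial.C β', add_mem (C_mem_nodeLE _ ?_)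
    (zz_mul_mem_nodeLE ?_), Polynomial.C α' + zz k * u', add_mem m2 m1, ?_⟩
  · exact h0 _ fun h => hα (by omega)
  · exact h0 _ fun h => hβ (by omega)
  · by_cases h : 1 ≤ N
    · exact C_mem_polyLE _ (by omega)
    · rw [hβ' (by omega), map_zero]; exact zero_mem _
  · simp only [zz]
    ring

lemma exists_generation_two' {w : Polynomial k} {N : ℤ} (hw : w ∈ polyLE k (3 * N + 2)) :
    ∃ p ∈ nodeLE k N, ∃ q ∈ nodeLE k N, ∃ r ∈ nodeLE k N, w = 𝕥 * p - q + zz k * r := by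
  obtain ⟨p, hp, q, hq, r, hr, rfl⟩ := exists_generation_two hw
  refine ⟨q, hq, -(p + r), neg_mem (add_mem hp hr), r, hr, ?_⟩
  simp only [zz]
  ring

/-- Sections of a line bundle of degree one, in terms of two of them. -/
lemma exists_generation_line {N : ℤ} {τ : k} {q : Polynomial k}
    (hq : q ∈ polyLE k (3 * N + 1)) (hq' : (1 + τ) * q.eval 1 + (1 - τ) * q.eval (-1) = 0)
    (hk : (2 : k) ≠ 0) :
    ∃ p ∈ nodeLE k N, ∃ r ∈ nodeLE k (N - 1), q = p * (𝕥 - Polynomial.C τ) +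
      r * (𝕥 ^ 2 - 𝕥 * Polynomial.C τ + Polynomial.C (τ ^ 2 - 1)) := by
  obtain ⟨α, β, u, rfl, hu, hβ, hα⟩ := exists_linear_add_zz_mul hq
  have e : α = -(τ * β) := by
    simp only [Polynomial.eval_add, Polynomial.eval_mul, Polynomial.eval_C, Polynomial.eval_X,
      eval_one_zz, eval_neg_one_zz, zero_mul, add_zero, mul_one] at hq'
    apply mul_left_cancel₀ hk
    linear_combination hq'
  obtain ⟨u', r, rfl, hu', hr, hr'⟩ := exists_divMod (Polynomial.monic_X_sub_C τ) hu
  rw [Polynomial.natDegree_X_sub_C] at hu' hr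
  have hrC := eq_C_of_mem_polyLE (by simpa using hr)
  set c := r.coeff 0
  have hc : N < 1 → c = 0 := fun h => hr' 0 (by push_cast; omega)
  -- The correction cτ comes from c(t²-1) = c(t² - τt + τ² - 1) + cτ(t - τ).
  refine ⟨Polynomial.C (β + c * τ) + zz k * u', add_mem (C_mem_nodeLE _ ?_)
    (zz_mul_mem_nodeLE (polyLE_mono (by push_cast; omega) hu')), Polynomial.C c,
    C_mem_nodeLE _ ?_, ?_⟩
  · by_cases h : 0 ≤ N
    · exact Or.inl h
    · exact Or.inr (by rw [hβ (by omega), hc (by omega)]; ring)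
  · by_cases h : 1 ≤ N
    · exact Or.inl (by omega)
    · exact Or.inr (hc (by omega))
  · rw [hrC, e]
    simp only [map_neg, map_mul, map_add, map_sub, map_one, map_pow, zz]
    ring

/-- Sections of a line bundle of degree two, in terms of two of them. -/
lemma exists_generation_line_two {N : ℤ} {τ : k} {q : Polynomial k}
    (hq : q ∈ polyLE k (3 * N + 2)) (hq' : (1 - τ) * q.eval 1 + (1 + τ) * q.eval (-1) = 0)
    (hk : (2 : k) ≠ 0) :
    ∃ p ∈ nodeLE k N, ∃ r ∈ nodeLE k N, q = p * (𝕥 + Polynomial.C τ) +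
      r * (𝕥 ^ 2 + 𝕥 * Polynomial.C τ + Polynomial.C (τ ^ 2 - 1)) := by
  obtain ⟨α, β, u, rfl, hu, hβ, hα⟩ := exists_linear_add_zz_mul hq
  have e : α = τ * β := by
    simp only [Polynomial.eval_add, Polynomial.eval_mul, Polynomial.eval_C, Polynomial.eval_X,
      eval_one_zz, eval_neg_one_zz, zero_mul, add_zero, mul_one] at hq'
    apply mul_left_cancel₀ hk
    linear_combination hq'
  -- Division first by t² and then by t + τ expresses u through the two sections and a constant,
  -- with v and s of degree at most 3N - 2, so that (t²-1)v and (t²-1)s lie in the cone in degree N.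
  obtain ⟨v, s, c, rfl, hv, hs, hc⟩ : ∃ v s c, u = (𝕥 ^ 2 + 𝕥 * Polynomial.C τ +
      Polynomial.C (τ ^ 2 - 1)) * v + (𝕥 + Polynomial.C τ) * s + Polynomial.C c ∧
      v ∈ polyLE k (3 * N - 2) ∧ s ∈ polyLE k (3 * N - 2) ∧ (N < 0 → c = 0) := by
    by_cases h : 1 ≤ N
    · obtain ⟨v, w, rfl, hv, hw, hw'⟩ := exists_divMod (Polynomial.monic_X_pow (R := k) 2) hu
      rw [Polynomial.natDegree_X_pow] at hv hw
      have hs : w - (𝕥 * Polynomial.C τ + Polynomial.C (τ ^ 2 - 1)) * v ∈ polyLE k (3 * N - 1) :=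
        sub_mem (polyLE_mono (by push_cast; omega) hw) (mul_mem_polyLE' (a := 1)
          (add_mem (mul_mem_polyLE' (X_mem_polyLE le_rfl) (C_mem_polyLE _ le_rfl) (by norm_num))
          (C_mem_polyLE _ (by norm_num))) hv (by push_cast; omega))
      obtain ⟨s, r, e', hs', hr, -⟩ := exists_divMod (Polynomial.monic_X_sub_C (-τ)) hs
      rw [Polynomial.natDegree_X_sub_C] at hs' hr
      have hrC := eq_C_of_mem_polyLE (by simpa using hr)
      refine ⟨v, s, r.coeff 0, ?_, polyLE_mono (by push_cast; omega) hv,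
        polyLE_mono (by push_cast; omega) hs', fun h' => by omega⟩
      rw [← hrC]
      rw [map_neg] at e'
      linear_combination e'
    · refine ⟨0, 0, u.coeff 0, ?_, zero_mem _, zero_mem _, fun h' => hu 0 (by push_cast; omega)⟩
      rw [← eq_C_of_mem_polyLE (polyLE_mono (by omega) hu)]
      ring
  refine ⟨Polynomial.C (β - c * τ) + zz k * s, add_mem (C_mem_nodeLE _ ?_)
    (zz_mul_mem_nodeLE hs), Polynomial.C c + zz k * v, add_mem (C_mem_nodeLE _ ?_)
    (zz_mul_mem_nodeLE hv), ?_⟩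
  · by_cases h : 0 ≤ N
    · exact Or.inl h
    · exact Or.inr (by rw [hβ (by omega), hc (by omega)]; ring)
  · by_cases h : 0 ≤ N
    · exact Or.inl h
    · exact Or.inr (hc (by omega))
  · rw [e]
    simp only [map_mul, map_sub, map_one, map_pow, zz]
    ring

/-- Sections of the trivial bundle twisted by one point, at infinity. -/
lemma exists_generation_infinity {N : ℤ} {q : Polynomial k}
    (hq : q ∈ polyLE k (3 * N + 1)) (hq' : q.eval 1 = q.eval (-1)) (hk : (2 : k) ≠ 0) :
    ∃ p ∈ nodeLE k N, ∃ r ∈ nodeLE k (N - 1), q = p + r * zz k ^ 2 := by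
  obtain ⟨u, e⟩ := exists_eq_add_zz_mul hk q hq'
  set α := q.eval 1
  have hα : 0 ≤ N ∨ α = 0 := by
    by_cases h : 0 ≤ N
    · exact Or.inl h
    · refine Or.inr ?_
      have : q = 0 := eq_zero_of_mem_polyLE_neg hq (by omega)
      simp [α, this]
  by_cases h : 1 ≤ N
  · have hu : u ∈ polyLE k (3 * N - 1) := by
      refine mem_polyLE_of_mul_mem (e := 2) zz_ne_zero (by rw [natDegree_zz]; norm_num) ?_
      rw [show zz k * u = q - Polynomial.C α by rw [e]; ring]
      exact sub_mem (polyLE_mono (by omega) hq) (C_mem_polyLE _ (by omega))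
    obtain ⟨n, rfl⟩ : ∃ n : ℕ, N = n + 1 := ⟨(N - 1).toNat, by omega⟩
    -- g is the dehomogenization of y₂^(N-1), and (t²-1)g is monic of degree 3N - 1, the largest
    -- degree allowed for u. Dividing by it removes just the top coefficient of u, which is the part
    -- carried by the section (t²-1)².
    set g : Polynomial k := (𝕥 * zz k) ^ n
    have hg : g ∈ nodeLE k n := by
      refine ⟨mem_polyLE_of_natDegree_le ?_, ?_⟩
      · rw [Polynomial.natDegree_pow, natDegree_X_mul_zz]
        push_cast
        omega
      · rcases n with _ | n <;> simp [g, pow_succ]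
    have hmonic : (zz k * g).Monic :=
      zz_monic.mul ((Polynomial.monic_X.mul zz_monic).pow n)
    have hdeg : (zz k * g).natDegree = 3 * n + 2 := by
      rw [zz_monic.natDegree_mul ((Polynomial.monic_X.mul zz_monic).pow n), Polynomial.natDegree_pow,
        natDegree_X_mul_zz, natDegree_zz]
      ring
    obtain ⟨c, r, e', hc, hr, -⟩ := exists_divMod hmonic hu
    rw [hdeg] at hc hr
    have hcC := eq_C_of_mem_polyLE (polyLE_mono (by push_cast; omega) hc)
    refine ⟨Polynomial.C α + zz k * r, add_mem (C_mem_nodeLE _ hα) (zz_mul_mem_nodeLE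
      (polyLE_mono (by push_cast; omega) hr)), Polynomial.C (c.coeff 0) * g,
      C_mul_mem_nodeLE _ (by simpa using hg), ?_⟩
    rw [e, e', ← hcC]
    ring
  · refine ⟨q, ⟨?_, hq'⟩, 0, zero_mem _, by ring⟩
    have hu : u = 0 := by
      by_contra h0
      have : zz k * u ∈ polyLE k 1 := by
        rw [show zz k * u = q - Polynomial.C α by rw [e]; ring]
        exact sub_mem (polyLE_mono (by omega) hq) (C_mem_polyLE _ (by omega))
      have := mem_polyLE_of_mul_mem (d := -1) (e := 2) (q := zz k) zz_ne_zero (by rw [natDegree_zz]; norm_num)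
        (by simpa using this)
      exact h0 (eq_zero_of_mem_polyLE_neg this (by norm_num))
    rw [e, hu, mul_zero, add_zero]
    exact (C_mem_nodeLE _ hα).1

lemma exists_generation_infinity_two {N : ℤ} {q : Polynomial k}
    (hq : q ∈ polyLE k (3 * N + 2)) (hq' : q.eval 1 = q.eval (-1)) (hk : (2 : k) ≠ 0) :
    ∃ p ∈ nodeLE k N, ∃ r ∈ nodeLE k N, q = p + r * 𝕥 ^ 2 := by
  obtain ⟨α, β, u, rfl, hu, hβ, hα⟩ := exists_linear_add_zz_mul hq
  have e : β = 0 := by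
    simp only [Polynomial.eval_add, Polynomial.eval_mul, Polynomial.eval_C, Polynomial.eval_X,
      eval_one_zz, eval_neg_one_zz, zero_mul, add_zero, mul_one] at hq'
    apply mul_left_cancel₀ hk
    linear_combination hq'
  subst e
  have h0 : ∀ c : k, (N < 0 → c = 0) → 0 ≤ N ∨ c = 0 := fun c hc => by
    by_cases h : 0 ≤ N
    · exact Or.inl h
    · exact Or.inr (hc (by omega))
  by_cases h : 1 ≤ N
  · obtain ⟨v, w, rfl, hv, hw, hw'⟩ := exists_divMod (Polynomial.monic_X_pow (R := k) 2) hu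
    rw [Polynomial.natDegree_X_pow] at hv hw
    refine ⟨Polynomial.C α + zz k * w, add_mem (C_mem_nodeLE _ (Or.inl (by omega)))
      (zz_mul_mem_nodeLE (polyLE_mono (by push_cast; omega) hw)), zz k * v,
      zz_mul_mem_nodeLE (polyLE_mono (by push_cast; omega) hv), ?_⟩
    simp only [map_zero]
    ring
  · have hu0 := eq_C_of_mem_polyLE (polyLE_mono (by omega) hu)
    set c := u.coeff 0
    have hc : N < 0 → c = 0 := fun h' => hu 0 (by push_cast; omega)
    refine ⟨Polynomial.C (α - c), C_mem_nodeLE _ (h0 _ fun h' => ?_), Polynomial.C c,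
      C_mem_nodeLE _ (h0 _ hc), ?_⟩
    · rw [hα (by omega), hc h', sub_zero]
    · rw [hu0]
      simp only [map_zero, map_sub, zz]
      ring

/-! ### The listed matrices -/

lemma mul_mem_polyDeg {a b d : ℤ} {p q : MvPolynomial (Fin 3) k} (hp : p ∈ polyDeg k a)
    (hq : q ∈ polyDeg k b) (h : a + b = d) : p * q ∈ polyDeg k d := by
  subst h
  exact IsWeightedHomogeneous.mul hp hq

lemma pow_mem_polyDeg {a d : ℤ} {p : MvPolynomial (Fin 3) k} (hp : p ∈ polyDeg k a) (n : ℕ)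
    (h : n * a = d) : p ^ n ∈ polyDeg k d := by
  subst h
  have := IsWeightedHomogeneous.pow (w := fun _ : Fin 3 => (1 : ℤ)) hp n
  rwa [nsmul_eq_mul] at this

lemma X_mem_polyDeg' (i : Fin 3) {d : ℤ} (h : 1 = d) : (X i : MvPolynomial (Fin 3) k) ∈ polyDeg k d :=
  h ▸ X_mem_polyDeg i

lemma one_mem_polyDeg {d : ℤ} (h : 0 = d) : (1 : MvPolynomial (Fin 3) k) ∈ polyDeg k d := by
  subst h
  exact isWeightedHomogeneous_one k _

/-! ### Factorization data for the ψ-matrices. -/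

/-- The common shape of `α^m_{ψ1}` (`ε = 1`) and `α^m_{ψ2}` (`ε = -1`). -/
def psiMat (ε : k) (m : ℕ) : DegMatrix k where
  rowDeg := ![1, 1, 1, m - 1, m]
  colDeg := ![2, 2, 2, m + 1, m + 1]
  mat := !![0, X 0, X 1, X 2 ^ m, -(C ε * X 2 ^ m);
            X 0, X 1, 0, -(C ε * X 2 ^ m), X 2 ^ m;
            X 2, 0, -X 0 - X 2, C ε * X 2 ^ m, 0;
            0, 0, 0, X 0 ^ 2 + X 0 * X 2, -(X 1 * X 2);
            0, 0, 0, -X 1, X 0]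

lemma alphaPsi1_eq (m : ℕ) : alphaPsi1 k m = psiMat 1 m := by
  simp [alphaPsi1, psiMat]

lemma alphaPsi2_eq (m : ℕ) : alphaPsi2 k m = psiMat (-1) m := by
  simp [alphaPsi2, psiMat]

/-- The other factor for `psiMat ε m`. -/
def psiAdj (ε : k) (m : ℕ) : Matrix (Fin 5) (Fin 5) (MvPolynomial (Fin 3) k) :=
  !![-(X 0 * X 1) - X 1 * X 2, X 0 ^ 2 + X 0 * X 2, -X 1 ^ 2, C ε * X 2 ^ m,
        -(X 0 * X 2 ^ m) - C ε * (X 1 * X 2 ^ m) - X 2 * X 2 ^ m;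
     X 0 ^ 2 + X 0 * X 2, -(X 1 * X 2), X 0 * X 1, -X 2 ^ m,
        C ε * (X 0 * X 2 ^ m) + C ε * (X 2 * X 2 ^ m);
     -(X 1 * X 2), X 0 * X 2, -X 0 ^ 2, C ε * X 2 ^ m, -(X 2 * X 2 ^ m);
     0, 0, 0, X 0, X 1 * X 2;
     0, 0, 0, X 1, X 0 ^ 2 + X 0 * X 2]

/-- The generators of the cokernel of `psiMat ε m`. -/
def psiGen (ε : k) : Fin 5 → Polynomial k × Polynomial k :=
  ![(-2 * (𝕥 - Polynomial.C ε) * 𝕥, 0), (2 * (𝕥 - Polynomial.C ε), 0),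
    (-2 * (𝕥 - Polynomial.C ε) * zz k, 0), (1, 1), (𝕥 - 2 * Polynomial.C ε, 𝕥)]

/-- The generators of the cokernel of the transpose of `psiMat ε m`. -/
def psiCogen (ε : k) : Fin 5 → Polynomial k × Polynomial k :=
  ![(𝕥 ^ 2, 𝕥 ^ 2 + 2 * Polynomial.C ε * 𝕥 + 2), (-𝕥, -𝕥 - 2 * Polynomial.C ε), (1, 1),
    (0, -2 * (𝕥 + Polynomial.C ε)), (0, -2 * 𝕥 * (𝕥 + Polynomial.C ε))]

lemma psi_isHomogeneous (ε : k) (m : ℕ) : (psiMat ε m).IsHomogeneous := by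
  intro i j
  fin_cases i <;> fin_cases j <;> simp [psiMat] <;>
    repeat' first
      | omega
      | with_reducible exact rfl
      | with_reducible exact X_mem_polyDeg _
      | with_reducible exact C_mem_polyDeg _
      | with_reducible refine X_mem_polyDeg' _ ?_
      | with_reducible refine one_mem_polyDeg ?_
      | with_reducible apply mul_mem_polyDeg
      | with_reducible apply pow_mem_polyDeg
      | with_reducible apply add_mem
      | with_reducible apply sub_mem
      | with_reducible apply neg_mem

lemma psiAdj_mem (ε : k) (m : ℕ) (i j : Fin 5) :
    psiAdj ε m i j ∈ polyDeg k (3 + (psiMat ε m).rowDeg j - (psiMat ε m).colDeg i) := by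
  fin_cases i <;> fin_cases j <;> simp [psiMat, psiAdj] <;>
    repeat' first
      | omega
      | with_reducible exact rfl
      | with_reducible exact X_mem_polyDeg _
      | with_reducible exact C_mem_polyDeg _
      | with_reducible refine X_mem_polyDeg' _ ?_
      | with_reducible refine one_mem_polyDeg ?_
      | with_reducible apply mul_mem_polyDeg
      | with_reducible apply pow_mem_polyDeg
      | with_reducible apply add_mem
      | with_reducible apply sub_mem
      | with_reducible apply neg_mem

lemma psi_mul (ε : k) (m : ℕ) :
    (psiMat ε m).mat * psiAdj ε m = nodePoly k • (1 : Matrix _ _ _) := by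
  ext1 i j
  fin_cases i <;> fin_cases j <;>
    simp only [Fin.zero_eta, Fin.mk_one, Fin.reduceFinMk, Fin.isValue, psiMat, psiAdj,
      Matrix.mul_apply, Fin.sum_univ_five, Matrix.of_apply, Matrix.cons_val, Matrix.smul_apply,
      Matrix.one_apply, reduceIte, Fin.reduceEq, smul_eq_mul, nodePoly,
      ] <;>
    ring1

lemma psi_relG (ε : k) (m : ℕ) (hε : ε = 1 ∨ ε = -1) (j : Fin 5) :
    ∑ i, dehom k ((psiMat ε m).mat i j) • psiGen ε i = 0 := by
  rcases hε with rfl | rfl <;> fin_cases j <;> ext1 <;>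
    simp only [Fin.zero_eta, Fin.mk_one, Fin.reduceFinMk, Fin.isValue, psiMat, psiGen,
      Fin.sum_univ_five, Matrix.of_apply, Matrix.cons_val, map_zero, map_one, map_neg,
      map_add, map_sub, map_mul, map_pow, dehom_X0, dehom_X1, dehom_X2, one_pow, zz,
      Prod.fst_add, Prod.snd_add, Prod.smul_fst, Prod.smul_snd, smul_eq_mul, Prod.fst_zero,
      Prod.snd_zero] <;>
    ring1

lemma psi_relH (ε : k) (m : ℕ) (hε : ε = 1 ∨ ε = -1) (i : Fin 5) :
    ∑ j, dehom k ((psiMat ε m).mat i j) • psiCogen ε j = 0 := by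
  rcases hε with rfl | rfl <;> fin_cases i <;> ext1 <;>
    simp only [Fin.zero_eta, Fin.mk_one, Fin.reduceFinMk, Fin.isValue, psiMat, psiCogen,
      Fin.sum_univ_five, Matrix.of_apply, Matrix.cons_val, map_zero, map_one, map_neg,
      map_add, map_sub, map_mul, map_pow, dehom_X0, dehom_X1, dehom_X2, one_pow, zz,
      Prod.fst_add, Prod.snd_add, Prod.smul_fst, Prod.smul_snd, smul_eq_mul, Prod.fst_zero,
      Prod.snd_zero] <;>
    ring1

lemma psi_dehom_eq (ε : k) (m : ℕ) (hε : ε = 1 ∨ ε = -1) (i j : Fin 5) :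
    Polynomial.C 2 * dehom k (psiAdj ε m i j) =
      (𝕥 + Polynomial.C ε) * (psiCogen ε i).1 * (psiGen ε j).1 -
        (𝕥 - Polynomial.C ε) * (psiCogen ε i).2 * (psiGen ε j).2 := by
  rcases hε with rfl | rfl <;> fin_cases i <;> fin_cases j <;>
    simp only [Fin.zero_eta, Fin.mk_one, Fin.reduceFinMk, Fin.isValue, psiAdj, psiGen, psiCogen,
      Matrix.of_apply, Matrix.cons_val, map_zero, map_one, map_ofNat, map_neg, map_add, map_sub,
      map_mul, map_pow, dehom_X0, dehom_X1, dehom_X2, one_pow, zz] <;>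
    ring1

lemma psi_factorization (hk : (2 : k) ≠ 0) {ε : k} (hε : ε = 1 ∨ ε = -1) (m : ℕ) :
    Factorization (psiMat ε m) ε 2 (psiGen ε) (psiCogen ε) (psiAdj ε m) :=
  ⟨psi_isHomogeneous ε m, psiAdj_mem ε m, psi_mul ε m, hk, psi_relG ε m hε, psi_relH ε m hε,
    psi_dehom_eq ε m hε⟩

/-! ### Factorization data for the φ-matrices. -/

/-- The common shape of `α^m_{φ1}` (`ε = 1`) and `α^m_{φ2}` (`ε = -1`). -/
def phiMat (ε : k) (m : ℕ) : DegMatrix k where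
  rowDeg := ![1, 1, 1, m, m]
  colDeg := ![2, 2, 2, m + 1, m + 2]
  mat := !![0, X 0, X 1, X 2 ^ m, C ε * X 2 ^ (m + 1);
            X 0, X 1, 0, -(C ε * X 2 ^ m), -X 2 ^ (m + 1);
            X 2, 0, -X 0 - X 2, 0, X 2 ^ (m + 1);
            0, 0, 0, X 0, X 1 * X 2;
            0, 0, 0, X 1, X 0 ^ 2 + X 0 * X 2]

lemma alphaPhi1_eq (m : ℕ) : alphaPhi1 k m = phiMat 1 m := by
  simp [alphaPhi1, phiMat]

lemma alphaPhi2_eq (m : ℕ) : alphaPhi2 k m = phiMat (-1) m := by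
  simp [alphaPhi2, phiMat]

/-- The other factor for `phiMat ε m`. -/
def phiAdj (ε : k) (m : ℕ) : Matrix (Fin 5) (Fin 5) (MvPolynomial (Fin 3) k) :=
  !![-(X 0 * X 1) - X 1 * X 2, X 0 ^ 2 + X 0 * X 2, -X 1 ^ 2,
        C ε * (X 0 * X 2 ^ m) + X 1 * X 2 ^ m + C ε * (X 2 * X 2 ^ m), X 2 * X 2 ^ m;
     X 0 ^ 2 + X 0 * X 2, -(X 1 * X 2), X 0 * X 1, -(X 0 * X 2 ^ m) - X 2 * X 2 ^ m,
        -(C ε * (X 2 * X 2 ^ m));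
     -(X 1 * X 2), X 0 * X 2, -X 0 ^ 2, C ε * (X 2 * X 2 ^ m), X 2 * X 2 ^ m;
     0, 0, 0, X 0 ^ 2 + X 0 * X 2, -(X 1 * X 2);
     0, 0, 0, -X 1, X 0]

/-- The generators of the cokernel of `phiMat ε m`. -/
def phiGen (ε : k) : Fin 5 → Polynomial k × Polynomial k :=
  ![(2 * Polynomial.C ε * (𝕥 - Polynomial.C ε) * 𝕥, 0),
    (-2 * Polynomial.C ε * (𝕥 - Polynomial.C ε), 0),
    (2 * Polynomial.C ε * (𝕥 - Polynomial.C ε) * zz k, 0), (𝕥 - 2 * Polynomial.C ε, 𝕥), (-1, -1)]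

/-- The generators of the cokernel of the transpose of `phiMat ε m`. -/
def phiCogen (ε : k) : Fin 5 → Polynomial k × Polynomial k :=
  ![(-Polynomial.C ε * 𝕥 ^ 2, -Polynomial.C ε * (𝕥 ^ 2 + 2 * Polynomial.C ε * 𝕥 + 2)),
    (Polynomial.C ε * 𝕥, Polynomial.C ε * (𝕥 + 2 * Polynomial.C ε)),
    (-Polynomial.C ε, -Polynomial.C ε),
    (0, -2 * 𝕥 * (𝕥 + Polynomial.C ε)), (0, 2 * (𝕥 + Polynomial.C ε))]

lemma phi_isHomogeneous (ε : k) (m : ℕ) : (phiMat ε m).IsHomogeneous := by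
  intro i j
  fin_cases i <;> fin_cases j <;> simp [phiMat] <;>
    repeat' first
      | omega
      | with_reducible exact rfl
      | with_reducible exact X_mem_polyDeg _
      | with_reducible exact C_mem_polyDeg _
      | with_reducible refine X_mem_polyDeg' _ ?_
      | with_reducible refine one_mem_polyDeg ?_
      | with_reducible apply mul_mem_polyDeg
      | with_reducible apply pow_mem_polyDeg
      | with_reducible apply add_mem
      | with_reducible apply sub_mem
      | with_reducible apply neg_mem

lemma phiAdj_mem (ε : k) (m : ℕ) (i j : Fin 5) :
    phiAdj ε m i j ∈ polyDeg k (3 + (phiMat ε m).rowDeg j - (phiMat ε m).colDeg i) := by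
  fin_cases i <;> fin_cases j <;> simp [phiMat, phiAdj] <;>
    repeat' first
      | omega
      | with_reducible exact rfl
      | with_reducible exact X_mem_polyDeg _
      | with_reducible exact C_mem_polyDeg _
      | with_reducible refine X_mem_polyDeg' _ ?_
      | with_reducible refine one_mem_polyDeg ?_
      | with_reducible apply mul_mem_polyDeg
      | with_reducible apply pow_mem_polyDeg
      | with_reducible apply add_mem
      | with_reducible apply sub_mem
      | with_reducible apply neg_mem

lemma phi_mul (ε : k) (m : ℕ) :
    (phiMat ε m).mat * phiAdj ε m = nodePoly k • (1 : Matrix _ _ _) := by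
  ext1 i j
  fin_cases i <;> fin_cases j <;>
    simp only [Fin.zero_eta, Fin.mk_one, Fin.reduceFinMk, Fin.isValue, phiMat, phiAdj,
      Matrix.mul_apply, Fin.sum_univ_five, Matrix.of_apply, Matrix.cons_val, Matrix.smul_apply,
      Matrix.one_apply, reduceIte, Fin.reduceEq, smul_eq_mul, nodePoly,
      ] <;>
    ring1

lemma phi_relG (ε : k) (m : ℕ) (hε : ε = 1 ∨ ε = -1) (j : Fin 5) :
    ∑ i, dehom k ((phiMat ε m).mat i j) • phiGen ε i = 0 := by
  rcases hε with rfl | rfl <;> fin_cases j <;> ext1 <;>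
    simp only [Fin.zero_eta, Fin.mk_one, Fin.reduceFinMk, Fin.isValue, phiMat, phiGen,
      Fin.sum_univ_five, Matrix.of_apply, Matrix.cons_val, map_zero, map_one, map_neg,
      map_add, map_sub, map_mul, map_pow, dehom_X0, dehom_X1, dehom_X2, one_pow, zz,
      Prod.fst_add, Prod.snd_add, Prod.smul_fst, Prod.smul_snd, smul_eq_mul, Prod.fst_zero,
      Prod.snd_zero] <;>
    ring1

lemma phi_relH (ε : k) (m : ℕ) (hε : ε = 1 ∨ ε = -1) (i : Fin 5) :
    ∑ j, dehom k ((phiMat ε m).mat i j) • phiCogen ε j = 0 := by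
  rcases hε with rfl | rfl <;> fin_cases i <;> ext1 <;>
    simp only [Fin.zero_eta, Fin.mk_one, Fin.reduceFinMk, Fin.isValue, phiMat, phiCogen,
      Fin.sum_univ_five, Matrix.of_apply, Matrix.cons_val, map_zero, map_one, map_neg,
      map_add, map_sub, map_mul, map_pow, dehom_X0, dehom_X1, dehom_X2, one_pow, zz,
      Prod.fst_add, Prod.snd_add, Prod.smul_fst, Prod.smul_snd, smul_eq_mul, Prod.fst_zero,
      Prod.snd_zero] <;>
    ring1

lemma phi_dehom_eq (ε : k) (m : ℕ) (hε : ε = 1 ∨ ε = -1) (i j : Fin 5) :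
    Polynomial.C 2 * dehom k (phiAdj ε m i j) =
      (𝕥 + Polynomial.C ε) * (phiCogen ε i).1 * (phiGen ε j).1 -
        (𝕥 - Polynomial.C ε) * (phiCogen ε i).2 * (phiGen ε j).2 := by
  rcases hε with rfl | rfl <;> fin_cases i <;> fin_cases j <;>
    simp only [Fin.zero_eta, Fin.mk_one, Fin.reduceFinMk, Fin.isValue, phiAdj, phiGen, phiCogen,
      Matrix.of_apply, Matrix.cons_val, map_zero, map_one, map_ofNat, map_neg, map_add, map_sub,
      map_mul, map_pow, dehom_X0, dehom_X1, dehom_X2, one_pow, zz] <;>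
    ring1

lemma phi_factorization (hk : (2 : k) ≠ 0) {ε : k} (hε : ε = 1 ∨ ε = -1) (m : ℕ) :
    Factorization (phiMat ε m) ε 2 (phiGen ε) (phiCogen ε) (phiAdj ε m) :=
  ⟨phi_isHomogeneous ε m, phiAdj_mem ε m, phi_mul ε m, hk, phi_relG ε m hε, phi_relH ε m hε,
    phi_dehom_eq ε m hε⟩

/-! ### Factorization data for the affine points λ. -/

/-- The other factor for `alphaPsiAffine k a b`. -/
def affineAdj (a b : k) : Matrix (Fin 5) (Fin 5) (MvPolynomial (Fin 3) k) :=
  !![-(X 0 * X 1) - X 1 * X 2, X 0 ^ 2 + X 0 * X 2, -X 1 ^ 2, C (a ^ 2 + a) * X 2,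
        -(C b * (X 0 * X 2)) - C a * (X 1 * X 2) - C (a * b + b) * X 2 ^ 2;
     X 0 ^ 2 + X 0 * X 2, -(X 1 * X 2), X 0 * X 1, -(C b * X 2),
        C a * (X 0 * X 2) + C (a ^ 2 + a) * X 2 ^ 2;
     -(X 1 * X 2), X 0 * X 2, -X 0 ^ 2, C a * X 2, -(C b * X 2 ^ 2);
     0, 0, 0, X 0 - C a * X 2, X 1 * X 2 + C b * X 2 ^ 2;
     0, 0, 0, X 1 - C b * X 2, X 0 ^ 2 + C (a + 1) * (X 0 * X 2) + C (a ^ 2 + a) * X 2 ^ 2]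

/-- The generators of the cokernel of `alphaPsiAffine k a b`, where `a = τ² - 1`, `b = τ a`. -/
def affineGen (τ : k) : Fin 5 → Polynomial k × Polynomial k :=
  ![(Polynomial.C (1 + τ) * (𝕥 - 1) * 𝕥, -Polynomial.C (1 - τ) * (𝕥 + 1) * 𝕥),
    (-Polynomial.C (1 + τ) * (𝕥 - 1), Polynomial.C (1 - τ) * (𝕥 + 1)),
    (Polynomial.C (1 + τ) * (𝕥 - 1) * zz k, -Polynomial.C (1 - τ) * (𝕥 + 1) * zz k),
    (Polynomial.C (1 - τ ^ 2), Polynomial.C (1 - τ ^ 2)),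
    (Polynomial.C (1 - τ ^ 2) * (𝕥 - Polynomial.C (τ + 1)),
      Polynomial.C (1 - τ ^ 2) * (𝕥 - Polynomial.C (τ - 1)))]

/-- The generators of the cokernel of the transpose of `alphaPsiAffine k a b`. -/
def affineCogen (τ : k) : Fin 5 → Polynomial k × Polynomial k :=
  ![(Polynomial.C (τ ^ 2 - 1) * (𝕥 ^ 2 + Polynomial.C (τ - 1) * 𝕥 + Polynomial.C (τ ^ 2 - τ)),
      Polynomial.C (τ ^ 2 - 1) * (𝕥 ^ 2 + Polynomial.C (τ + 1) * 𝕥 + Polynomial.C (τ ^ 2 + τ))),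
    (-Polynomial.C (τ ^ 2 - 1) * (𝕥 + Polynomial.C (τ - 1)),
      -Polynomial.C (τ ^ 2 - 1) * (𝕥 + Polynomial.C (τ + 1))),
    (Polynomial.C (τ ^ 2 - 1), Polynomial.C (τ ^ 2 - 1)),
    (Polynomial.C (1 - τ) * (𝕥 + Polynomial.C τ), -Polynomial.C (1 + τ) * (𝕥 + Polynomial.C τ)),
    (Polynomial.C (1 - τ) * (𝕥 ^ 2 + Polynomial.C τ * 𝕥 + Polynomial.C (τ ^ 2 - 1)),
      -Polynomial.C (1 + τ) * (𝕥 ^ 2 + Polynomial.C τ * 𝕥 + Polynomial.C (τ ^ 2 - 1)))]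

lemma affine_isHomogeneous (τ : k) : (alphaPsiAffine k (τ ^ 2 - 1) (τ * (τ ^ 2 - 1))).IsHomogeneous := by
  intro i j
  fin_cases i <;> fin_cases j <;> simp [alphaPsiAffine] <;>
    repeat' first
      | omega
      | with_reducible exact rfl
      | with_reducible exact X_mem_polyDeg _
      | with_reducible exact C_mem_polyDeg _
      | with_reducible refine X_mem_polyDeg' _ ?_
      | with_reducible refine one_mem_polyDeg ?_
      | with_reducible apply mul_mem_polyDeg
      | with_reducible apply pow_mem_polyDeg
      | with_reducible apply add_mem
      | with_reducible apply sub_mem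
      | with_reducible apply neg_mem

lemma affineAdj_mem (τ : k) (i j : Fin 5) :
    affineAdj (τ ^ 2 - 1) (τ * (τ ^ 2 - 1)) i j ∈
      polyDeg k (3 + (alphaPsiAffine k (τ ^ 2 - 1) (τ * (τ ^ 2 - 1))).rowDeg j -
        (alphaPsiAffine k (τ ^ 2 - 1) (τ * (τ ^ 2 - 1))).colDeg i) := by
  fin_cases i <;> fin_cases j <;> simp [alphaPsiAffine, affineAdj] <;>
    repeat' first
      | omega
      | with_reducible exact rfl
      | with_reducible exact X_mem_polyDeg _
      | with_reducible exact C_mem_polyDeg _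
      | with_reducible refine X_mem_polyDeg' _ ?_
      | with_reducible refine one_mem_polyDeg ?_
      | with_reducible apply mul_mem_polyDeg
      | with_reducible apply pow_mem_polyDeg
      | with_reducible apply add_mem
      | with_reducible apply sub_mem
      | with_reducible apply neg_mem

lemma affine_mul (τ : k) :
    (alphaPsiAffine k (τ ^ 2 - 1) (τ * (τ ^ 2 - 1))).mat * affineAdj (τ ^ 2 - 1) (τ * (τ ^ 2 - 1)) =
      nodePoly k • (1 : Matrix _ _ _) := by
  ext1 i j
  fin_cases i <;> fin_cases j <;>
    simp only [Fin.zero_eta, Fin.mk_one, Fin.reduceFinMk, Fin.isValue, alphaPsiAffine, affineAdj,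
      Matrix.mul_apply, Fin.sum_univ_five, Matrix.of_apply, Matrix.cons_val, Matrix.smul_apply,
      Matrix.one_apply, reduceIte, Fin.reduceEq, smul_eq_mul, nodePoly, map_add, map_sub,
      map_mul, map_pow, map_one] <;>
    ring1

lemma affine_relG (τ : k) (j : Fin 5) :
    ∑ i, dehom k ((alphaPsiAffine k (τ ^ 2 - 1) (τ * (τ ^ 2 - 1))).mat i j) • affineGen τ i = 0 := by
  fin_cases j <;> ext1 <;>
    simp only [Fin.zero_eta, Fin.mk_one, Fin.reduceFinMk, Fin.isValue, alphaPsiAffine, affineGen,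
      Fin.sum_univ_five, Matrix.of_apply, Matrix.cons_val, map_zero, map_one, map_neg,
      map_add, map_sub, map_mul, map_pow, dehom_X0, dehom_X1, dehom_X2, dehom_C, one_pow, zz,
      Prod.fst_add, Prod.snd_add, Prod.smul_fst, Prod.smul_snd, smul_eq_mul, Prod.fst_zero,
      Prod.snd_zero] <;>
    ring1

lemma affine_relH (τ : k) (i : Fin 5) :
    ∑ j, dehom k ((alphaPsiAffine k (τ ^ 2 - 1) (τ * (τ ^ 2 - 1))).mat i j) • affineCogen τ j = 0 := by
  fin_cases i <;> ext1 <;>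
    simp only [Fin.zero_eta, Fin.mk_one, Fin.reduceFinMk, Fin.isValue, alphaPsiAffine,
      affineCogen, Fin.sum_univ_five, Matrix.of_apply, Matrix.cons_val, map_zero, map_one,
      map_neg, map_add, map_sub, map_mul, map_pow, dehom_X0, dehom_X1, dehom_X2,
      dehom_C, one_pow, zz, Prod.fst_add, Prod.snd_add, Prod.smul_fst, Prod.smul_snd,
      smul_eq_mul, Prod.fst_zero, Prod.snd_zero] <;>
    ring1

lemma affine_dehom_eq (τ : k) (i j : Fin 5) :
    Polynomial.C (2 * (1 - τ ^ 2)) * dehom k (affineAdj (τ ^ 2 - 1) (τ * (τ ^ 2 - 1)) i j) =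
      (𝕥 + Polynomial.C 1) * (affineCogen τ i).1 * (affineGen τ j).1 -
        (𝕥 - Polynomial.C 1) * (affineCogen τ i).2 * (affineGen τ j).2 := by
  fin_cases i <;> fin_cases j <;>
    simp only [Fin.zero_eta, Fin.mk_one, Fin.reduceFinMk, Fin.isValue, affineAdj, affineGen,
      affineCogen, Matrix.of_apply, Matrix.cons_val, map_zero, map_one, map_ofNat, map_neg,
      map_add, map_sub, map_mul, map_pow, dehom_X0, dehom_X1, dehom_X2, dehom_C, one_pow, zz] <;>
    ring1

lemma affine_factorization (hk : (2 : k) ≠ 0) (τ : k) (hτ : 1 - τ ^ 2 ≠ 0) :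
    Factorization (alphaPsiAffine k (τ ^ 2 - 1) (τ * (τ ^ 2 - 1))) 1 (2 * (1 - τ ^ 2))
      (affineGen τ) (affineCogen τ) (affineAdj (τ ^ 2 - 1) (τ * (τ ^ 2 - 1))) :=
  ⟨affine_isHomogeneous τ, affineAdj_mem τ, affine_mul τ, mul_ne_zero hk hτ, affine_relG τ,
    affine_relH τ, affine_dehom_eq τ⟩

/-! ### Factorization data for the point λ at infinity. -/

/-- The other factor for `alphaPsiInfinity k`. -/
def infinityAdj (k : Type u) [Field k] : Matrix (Fin 5) (Fin 5) (MvPolynomial (Fin 3) k) :=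
  !![-(X 0 * X 1) - X 1 * X 2, X 0 ^ 2 + X 0 * X 2, -X 1 ^ 2, -X 1, X 0 * X 1;
     X 0 ^ 2 + X 0 * X 2, -(X 1 * X 2), X 0 * X 1, 0, -X 1 ^ 2;
     -(X 1 * X 2), X 0 * X 2, -X 0 ^ 2, 0, X 0 * X 1;
     0, 0, 0, X 0 + X 2, X 1 ^ 2;
     0, 0, 0, X 2, X 0 ^ 2]

/-- The generators of the cokernel of `alphaPsiInfinity k`. -/
def infinityGen (k : Type u) [Field k] : Fin 5 → Polynomial k × Polynomial k :=
  ![((𝕥 - 1) * 𝕥, (𝕥 + 1) * 𝕥), (-(𝕥 - 1), -(𝕥 + 1)), ((𝕥 - 1) * zz k, (𝕥 + 1) * zz k), (1, 1),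
    (zz k * (𝕥 - 1), -(zz k * (𝕥 + 1)))]

/-- The generators of the cokernel of the transpose of `alphaPsiInfinity k`. -/
def infinityCogen (k : Type u) [Field k] : Fin 5 → Polynomial k × Polynomial k :=
  ![(𝕥 - 𝕥 ^ 2, 𝕥 ^ 2 + 𝕥), (𝕥 - 𝕥 ^ 2, -𝕥 ^ 2 - 𝕥), (𝕥 - 1, 𝕥 + 1), (𝕥 ^ 2, 𝕥 ^ 2), (1, 1)]

lemma infinity_isHomogeneous (k : Type u) [Field k] : (alphaPsiInfinity k).IsHomogeneous := by
  intro i j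
  fin_cases i <;> fin_cases j <;> simp [alphaPsiInfinity] <;>
    repeat' first
      | omega
      | with_reducible exact rfl
      | with_reducible exact X_mem_polyDeg _
      | with_reducible exact C_mem_polyDeg _
      | with_reducible refine X_mem_polyDeg' _ ?_
      | with_reducible refine one_mem_polyDeg ?_
      | with_reducible apply mul_mem_polyDeg
      | with_reducible apply pow_mem_polyDeg
      | with_reducible apply add_mem
      | with_reducible apply sub_mem
      | with_reducible apply neg_mem

lemma infinityAdj_mem (k : Type u) [Field k] (i j : Fin 5) :
    infinityAdj k i j ∈ polyDeg k (3 + (alphaPsiInfinity k).rowDeg j - (alphaPsiInfinity k).colDeg i) := by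
  fin_cases i <;> fin_cases j <;> simp [alphaPsiInfinity, infinityAdj] <;>
    repeat' first
      | omega
      | with_reducible exact rfl
      | with_reducible exact X_mem_polyDeg _
      | with_reducible exact C_mem_polyDeg _
      | with_reducible refine X_mem_polyDeg' _ ?_
      | with_reducible refine one_mem_polyDeg ?_
      | with_reducible apply mul_mem_polyDeg
      | with_reducible apply pow_mem_polyDeg
      | with_reducible apply add_mem
      | with_reducible apply sub_mem
      | with_reducible apply neg_mem

lemma infinity_mul (k : Type u) [Field k] :
    (alphaPsiInfinity k).mat * infinityAdj k = nodePoly k • (1 : Matrix _ _ _) := by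
  ext1 i j
  fin_cases i <;> fin_cases j <;>
    simp only [Fin.zero_eta, Fin.mk_one, Fin.reduceFinMk, Fin.isValue, alphaPsiInfinity,
      infinityAdj, Matrix.mul_apply, Fin.sum_univ_five, Matrix.of_apply, Matrix.cons_val,
      Matrix.smul_apply, Matrix.one_apply, reduceIte, Fin.reduceEq, smul_eq_mul, nodePoly,
      ] <;>
    ring1

lemma infinity_relG (k : Type u) [Field k] (j : Fin 5) :
    ∑ i, dehom k ((alphaPsiInfinity k).mat i j) • infinityGen k i = 0 := by
  fin_cases j <;> ext1 <;>
    simp only [Fin.zero_eta, Fin.mk_one, Fin.reduceFinMk, Fin.isValue, alphaPsiInfinity,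
      infinityGen, Fin.sum_univ_five, Matrix.of_apply, Matrix.cons_val, map_zero,
      map_neg, map_add, map_sub, map_pow, dehom_X0, dehom_X1, dehom_X2,
      zz, Prod.fst_add, Prod.snd_add, Prod.smul_fst, Prod.smul_snd,
      smul_eq_mul, Prod.fst_zero, Prod.snd_zero] <;>
    ring1

lemma infinity_relH (k : Type u) [Field k] (i : Fin 5) :
    ∑ j, dehom k ((alphaPsiInfinity k).mat i j) • infinityCogen k j = 0 := by
  fin_cases i <;> ext1 <;>
    simp only [Fin.zero_eta, Fin.mk_one, Fin.reduceFinMk, Fin.isValue, alphaPsiInfinity,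
      infinityCogen, Fin.sum_univ_five, Matrix.of_apply, Matrix.cons_val, map_zero,
      map_neg, map_add, map_sub, map_pow, dehom_X0, dehom_X1, dehom_X2,
      zz, Prod.fst_add, Prod.snd_add, Prod.smul_fst, Prod.smul_snd,
      smul_eq_mul, Prod.fst_zero, Prod.snd_zero] <;>
    ring1

lemma infinity_dehom_eq (k : Type u) [Field k] (i j : Fin 5) :
    Polynomial.C 2 * dehom k (infinityAdj k i j) =
      (𝕥 + Polynomial.C 1) * (infinityCogen k i).1 * (infinityGen k j).1 -
        (𝕥 - Polynomial.C 1) * (infinityCogen k i).2 * (infinityGen k j).2 := by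
  fin_cases i <;> fin_cases j <;>
    simp only [Fin.zero_eta, Fin.mk_one, Fin.reduceFinMk, Fin.isValue, infinityAdj, infinityGen,
      infinityCogen, Matrix.of_apply, Matrix.cons_val, map_zero, map_one, map_ofNat, map_neg,
      map_add, map_sub, map_mul, map_pow, dehom_X0, dehom_X1, dehom_X2, zz] <;>
    ring1

lemma infinity_factorization (hk : (2 : k) ≠ 0) :
    Factorization (alphaPsiInfinity k) 1 2 (infinityGen k) (infinityCogen k) (infinityAdj k) :=
  ⟨infinity_isHomogeneous k, infinityAdj_mem k, infinity_mul k, hk, infinity_relG k,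
    infinity_relH k, infinity_dehom_eq k⟩

section

/-! ### The cokernels of the listed matrices -/

lemma mem_polyLE_of_natDegree_le' {d : ℤ} {p : Polynomial k} (n : ℕ) (h : p.natDegree ≤ n)
    (hn : (n : ℤ) ≤ d) : p ∈ polyLE k d :=
  mem_polyLE_of_natDegree_le ((Int.ofNat_le.2 h).trans hn)

lemma exists_X_sub_C_mul {c : k} {d : ℤ} {p : Polynomial k} (hp : p ∈ polyLE k d)
    (h0 : p.eval c = 0) : ∃ w ∈ polyLE k (d - 1), p = (𝕥 - Polynomial.C c) * w := by
  obtain ⟨w, rfl⟩ := Polynomial.dvd_iff_isRoot.2 h0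
  refine ⟨w, ?_, rfl⟩
  refine mem_polyLE_of_mul_mem (e := 1) (Polynomial.X_sub_C_ne_zero c)
    (by rw [Polynomial.natDegree_X_sub_C]; norm_num) ?_
  rwa [sub_add_cancel]

lemma eval_neg_of_mem_nodeLE {ε : k} (hε : ε = 1 ∨ ε = -1) {d : ℤ} {p : Polynomial k}
    (hp : p ∈ nodeLE k d) : p.eval (-ε) = p.eval ε := by
  rcases hε with rfl | rfl
  · exact hp.2.symm
  · rw [neg_neg]; exact hp.2

lemma generated_of {r : Fin 5 → ℤ} {G : Fin 5 → Polynomial k × Polynomial k} {n : ℤ}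
    {v : Polynomial k × Polynomial k} {p₀ p₁ p₂ p₃ p₄ : Polynomial k} {N₀ N₁ N₂ N₃ N₄ : ℤ}
    (h₀ : p₀ ∈ nodeLE k N₀) (h₁ : p₁ ∈ nodeLE k N₁) (h₂ : p₂ ∈ nodeLE k N₂) (h₃ : p₃ ∈ nodeLE k N₃)
    (h₄ : p₄ ∈ nodeLE k N₄) (hN : ∀ i, ![N₀, N₁, N₂, N₃, N₄] i ≤ n - r i)
    (hv₁ : v.1 = p₀ * (G 0).1 + p₁ * (G 1).1 + p₂ * (G 2).1 + p₃ * (G 3).1 + p₄ * (G 4).1)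
    (hv₂ : v.2 = p₀ * (G 0).2 + p₁ * (G 1).2 + p₂ * (G 2).2 + p₃ * (G 3).2 + p₄ * (G 4).2) :
    generated r G n v := by
  refine ⟨![p₀, p₁, p₂, p₃, p₄], fun i => ?_, ?_⟩
  · refine nodeLE_mono (hN i) ?_
    fin_cases i
    exacts [h₀, h₁, h₂, h₃, h₄]
  · rw [Fin.sum_univ_five]
    exact Prod.ext hv₁ hv₂

lemma exists_inv_two (hk : (2 : k) ≠ 0) : ∃ c : k, Polynomial.C c * 2 = 1 := by
  refine ⟨2⁻¹, ?_⟩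
  have h2 : Polynomial.C (2 : k) = 2 := map_ofNat _ 2
  rw [← h2, ← map_mul, inv_mul_cancel₀ hk, map_one]

lemma mem_stringSet_of {ε : k} {d₁ d₂ n : ℤ} {v : Polynomial k × Polynomial k} (n₁ n₂ : ℕ)
    (h₁ : v.1.natDegree ≤ n₁) (h₂ : v.2.natDegree ≤ n₂) (hn₁ : (n₁ : ℤ) ≤ 3 * n + d₁)
    (hn₂ : (n₂ : ℤ) ≤ 3 * n + d₂) (he : v.1.eval ε = v.2.eval (-ε)) : v ∈ stringSet ε d₁ d₂ n :=
  ⟨mem_polyLE_of_natDegree_le' n₁ h₁ hn₁, mem_polyLE_of_natDegree_le' n₂ h₂ hn₂, he⟩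

lemma zz_eq : zz k = 𝕥 ^ 2 - 1 := rfl

section

variable {ε : k}

lemma C_mul_self_of_sign (hε : ε = 1 ∨ ε = -1) : Polynomial.C ε * Polynomial.C ε = 1 := by
  rcases hε with rfl | rfl <;> simp

lemma psiGen_mem {m : ℕ} (hm : 1 ≤ m) (i : Fin 5) :
    psiGen ε i ∈ stringSet ε 0 (-3 * (m - 1)) ((psiMat ε m).rowDeg i) := by
  fin_cases i
  · exact fst_mem_stringSet (n := 1) (mem_polyLE_of_natDegree_le' 2 (by compute_degree) (by norm_num))
      (by simp)
  · exact fst_mem_stringSet (n := 1) (mem_polyLE_of_natDegree_le' 1 (by compute_degree) (by norm_num))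
      (by simp)
  · exact fst_mem_stringSet (n := 1) (mem_polyLE_of_natDegree_le' 3
      (by rw [zz_eq]; compute_degree) (by norm_num)) (by simp)
  · exact mem_stringSet_of (n := m - 1) (v := (1, 1)) 0 0 (by simp) (by simp) (by push_cast; omega)
      (by push_cast; omega) (by simp)
  · exact mem_stringSet_of (n := m) (v := (𝕥 - 2 * Polynomial.C ε, 𝕥)) 1 1 (by dsimp only; compute_degree)
      (by dsimp only; compute_degree) (by push_cast; omega) (by push_cast; omega)
      (by simp; ring)

lemma psiCogen_mem (hε : ε = 1 ∨ ε = -1) {m : ℕ} (hm : 1 ≤ m) (i : Fin 5) :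
    psiCogen ε i ∈ stringSet ε 8 (3 * m + 5) ((psiMat ε m).transpose.rowDeg i) := by
  have hs : ε ^ 2 = 1 := by rcases hε with rfl | rfl <;> norm_num
  fin_cases i
  · exact mem_stringSet_of (n := -2) (v := (𝕥 ^ 2, 𝕥 ^ 2 + 2 * Polynomial.C ε * 𝕥 + 2)) 2 2
      (by dsimp only; compute_degree) (by dsimp only; compute_degree) (by norm_num) (by push_cast; omega)
      (by simp; linear_combination 2 * hs)
  · exact mem_stringSet_of (n := -2) (v := (-𝕥, -𝕥 - 2 * Polynomial.C ε)) 1 1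
      (by dsimp only; compute_degree) (by dsimp only; compute_degree) (by norm_num) (by push_cast; omega)
      (by simp; ring)
  · exact mem_stringSet_of (n := -2) (v := (1, 1)) 0 0
      (by simp) (by simp) (by norm_num) (by push_cast; omega) (by simp)
  · exact snd_mem_stringSet (n := -(m + 1)) (mem_polyLE_of_natDegree_le' 1 (by compute_degree)
      (by push_cast; omega)) (by simp)
  · exact snd_mem_stringSet (n := -(m + 1)) (mem_polyLE_of_natDegree_le' 2 (by compute_degree)
      (by push_cast; omega)) (by simp)

lemma phiGen_mem {m : ℕ} (hm : 1 ≤ m) (i : Fin 5) :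
    phiGen ε i ∈ stringSet ε 0 (-3 * m + 1) ((phiMat ε m).rowDeg i) := by
  fin_cases i
  · exact fst_mem_stringSet (n := 1) (mem_polyLE_of_natDegree_le' 2 (by compute_degree) (by norm_num))
      (by simp)
  · exact fst_mem_stringSet (n := 1) (mem_polyLE_of_natDegree_le' 1 (by compute_degree) (by norm_num))
      (by simp)
  · exact fst_mem_stringSet (n := 1) (mem_polyLE_of_natDegree_le' 3
      (by rw [zz_eq]; compute_degree) (by norm_num)) (by simp)
  · exact mem_stringSet_of (n := m) (v := (𝕥 - 2 * Polynomial.C ε, 𝕥)) 1 1 (by dsimp only; compute_degree)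
      (by dsimp only; compute_degree) (by push_cast; omega) (by push_cast; omega)
      (by simp; ring)
  · exact mem_stringSet_of (n := m) (v := (-1, -1)) 0 0 (by simp) (by simp) (by push_cast; omega)
      (by push_cast; omega) (by simp)

lemma phiCogen_mem (hε : ε = 1 ∨ ε = -1) {m : ℕ} (hm : 1 ≤ m) (i : Fin 5) :
    phiCogen ε i ∈ stringSet ε 8 (3 * m + 7) ((phiMat ε m).transpose.rowDeg i) := by
  fin_cases i
  · exact mem_stringSet_of (n := -2) (v := (-Polynomial.C ε * 𝕥 ^ 2,
      -Polynomial.C ε * (𝕥 ^ 2 + 2 * Polynomial.C ε * 𝕥 + 2))) 2 2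
      (by dsimp only; compute_degree) (by dsimp only; compute_degree) (by norm_num) (by push_cast; omega)
      (by rcases hε with rfl | rfl <;> norm_num)
  · exact mem_stringSet_of (n := -2) (v := (Polynomial.C ε * 𝕥,
      Polynomial.C ε * (𝕥 + 2 * Polynomial.C ε))) 1 1
      (by dsimp only; compute_degree) (by dsimp only; compute_degree) (by norm_num) (by push_cast; omega)
      (by rcases hε with rfl | rfl <;> norm_num)
  · exact mem_stringSet_of (n := -2) (v := (-Polynomial.C ε, -Polynomial.C ε)) 0 0
      (by simp) (by simp) (by norm_num) (by push_cast; omega) (by simp)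
  · exact snd_mem_stringSet (n := -(m + 1)) (mem_polyLE_of_natDegree_le' 2 (by compute_degree)
      (by push_cast; omega)) (by simp)
  · exact snd_mem_stringSet (n := -(m + 2)) (mem_polyLE_of_natDegree_le' 1 (by compute_degree)
      (by push_cast; omega)) (by simp)

lemma affineGen_mem (τ : k) (i : Fin 5) : affineGen τ i ∈ stringSet 1 0 0
    ((alphaPsiAffine k (τ ^ 2 - 1) (τ * (τ ^ 2 - 1))).rowDeg i) := by
  fin_cases i
  · exact mem_stringSet_of (n := 1) (v := (Polynomial.C (1 + τ) * (𝕥 - 1) * 𝕥,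
      -Polynomial.C (1 - τ) * (𝕥 + 1) * 𝕥)) 2 2
      (by dsimp only; compute_degree) (by dsimp only; compute_degree) (by norm_num) (by norm_num) (by simp)
  · exact mem_stringSet_of (n := 1) (v := (-Polynomial.C (1 + τ) * (𝕥 - 1),
      Polynomial.C (1 - τ) * (𝕥 + 1))) 1 1
      (by dsimp only; compute_degree) (by dsimp only; compute_degree) (by norm_num) (by norm_num) (by simp)
  · exact mem_stringSet_of (n := 1) (v := (Polynomial.C (1 + τ) * (𝕥 - 1) * (𝕥 ^ 2 - 1),
      -Polynomial.C (1 - τ) * (𝕥 + 1) * (𝕥 ^ 2 - 1))) 3 3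
      (by dsimp only; compute_degree) (by dsimp only; compute_degree) (by norm_num) (by norm_num) (by simp)
  · exact mem_stringSet_of (n := 0) (v := (Polynomial.C (1 - τ ^ 2), Polynomial.C (1 - τ ^ 2))) 0 0
      (Polynomial.natDegree_C _).le (Polynomial.natDegree_C _).le (by norm_num) (by norm_num) (by simp)
  · exact mem_stringSet_of (n := 1) (v := (Polynomial.C (1 - τ ^ 2) * (𝕥 - Polynomial.C (τ + 1)),
      Polynomial.C (1 - τ ^ 2) * (𝕥 - Polynomial.C (τ - 1)))) 1 1
      (by dsimp only; compute_degree) (by dsimp only; compute_degree) (by norm_num) (by norm_num) (by simp; ring)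

lemma affineCogen_mem (τ : k) (i : Fin 5) : affineCogen τ i ∈ stringSet 1 8 8
    ((alphaPsiAffine k (τ ^ 2 - 1) (τ * (τ ^ 2 - 1))).transpose.rowDeg i) := by
  fin_cases i
  · exact mem_stringSet_of (n := -2) (v := (Polynomial.C (τ ^ 2 - 1) *
      (𝕥 ^ 2 + Polynomial.C (τ - 1) * 𝕥 + Polynomial.C (τ ^ 2 - τ)), Polynomial.C (τ ^ 2 - 1) *
      (𝕥 ^ 2 + Polynomial.C (τ + 1) * 𝕥 + Polynomial.C (τ ^ 2 + τ)))) 2 2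
      (by dsimp only; compute_degree) (by dsimp only; compute_degree) (by norm_num) (by norm_num) (by simp)
  · exact mem_stringSet_of (n := -2) (v := (-Polynomial.C (τ ^ 2 - 1) * (𝕥 + Polynomial.C (τ - 1)),
      -Polynomial.C (τ ^ 2 - 1) * (𝕥 + Polynomial.C (τ + 1)))) 1 1
      (by dsimp only; compute_degree) (by dsimp only; compute_degree) (by norm_num) (by norm_num) (by simp)
  · exact mem_stringSet_of (n := -2) (v := (Polynomial.C (τ ^ 2 - 1), Polynomial.C (τ ^ 2 - 1))) 0 0
      (Polynomial.natDegree_C _).le (Polynomial.natDegree_C _).le (by norm_num) (by norm_num) (by simp)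
  · exact mem_stringSet_of (n := -2) (v := (Polynomial.C (1 - τ) * (𝕥 + Polynomial.C τ),
      -Polynomial.C (1 + τ) * (𝕥 + Polynomial.C τ))) 1 1
      (by dsimp only; compute_degree) (by dsimp only; compute_degree) (by norm_num) (by norm_num) (by simp; ring)
  · exact mem_stringSet_of (n := -2) (v := (Polynomial.C (1 - τ) *
      (𝕥 ^ 2 + Polynomial.C τ * 𝕥 + Polynomial.C (τ ^ 2 - 1)), -Polynomial.C (1 + τ) *
      (𝕥 ^ 2 + Polynomial.C τ * 𝕥 + Polynomial.C (τ ^ 2 - 1)))) 2 2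
      (by dsimp only; compute_degree) (by dsimp only; compute_degree) (by norm_num) (by norm_num) (by simp; ring)

lemma infinityGen_mem (i : Fin 5) :
    infinityGen k i ∈ stringSet 1 0 0 ((alphaPsiInfinity k).rowDeg i) := by
  fin_cases i
  · exact mem_stringSet_of (n := 1) (v := ((𝕥 - 1) * 𝕥, (𝕥 + 1) * 𝕥)) 2 2
      (by dsimp only; compute_degree) (by dsimp only; compute_degree) (by norm_num) (by norm_num) (by simp)
  · exact mem_stringSet_of (n := 1) (v := (-(𝕥 - 1), -(𝕥 + 1))) 1 1
      (by dsimp only; compute_degree) (by dsimp only; compute_degree) (by norm_num) (by norm_num) (by simp)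
  · exact mem_stringSet_of (n := 1) (v := ((𝕥 - 1) * (𝕥 ^ 2 - 1), (𝕥 + 1) * (𝕥 ^ 2 - 1))) 3 3
      (by dsimp only; compute_degree) (by dsimp only; compute_degree) (by norm_num) (by norm_num) (by simp)
  · exact mem_stringSet_of (n := 0) (v := (1, 1)) 0 0
      (by simp) (by simp) (by norm_num) (by norm_num) (by simp)
  · exact mem_stringSet_of (n := 1) (v := ((𝕥 ^ 2 - 1) * (𝕥 - 1), -((𝕥 ^ 2 - 1) * (𝕥 + 1)))) 3 3
      (by dsimp only; compute_degree) (by dsimp only; compute_degree) (by norm_num) (by norm_num) (by simp)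

lemma infinityCogen_mem (i : Fin 5) :
    infinityCogen k i ∈ stringSet 1 8 8 ((alphaPsiInfinity k).transpose.rowDeg i) := by
  fin_cases i
  · exact mem_stringSet_of (n := -2) (v := (𝕥 - 𝕥 ^ 2, 𝕥 ^ 2 + 𝕥)) 2 2
      (by dsimp only; compute_degree) (by dsimp only; compute_degree) (by norm_num) (by norm_num) (by simp)
  · exact mem_stringSet_of (n := -2) (v := (𝕥 - 𝕥 ^ 2, -𝕥 ^ 2 - 𝕥)) 2 2
      (by dsimp only; compute_degree) (by dsimp only; compute_degree) (by norm_num) (by norm_num) (by simp)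
  · exact mem_stringSet_of (n := -2) (v := (𝕥 - 1, 𝕥 + 1)) 1 1
      (by dsimp only; compute_degree) (by dsimp only; compute_degree) (by norm_num) (by norm_num) (by simp)
  · exact mem_stringSet_of (n := -2) (v := (𝕥 ^ 2, 𝕥 ^ 2)) 2 2
      (by dsimp only; compute_degree) (by dsimp only; compute_degree) (by norm_num) (by norm_num) (by simp)
  · exact mem_stringSet_of (n := -2) (v := (1, 1)) 0 0
      (by simp) (by simp) (by norm_num) (by norm_num) (by simp)

end

end

/-! ### The chosen vectors generate the strings. -/

section

section

variable {ε : k}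

/-- The second coordinate has degree at most 3(n - m + 1) and is generated by 1 and t, whose lifts
are (1, 1) and (t - 2ε, t). After subtracting them, what is left is ((t-ε)w, 0) with deg w ≤ 3(n-1)
+ 2, and the first three vectors supply three generators for w. -/
lemma psi_generated (hε : ε = 1 ∨ ε = -1) (hk : (2 : k) ≠ 0) {m : ℕ} (hm : 1 ≤ m) (n : ℤ)
    (v : Polynomial k × Polynomial k) (hv : v ∈ stringSet ε 0 (-3 * (m - 1)) n) :
    generated (psiMat ε m).rowDeg (psiGen ε) n v := by
  obtain ⟨g, h⟩ := v
  obtain ⟨hg, hh, he⟩ := hv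
  obtain ⟨c, hc⟩ := exists_inv_two hk
  dsimp only at hg hh he
  obtain ⟨p₃, h₃, p₄, h₄, rfl⟩ := exists_generation_zero (N := n - (m - 1))
    (polyLE_mono (by omega) hh)
  obtain ⟨w, hw, ew⟩ := exists_X_sub_C_mul (c := ε) (d := 3 * n)
    (p := g - p₃ - p₄ * (𝕥 - 2 * Polynomial.C ε))
    (sub_mem (sub_mem (polyLE_mono (by omega) hg) (polyLE_mono (by omega) h₃.1))
      (mul_mem_polyLE' h₄.1 (mem_polyLE_of_natDegree_le' 1 (by compute_degree) le_rfl)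
        (by push_cast; omega))) (by
      simp only [Polynomial.eval_sub, Polynomial.eval_mul, Polynomial.eval_add, Polynomial.eval_X,
        Polynomial.eval_C, Polynomial.eval_ofNat, eval_neg_of_mem_nodeLE hε h₃,
        eval_neg_of_mem_nodeLE hε h₄] at he ⊢
      linear_combination he)
  obtain ⟨p, hp, q, hq, r, hr, rfl⟩ := exists_generation_two' (N := n - 1) (polyLE_mono (by omega) hw)
  refine generated_of (C_mul_mem_nodeLE (-c) hp) (C_mul_mem_nodeLE (-c) hq)
    (C_mul_mem_nodeLE (-c) hr) h₃ h₄ ?_ ?_ ?_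
  · intro i
    fin_cases i <;> simp [psiMat]
  · simp only [psiGen, Matrix.cons_val, map_neg]
    linear_combination ew + (Polynomial.C ε - (𝕥 : Polynomial k)) * ((𝕥 : Polynomial k) * p - q + zz k * r) * hc
  · simp only [psiGen, Matrix.cons_val]
    ring

/-- As for ψ, except that the second coordinate has the bound 3(n-m) + 1, for which 1 and t are
needed in the same degree m. -/
lemma phi_generated (hε : ε = 1 ∨ ε = -1) (hk : (2 : k) ≠ 0) {m : ℕ} (hm : 1 ≤ m) (n : ℤ)
    (v : Polynomial k × Polynomial k) (hv : v ∈ stringSet ε 0 (-3 * m + 1) n) :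
    generated (phiMat ε m).rowDeg (phiGen ε) n v := by
  obtain ⟨g, h⟩ := v
  obtain ⟨hg, hh, he⟩ := hv
  obtain ⟨c, hc⟩ := exists_inv_two hk
  have hs := C_mul_self_of_sign hε
  dsimp only at hg hh he
  obtain ⟨p₄, h₄, p₃, h₃, rfl⟩ := exists_generation_one (N := n - m)
    (polyLE_mono (by omega) hh)
  obtain ⟨w, hw, ew⟩ := exists_X_sub_C_mul (c := ε) (d := 3 * n)
    (p := g - p₄ - p₃ * (𝕥 - 2 * Polynomial.C ε))
    (sub_mem (sub_mem (polyLE_mono (by omega) hg) (polyLE_mono (by omega) h₄.1))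
      (mul_mem_polyLE' h₃.1 (mem_polyLE_of_natDegree_le' 1 (by compute_degree) le_rfl)
        (by push_cast; omega))) (by
      simp only [Polynomial.eval_sub, Polynomial.eval_mul, Polynomial.eval_add, Polynomial.eval_X,
        Polynomial.eval_C, Polynomial.eval_ofNat, eval_neg_of_mem_nodeLE hε h₃,
        eval_neg_of_mem_nodeLE hε h₄] at he ⊢
      linear_combination he)
  obtain ⟨p, hp, q, hq, r, hr, rfl⟩ := exists_generation_two' (N := n - 1) (polyLE_mono (by omega) hw)
  refine generated_of (C_mul_mem_nodeLE (c * ε) hp) (C_mul_mem_nodeLE (c * ε) hq)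
    (C_mul_mem_nodeLE (c * ε) hr) h₃ (neg_mem h₄) ?_ ?_ ?_
  · intro i
    fin_cases i <;> simp [phiMat]
  · simp only [phiGen, Matrix.cons_val, map_mul]
    linear_combination ew - ((𝕥 : Polynomial k) - Polynomial.C ε) * ((𝕥 : Polynomial k) * p - q + zz k * r) *
      (hc + 2 * Polynomial.C c * hs)
  · simp only [phiGen, Matrix.cons_val]
    ring

/-- Here the first coordinate is lifted. Its bound 3(n+2) + 2 requires three generators 1, t, t²;
the kernel consists of the (0, (t+ε)w) with deg w ≤ 3(n+m+1) + 1 and requires two in equal degree.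
-/
lemma psi_cogenerated (hε : ε = 1 ∨ ε = -1) (hk : (2 : k) ≠ 0) {m : ℕ} (hm : 1 ≤ m) (n : ℤ)
    (v : Polynomial k × Polynomial k) (hv : v ∈ stringSet ε 8 (3 * m + 5) n) :
    generated (psiMat ε m).transpose.rowDeg (psiCogen ε) n v := by
  obtain ⟨g, h⟩ := v
  obtain ⟨hg, hh, he⟩ := hv
  obtain ⟨c, hc⟩ := exists_inv_two hk
  have hs := C_mul_self_of_sign hε
  have hs' : ε * ε = 1 := by rcases hε with rfl | rfl <;> norm_num
  dsimp only at hg hh he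
  obtain ⟨r, hr, q, hq, p, hp, rfl⟩ := exists_generation_two (N := n + 2)
    (polyLE_mono (by omega) hg)
  obtain ⟨w, hw, ew⟩ := exists_X_sub_C_mul (c := -ε) (d := 3 * n + (3 * m + 5))
    (p := h - (p * (𝕥 ^ 2 + 2 * Polynomial.C ε * 𝕥 + 2) + q * (𝕥 + 2 * Polynomial.C ε) + r))
    (sub_mem hh (add_mem (add_mem
      (mul_mem_polyLE' hp.1 (mem_polyLE_of_natDegree_le' 2 (by compute_degree) le_rfl)
        (by push_cast; omega))
      (mul_mem_polyLE' hq.1 (mem_polyLE_of_natDegree_le' 1 (by compute_degree) le_rfl)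
        (by push_cast; omega))) (polyLE_mono (by omega) hr.1))) (by
      simp only [Polynomial.eval_sub, Polynomial.eval_mul, Polynomial.eval_add, Polynomial.eval_X,
        Polynomial.eval_C, Polynomial.eval_ofNat, Polynomial.eval_pow, eval_neg_of_mem_nodeLE hε hp,
        eval_neg_of_mem_nodeLE hε hq, eval_neg_of_mem_nodeLE hε hr] at he ⊢
      linear_combination -he + 2 * p.eval ε * hs')
  obtain ⟨x, hx, y, hy, rfl⟩ := exists_generation_one (N := n + m + 1) (polyLE_mono (by omega) hw)
  refine generated_of hp (neg_mem hq) hr (C_mul_mem_nodeLE (-c) hx) (C_mul_mem_nodeLE (-c) hy)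
    ?_ ?_ ?_
  · intro i
    fin_cases i <;> simp [psiMat, DegMatrix.transpose] <;> omega
  · simp only [psiCogen, Matrix.cons_val, map_neg]
    ring
  · simp only [psiCogen, Matrix.cons_val, map_neg] at ew ⊢
    linear_combination ew - ((𝕥 : Polynomial k) + Polynomial.C ε) * (x + (𝕥 : Polynomial k) * y) * hc

/-- As for ψ, except that w now has the bound 3(n+m+2), so the generator for 1 sits one degree below
the one for t. -/
lemma phi_cogenerated (hε : ε = 1 ∨ ε = -1) (hk : (2 : k) ≠ 0) {m : ℕ} (hm : 1 ≤ m) (n : ℤ)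
    (v : Polynomial k × Polynomial k) (hv : v ∈ stringSet ε 8 (3 * m + 7) n) :
    generated (phiMat ε m).transpose.rowDeg (phiCogen ε) n v := by
  obtain ⟨g, h⟩ := v
  obtain ⟨hg, hh, he⟩ := hv
  obtain ⟨c, hc⟩ := exists_inv_two hk
  have hs := C_mul_self_of_sign hε
  have hs' : ε * ε = 1 := by rcases hε with rfl | rfl <;> norm_num
  dsimp only at hg hh he
  obtain ⟨r, hr, q, hq, p, hp, rfl⟩ := exists_generation_two (N := n + 2)
    (polyLE_mono (by omega) hg)
  obtain ⟨w, hw, ew⟩ := exists_X_sub_C_mul (c := -ε) (d := 3 * n + (3 * m + 7))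
    (p := h - (p * (𝕥 ^ 2 + 2 * Polynomial.C ε * 𝕥 + 2) + q * (𝕥 + 2 * Polynomial.C ε) + r))
    (sub_mem hh (add_mem (add_mem
      (mul_mem_polyLE' hp.1 (mem_polyLE_of_natDegree_le' 2 (by compute_degree) le_rfl)
        (by push_cast; omega))
      (mul_mem_polyLE' hq.1 (mem_polyLE_of_natDegree_le' 1 (by compute_degree) le_rfl)
        (by push_cast; omega))) (polyLE_mono (by omega) hr.1))) (by
      simp only [Polynomial.eval_sub, Polynomial.eval_mul, Polynomial.eval_add, Polynomial.eval_X,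
        Polynomial.eval_C, Polynomial.eval_ofNat, Polynomial.eval_pow, eval_neg_of_mem_nodeLE hε hp,
        eval_neg_of_mem_nodeLE hε hq, eval_neg_of_mem_nodeLE hε hr] at he ⊢
      linear_combination -he + 2 * p.eval ε * hs')
  obtain ⟨y, hy, x, hx, rfl⟩ := exists_generation_zero (N := n + m + 2) (polyLE_mono (by omega) hw)
  refine generated_of (C_mul_mem_nodeLE (-ε) hp) (C_mul_mem_nodeLE ε hq) (C_mul_mem_nodeLE (-ε) hr)
    (C_mul_mem_nodeLE (-c) hx) (C_mul_mem_nodeLE c hy) ?_ ?_ ?_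
  · intro i
    fin_cases i <;> simp [phiMat, DegMatrix.transpose] <;> omega
  · simp only [phiCogen, Matrix.cons_val, map_neg]
    linear_combination -(p * (𝕥 : Polynomial k) ^ 2 + q * (𝕥 : Polynomial k) + r) * hs
  · simp only [phiCogen, Matrix.cons_val, map_neg] at ew ⊢
    linear_combination ew - ((𝕥 : Polynomial k) + Polynomial.C ε) * (y + (𝕥 : Polynomial k) * x) * hc -
      (p * ((𝕥 : Polynomial k) ^ 2 + 2 * Polynomial.C ε * (𝕥 : Polynomial k) + 2) + q * ((𝕥 : Polynomial k) + 2 * Polynomial.C ε) + r) * hs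

/-- The functional (1-τ)(t+1)g + (1+τ)(t-1)h vanishes on the first three generators and sends the
last two to multiples of the sections t - τ and t² - τt + τ² - 1 of `exists_generation_line`. This
exhibits the string as an extension different from the coordinate one. -/
lemma affine_generated (hk : (2 : k) ≠ 0) {τ : k} (hτ : 1 - τ ^ 2 ≠ 0) (n : ℤ)
    (v : Polynomial k × Polynomial k) (hv : v ∈ stringSet 1 0 0 n) :
    generated (alphaPsiAffine k (τ ^ 2 - 1) (τ * (τ ^ 2 - 1))).rowDeg (affineGen τ) n v := by
  obtain ⟨g, h⟩ := v
  obtain ⟨hg, hh, he⟩ := hv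
  have h1 : 1 - τ ≠ 0 := fun h0 => hτ (by linear_combination (1 + τ) * h0)
  have h2 : 1 + τ ≠ 0 := fun h0 => hτ (by linear_combination (1 - τ) * h0)
  obtain ⟨c, hc⟩ : ∃ c : k, c * (1 - τ ^ 2) = 1 := ⟨_, inv_mul_cancel₀ hτ⟩
  obtain ⟨d, hd⟩ : ∃ d : k, d * 2 = 1 := ⟨_, inv_mul_cancel₀ hk⟩
  dsimp only at hg hh he
  obtain ⟨p₃, h₃, p₄, h₄, e⟩ := exists_generation_line (τ := τ) (N := n)
    (q := Polynomial.C (1 - τ) * ((𝕥 + 1) * g) + Polynomial.C (1 + τ) * ((𝕥 - 1) * h))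
    (add_mem (C_mul_mem_polyLE _ (mul_mem_polyLE' (mem_polyLE_of_natDegree_le' 1
      (by compute_degree) le_rfl) hg (by push_cast; omega))) (C_mul_mem_polyLE _
      (mul_mem_polyLE' (mem_polyLE_of_natDegree_le' 1 (by compute_degree) le_rfl) hh
        (by push_cast; omega))))
    (by simp; linear_combination 2 * (1 - τ ^ 2) * he) hk
  have ez : ∀ x : Polynomial k, Polynomial.C c * ((1 - Polynomial.C τ ^ 2) * x) = x := by
    intro x
    have := congrArg Polynomial.C hc
    simp only [map_mul, map_sub, map_one, map_pow] at this
    linear_combination x * this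
  have ed : Polynomial.C d * 2 = 1 := by
    have := congrArg Polynomial.C hd
    rwa [map_mul, map_one, map_ofNat] at this
  have ec : Polynomial.C c * (1 - Polynomial.C τ ^ 2) = 1 := by simpa using ez 1
  simp only [map_sub, map_add, map_one, map_pow] at e
  set T := Polynomial.C τ
  set K := Polynomial.C c
  set D := Polynomial.C d
  have hm : ∀ a : k, (𝕥 - Polynomial.C a) ∈ polyLE k 1 := fun a => X_sub_C_mem_polyLE a le_rfl
  -- the difference is killed by the functional
  obtain ⟨w, hw, ew⟩ := exists_X_sub_C_mul (c := (1 : k)) (d := 3 * n)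
    (p := g - D * p₃ - D * (p₄ * (𝕥 - Polynomial.C (τ + 1))))
    (sub_mem (sub_mem (polyLE_mono (by omega) hg) (C_mul_mem_polyLE _ h₃.1))
      (C_mul_mem_polyLE _ (mul_mem_polyLE' h₄.1 (hm _) (by omega)))) (by
      have := congrArg (Polynomial.eval 1) e
      simp [T, D] at this ⊢
      apply mul_left_cancel₀ hk
      apply mul_left_cancel₀ h1
      linear_combination this - (1 - τ) * (p₃.eval 1 - τ * p₄.eval 1) * hd)
  -- The functional vanishes on the residual vector. As its first coordinate is (t-1)w, cancelling t
  -- - 1 expresses its second coordinate by the same w.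
  have ew' : Polynomial.C (1 + τ) * (h - D * p₃ - D * (p₄ * (𝕥 - Polynomial.C (τ - 1)))) =
      -Polynomial.C (1 - τ) * ((𝕥 + 1) * w) := by
    apply mul_left_cancel₀ (Polynomial.X_sub_C_ne_zero (1 : k))
    simp only [map_sub, map_add, map_one] at ew ⊢
    change _ = (𝕥 - 1) * w at ew
    linear_combination e - (1 - T) * ((𝕥 : Polynomial k) + 1) * ew -
      (p₃ * ((𝕥 : Polynomial k) - T) + p₄ * ((𝕥 : Polynomial k) ^ 2 - (𝕥 : Polynomial k) * T + (T ^ 2 - 1))) * ed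
  obtain ⟨p, hp, q, hq, r, hr, rfl⟩ := exists_generation_two' (N := n - 1) (polyLE_mono (by omega) hw)
  refine generated_of (C_mul_mem_nodeLE (c * (1 - τ)) hp) (C_mul_mem_nodeLE (c * (1 - τ)) hq)
    (C_mul_mem_nodeLE (c * (1 - τ)) hr) (C_mul_mem_nodeLE (c * d) h₃) (C_mul_mem_nodeLE (c * d) h₄)
    ?_ ?_ ?_
  · intro i
    fin_cases i <;> simp [alphaPsiAffine]
  · simp only [affineGen, Matrix.cons_val, map_mul, map_sub, map_add, map_one, map_pow] at ew ⊢
    change g = K * (1 - T) * p * ((1 + T) * (𝕥 - 1) * 𝕥) + K * (1 - T) * q * (-(1 + T) * (𝕥 - 1)) +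
      K * (1 - T) * r * ((1 + T) * (𝕥 - 1) * zz k) + K * D * p₃ * (1 - T ^ 2) +
      K * D * p₄ * ((1 - T ^ 2) * (𝕥 - (T + 1)))
    linear_combination ew - (((𝕥 : Polynomial k) - 1) * ((𝕥 : Polynomial k) * p - q + zz k * r) + D * p₃ +
      D * p₄ * ((𝕥 : Polynomial k) - (T + 1))) * ec
  · simp only [affineGen, Matrix.cons_val, map_mul, map_sub, map_add, map_one, map_pow] at ew' ⊢
    change h = K * (1 - T) * p * (-(1 - T) * (𝕥 + 1) * 𝕥) + K * (1 - T) * q * ((1 - T) * (𝕥 + 1)) +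
      K * (1 - T) * r * (-(1 - T) * (𝕥 + 1) * zz k) + K * D * p₃ * (1 - T ^ 2) +
      K * D * p₄ * ((1 - T ^ 2) * (𝕥 - (T - 1)))
    linear_combination K * (1 - T) * ew' - h * ec

end

end

/-- The functional (1+τ)g + (1-τ)h vanishes on the last two generators and sends the first three to
scalar multiples of t², t, 1. The residual vector is a multiple of (1-τ, -(1+τ)), and the gluing
turns its factor into a section as in `exists_generation_line_two`. -/
lemma affine_cogenerated (hk : (2 : k) ≠ 0) {τ : k} (hτ : 1 - τ ^ 2 ≠ 0) (n : ℤ)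
    (v : Polynomial k × Polynomial k) (hv : v ∈ stringSet 1 8 8 n) :
    generated (alphaPsiAffine k (τ ^ 2 - 1) (τ * (τ ^ 2 - 1))).transpose.rowDeg
      (affineCogen τ) n v := by
  obtain ⟨g, h⟩ := v
  obtain ⟨hg, hh, he⟩ := hv
  obtain ⟨c, hc⟩ : ∃ c : k, c * (1 - τ ^ 2) = 1 := ⟨_, inv_mul_cancel₀ hτ⟩
  obtain ⟨d, hd⟩ : ∃ d : k, d * 2 = 1 := ⟨_, inv_mul_cancel₀ hk⟩
  dsimp only at hg hh he
  obtain ⟨r, hr, q, hq, p, hp, e⟩ := exists_generation_two (N := n + 2)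
    (w := Polynomial.C (1 + τ) * g + Polynomial.C (1 - τ) * h)
    (add_mem (C_mul_mem_polyLE _ (polyLE_mono (by omega) hg))
      (C_mul_mem_polyLE _ (polyLE_mono (by omega) hh)))
  have ed : Polynomial.C d * 2 = 1 := by
    have := congrArg Polynomial.C hd
    rwa [map_mul, map_one, map_ofNat] at this
  have ec : Polynomial.C c * (1 - Polynomial.C τ ^ 2) = 1 := by
    have := congrArg Polynomial.C hc
    simpa only [map_mul, map_sub, map_one, map_pow] using this
  have m1 : ∀ a : k, 𝕥 + Polynomial.C a ∈ polyLE k 1 := fun a =>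
    add_mem (X_mem_polyLE le_rfl) (C_mem_polyLE _ (by norm_num))
  have m2 : ∀ a b : k, 𝕥 ^ 2 + Polynomial.C a * 𝕥 + Polynomial.C b ∈ polyLE k 2 := fun a b =>
    mem_polyLE_of_natDegree_le' 2 (by compute_degree) le_rfl
  obtain ⟨g', hg'⟩ : ∃ g', g' = g - Polynomial.C d *
    (p * (𝕥 ^ 2 + Polynomial.C (τ - 1) * 𝕥 + Polynomial.C (τ ^ 2 - τ)) +
      q * (𝕥 + Polynomial.C (τ - 1)) + r) := ⟨_, rfl⟩
  obtain ⟨h', hh'⟩ : ∃ h', h' = h - Polynomial.C d *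
    (p * (𝕥 ^ 2 + Polynomial.C (τ + 1) * 𝕥 + Polynomial.C (τ ^ 2 + τ)) +
      q * (𝕥 + Polynomial.C (τ + 1)) + r) := ⟨_, rfl⟩
  have hg'm : g' ∈ polyLE k (3 * n + 8) := hg' ▸ sub_mem hg (C_mul_mem_polyLE _ (add_mem (add_mem
    (mul_mem_polyLE' hp.1 (m2 _ _) (by omega)) (mul_mem_polyLE' hq.1 (m1 _) (by omega)))
    (polyLE_mono (by omega) hr.1)))
  have he' : g'.eval 1 = h'.eval (-1) := by
    simp only [hg', hh', Polynomial.eval_sub, Polynomial.eval_mul, Polynomial.eval_add,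
      Polynomial.eval_X, Polynomial.eval_C, Polynomial.eval_pow, ← hp.2, ← hq.2, ← hr.2]
    linear_combination he
  have e' : (1 + Polynomial.C τ) * g' = -(1 - Polynomial.C τ) * h' := by
    simp only [map_sub, map_add, map_one, map_pow] at e hg' hh'
    rw [hg', hh']
    linear_combination e - (r + Polynomial.X * q + Polynomial.X ^ 2 * p) * ed
  obtain ⟨x, hx, y, hy, e''⟩ := exists_generation_line_two (τ := τ) (N := n + 2)
    (q := Polynomial.C (c * (1 + τ)) * g') (C_mul_mem_polyLE _ (polyLE_mono (by omega) hg'm)) (by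
      have := congrArg (Polynomial.eval (-1)) e'
      simp only [Polynomial.eval_mul, Polynomial.eval_C, Polynomial.eval_add, Polynomial.eval_one,
        Polynomial.eval_neg, Polynomial.eval_sub] at this ⊢
      linear_combination (1 - τ ^ 2) * c * he' + c * (1 + τ) * this) hk
  refine generated_of (C_mul_mem_nodeLE (-c * d) hp) (C_mul_mem_nodeLE (c * d) hq)
    (C_mul_mem_nodeLE (-c * d) hr) hx hy ?_ ?_ ?_
  · intro i
    fin_cases i <;> simp [alphaPsiAffine, DegMatrix.transpose]
  · simp only [affineCogen, Matrix.cons_val, map_mul, map_sub, map_add, map_one, map_pow,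
      map_neg] at e'' hg' ⊢
    linear_combination (1 - Polynomial.C τ) * e'' -
      Polynomial.C c * (1 - Polynomial.C τ ^ 2) * hg' - g * ec
  · simp only [affineCogen, Matrix.cons_val, map_mul, map_sub, map_add, map_one, map_pow,
      map_neg] at e'' hh' ⊢
    linear_combination -(1 + Polynomial.C τ) * e'' +
      Polynomial.C c * (1 + Polynomial.C τ) * e' -
      Polynomial.C c * (1 - Polynomial.C τ ^ 2) * hh' - h * ec

/-- The functional (t+1)g - (t-1)h vanishes on the first three generators and has the values 2 and
2(t²-1)² on the last two, which are the sections of `exists_generation_infinity` up to a scalar. -/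
lemma infinity_generated (hk : (2 : k) ≠ 0) (n : ℤ)
    (v : Polynomial k × Polynomial k) (hv : v ∈ stringSet 1 0 0 n) :
    generated (alphaPsiInfinity k).rowDeg (infinityGen k) n v := by
  obtain ⟨g, h⟩ := v
  obtain ⟨hg, hh, he⟩ := hv
  obtain ⟨d, hd⟩ : ∃ d : k, d * 2 = 1 := ⟨_, inv_mul_cancel₀ hk⟩
  have ed : Polynomial.C d * 2 = 1 := by
    have := congrArg Polynomial.C hd
    rwa [map_mul, map_one, map_ofNat] at this
  dsimp only at hg hh he
  obtain ⟨p₃, h₃, p₄, h₄, e⟩ := exists_generation_infinity (N := n)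
    (q := (𝕥 + 1) * g - (𝕥 - 1) * h)
    (sub_mem (mul_mem_polyLE' (mem_polyLE_of_natDegree_le' 1
      (by compute_degree) le_rfl) hg (by push_cast; omega))
      (mul_mem_polyLE' (mem_polyLE_of_natDegree_le' 1 (by compute_degree) le_rfl) hh
        (by push_cast; omega)))
    (by simp; linear_combination 2 * he) hk
  obtain ⟨w, hw, ew⟩ := exists_X_sub_C_mul (c := (1 : k)) (d := 3 * n)
    (p := g - Polynomial.C d * p₃ - Polynomial.C d * (p₄ * (zz k * (𝕥 - 1))))
    (sub_mem (sub_mem (polyLE_mono (by omega) hg) (C_mul_mem_polyLE _ h₃.1))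
      (C_mul_mem_polyLE _ (mul_mem_polyLE' h₄.1 (mem_polyLE_of_natDegree_le' 3
        (by rw [zz_eq]; compute_degree) le_rfl) (by push_cast; omega)))) (by
      have := congrArg (Polynomial.eval 1) e
      simp at this ⊢
      linear_combination d * this - g.eval 1 * hd)
  have ew' : h - Polynomial.C d * p₃ + Polynomial.C d * (p₄ * (zz k * (𝕥 + 1))) = (𝕥 + 1) * w := by
    apply mul_left_cancel₀ (Polynomial.X_sub_C_ne_zero (1 : k))
    simp only [map_one] at ew ⊢
    linear_combination -e + ((𝕥 : Polynomial k) + 1) * ew + (p₃ + p₄ * zz k ^ 2) * ed -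
      2 * Polynomial.C d * p₄ * zz k * zz_eq (k := k)
  obtain ⟨p, hp, q, hq, r, hr, rfl⟩ := exists_generation_two' (N := n - 1) (polyLE_mono (by omega) hw)
  refine generated_of hp hq hr (C_mul_mem_nodeLE d h₃) (C_mul_mem_nodeLE d h₄) ?_ ?_ ?_
  · intro i
    fin_cases i <;> simp [alphaPsiInfinity]
  · simp only [infinityGen, Matrix.cons_val, map_one] at ew ⊢
    linear_combination ew
  · simp only [infinityGen, Matrix.cons_val]
    linear_combination ew'

/-- The functional h - g sends the first three generators to multiples of t², t, 1 and kills the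
diagonal ones. The residual vector is diagonal, and the gluing says that its entry has equal values
at 1 and -1. -/
lemma infinity_cogenerated (hk : (2 : k) ≠ 0) (n : ℤ)
    (v : Polynomial k × Polynomial k) (hv : v ∈ stringSet 1 8 8 n) :
    generated (alphaPsiInfinity k).transpose.rowDeg (infinityCogen k) n v := by
  obtain ⟨g, h⟩ := v
  obtain ⟨hg, hh, he⟩ := hv
  obtain ⟨d, hd⟩ : ∃ d : k, d * 2 = 1 := ⟨_, inv_mul_cancel₀ hk⟩
  have ed : Polynomial.C d * 2 = 1 := by
    have := congrArg Polynomial.C hd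
    rwa [map_mul, map_one, map_ofNat] at this
  dsimp only at hg hh he
  obtain ⟨r, hr, q, hq, p, hp, e⟩ := exists_generation_two (N := n + 2) (w := h - g)
    (sub_mem (polyLE_mono (by omega) hh) (polyLE_mono (by omega) hg))
  set g' := g - Polynomial.C d * (p * (𝕥 - 𝕥 ^ 2) - q * (𝕥 - 𝕥 ^ 2) + r * (𝕥 - 1)) with hg'
  have e' : g' = h - Polynomial.C d * (p * (𝕥 ^ 2 + 𝕥) - q * (-𝕥 ^ 2 - 𝕥) + r * (𝕥 + 1)) := by
    rw [hg']
    linear_combination -e + (r + Polynomial.X * q + Polynomial.X ^ 2 * p) * ed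
  have m2 : 𝕥 - 𝕥 ^ 2 ∈ polyLE k 2 := mem_polyLE_of_natDegree_le' 2 (by compute_degree) le_rfl
  obtain ⟨x, hx, y, hy, e''⟩ := exists_generation_infinity_two (N := n + 2) (q := g')
    (sub_mem (polyLE_mono (by omega) hg) (C_mul_mem_polyLE _ (add_mem (sub_mem
      (mul_mem_polyLE' hp.1 m2 (by omega)) (mul_mem_polyLE' hq.1 m2 (by omega)))
      (mul_mem_polyLE' hr.1 (mem_polyLE_of_natDegree_le' 1 (by compute_degree) le_rfl)
        (by push_cast; omega))))) (by
      conv_rhs => rw [e']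
      rw [hg']
      simp
      linear_combination he) hk
  refine generated_of (C_mul_mem_nodeLE d hp) (C_mul_mem_nodeLE (-d) hq)
    (C_mul_mem_nodeLE d hr) hy hx ?_ ?_ ?_
  · intro i
    fin_cases i <;> simp [alphaPsiInfinity, DegMatrix.transpose]
  · simp only [infinityCogen, Matrix.cons_val, map_neg]
    linear_combination e'' - hg'
  · simp only [infinityCogen, Matrix.cons_val, map_neg]
    linear_combination e'' - e'

/-! ### The listed matrices -/

lemma psi_isString (hk : (2 : k) ≠ 0) {ε : k} (hε : ε = 1 ∨ ε = -1) {m : ℕ} (hm : 1 ≤ m) :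
    IsString (psiMat ε m).cokerGrading ε 0 (-3 * (m - 1)) :=
  (psi_factorization hk hε m).isString hk hε (psiGen_mem hm) (psi_generated hε hk hm)

lemma psi_transpose_isString (hk : (2 : k) ≠ 0) {ε : k} (hε : ε = 1 ∨ ε = -1) {m : ℕ} (hm : 1 ≤ m) :
    IsString (psiMat ε m).transpose.cokerGrading ε 8 (3 * m + 5) :=
  (psi_factorization hk hε m).transpose.isString hk hε (psiCogen_mem hε hm)
    (psi_cogenerated hε hk hm)

lemma phi_isString (hk : (2 : k) ≠ 0) {ε : k} (hε : ε = 1 ∨ ε = -1) {m : ℕ} (hm : 1 ≤ m) :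
    IsString (phiMat ε m).cokerGrading ε 0 (-3 * m + 1) :=
  (phi_factorization hk hε m).isString hk hε (phiGen_mem hm) (phi_generated hε hk hm)

lemma phi_transpose_isString (hk : (2 : k) ≠ 0) {ε : k} (hε : ε = 1 ∨ ε = -1) {m : ℕ} (hm : 1 ≤ m) :
    IsString (phiMat ε m).transpose.cokerGrading ε 8 (3 * m + 7) :=
  (phi_factorization hk hε m).transpose.isString hk hε (phiCogen_mem hε hm)
    (phi_cogenerated hε hk hm)

lemma affine_isString (hk : (2 : k) ≠ 0) {τ : k} (hτ : 1 - τ ^ 2 ≠ 0) :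
    IsString (alphaPsiAffine k (τ ^ 2 - 1) (τ * (τ ^ 2 - 1))).cokerGrading (1 : k) 0 0 :=
  (affine_factorization hk τ hτ).isString hk (.inl rfl) (affineGen_mem τ) (affine_generated hk hτ)

lemma affine_transpose_isString (hk : (2 : k) ≠ 0) {τ : k} (hτ : 1 - τ ^ 2 ≠ 0) :
    IsString (alphaPsiAffine k (τ ^ 2 - 1) (τ * (τ ^ 2 - 1))).transpose.cokerGrading (1 : k) 8 8 :=
  (affine_factorization hk τ hτ).transpose.isString hk (.inl rfl) (affineCogen_mem τ)
    (affine_cogenerated hk hτ)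

lemma infinity_isString (hk : (2 : k) ≠ 0) :
    IsString (alphaPsiInfinity k).cokerGrading (1 : k) 0 0 :=
  (infinity_factorization hk).isString hk (.inl rfl) infinityGen_mem (infinity_generated hk)

lemma infinity_transpose_isString (hk : (2 : k) ≠ 0) :
    IsString (alphaPsiInfinity k).transpose.cokerGrading (1 : k) 8 8 :=
  (infinity_factorization hk).transpose.isString hk (.inl rfl) infinityCogen_mem
    (infinity_cogenerated hk)

/-- τ = b/a is the slope of the line joining the point to the node. A point with a = 0 has b = 0 and
is the node itself; τ² = 1 would give a = 0. -/
lemma exists_parameter {a b : k} (hab : a ^ 3 + a ^ 2 - b ^ 2 = 0) (hreg : (a, b) ≠ (0, 0)) :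
    ∃ τ : k, 1 - τ ^ 2 ≠ 0 ∧ a = τ ^ 2 - 1 ∧ b = τ * (τ ^ 2 - 1) := by
  have ha : a ≠ 0 := by
    rintro rfl
    have : b = 0 := by
      have : b ^ 2 = 0 := by linear_combination -hab
      exact pow_eq_zero_iff (by norm_num) |>.1 this
    exact hreg (by rw [this])
  have h1 : a = (b / a) ^ 2 - 1 := by
    field_simp
    linear_combination hab
  refine ⟨b / a, fun h => ha (by linear_combination h1 - h), h1, ?_⟩
  rw [← h1]
  field_simp

lemma IsListed.isString (hk : (2 : k) ≠ 0) {A : DegMatrix k} (hA : IsListed A) :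
    A.IsHomogeneous ∧ (∀ i j, constantCoeff (A.mat i j) = 0) ∧
      ∃ ε : k, (ε = 1 ∨ ε = -1) ∧ (∃ d₁ d₂, IsString A.cokerGrading ε d₁ d₂) ∧
        ∃ d₁ d₂, IsString A.transpose.cokerGrading ε d₁ d₂ := by
  cases hA with
  | psi1 m hm =>
    refine ⟨?_, ?_, 1, .inl rfl, ?_⟩
    · rw [alphaPsi1_eq]
      exact psi_isHomogeneous 1 m
    · intro i j
      fin_cases i <;> fin_cases j <;> simp [alphaPsi1] <;> omega
    · rw [alphaPsi1_eq]
      exact ⟨⟨_, _, psi_isString hk (.inl rfl) hm⟩, _, _, psi_transpose_isString hk (.inl rfl) hm⟩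
  | psi2 m hm =>
    refine ⟨?_, ?_, -1, .inr rfl, ?_⟩
    · rw [alphaPsi2_eq]
      exact psi_isHomogeneous (-1) m
    · intro i j
      fin_cases i <;> fin_cases j <;> simp [alphaPsi2] <;> omega
    · rw [alphaPsi2_eq]
      exact ⟨⟨_, _, psi_isString hk (.inr rfl) hm⟩, _, _, psi_transpose_isString hk (.inr rfl) hm⟩
  | phi1 m hm =>
    refine ⟨?_, ?_, 1, .inl rfl, ?_⟩
    · rw [alphaPhi1_eq]
      exact phi_isHomogeneous 1 m
    · intro i j
      fin_cases i <;> fin_cases j <;> simp [alphaPhi1] <;> omega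
    · rw [alphaPhi1_eq]
      exact ⟨⟨_, _, phi_isString hk (.inl rfl) hm⟩, _, _, phi_transpose_isString hk (.inl rfl) hm⟩
  | phi2 m hm =>
    refine ⟨?_, ?_, -1, .inr rfl, ?_⟩
    · rw [alphaPhi2_eq]
      exact phi_isHomogeneous (-1) m
    · intro i j
      fin_cases i <;> fin_cases j <;> simp [alphaPhi2] <;> omega
    · rw [alphaPhi2_eq]
      exact ⟨⟨_, _, phi_isString hk (.inr rfl) hm⟩, _, _, phi_transpose_isString hk (.inr rfl) hm⟩
  | affinePoint a b hab hreg =>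
    obtain ⟨τ, hτ, rfl, rfl⟩ := exists_parameter hab hreg
    refine ⟨affine_isHomogeneous τ, ?_, 1, .inl rfl, ⟨_, _, affine_isString hk hτ⟩, _, _,
      affine_transpose_isString hk hτ⟩
    intro i j
    fin_cases i <;> fin_cases j <;> simp [alphaPsiAffine]
  | infinitePoint =>
    refine ⟨infinity_isHomogeneous k, ?_, 1, .inl rfl, ⟨_, _, infinity_isString hk⟩, _, _,
      infinity_transpose_isString hk⟩
    intro i j
    fin_cases i <;> fin_cases j <;> simp [alphaPsiInfinity]

lemma DegMatrix.IsHomogeneous.transpose {A : DegMatrix k} (h : A.IsHomogeneous) :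
    A.transpose.IsHomogeneous := by
  intro i j
  have := h j i
  rwa [← neg_sub_neg] at this

/-! ### The direct part of the classification. -/

lemma IsString.isTarget {A : DegMatrix k} (hk : (2 : k) ≠ 0) {ε : k} (hε : ε = 1 ∨ ε = -1)
    {d₁ d₂ : ℤ} (h : IsString A.cokerGrading ε d₁ d₂)
    (hA : ∀ i j, constantCoeff (A.mat i j) = 0) : IsTarget k A.cokerGrading where
  gradedMCM := ⟨h.graded, h.isMCM⟩
  indecomposable := h.isIndecomposable hk hε
  rank_eq := h.finrank_eq hk
  not_locallyFree := h.not_isLocallyFree hk hε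
  minGenerators := spanFinrank_coker A hA

lemma IsListedOrTranspose.isTarget (hk : (2 : k) ≠ 0) {A : DegMatrix k}
    (hA : IsListedOrTranspose A) :
    A.IsHomogeneous ∧ IsTarget k A.cokerGrading ∧ IsExtensionOfRankOne k A.cokerGrading := by
  rcases hA with hA | ⟨A, hA, rfl⟩
  · obtain ⟨h1, h2, ε, hε, ⟨d₁, d₂, h⟩, -⟩ := hA.isString hk
    exact ⟨h1, h.isTarget hk hε h2, h.isExtensionOfRankOne hk⟩
  · obtain ⟨h1, h2, ε, hε, -, d₁, d₂, h⟩ := hA.isString hk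
    exact ⟨h1.transpose, h.isTarget hk hε fun i j => h2 j i, h.isExtensionOfRankOne hk⟩

section

/-! ### Strings with five generators -/

section

variable {M : Type v} [AddCommGroup M] [Module (Cone k) M] {𝓜 : ℤ → AddSubgroup M} {ε : k}
  {d₁ d₂ : ℤ}

lemma Realizes.cf_smul {Φ : M →ₗ[Cone k] Param k × Param k}
    {F : ℤ → Submodule k (Polynomial k × Polynomial k)} (h : Realizes 𝓜 Φ F)
    (hg : IsGradedModule (k := k) 𝓜) {r : Cone k} {d : ℤ} {p : Polynomial k} (hr : r ∈ coneDeg k d)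
    (e : toParam k r = 𝐂 p * 𝐓 d) (n : ℤ) (x : M) : cf n (Φ (r • x)) = p • cf (n - d) (Φ x) := by
  apply emb_injective n
  rw [← h.map_comp hg.isInternal, comp_smul' hg hr, map_smul, h.map_comp hg.isInternal, smul_emb e,
    add_sub_cancel]

lemma IsString.isIsoUpToShift {M' : Type*} [AddCommGroup M'] [Module (Cone k) M']
    {𝓜' : ℤ → AddSubgroup M'} {d₁' d₂' : ℤ} (h : IsString 𝓜 ε d₁ d₂) (h' : IsString 𝓜' ε d₁' d₂')
    (s : ℤ) (h₁ : d₁ = d₁' + 3 * s) (h₂ : d₂ = d₂' + 3 * s) : IsIsoUpToShift k 𝓜 𝓜' := by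
  obtain ⟨Φ, hΦ⟩ := h.exists_realizes
  obtain ⟨Ψ, hΨ⟩ := h'.exists_realizes
  refine hΦ.isIsoUpToShift hΨ h.graded.isInternal h'.graded.isInternal s fun n => ?_
  ext v
  rw [mem_stringSet, mem_stringSet, h₁, h₂, show 3 * n + (d₁' + 3 * s) = 3 * (n + s) + d₁' by ring,
    show 3 * n + (d₂' + 3 * s) = 3 * (n + s) + d₂' by ring]

lemma IsString.spanFinrank_le {N : ℕ} (h : IsString 𝓜 ε d₁ d₂) (r : Fin N → ℤ)
    (G : Fin N → Polynomial k × Polynomial k) (hk : (2 : k) ≠ 0)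
    (hG : ∀ i, G i ∈ stringSet ε d₁ d₂ (r i))
    (hgen : ∀ n, ∀ v ∈ stringSet ε d₁ d₂ n, ∃ p : Fin N → Polynomial k,
      (∀ i, p i ∈ nodeLE k (n - r i)) ∧ v = ∑ i, p i • G i) :
    (⊤ : Submodule (Cone k) M).spanFinrank ≤ N := by
  obtain ⟨Φ, hΦ⟩ := h.exists_realizes
  choose w hw e using fun i => hΦ.exists_of_mem _ _ (hG i)
  refine spanFinrank_le_of_span_range w ?_
  rw [eq_top_iff]
  rintro x -
  have key : ∀ n, ∀ x ∈ 𝓜 n, x ∈ Submodule.span (Cone k) (Set.range w) := by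
    intro n x hx
    obtain ⟨v, hv, ex⟩ := hΦ.map_mem n x hx
    obtain ⟨p, hp, rfl⟩ := hgen n v hv
    choose s hs es using fun i => exists_coneDeg_of_mem_nodeLE hk (hp i)
    have : x = ∑ i, s i • w i := by
      apply hΦ.injective
      rw [ex, emb_sum, map_sum]
      refine Finset.sum_congr rfl fun i _ => ?_
      rw [map_smul, e, smul_emb (es i), sub_add_cancel]
    rw [this]
    exact sum_mem fun i _ => Submodule.smul_mem _ _ (Submodule.subset_span ⟨i, rfl⟩)
  obtain ⟨s, hs, -⟩ := exists_sum_comp h.graded.isInternal x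
  rw [hs]
  exact sum_mem fun n _ => key n _ (comp_mem _ n x)

lemma exists_generation {w : Polynomial k} {N c : ℤ} (hc : c = 0 ∨ c = 1)
    (hw : w ∈ polyLE k (3 * N + c)) :
    ∃ p ∈ nodeLE k N, ∃ q ∈ nodeLE k (N - (1 - c)), w = p + 𝕥 * q := by
  rcases hc with rfl | rfl
  · exact exists_generation_zero (by rwa [add_zero] at hw)
  · obtain ⟨p, hp, q, hq, e⟩ := exists_generation_one hw
    exact ⟨p, hp, q, by rwa [sub_self, sub_zero], e⟩

/-- The submodule v₂ = 0 is t - ε times polynomials with bound 3n + c, and the second coordinate has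
bound 3(n-e) + j. For c and j in {0, 1} each needs only two generators, and e ≥ 0 leaves room to
lift 1 and t with constant first coordinates. -/
lemma IsString.spanFinrank_le_four (h : IsString 𝓜 ε d₁ d₂) (hk : (2 : k) ≠ 0)
    (hε : ε = 1 ∨ ε = -1) {c j e : ℤ} (hc : c = 0 ∨ c = 1) (hj : j = 0 ∨ j = 1) (he : 0 ≤ e)
    (h₁ : d₁ = c + 1) (h₂ : d₂ = j - 3 * e) : (⊤ : Submodule (Cone k) M).spanFinrank ≤ 4 := by
  subst h₁ h₂
  refine h.spanFinrank_le ![0, 1 - c, e, e + (1 - j)]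
    ![(𝕥 - Polynomial.C ε, 0), ((𝕥 - Polynomial.C ε) * 𝕥, 0), (1, 1), (-Polynomial.C ε, 𝕥)] hk ?_ ?_
  · intro i
    fin_cases i
    · exact fst_mem_stringSet (n := 0) (mem_polyLE_of_natDegree_le' 1 (by compute_degree)
        (by push_cast; omega)) (by simp)
    · exact fst_mem_stringSet (n := 1 - c) (mem_polyLE_of_natDegree_le' 2 (by compute_degree)
        (by push_cast; omega)) (by simp)
    · exact mem_stringSet_of (n := e) (v := (1, 1)) 0 0 (by simp) (by simp) (by push_cast; omega)
        (by push_cast; omega) (by simp)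
    · exact mem_stringSet_of (n := e + (1 - j)) (v := (-Polynomial.C ε, 𝕥)) 0 1
        (by simp) (by simp) (by push_cast; omega)
        (by push_cast; omega) (by simp)
  · rintro n ⟨g, h⟩ ⟨hg, hh, hgh⟩
    dsimp only at hg hh hgh
    obtain ⟨p, hp, q, hq, rfl⟩ := exists_generation (N := n - e) hj (polyLE_mono (by omega) hh)
    have hp' := eval_neg_of_mem_nodeLE hε hp
    have hq' := eval_neg_of_mem_nodeLE hε hq
    obtain ⟨w, hw, ew⟩ := exists_X_sub_C_mul (c := ε) (d := 3 * n + (c + 1))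
      (p := g - p + Polynomial.C ε * q) (add_mem (sub_mem hg (polyLE_mono (by omega) hp.1))
        (C_mul_mem_polyLE _ (polyLE_mono (by omega) hq.1))) (by
        simp only [Polynomial.eval_add, Polynomial.eval_mul, Polynomial.eval_X, hp', hq',
          Polynomial.eval_sub, Polynomial.eval_C] at hgh ⊢
        linear_combination hgh)
    obtain ⟨a, ha, b, hb, rfl⟩ := exists_generation (N := n) hc (polyLE_mono (by omega) hw)
    refine ⟨![a, b, p, q], fun i => ?_, ?_⟩
    · fin_cases i
      · exact nodeLE_mono (by simp) ha
      · exact hb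
      · exact hp
      · exact nodeLE_mono (by simp; omega) hq
    · rw [Fin.sum_univ_four]
      ext1
      · simp
        linear_combination ew
      · simp
        ring

/-- Three coefficients of the first coordinate in degree 1 and three of the second coordinate in
degree e cannot be reached from below: one degree lower the relevant coordinates are zero. They give
a map onto k⁶ killed by the vertex ideal. -/
lemma IsString.six_le_spanFinrank (h : IsString 𝓜 ε 0 d₂) [Module.Finite (Cone k) M] {e : ℤ}
    (he : 1 ≤ e) (h₂ : d₂ = 2 - 3 * e) : 6 ≤ (⊤ : Submodule (Cone k) M).spanFinrank := by
  subst h₂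
  obtain ⟨Φ, hΦ⟩ := h.exists_realizes
  let ρ : M →+ (Fin 6 → k) :=
    { toFun := fun x => ![(cf 1 (Φ x)).1.coeff 1, (cf 1 (Φ x)).1.coeff 2, (cf 1 (Φ x)).1.coeff 3,
        (cf e (Φ x)).2.coeff 0, (cf e (Φ x)).2.coeff 1, (cf e (Φ x)).2.coeff 2]
      map_zero' := by ext i; fin_cases i <;> simp
      map_add' := fun x y => by ext i; fin_cases i <;> simp [cf_add] }
  have hρ : ∀ x, ρ x = ![(cf 1 (Φ x)).1.coeff 1, (cf 1 (Φ x)).1.coeff 2, (cf 1 (Φ x)).1.coeff 3,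
        (cf e (Φ x)).2.coeff 0, (cf e (Φ x)).2.coeff 1, (cf e (Φ x)).2.coeff 2] := fun x => rfl
  have hX : ∀ i x, ρ (toCone k (X i) • x) = 0 := by
    intro i x
    obtain ⟨p, -, ep⟩ := toParam_of_mem_coneDeg (X_mem_coneDeg (k := k) i)
    obtain ⟨h1, h2, h3⟩ := hΦ.cf_mem h.graded.isInternal (1 - 1) x
    obtain ⟨-, h4, -⟩ := hΦ.cf_mem h.graded.isInternal (e - 1) x
    have e2 := eq_zero_of_mem_polyLE_neg h2 (by omega)
    have e4 := eq_zero_of_mem_polyLE_neg h4 (by omega)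
    -- In degree 0 the first coordinate is a constant, and the second vanishes because its bound 2 -
    -- 3e is negative; the gluing then kills the constant.
    have e1 : (cf (1 - 1) (Φ x)).1 = 0 := by
      have e5 := eq_C_of_mem_polyLE (polyLE_mono (by omega) h1)
      rw [e2, e5] at h3
      simp only [Polynomial.eval_C, Polynomial.eval_zero] at h3
      rw [e5, h3, map_zero]
    rw [hρ, hΦ.cf_smul h.graded (X_mem_coneDeg i) ep, hΦ.cf_smul h.graded (X_mem_coneDeg i) ep]
    simp only [Prod.smul_fst, Prod.smul_snd, e1, e4, smul_zero, Polynomial.coeff_zero]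
    ext i
    fin_cases i <;> rfl
  refine le_spanFinrank_of_residue ρ ?_ ?_
  · intro r
    obtain ⟨F, rfl⟩ := Ideal.Quotient.mk_surjective r
    induction F using MvPolynomial.induction_on with
    | C a =>
      intro x
      have ea : toParam k (toCone k (C a)) = 𝐂 (Polynomial.C a) * 𝐓 0 := by simp
      rw [hρ, hΦ.cf_smul h.graded (C_mem_coneDeg a) ea, hΦ.cf_smul h.graded (C_mem_coneDeg a) ea,
        hρ, residue_toCone, constantCoeff_C, sub_zero, sub_zero]
      ext i
      fin_cases i <;> simp
    | add p q hp hq =>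
      intro x
      rw [map_add, add_smul, map_add, hp, hq, map_add, add_smul]
    | mul_X p i hp =>
      intro x
      rw [map_mul, mul_comm, mul_smul, hX, map_mul, residue_toCone, constantCoeff_X, zero_mul,
        zero_smul]
  · intro c
    -- The constant coefficient of the first coordinate, which ρ does not see, is free to be
    -- adjusted to meet the gluing condition.
    let g : Polynomial k := Polynomial.C (c 0) * 𝕥 + Polynomial.C (c 1) * 𝕥 ^ 2 +
      Polynomial.C (c 2) * 𝕥 ^ 3
    let q : Polynomial k := Polynomial.C (c 3) + Polynomial.C (c 4) * 𝕥 + Polynomial.C (c 5) * 𝕥 ^ 2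
    obtain ⟨x, -, ex⟩ := hΦ.exists_of_mem 1 (g - Polynomial.C (g.eval ε), 0)
      (fst_mem_stringSet (mem_polyLE_of_natDegree_le' 3 (by dsimp only [g]; compute_degree)
        (by norm_num)) (by simp))
    obtain ⟨y, -, ey⟩ := hΦ.exists_of_mem e (Polynomial.C (q.eval (-ε)), q)
      (mem_stringSet_of 0 2 (by simp) (by dsimp only [q]; compute_degree) (by push_cast; omega)
        (by push_cast; omega) (by simp))
    refine ⟨x + y, ?_⟩
    have e1 : (cf 1 (Φ (x + y))).1 = g - Polynomial.C (g.eval ε) +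
        Polynomial.C (if e = 1 then q.eval (-ε) else 0) := by
      rw [map_add, cf_add, ex, ey, cf_emb]
      split_ifs with h1
      · rw [h1, cf_emb]; rfl
      · rw [cf_emb_ne h1]; simp
    have e2 : (cf e (Φ (x + y))).2 = q := by
      rw [map_add, cf_add, ex, ey, cf_emb]
      by_cases h1 : e = 1
      · rw [h1, cf_emb]; simp
      · rw [cf_emb_ne (Ne.symm h1)]; simp
    rw [hρ, e1, e2]
    generalize Polynomial.eval ε g = a
    ext i
    fin_cases i <;> simp [g, q, Polynomial.coeff_X, Polynomial.coeff_C]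

lemma isListed_psiMat (hε : ε = 1 ∨ ε = -1) {m : ℕ} (hm : 1 ≤ m) : IsListed (psiMat ε m) := by
  rcases hε with rfl | rfl
  · exact alphaPsi1_eq (k := k) m ▸ .psi1 m hm
  · exact alphaPsi2_eq (k := k) m ▸ .psi2 m hm

lemma isListed_phiMat (hε : ε = 1 ∨ ε = -1) {m : ℕ} (hm : 1 ≤ m) : IsListed (phiMat ε m) := by
  rcases hε with rfl | rfl
  · exact alphaPhi1_eq (k := k) m ▸ .phi1 m hm
  · exact alphaPhi2_eq (k := k) m ▸ .phi2 m hm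

lemma IsString.shift (h : IsString 𝓜 ε d₁ d₂) (s : ℤ) :
    IsString (fun n => 𝓜 (n + s)) ε (d₁ + 3 * s) (d₂ + 3 * s) := by
  obtain ⟨Φ, hΦ⟩ := h.exists_realizes
  have he : ∀ n (v : Polynomial k × Polynomial k), mulLeft (𝐓 (-s)) (emb (n + s) v) = emb n v := by
    intro n v
    have : n + s + -s = n := by ring
    ext1 <;> simp only [mulLeft, LinearMap.coe_mk, AddHom.coe_mk, emb] <;>
      rw [mul_left_comm, ← LaurentPolynomial.T_add, add_comm, this]
  have hF : ∀ n, stringSet ε d₁ d₂ (n + s) = stringSet ε (d₁ + 3 * s) (d₂ + 3 * s) n := by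
    intro n
    ext v
    rw [mem_stringSet, mem_stringSet, show 3 * (n + s) + d₁ = 3 * n + (d₁ + 3 * s) by ring,
      show 3 * (n + s) + d₂ = 3 * n + (d₂ + 3 * s) by ring]
  have hinj : Function.Injective ((mulLeft (𝐓 (-s))).comp Φ) := by
    intro x y hxy
    apply hΦ.injective
    have h0 := (LaurentPolynomial.isUnit_T (R := Polynomial k) (-s))
    exact Prod.ext (h0.mul_left_cancel (congrArg Prod.fst hxy))
      (h0.mul_left_cancel (congrArg Prod.snd hxy))
  have hreal : Realizes (fun n => 𝓜 (n + s)) ((mulLeft (𝐓 (-s))).comp Φ)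
      (stringSet ε (d₁ + 3 * s) (d₂ + 3 * s)) := by
    refine ⟨hinj, fun n x hx => ?_, fun n v hv => ?_⟩
    · obtain ⟨v, hv, e⟩ := hΦ.map_mem _ x hx
      exact ⟨v, hF n ▸ hv, by rw [LinearMap.comp_apply, e, he]⟩
    · obtain ⟨x, hx, e⟩ := hΦ.exists_of_mem _ v ((hF n).symm ▸ hv)
      exact ⟨x, hx, by rw [LinearMap.comp_apply, e, he]⟩
  refine ⟨⟨fun d n r x hr hx => ?_, isInternal_of_graded_injective hinj
    (fun n x hx => (hreal.map_mem n x hx).imp fun v hv => hv.2) fun x => ?_⟩, _, hreal⟩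
  · have := h.graded.smul_mem d (n + s) r x hr hx
    rwa [← add_assoc] at this
  · have := mem_iSup_of_isInternal h.graded.isInternal x
    rwa [← (Equiv.addRight s).iSup_comp] at this

/-- The strings with five generators are cokernels of listed matrices. -/
lemma IsString.exists_isListedOrTranspose (h : IsString 𝓜 ε d₁ d₂) [Module.Finite (Cone k) M]
    (hk : (2 : k) ≠ 0) (hε : ε = 1 ∨ ε = -1)
    (h5 : (⊤ : Submodule (Cone k) M).spanFinrank = 5) :
    ∃ A : DegMatrix k, IsListedOrTranspose A ∧ IsIsoUpToShift k 𝓜 A.cokerGrading := by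
  have hε' : -ε = 1 ∨ -ε = -1 := by
    rcases hε with rfl | rfl
    · exact .inr rfl
    · exact .inl (neg_neg 1)
  -- Exchanging the coordinates replaces ε by -ε, so the larger bound may be put first.
  wlog hd : d₂ ≤ d₁ generalizing ε d₁ d₂
  · exact this h.swap hε' (by rwa [neg_neg]) (by omega)
  -- A shift of the grading changes both bounds by the same multiple of 3. What remains is the
  -- residue i of d₁, the residue j of d₂ and the offset e.
  obtain ⟨s, i, hi, rfl⟩ : ∃ s i, (i = 0 ∨ i = 1 ∨ i = 2) ∧ d₁ = i + 3 * s :=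
    ⟨d₁ / 3, d₁ % 3, by omega, by omega⟩
  obtain ⟨e, j, hj, rfl⟩ : ∃ e j, (j = 0 ∨ j = 1 ∨ j = 2) ∧ d₂ = j - 3 * e + 3 * s :=
    ⟨s - d₂ / 3, d₂ % 3, by omega, by omega⟩
  have hs := h.shift (-s)
  rw [show i + 3 * s + 3 * -s = i by ring, show j - 3 * e + 3 * s + 3 * -s = j - 3 * e by ring] at hs
  have h4 : (j = 0 ∨ j = 1) → 1 ≤ i → False := by
    intro hj' hi'
    have := hs.spanFinrank_le_four hk hε (c := i - 1) (j := j) (e := e) (by omega) hj' (by omega)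
      (by omega) rfl
    omega
  have h6 : i = 0 → j = 2 → False := by
    rintro rfl rfl
    have := hs.six_le_spanFinrank (e := e) (by omega) rfl
    omega
  have listed : ∀ {A : DegMatrix k} {d₁' d₂' s' : ℤ}, IsListedOrTranspose A →
      IsString A.cokerGrading ε d₁' d₂' → i + 3 * s = d₁' + 3 * s' →
      j - 3 * e + 3 * s = d₂' + 3 * s' →
      ∃ A : DegMatrix k, IsListedOrTranspose A ∧ IsIsoUpToShift k 𝓜 A.cokerGrading :=
    fun hA hA' h₁ h₂ => ⟨_, hA, h.isIsoUpToShift hA' _ h₁ h₂⟩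
  rcases hi with rfl | rfl | rfl
  · rcases hj with rfl | rfl | rfl
    -- For the residues (0, 0) the offset e corresponds to the ψ-matrix of index e + 1, because its
    -- string has d₂ = -3(m-1).
    · obtain ⟨m, rfl⟩ := Int.eq_ofNat_of_zero_le (show 0 ≤ e by omega)
      exact listed (.inl (isListed_psiMat hε (Nat.le_add_left 1 m)))
        (psi_isString hk hε (Nat.le_add_left 1 m)) rfl (by push_cast; ring)
    · obtain ⟨m, rfl⟩ := Int.eq_ofNat_of_zero_le (show 0 ≤ e by omega)
      have hm : 1 ≤ m := by omega
      exact listed (.inl (isListed_phiMat hε hm)) (phi_isString hk hε hm) rfl (by ring)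
    · exact (h6 rfl rfl).elim
  · rcases hj with rfl | rfl | rfl
    · exact (h4 (by norm_num) le_rfl).elim
    · exact (h4 (by norm_num) le_rfl).elim
    · obtain ⟨m, rfl⟩ := Int.eq_ofNat_of_zero_le (show 0 ≤ e by omega)
      have hm : 1 ≤ m := by omega
      -- The dual strings have 8 as their first bound and a larger second one. Swapping puts the
      -- larger one first and turns -ε into ε; the bound 8 then accounts for the residue 2 of d₂.
      have := (phi_transpose_isString hk hε' hm).swap
      rw [neg_neg] at this
      exact listed (s' := s - m - 2) (.inr ⟨_, isListed_phiMat hε' hm, rfl⟩) this (by ring) (by ring)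
  · rcases hj with rfl | rfl | rfl
    · exact (h4 (by norm_num) (by norm_num)).elim
    · exact (h4 (by norm_num) (by norm_num)).elim
    · obtain ⟨m, rfl⟩ := Int.eq_ofNat_of_zero_le (show 0 ≤ e by omega)
      have := (psi_transpose_isString hk hε' (Nat.le_add_left 1 m)).swap
      rw [neg_neg] at this
      exact listed (s' := s - m - 2) (.inr ⟨_, isListed_psiMat hε' (Nat.le_add_left 1 m), rfl⟩) this
        (by push_cast; ring) (by ring)

end

end

section

/-! ### Graded maximal Cohen-Macaulay modules are torsion-free -/

section

variable {M : Type v} [AddCommGroup M] [Module (Cone k) M] {𝓜 : ℤ → AddSubgroup M}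

lemma exists_sum_of_mem_irrelevant {r : Cone k} (hr : r ∈ irrelevant k) :
    ∃ c : Fin 3 → Cone k, r = ∑ i, c i * toCone k (X i) := by
  obtain ⟨c, hc⟩ := (Ideal.mem_span_range_iff_exists_fun).1 hr
  exact ⟨c, hc.symm⟩

lemma IsMCM.exists_pair (h : IsMCM k M) : ∃ a b : Cone k, a ∈ irrelevant k ∧ b ∈ irrelevant k ∧
    (∀ x : M, a • x = 0 → x = 0) ∧ ∀ x y : M, b • x = a • y → ∃ z, x = a • z := by
  obtain ⟨-, rs, hrs, hreg, hlen⟩ := h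
  rw [ringKrullDim_cone] at hlen
  have hlen : rs.length = 2 := by exact_mod_cast hlen
  obtain ⟨a, b, rfl⟩ := List.length_eq_two.1 hlen
  have := (isWeaklyRegular_pair_iff a b).1 hreg.toIsWeaklyRegular
  exact ⟨a, b, hrs a (by simp), hrs b (by simp), this.1, this.2⟩

/-- The depth condition: compatible triples are divisible by the coordinates. -/
lemma IsMCM.exists_of_compatible (h : IsMCM k M) (v : Fin 3 → M)
    (hv : ∀ i j, toCone k (X i) • v j = toCone k (X j) • v i) :
    ∃ x, ∀ i, v i = toCone k (X i) • x := by
  obtain ⟨a, b, ha, hb, h1, h2⟩ := h.exists_pair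
  obtain ⟨c, rfl⟩ := exists_sum_of_mem_irrelevant ha
  obtain ⟨d, rfl⟩ := exists_sum_of_mem_irrelevant hb
  have key : ∀ (c : Fin 3 → Cone k) j,
      toCone k (X j) • ∑ i, c i • v i = (∑ i, c i * toCone k (X i)) • v j := by
    intro c j
    rw [Finset.smul_sum, Finset.sum_smul]
    refine Finset.sum_congr rfl fun i _ => ?_
    rw [mul_smul, hv i j, smul_comm]
  -- With a = Σ cᵢyᵢ and u = Σ cᵢvᵢ, compatibility gives yⱼu = a vⱼ, and bu is a multiple of a.
  -- Regularity of the pair gives u = az, and cancelling a leaves vⱼ = yⱼz.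
  obtain ⟨z, hz⟩ := h2 (∑ i, c i • v i) (∑ i, d i • v i) (by
    rw [Finset.sum_smul, Finset.smul_sum]
    refine Finset.sum_congr rfl fun i _ => ?_
    rw [mul_smul, key, smul_comm])
  refine ⟨z, fun j => sub_eq_zero.1 (h1 _ ?_)⟩
  rw [smul_sub, ← key, hz, smul_comm, sub_self]

lemma eq_zero_of_mem_coneDeg_neg {d : ℤ} (hd : d < 0) {r : Cone k} (hr : r ∈ coneDeg k d) :
    r = 0 := by
  obtain ⟨p, hp, e⟩ := toParam_of_mem_coneDeg hr
  rw [← toParam_eq_zero, e, eq_zero_of_mem_polyLE_neg hp.1 (by omega)]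
  simp

/-- Finitely generated graded modules vanish in small degrees. -/
lemma IsGradedModule.exists_bound (hg : IsGradedModule (k := k) 𝓜) [Module.Finite (Cone k) M] :
    ∃ N : ℤ, ∀ n < N, ∀ x ∈ 𝓜 n, x = 0 := by
  classical
  have hsmul : ∀ (N : ℤ) (r : Cone k) (x : M), (∀ n < N, comp hg.isInternal n x = 0) →
      ∀ n < N, comp hg.isInternal n (r • x) = 0 := by
    intro N r x hx n hn
    have hr := mem_iSup_coneDeg r
    induction hr using AddSubgroup.iSup_induction' with
    | hp d r hr =>
      rw [comp_smul' hg hr]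
      by_cases hd : d < 0
      · rw [eq_zero_of_mem_coneDeg_neg hd hr]
        exact zero_smul (Cone k) (comp hg.isInternal (n - d) x)
      · rw [hx _ (by omega), smul_zero]
    | h1 =>
      have h0 : (0 : Cone k) • x = 0 := zero_smul (Cone k) x
      exact (congrArg _ h0).trans (map_zero _)
    | hadd r s _ _ hr hs => rw [add_smul, map_add, hr, hs, add_zero]
  let P : ℤ → Submodule (Cone k) M := fun N =>
    { carrier := {x | ∀ n < N, comp hg.isInternal n x = 0}
      add_mem' := fun hx hy n hn => by rw [map_add, hx n hn, hy n hn, add_zero]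
      zero_mem' := fun n _ => map_zero _
      smul_mem' := hsmul N }
  have hP : ∀ s : Finset M, ∃ N, ∀ x ∈ s, x ∈ P N := by
    intro s
    induction s using Finset.induction_on with
    | empty => exact ⟨0, by simp⟩
    | insert x s _ ih =>
      obtain ⟨N, hN⟩ := ih
      obtain ⟨t, -, ht⟩ := exists_sum_comp hg.isInternal x
      obtain ⟨N', hN'⟩ := t.bddBelow
      refine ⟨min N N', fun y hy n hn => ?_⟩
      rcases Finset.mem_insert.1 hy with rfl | hy
      · refine ht n fun hnt => ?_
        have := hN' hnt
        omega
      · exact hN y hy n (by omega)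
  obtain ⟨s, hs⟩ := (Module.Finite.fg_top (R := Cone k) (M := M))
  obtain ⟨N, hN⟩ := hP s
  have htop : (⊤ : Submodule (Cone k) M) ≤ P N := by
    rw [← hs, Submodule.span_le]
    exact hN
  refine ⟨N, fun n hn x hx => ?_⟩
  rw [← comp_of_mem hg.isInternal hx]
  exact htop (show x ∈ ⊤ from trivial) n hn

lemma X_pow_three_smul (x : M) : toCone k (X 0) ^ 3 • x = toCone k (X 2) •
    (toCone k (X 1) ^ 2 - toCone k (X 0) ^ 2) • x := by
  rw [smul_smul, toCone_X0_pow_three]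
  congr 1
  ring

/-- If y₁ and y₃ kill a homogeneous x, then (0, x, 0) is a compatible triple, so x = y₂z where z has
lower degree and is killed in the same way; degrees are bounded below, hence x = 0. If only y₃ kills
x, so does y₁³, which is a multiple of y₃, and y₁²x, y₁x, x vanish in turn. -/
lemma IsGradedMCM.X2_smul_eq_zero (h : IsGradedMCM k 𝓜) {x : M} (hx : toCone k (X 2) • x = 0) :
    x = 0 := by
  have hg := h.1
  have : Module.Finite (Cone k) M := h.2.1
  obtain ⟨N, hN⟩ := hg.exists_bound
  have key : ∀ n (m : ℕ), n < N + m → ∀ x ∈ 𝓜 n, toCone k (X 2) • x = 0 →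
      toCone k (X 0) • x = 0 → x = 0 := by
    intro n m
    induction m generalizing n with
    | zero => intro hn x hx _ _; exact hN n (by simpa using hn) x hx
    | succ m ih =>
      intro hn x hx h2 h0
      obtain ⟨z, hz⟩ := h.2.exists_of_compatible ![0, x, 0] (by
        intro i j
        fin_cases i <;> fin_cases j <;> simp [h2, h0])
      have z0 : toCone k (X 0) • z = 0 := (hz 0).symm
      have z1 : toCone k (X 1) • z = x := (hz 1).symm
      have z2 : toCone k (X 2) • z = 0 := (hz 2).symm
      have hc : ∀ i, toCone k (X i) • comp hg.isInternal (n - 1) z =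
          comp hg.isInternal n (toCone k (X i) • z) := fun i => (comp_smul' hg (X_mem_coneDeg i) n z).symm
      have := ih (n - 1) (by push_cast at hn; omega) _ (comp_mem hg.isInternal (n - 1) z)
        (by rw [hc, z2, map_zero]) (by rw [hc, z0, map_zero])
      rw [← comp_of_mem hg.isInternal hx, ← z1, ← hc, this, smul_zero]
  have key2 : ∀ n, ∀ x ∈ 𝓜 n, toCone k (X 2) • x = 0 → toCone k (X 0) • x = 0 → x = 0 := by
    intro n
    exact key n (n - N + 1).toNat (by omega)
  have key3 : ∀ x : M, toCone k (X 2) • x = 0 → toCone k (X 0) • x = 0 → x = 0 := by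
    intro x h2 h0
    refine eq_zero_of_comp hg.isInternal fun n => key2 n _ (comp_mem _ n x) ?_ ?_
    · rw [← comp_smul hg (X_mem_coneDeg 2), h2, map_zero]
    · rw [← comp_smul hg (X_mem_coneDeg 0), h0, map_zero]
  have hy : ∀ r : Cone k, toCone k (X 2) • r • x = 0 := fun r => by rw [smul_comm, hx, smul_zero]
  refine key3 x hx (key3 _ (hy _) (key3 _ (by rw [smul_smul (toCone k (X 0))]; exact hy _) ?_))
  have := X_pow_three_smul (k := k) x
  rw [hy, pow_succ, pow_two, mul_smul, mul_smul] at this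
  exact this

/-- If y₁x is also divisible by y₃, the two quotients and x form a compatible triple, and x is
divisible by y₃. Since y₁³ is a multiple of y₃, this applies in turn to y₁²x, y₁x and x. -/
lemma IsGradedMCM.exists_of_X1_smul (h : IsGradedMCM k 𝓜) {x y : M}
    (hxy : toCone k (X 1) • x = toCone k (X 2) • y) : ∃ z, x = toCone k (X 2) • z := by
  have key : ∀ x y y' : M, toCone k (X 1) • x = toCone k (X 2) • y →
      toCone k (X 0) • x = toCone k (X 2) • y' → ∃ z, x = toCone k (X 2) • z := by
    intro x y y' h1 h0
    have hyy : toCone k (X 0) • y = toCone k (X 1) • y' := by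
      refine sub_eq_zero.1 (h.X2_smul_eq_zero ?_)
      rw [smul_sub, smul_comm _ (toCone k (X 0)), ← h1, smul_comm _ (toCone k (X 1)) y',
        ← h0, smul_comm, sub_self]
    obtain ⟨z, hz⟩ := h.2.exists_of_compatible ![y', y, x] (by
      intro i j
      fin_cases i <;> fin_cases j <;> simp [h1, h0, hyy])
    exact ⟨z, hz 2⟩
  have key' : ∀ (r : Cone k), toCone k (X 1) • r • x = toCone k (X 2) • r • y := fun r => by
    rw [smul_comm, hxy, smul_comm]
  obtain ⟨z, hz⟩ := key _ _ ((toCone k (X 1) ^ 2 - toCone k (X 0) ^ 2) • x) (key' (toCone k (X 0) ^ 2))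
    (by rw [← X_pow_three_smul, smul_smul, ← pow_succ'])
  obtain ⟨z, hz⟩ := key _ _ z (key' (toCone k (X 0))) (by rw [← hz, smul_smul, ← pow_two])
  exact key _ _ z hxy hz

lemma IsGradedMCM.exists_of_X1_pow_smul (h : IsGradedMCM k 𝓜) (e : ℕ) {x y : M}
    (hxy : toCone k (X 1) ^ e • x = toCone k (X 2) • y) : ∃ z, x = toCone k (X 2) • z := by
  induction e generalizing y with
  | zero => exact ⟨y, by simpa using hxy⟩
  | succ e ih =>
    rw [pow_succ', mul_smul] at hxy
    obtain ⟨z, hz⟩ := h.exists_of_X1_smul hxy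
    exact ih hz

/-- The form of degree `e` in `y₂, y₃` with the coefficients of `Q`. -/
def form (Q : Polynomial k) (e : ℕ) : Cone k :=
  ∑ i ∈ Finset.range (e + 1), toCone k (C (Q.coeff i)) * (toCone k (X 1) ^ i * toCone k (X 2) ^ (e - i))

lemma form_succ (Q : Polynomial k) (e : ℕ) : form Q (e + 1) =
    toCone k (C (Q.coeff (e + 1))) * toCone k (X 1) ^ (e + 1) + toCone k (X 2) * form Q e := by
  rw [form, Finset.sum_range_succ, add_comm, form, Finset.mul_sum, Nat.sub_self, pow_zero, mul_one]
  congr 1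
  refine Finset.sum_congr rfl fun i hi => ?_
  rw [Nat.succ_sub (by have := Finset.mem_range.1 hi; omega), pow_succ]
  ring

lemma toParam_form (Q : Polynomial k) {e : ℕ} (he : Q.natDegree ≤ e) :
    toParam k (form Q e) = 𝐂 (Q.comp (𝕥 * zz k)) * 𝐓 e := by
  rw [Polynomial.comp, Polynomial.eval₂_eq_sum_range' _ (Nat.lt_succ_of_le he), form, map_sum, map_sum,
    Finset.sum_mul]
  refine Finset.sum_congr rfl fun i hi => ?_
  have hi : i ≤ e := by have := Finset.mem_range.1 hi; omega
  simp only [map_mul, map_pow, toParam_toCone, polyParam_C, polyParam_X1, polyParam_X2, mul_pow,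
    LaurentPolynomial.T_pow, mul_one]
  have : (e : ℤ) = i + (e - i : ℕ) := by omega
  rw [this, LaurentPolynomial.T_add]
  ring

lemma C_smul_cancel {c : k} (hc : c ≠ 0) {x y : M} (h : toCone k (C c) • x = y) :
    x = toCone k (C c⁻¹) • y := by
  rw [← h, smul_smul, ← map_mul, ← map_mul, inv_mul_cancel₀ hc, map_one, map_one, one_smul]

/-- If the coefficient of y₂^e vanishes, a factor y₃ can be cancelled. Otherwise y₂^e x is divisible
by y₃, hence so is x, and x = y₃z with z of lower degree killed by the same form; the descent stops
because degrees are bounded below. -/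
lemma IsGradedMCM.eq_zero_of_form_smul (h : IsGradedMCM k 𝓜) {Q : Polynomial k} (hQ : Q ≠ 0) {e : ℕ}
    (he : Q.natDegree ≤ e) {n : ℤ} {x : M} (hx : x ∈ 𝓜 n) (h0 : form Q e • x = 0) : x = 0 := by
  have hg := h.1
  have : Module.Finite (Cone k) M := h.2.1
  obtain ⟨N, hN⟩ := hg.exists_bound
  induction e with
  | zero =>
    rw [form, Finset.sum_range_one, pow_zero, pow_zero, mul_one, mul_one] at h0
    have hc : Q.coeff 0 ≠ 0 := fun hc => hQ (by
      rw [Polynomial.eq_C_of_natDegree_le_zero he, hc, map_zero])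
    rw [C_smul_cancel hc h0, smul_zero]
  | succ e ih =>
    by_cases hc : Q.coeff (e + 1) = 0
    · rw [form_succ, hc, map_zero, map_zero, zero_mul, zero_add, mul_smul] at h0
      refine ih ?_ (h.X2_smul_eq_zero h0)
      by_contra! hd
      have : Q.natDegree = e + 1 := by omega
      rw [← this] at hc
      exact hQ (Polynomial.leadingCoeff_eq_zero.1 hc)
    · have key : ∀ (m : ℕ) n, n < N + m → ∀ x ∈ 𝓜 n, form Q (e + 1) • x = 0 → x = 0 := by
        intro m
        induction m with
        | zero => intro n hn x hx _; exact hN n (by simpa using hn) x hx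
        | succ m ihm =>
          intro n hn x hx hx0
          have h1 := hx0
          rw [form_succ, add_smul, mul_smul, mul_smul, add_eq_zero_iff_eq_neg] at h1
          have h2 := C_smul_cancel hc h1
          rw [smul_neg, smul_comm, ← smul_neg] at h2
          obtain ⟨z, hz⟩ := h.exists_of_X1_pow_smul _ h2
          have hzc : x = toCone k (X 2) • comp hg.isInternal (n - 1) z := by
            rw [← comp_smul' hg (X_mem_coneDeg 2), ← hz, comp_of_mem _ hx]
          have := ihm (n - 1) (by push_cast at hn; omega) _ (comp_mem hg.isInternal (n - 1) z)
            (h.X2_smul_eq_zero (by rw [smul_comm, ← hzc, hx0]))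
          rw [hzc, this, smul_zero]
      exact key (n - N + 1).toNat n (by omega) x hx h0

/-- Every nonzero polynomial divides a nonzero polynomial in `t (t² - 1)`. -/
lemma exists_comp_eq_mul {p : Polynomial k} (hp : p ≠ 0) :
    ∃ Q u : Polynomial k, Q ≠ 0 ∧ Q.comp (𝕥 * zz k) = p * u := by
  -- The class of t(t²-1) in the finite-dimensional algebra k[t]/(p) is algebraic over k, and its
  -- minimal polynomial is the required Q.
  have : Module.Finite k (AdjoinRoot p) :=
    (AdjoinRoot.powerBasis hp).finite
  have hi : IsIntegral k (AdjoinRoot.mk p (𝕥 * zz k)) := Algebra.IsIntegral.isIntegral _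
  refine ⟨minpoly k (AdjoinRoot.mk p (𝕥 * zz k)), ?_⟩
  have h1 := minpoly.aeval k (AdjoinRoot.mk p (𝕥 * zz k))
  have h2 : AdjoinRoot.mk p ((minpoly k (AdjoinRoot.mk p (𝕥 * zz k))).comp (𝕥 * zz k)) = 0 := by
    rw [← h1, Polynomial.comp, Polynomial.aeval_def, Polynomial.hom_eval₂]
    rfl
  obtain ⟨u, hu⟩ := AdjoinRoot.mk_eq_zero.1 h2
  exact ⟨u, minpoly.ne_zero hi, hu⟩

/-- A suitable nonzero multiple of r is a form in y₂ and y₃ alone, and such forms are already known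
to act injectively on homogeneous elements. -/
lemma IsGradedMCM.eq_zero_of_smul (h : IsGradedMCM k 𝓜) (hk : (2 : k) ≠ 0) {d : ℤ} {r : Cone k}
    (hr : r ∈ coneDeg k d) (hr0 : r ≠ 0) {x : M} (hx : r • x = 0) : x = 0 := by
  have hg := h.1
  obtain ⟨p, hp, er⟩ := toParam_of_mem_coneDeg hr
  have hp0 : p ≠ 0 := by
    rintro rfl
    exact hr0 (toParam_eq_zero.1 (by rw [er]; simp))
  have hd : 0 ≤ d := by
    by_contra! hd
    exact hr0 (eq_zero_of_mem_coneDeg_neg hd hr)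
  obtain ⟨Q, u, hQ, e⟩ := exists_comp_eq_mul hp0
  let E : ℕ := (𝕥 * zz k * u).natDegree + (Q * 𝕥).natDegree
  -- The extra factor t(t²-1) makes the cofactor vanish at 1 and -1, so that it belongs to the cone;
  -- it is why the form below is built from Q·t instead of Q.
  obtain ⟨s, hs, es⟩ := exists_coneDeg_of_mem_nodeLE hk (p := 𝕥 * zz k * u) (d := E)
    ⟨mem_polyLE_of_natDegree_le (by omega), by simp⟩
  have hform : form (Q * 𝕥) (d + E).toNat = s * r := by
    apply toParam_injective
    have e1 : ((d + E).toNat : ℤ) = E + d := by omega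
    rw [toParam_form _ (by omega), map_mul, es, er, Polynomial.mul_comp, e, Polynomial.X_comp, e1,
      LaurentPolynomial.T_add]
    simp only [map_mul]
    ring
  refine eq_zero_of_comp hg.isInternal fun n => h.eq_zero_of_form_smul
    (mul_ne_zero hQ Polynomial.X_ne_zero) (e := (d + E).toNat) (by omega) (comp_mem _ n x) ?_
  rw [hform, mul_smul, ← comp_smul hg hr, hx, map_zero, smul_zero]

end

end

section

/-! ### Embedding of graded modules of rank two -/

section

variable {M : Type v} [AddCommGroup M] [Module (Cone k) M] {𝓜 : ℤ → AddSubgroup M}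

lemma comp_smul_of_mem (hg : IsGradedModule (k := k) 𝓜) {m : ℤ} {x : M} (hx : x ∈ 𝓜 m) (n : ℤ)
    (r : Cone k) : comp hg.isInternal n (r • x) = comp coneDeg_isInternal (n - m) r • x := by
  have hr := mem_iSup_coneDeg r
  induction hr using AddSubgroup.iSup_induction' with
  | hp d r hr =>
    rw [comp_smul' hg hr]
    by_cases h : d = n - m
    · subst h
      rw [comp_of_mem coneDeg_isInternal hr, sub_sub_cancel, comp_of_mem _ hx]
    · rw [comp_of_mem_ne _ hx (by omega), comp_of_mem_ne _ hr h, smul_zero]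
      exact (zero_smul (Cone k) x).symm
  | h1 =>
    have h0 : (0 : Cone k) • x = 0 := zero_smul (Cone k) x
    refine (congrArg _ h0).trans ?_
    rw [map_zero, map_zero]
    exact h0.symm
  | hadd r s _ _ hr hs => rw [add_smul, map_add, map_add, hr, hs, add_smul]

lemma exists_comp_ne_zero (h : DirectSum.IsInternal 𝓜) {x : M} (hx : x ≠ 0) :
    ∃ n, comp h n x ≠ 0 := by
  by_contra! h0
  exact hx (eq_zero_of_comp h h0)

variable {n : ℕ} {w : Fin n → M}

lemma isHomogeneousSubmodule_span (hw : ∀ i, ∃ m, w i ∈ 𝓜 m) :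
    IsHomogeneousSubmodule 𝓜 (Submodule.span (Cone k) (Set.range w)) := by
  apply le_antisymm
  · refine Submodule.span_mono ?_
    rintro _ ⟨i, rfl⟩
    exact ⟨Submodule.subset_span ⟨i, rfl⟩, hw i⟩
  · exact Submodule.span_le.2 fun x hx => hx.1

/-- `x` has a nonzero homogeneous multiple in the span of `w`. -/
def IsDependent (w : Fin n → M) (x : M) : Prop :=
  ∃ d, ∃ r ∈ coneDeg k d, r ≠ 0 ∧ r • x ∈ Submodule.span (Cone k) (Set.range w)

lemma IsDependent.add {x y : M} (hx : IsDependent (k := k) w x) (hy : IsDependent (k := k) w y) :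
    IsDependent (k := k) w (x + y) := by
  obtain ⟨d, r, hr, hr0, hrx⟩ := hx
  obtain ⟨e, s, hs, hs0, hsy⟩ := hy
  refine ⟨_, r * s, mul_mem_coneDeg hr hs, mul_ne_zero hr0 hs0, ?_⟩
  rw [smul_add]
  refine add_mem ?_ ?_
  · rw [mul_comm, mul_smul]
    exact Submodule.smul_mem _ _ hrx
  · rw [mul_smul]
    exact Submodule.smul_mem _ _ hsy

lemma isDependent_zero : IsDependent (k := k) w 0 :=
  ⟨0, 1, one_mem_coneDeg, one_ne_zero, by rw [smul_zero]; exact zero_mem _⟩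

lemma isDependent_of_homogeneous (hg : IsGradedModule (k := k) 𝓜)
    (h : ∀ m, ∀ x ∈ 𝓜 m, IsDependent (k := k) w x) (x : M) : IsDependent (k := k) w x := by
  have hx := mem_iSup_of_isInternal hg.isInternal x
  induction hx using AddSubgroup.iSup_induction' with
  | hp m x hx => exact h m x hx
  | h1 => exact isDependent_zero
  | hadd x y _ _ hx hy => exact hx.add hy

/-- In a relation cx + y = 0 with y in the homogeneous span of w, each homogeneous component of c
carries x into the span; a nonzero one would make x dependent. -/
lemma linearIndependent_cons (hg : IsGradedModule (k := k) 𝓜) (hw : ∀ i, ∃ m, w i ∈ 𝓜 m)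
    (hli : LinearIndependent (Cone k) w) {m : ℤ} {x : M} (hx : x ∈ 𝓜 m)
    (hdep : ¬ IsDependent (k := k) w x) : LinearIndependent (Cone k) (Fin.cons x w : Fin (n + 1) → M) := by
  refine hli.finCons' _ _ ?_
  intro c y hy hcy
  by_contra hc
  obtain ⟨d, hd⟩ := exists_comp_ne_zero coneDeg_isInternal hc
  refine hdep ⟨d, _, comp_mem coneDeg_isInternal d c, hd, ?_⟩
  have h1 := congrArg (comp hg.isInternal (d + m)) hcy
  rw [map_add, comp_smul_of_mem hg hx, add_sub_cancel_right, map_zero, add_eq_zero_iff_eq_neg] at h1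
  rw [h1]
  exact neg_mem ((isHomogeneousSubmodule_span hw).comp_mem hg _ hy)

lemma exists_linearIndependent_cons (hg : IsGradedModule (k := k) 𝓜) [Module.Finite (Cone k) M]
    (hw : ∀ i, ∃ m, w i ∈ 𝓜 m) (hli : LinearIndependent (Cone k) w)
    (hn : Module.finrank (Cone k) M ≠ n) : ∃ m, ∃ x ∈ 𝓜 m,
      LinearIndependent (Cone k) (Fin.cons x w : Fin (n + 1) → M) := by
  by_contra! h
  refine hn (finrank_eq_of_linearIndependent w hli fun x => ?_)
  obtain ⟨d, r, -, hr⟩ := isDependent_of_homogeneous hg (w := w) (fun m x hx => by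
    by_contra hdep
    exact h m x hx (linearIndependent_cons hg hw hli hx hdep)) x
  exact ⟨r, hr⟩

lemma isDependent_of_finrank (hg : IsGradedModule (k := k) 𝓜) [Module.Finite (Cone k) M]
    (hw : ∀ i, ∃ m, w i ∈ 𝓜 m) (hli : LinearIndependent (Cone k) w)
    (hn : Module.finrank (Cone k) M = n) (x : M) : IsDependent (k := k) w x := by
  refine isDependent_of_homogeneous hg (fun m x hx => ?_) x
  by_contra hdep
  have := (linearIndependent_cons hg hw hli hx hdep).fintype_card_le_finrank
  rw [Fintype.card_fin] at this
  omega

lemma exists_common_multiple [Module.Finite (Cone k) M] (h : ∀ x, IsDependent (k := k) w x) :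
    ∃ d, ∃ r ∈ coneDeg k d, r ≠ 0 ∧ ∀ x, r • x ∈ Submodule.span (Cone k) (Set.range w) := by
  classical
  have key : ∀ s : Finset M, ∃ d, ∃ r ∈ coneDeg k d, r ≠ 0 ∧
      ∀ x ∈ s, r • x ∈ Submodule.span (Cone k) (Set.range w) := by
    intro s
    induction s using Finset.induction_on with
    | empty => exact ⟨0, 1, one_mem_coneDeg, one_ne_zero, by simp⟩
    | insert x s _ ih =>
      obtain ⟨d, r, hr, hr0, hrs⟩ := ih
      obtain ⟨e, s, hs, hs0, hsx⟩ := h x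
      refine ⟨_, r * s, mul_mem_coneDeg hr hs, mul_ne_zero hr0 hs0, fun y hy => ?_⟩
      rcases Finset.mem_insert.1 hy with rfl | hy
      · rw [mul_smul]
        exact Submodule.smul_mem _ _ hsx
      · rw [mul_comm, mul_smul]
        exact Submodule.smul_mem _ _ (hrs y hy)
  obtain ⟨s, hs⟩ := (Module.Finite.fg_top (R := Cone k) (M := M))
  obtain ⟨d, r, hr, hr0, hrs⟩ := key s
  refine ⟨d, r, hr, hr0, fun x => ?_⟩
  have hx : x ∈ Submodule.span (Cone k) (s : Set M) := by rw [hs]; trivial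
  have : Submodule.span (Cone k) (s : Set M) ≤
      (Submodule.span (Cone k) (Set.range w)).comap (LinearMap.lsmul (Cone k) M r) :=
    Submodule.span_le.2 hrs
  exact this hx

lemma exists_realizes_of_graded (hg : IsGradedModule (k := k) 𝓜) {Φ : M →ₗ[Cone k] Param k × Param k}
    (hΦ : Function.Injective Φ) (hmap : ∀ n, ∀ x ∈ 𝓜 n, ∃ v, Φ x = emb n v) :
    ∃ F : ℤ → Submodule k (Polynomial k × Polynomial k), Realizes 𝓜 Φ F := by
  refine ⟨fun n =>
    { carrier := {v | ∃ x ∈ 𝓜 n, Φ x = emb n v}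
      add_mem' := ?_
      zero_mem' := ⟨0, zero_mem _, by simp⟩
      smul_mem' := ?_ }, hΦ, ?_, ?_⟩
  · rintro v w ⟨x, hx, ex⟩ ⟨y, hy, ey⟩
    exact ⟨x + y, add_mem hx hy, by rw [map_add, ex, ey, emb_add]⟩
  · rintro c v ⟨x, hx, ex⟩
    refine ⟨toCone k (C c) • x, ?_, ?_⟩
    · have := hg.smul_mem 0 n _ x (C_mem_coneDeg c) hx
      rwa [zero_add] at this
    · rw [map_smul, ex, smul_emb (p := Polynomial.C c) (d := 0) (by simp), zero_add]
      congr 1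
      ext1 <;> simp [Polynomial.smul_eq_C_mul]
  · intro n x hx
    obtain ⟨v, e⟩ := hmap n x hx
    exact ⟨v, ⟨x, hx, e⟩, e⟩
  · rintro n v ⟨x, hx, e⟩
    exact ⟨x, hx, e⟩

/-- This is the depth condition in terms of F: the three vectors are y₁, y₂, y₃ times a would-be
element v of degree n, and they form a compatible triple, so that element exists. -/
lemma Realizes.mem_of_mul_mem {Φ : M →ₗ[Cone k] Param k × Param k}
    {F : ℤ → Submodule k (Polynomial k × Polynomial k)} (h : Realizes 𝓜 Φ F)
    (hM : IsGradedMCM k 𝓜) {n : ℤ} {v : Polynomial k × Polynomial k} (h₂ : v ∈ F (n + 1))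
    (h₀ : zz k • v ∈ F (n + 1)) (h₁ : (𝕥 * zz k) • v ∈ F (n + 1)) : v ∈ F n := by
  have hg := hM.1
  obtain ⟨x₀, hx₀, e₀⟩ := h.exists_of_mem _ _ h₀
  obtain ⟨x₁, hx₁, e₁⟩ := h.exists_of_mem _ _ h₁
  obtain ⟨x₂, hx₂, e₂⟩ := h.exists_of_mem _ _ h₂
  have t0 : toParam k (toCone k (X 0)) = 𝐂 (zz k) * 𝐓 1 := by simp
  have t1 : toParam k (toCone k (X 1)) = 𝐂 (𝕥 * zz k) * 𝐓 1 := by simp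
  have t2 : toParam k (toCone k (X 2)) = 𝐂 1 * 𝐓 1 := by simp
  obtain ⟨x, hx⟩ := hM.2.exists_of_compatible ![x₀, x₁, x₂] (by
    intro i j
    apply h.injective
    rw [map_smul, map_smul]
    fin_cases i <;> fin_cases j <;>
      simp only [Fin.zero_eta, Fin.mk_one, Fin.reduceFinMk, Matrix.cons_val, e₀, e₁, e₂, smul_emb t0,
        smul_emb t1, smul_emb t2, smul_smul, one_mul] <;> ring_nf)
  have e : x₂ = toCone k (X 2) • comp hg.isInternal n x := by
    have := congrArg (comp hg.isInternal (n + 1)) (hx 2)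
    rw [comp_smul' hg (X_mem_coneDeg 2), add_sub_cancel_right] at this
    rw [← this]
    exact (comp_of_mem _ hx₂).symm
  obtain ⟨u, hu, eu⟩ := h.map_mem n _ (comp_mem hg.isInternal n x)
  rw [e, map_smul, eu, smul_emb t2, one_smul, add_comm] at e₂
  rwa [← emb_injective _ e₂]

/-- The properties of the family of spaces of vectors that realizes a graded maximal Cohen-Macaulay
module of rank two. -/
structure IsLattice (F : ℤ → Submodule k (Polynomial k × Polynomial k)) (D : ℤ) : Prop where
  smul_mem : ∀ {d n : ℤ} {p : Polynomial k} {v}, p ∈ nodeLE k d → v ∈ F n → p • v ∈ F (d + n)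
  mem_of_mul_mem : ∀ {n v}, v ∈ F (n + 1) → zz k • v ∈ F (n + 1) → (𝕥 * zz k) • v ∈ F (n + 1) → v ∈ F n
  bound : ∀ {n v}, v ∈ F n → v.1 ∈ polyLE k (3 * n + D) ∧ v.2 ∈ polyLE k (3 * n + D)
  exists_fst : ∃ n g, g ≠ 0 ∧ (g, 0) ∈ F n
  exists_snd : ∃ n g, g ≠ 0 ∧ (0, g) ∈ F n

/-- Choose independent homogeneous w₀, w₁ and a homogeneous r ≠ 0 with rM in their span. The
coordinates of rx are an embedding because M is torsion-free. -/
lemma IsGradedMCM.exists_isLattice (hM : IsGradedMCM k 𝓜) (hk : (2 : k) ≠ 0)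
    (hrank : Module.finrank (Cone k) M = 2) :
    ∃ (Φ : M →ₗ[Cone k] Param k × Param k) (F : ℤ → Submodule k (Polynomial k × Polynomial k)) (D : ℤ),
      Realizes 𝓜 Φ F ∧ IsLattice F D := by
  have hg := hM.1
  have : Module.Finite (Cone k) M := hM.2.1
  obtain ⟨m₁, w₁, hw₁, hli₁⟩ := exists_linearIndependent_cons (w := (![] : Fin 0 → M)) hg
    (fun i => i.elim0) linearIndependent_empty_type (by omega)
  obtain ⟨m₀, w₀, hw₀, hli⟩ := exists_linearIndependent_cons hg (w := Fin.cons w₁ ![])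
    (fun i => ⟨m₁, by fin_cases i; exact hw₁⟩) hli₁ (by omega)
  replace hli : LinearIndependent (Cone k) ![w₀, w₁] := hli
  set w : Fin 2 → M := ![w₀, w₁] with hw
  let m : Fin 2 → ℤ := ![m₀, m₁]
  have hwm : ∀ i, w i ∈ 𝓜 (m i) := by
    intro i
    fin_cases i
    exacts [hw₀, hw₁]
  obtain ⟨d, r, hr, hr0, hspan⟩ := exists_common_multiple (w := w)
    (isDependent_of_finrank hg (fun i => ⟨_, hwm i⟩) hli hrank)
  let c : M →ₗ[Cone k] (Fin 2 →₀ Cone k) :=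
    hli.repr.comp ((LinearMap.lsmul (Cone k) M r).codRestrict _ hspan)
  have hc : ∀ x, r • x = ∑ i, c x i • w i := by
    intro x
    have := hli.linearCombination_repr ⟨r • x, hspan x⟩
    rw [Finsupp.linearCombination_apply, Finsupp.sum_fintype _ _ fun i => zero_smul (Cone k) (w i)] at this
    exact this.symm
  have hc' : ∀ x (a : Fin 2 → Cone k), r • x = ∑ i, a i • w i → ∀ i, c x i = a i := by
    intro x a ha i
    have h1 : ∑ i, (c x i - a i) • w i = 0 := by
      simp_rw [sub_smul]
      rw [Finset.sum_sub_distrib, ← hc, ← ha, sub_self]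
    exact sub_eq_zero.1 (Fintype.linearIndependent_iff.1 hli _ h1 i)
  have hcw : ∀ i j, j ≠ i → c (w i) j = 0 := by
    intro i j hji
    rw [hc' (w i) (Pi.single i r) ?_ j, Pi.single_eq_of_ne hji]
    rw [Finset.sum_eq_single i, Pi.single_eq_same]
    · intro l _ hl
      rw [Pi.single_eq_of_ne hl]
      exact zero_smul (Cone k) (w l)
    · simp
  have hcdeg : ∀ n, ∀ x ∈ 𝓜 n, ∀ i, c x i ∈ coneDeg k (d + n - m i) := by
    intro n x hx i
    rw [hc' x (fun i => comp coneDeg_isInternal (d + n - m i) (c x i)) ?_ i]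
    · exact comp_mem _ _ _
    · rw [← comp_of_mem hg.isInternal (hg.smul_mem d n r x hr hx), hc, map_sum]
      exact Finset.sum_congr rfl fun i _ => comp_smul_of_mem hg (hwm i) _ _
  -- The twists by T compensate for the degrees of r and of the wᵢ, so that an element of degree n
  -- gets coordinates that are multiples of T^n.
  let Φ : M →ₗ[Cone k] Param k × Param k :=
    { toFun := fun x => (toParam k (c x 0) * 𝐓 (m 0 - d), toParam k (c x 1) * 𝐓 (m 1 - d))
      map_add' := fun x y => by simp [add_mul]
      map_smul' := fun s x => by simp [cone_smul_def, mul_assoc] }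
  have hΦ : ∀ x, Φ x = (toParam k (c x 0) * 𝐓 (m 0 - d), toParam k (c x 1) * 𝐓 (m 1 - d)) :=
    fun x => rfl
  have hT : ∀ e : ℤ, IsUnit (𝐓 e : Param k) := fun e => LaurentPolynomial.isUnit_T e
  have hinj : Function.Injective Φ := by
    rw [injective_iff_map_eq_zero]
    intro x hx
    rw [hΦ, Prod.mk_eq_zero, (hT _).mul_left_eq_zero, (hT _).mul_left_eq_zero, toParam_eq_zero,
      toParam_eq_zero] at hx
    refine hM.eq_zero_of_smul hk hr hr0 ?_
    rw [hc]
    refine Finset.sum_eq_zero fun i _ => ?_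
    have : c x i = 0 := by
      fin_cases i
      exacts [hx.1, hx.2]
    rw [this]
    exact zero_smul (Cone k) (w i)
  have hmap : ∀ n, ∀ x ∈ 𝓜 n, ∃ v : Polynomial k × Polynomial k, (v.1 ∈ nodeLE k (d + n - m 0) ∧
      v.2 ∈ nodeLE k (d + n - m 1)) ∧ Φ x = emb n v := by
    intro n x hx
    obtain ⟨p, hp, ep⟩ := toParam_of_mem_coneDeg (hcdeg n x hx 0)
    obtain ⟨q, hq, eq⟩ := toParam_of_mem_coneDeg (hcdeg n x hx 1)
    refine ⟨(p, q), ⟨hp, hq⟩, ?_⟩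
    rw [hΦ, ep, eq, mul_assoc, mul_assoc, ← LaurentPolynomial.T_add, ← LaurentPolynomial.T_add, emb]
    congr 3 <;> ring
  obtain ⟨F, hF⟩ := exists_realizes_of_graded hg hinj fun n x hx => (hmap n x hx).imp fun v hv => hv.2
  refine ⟨Φ, F, max (3 * (d - m 0)) (3 * (d - m 1)), hF, fun hp hv => hF.smul_mem hk hg hp hv,
    fun h1 h2 h3 => hF.mem_of_mul_mem hM h1 h2 h3, ?_, ?_, ?_⟩
  · intro n v hv
    obtain ⟨x, hx, e⟩ := hF.exists_of_mem n v hv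
    obtain ⟨u, hu, e'⟩ := hmap n x hx
    obtain rfl := emb_injective _ (e'.symm.trans e)
    exact ⟨polyLE_mono (by omega) hu.1.1, polyLE_mono (by omega) hu.2.1⟩
  · obtain ⟨v, hv, e⟩ := hF.map_mem _ _ (hwm 0)
    have h1 : c (w 0) 1 = 0 := hcw 0 1 (by decide)
    have h2 : v.2 = 0 := by
      rw [← cf_emb (m 0) v, ← e, hΦ, h1]
      simp [cf]
    refine ⟨m 0, v.1, fun h0 => hli.ne_zero 0 (hinj ?_), ?_⟩
    · rw [e, map_zero, Prod.ext (x := v) (y := 0) h0 h2, emb_zero]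
    · convert hv using 2
      exact h2.symm
  · obtain ⟨v, hv, e⟩ := hF.map_mem _ _ (hwm 1)
    have h1 : c (w 1) 0 = 0 := hcw 1 0 (by decide)
    have h2 : v.1 = 0 := by
      rw [← cf_emb (m 1) v, ← e, hΦ, h1]
      simp [cf]
    refine ⟨m 1, v.2, fun h0 => hli.ne_zero 1 (hinj ?_), ?_⟩
    · rw [e, map_zero, Prod.ext (x := v) (y := 0) h2 h0, emb_zero]
    · convert hv using 2
      exact h2.symm

end

end

section

/-! ### Splitting of filtered lattices -/

lemma C_smul_eq (c : k) (x : Polynomial k × Polynomial k) : Polynomial.C c • x = c • x := by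
  ext1 <;> simp [Polynomial.smul_eq_C_mul]

/-- The properties of the spaces of sections of the twists of a vector bundle of rank two on the
projective line, as subspaces of the pairs of polynomials. -/
structure IsBundle (U : ℤ → Submodule k (Polynomial k × Polynomial k)) (D : ℤ) : Prop where
  mono : ∀ {j x}, x ∈ U j → x ∈ U (j + 1)
  X_smul : ∀ {j x}, x ∈ U j → (𝕥 : Polynomial k) • x ∈ U (j + 1)
  mem_of_X_smul : ∀ {j x}, x ∈ U (j + 1) → (𝕥 : Polynomial k) • x ∈ U (j + 1) → x ∈ U j
  bound : ∀ {j x}, x ∈ U j → x.1 ∈ polyLE k (j + D) ∧ x.2 ∈ polyLE k (j + D)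
  exists_fst : ∃ j g, g ≠ 0 ∧ (g, 0) ∈ U j
  exists_snd : ∃ j g, g ≠ 0 ∧ (0, g) ∈ U j

section

variable {U : ℤ → Submodule k (Polynomial k × Polynomial k)} {D : ℤ}

lemma IsBundle.mono' (h : IsBundle U D) {i j : ℤ} (hij : i ≤ j) {x} (hx : x ∈ U i) : x ∈ U j := by
  obtain ⟨n, rfl⟩ := Int.le.dest hij
  induction n with
  | zero => simpa using hx
  | succ n ih =>
    have := h.mono (ih (by omega))
    rwa [add_assoc] at this

lemma IsBundle.X_pow_smul (h : IsBundle U D) (n : ℕ) {j : ℤ} {x} (hx : x ∈ U j) :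
    (𝕥 ^ n : Polynomial k) • x ∈ U (j + n) := by
  induction n with
  | zero => simpa using hx
  | succ n ih =>
    have := h.X_smul ih
    rwa [smul_smul, ← pow_succ', add_assoc] at this

lemma IsBundle.smul_mem (h : IsBundle U D) {a j : ℤ} {x} (hx : x ∈ U a) {p : Polynomial k}
    (hp : p ∈ polyLE k (j - a)) : p • x ∈ U j := by
  rw [p.as_sum_range_C_mul_X_pow, Finset.sum_smul]
  refine Submodule.sum_mem _ fun i _ => ?_
  by_cases hi : j - a < i
  · rw [hp i hi, map_zero, zero_mul, zero_smul]
    exact zero_mem _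
  · rw [mul_smul, C_smul_eq]
    exact Submodule.smul_mem _ _ (h.mono' (by omega) (h.X_pow_smul i hx))

lemma IsBundle.mem_of_X_pow_smul (h : IsBundle U D) (n : ℕ) {j : ℤ} {x} (hx : x ∈ U j)
    (hx' : (𝕥 ^ n : Polynomial k) • x ∈ U (j + n - 1)) : x ∈ U (j - 1) := by
  induction n with
  | zero => simpa using hx'
  | succ n ih =>
    have e : j + n - 1 + 1 = j + n := by ring
    refine ih (h.mem_of_X_smul ?_ ?_)
    · rw [e]
      exact h.X_pow_smul n hx
    · rw [e, smul_smul, ← pow_succ']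
      convert hx' using 2
      push_cast
      ring

lemma exists_eq_top_add {d : ℤ} (hd : 0 ≤ d) {q : Polynomial k} (hq : q ∈ polyLE k d) :
    ∃ c, ∃ r ∈ polyLE k (d - 1), q = Polynomial.C c * 𝕥 ^ d.toNat + r := by
  refine ⟨q.coeff d.toNat, q - Polynomial.C (q.coeff d.toNat) * 𝕥 ^ d.toNat, fun i hi => ?_, by ring⟩
  rw [Polynomial.coeff_sub, Polynomial.coeff_C_mul_X_pow]
  split_ifs with h
  · rw [h, sub_self]
  · rw [hq i (by omega), sub_zero]

lemma C_mul_X_pow_mem_iff {d : ℤ} (hd : 0 ≤ d) {c : k} {r : Polynomial k}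
    (h : Polynomial.C c * 𝕥 ^ d.toNat + r ∈ polyLE k (d - 1)) (hr : r ∈ polyLE k (d - 1)) : c = 0 := by
  have := h d.toNat (by omega)
  rwa [Polynomial.coeff_add, hr d.toNat (by omega), add_zero, Polynomial.coeff_C_mul_X_pow,
    if_pos rfl] at this

/-- Vector bundles of rank two on the projective line split. -/
theorem IsBundle.exists_splitting (h : IsBundle U D) :
    ∃ (e₁ e₂ : Polynomial k × Polynomial k) (a₁ a₂ : ℤ), e₁.1 * e₂.2 - e₁.2 * e₂.1 ≠ 0 ∧
      ∀ j x, x ∈ U j ↔ ∃ p₁ ∈ polyLE k (j - a₁), ∃ p₂ ∈ polyLE k (j - a₂), x = p₁ • e₁ + p₂ • e₂ := by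
  obtain ⟨j₁, g₁, hg₁, hm₁⟩ := h.exists_fst
  obtain ⟨j₂, g₂, hg₂, hm₂⟩ := h.exists_snd
  -- e₁ is a nonzero section of the least possible degree; the degree bounds make that minimum
  -- exist.
  obtain ⟨a₁, ⟨e₁, he₁, he₁0⟩, hmin₁⟩ := Int.exists_least_of_bdd (P := fun j => ∃ x ∈ U j, x ≠ 0)
    ⟨-D, fun j ⟨x, hx, hx0⟩ => by
      by_contra! hj
      exact hx0 (Prod.ext (eq_zero_of_mem_polyLE_neg (h.bound hx).1 (by omega))
        (eq_zero_of_mem_polyLE_neg (h.bound hx).2 (by omega)))⟩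
    ⟨j₁, _, hm₁, fun h0 => hg₁ (congrArg Prod.fst h0)⟩
  -- e₂ is a section of least degree that is not an admissible multiple of e₁. One exists, since
  -- otherwise (g₁, 0) and (0, g₂) would both be multiples of e₁.
  obtain ⟨a₂, ⟨e₂, he₂, he₂0⟩, hmin₂⟩ := Int.exists_least_of_bdd
    (P := fun j => ∃ x ∈ U j, ∀ p ∈ polyLE k (j - a₁), x ≠ p • e₁)
    ⟨a₁, fun j ⟨x, hx, hx0⟩ => hmin₁ j ⟨x, hx, fun h0 => hx0 0 (zero_mem _) (by rw [h0, zero_smul])⟩⟩ (by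
      by_contra! hcon
      obtain ⟨p, -, ep⟩ := hcon j₁ _ hm₁
      obtain ⟨q, -, eq⟩ := hcon j₂ _ hm₂
      have hp0 : p ≠ 0 := by
        rintro rfl
        exact hg₁ (by simpa using congrArg Prod.fst ep)
      have hq0 : q ≠ 0 := by
        rintro rfl
        exact hg₂ (by simpa using congrArg Prod.snd eq)
      have h1 := congrArg Prod.snd ep
      have h2 := congrArg Prod.fst eq
      simp only [Prod.smul_fst, Prod.smul_snd, smul_eq_mul, zero_eq_mul, hp0, hq0, false_or] at h1 h2
      exact he₁0 (Prod.ext h2 h1))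
  have line : ∀ j < a₂, ∀ x ∈ U j, ∃ p ∈ polyLE k (j - a₁), x = p • e₁ := by
    intro j hj x hx
    by_contra! hcon
    have := hmin₂ j ⟨x, hx, hcon⟩
    omega
  have ha : a₁ ≤ a₂ := hmin₁ a₂ ⟨e₂, he₂, fun h0 => he₂0 0 (zero_mem _) (by rw [h0, zero_smul])⟩
  -- There is no cancellation at infinity. If a combination drops one degree, so does c₁t^(a₂-a₁)e₁
  -- + c₂e₂, formed from the top coefficients; it lies below degree a₂, hence is a multiple of e₁,
  -- and minimality forces c₂ = 0 and then c₁ = 0.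
  have step : ∀ N q₁ q₂, q₁ ∈ polyLE k (N - a₁) → q₂ ∈ polyLE k (N - a₂) →
      q₁ • e₁ + q₂ • e₂ ∈ U (N - 1) → q₁ ∈ polyLE k (N - 1 - a₁) ∧ q₂ ∈ polyLE k (N - 1 - a₂) := by
    intro N q₁ q₂ h₁ h₂ hU
    have hsub : ∀ a : ℤ, N - 1 - a = N - a - 1 := fun a => by ring
    by_cases hN : N < a₂
    · have hq : q₂ = 0 := eq_zero_of_mem_polyLE_neg h₂ (by omega)
      subst hq
      refine ⟨?_, zero_mem _⟩
      obtain ⟨p, hp, e⟩ := line _ (by omega) _ hU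
      rw [zero_smul, add_zero] at e
      rwa [smul_left_injective _ he₁0 e]
    · obtain ⟨c₁, r₁, hr₁, rfl⟩ := exists_eq_top_add (by omega) h₁
      obtain ⟨c₂, r₂, hr₂, rfl⟩ := exists_eq_top_add (by omega) h₂
      have hy : (Polynomial.C c₁ * 𝕥 ^ (a₂ - a₁).toNat) • e₁ + Polynomial.C c₂ • e₂ ∈ U a₂ :=
        add_mem (h.smul_mem he₁ (C_mul_mem_polyLE _ (X_pow_mem_polyLE _ (by omega))))
          (h.smul_mem he₂ (C_mem_polyLE _ (by omega)))
      have hy' := h.mem_of_X_pow_smul (N - a₂).toNat hy (by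
        have e1 : a₂ + ((N - a₂).toNat : ℤ) - 1 = N - 1 := by omega
        have e2 : (N - a₁).toNat = (N - a₂).toNat + (a₂ - a₁).toNat := by omega
        rw [e1]
        have := sub_mem (sub_mem hU (h.smul_mem (j := N - 1) he₁ (by rwa [hsub])))
          (h.smul_mem (j := N - 1) he₂ (by rwa [hsub]) : r₂ • e₂ ∈ _)
        convert this using 1
        rw [e2, pow_add]
        ext1 <;> simp <;> ring)
      obtain ⟨p, hp, e⟩ := line _ (by omega) _ hy'
      have hc₂ : c₂ = 0 := by
        by_contra hc
        refine he₂0 (Polynomial.C c₂⁻¹ * (p - Polynomial.C c₁ * 𝕥 ^ (a₂ - a₁).toNat))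
          (C_mul_mem_polyLE _ (sub_mem (polyLE_mono (by omega) hp)
            (C_mul_mem_polyLE _ (X_pow_mem_polyLE _ (by omega))))) ?_
        rw [mul_smul, sub_smul, ← e, add_sub_cancel_left, smul_smul, ← map_mul, inv_mul_cancel₀ hc,
          map_one, one_smul]
      subst hc₂
      rw [map_zero, zero_smul, add_zero] at e
      have hc₁ : c₁ = 0 := C_mul_X_pow_mem_iff (d := a₂ - a₁) (r := 0) (by omega) (by
        rw [add_zero, smul_left_injective _ he₁0 e]
        exact polyLE_mono (by omega) hp) (zero_mem _)
      subst hc₁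
      simpa [hsub] using ⟨hr₁, hr₂⟩
  have coords : ∀ j q₁ q₂, q₁ • e₁ + q₂ • e₂ ∈ U j →
      q₁ ∈ polyLE k (j - a₁) ∧ q₂ ∈ polyLE k (j - a₂) := by
    intro j q₁ q₂ hU
    have key : ∀ n : ℕ, q₁ ∈ polyLE k (j + n - a₁) → q₂ ∈ polyLE k (j + n - a₂) →
        q₁ ∈ polyLE k (j - a₁) ∧ q₂ ∈ polyLE k (j - a₂) := by
      intro n
      induction n with
      | zero =>
        intro h1 h2
        rw [Nat.cast_zero, add_zero] at h1 h2
        exact ⟨h1, h2⟩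
      | succ n ih =>
        intro h1 h2
        have e : j + (n + 1 : ℕ) - 1 = j + n := by push_cast; ring
        have := step _ _ _ h1 h2 (h.mono' (by omega) hU)
        rw [e] at this
        exact ih this.1 this.2
    exact key (q₁.natDegree + q₂.natDegree + (a₁ - j).toNat + (a₂ - j).toNat)
      (mem_polyLE_of_natDegree_le (by push_cast; omega))
      (mem_polyLE_of_natDegree_le (by push_cast; omega))
  have indep : ∀ q₁ q₂ : Polynomial k, q₁ • e₁ + q₂ • e₂ = 0 → q₁ = 0 ∧ q₂ = 0 := by
    intro q₁ q₂ h0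
    have h1 := coords (a₁ - 1) q₁ q₂ (by rw [h0]; exact zero_mem _)
    exact ⟨eq_zero_of_mem_polyLE_neg h1.1 (by omega), eq_zero_of_mem_polyLE_neg h1.2 (by omega)⟩
  have hdet : e₁.1 * e₂.2 - e₁.2 * e₂.1 ≠ 0 := by
    intro h0
    have h1 := indep e₂.1 (-e₁.1) (Prod.ext (by simp; ring) (by simp; linear_combination -h0))
    have h2 := indep e₂.2 (-e₁.2) (Prod.ext (by simp; linear_combination h0) (by simp; ring))
    exact he₁0 (Prod.ext (neg_eq_zero.1 h1.2) (neg_eq_zero.1 h2.2))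
  refine ⟨e₁, e₂, a₁, a₂, hdet, fun j x => ⟨fun hx => ?_, ?_⟩⟩
  · set δ := e₁.1 * e₂.2 - e₁.2 * e₂.1 with hδ
    have key : ∀ (n : ℕ) j, j < a₂ + n → ∀ x ∈ U j, ∃ p₁ ∈ polyLE k (j - a₁),
        ∃ p₂ ∈ polyLE k (j - a₂), x = p₁ • e₁ + p₂ • e₂ := by
      intro n
      induction n with
      | zero =>
        intro j hj x hx
        obtain ⟨p, hp, rfl⟩ := line j (by simpa using hj) x hx
        exact ⟨p, hp, 0, zero_mem _, by rw [zero_smul, add_zero]⟩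
      | succ n ih =>
        intro j hj x hx
        by_cases hj' : j < a₂
        · exact ih j (by omega) x hx
        -- Cramer's rule: δx is a polynomial combination of e₁ and e₂.
        have hcr : δ • x = (x.1 * e₂.2 - x.2 * e₂.1) • e₁ + (e₁.1 * x.2 - e₁.2 * x.1) • e₂ := by
          ext1 <;> simp [hδ] <;> ring
        have hδx : δ • x ∈ U (j + δ.natDegree) :=
          h.smul_mem hx (by rw [add_sub_cancel_left]; exact mem_polyLE_natDegree _)
        obtain ⟨h1, h2⟩ := coords _ _ _ (hcr ▸ hδx)
        obtain ⟨c₁, r₁, hr₁, e1⟩ := exists_eq_top_add (by omega) h1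
        obtain ⟨c₂, r₂, hr₂, e2⟩ := exists_eq_top_add (by omega) h2
        obtain ⟨c, r, hr, e⟩ := exists_eq_top_add (by omega) (mem_polyLE_natDegree δ)
        rw [Int.toNat_natCast] at e
        have hc : c ≠ 0 := by
          rintro rfl
          rw [map_zero, zero_mul, zero_add] at e
          rw [← e, mem_polyLE_iff_natDegree hdet] at hr
          omega
        -- The division by δ is performed at infinity only. Subtracting from cx the combination with
        -- the leading coefficients of Cramer's rule leaves a vector whose product with t^(deg δ)
        -- drops one degree, so it lies in U (j - 1) and the induction applies.
        have hy : Polynomial.C c • x - (Polynomial.C c₁ * 𝕥 ^ (j - a₁).toNat) • e₁ -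
            (Polynomial.C c₂ * 𝕥 ^ (j - a₂).toNat) • e₂ ∈ U j :=
          sub_mem (sub_mem (h.smul_mem hx (C_mem_polyLE _ (by omega)))
            (h.smul_mem he₁ (C_mul_mem_polyLE _ (X_pow_mem_polyLE _ (by omega)))))
            (h.smul_mem he₂ (C_mul_mem_polyLE _ (X_pow_mem_polyLE _ (by omega))))
        have hy' := h.mem_of_X_pow_smul δ.natDegree hy (by
          have e3 : (j + δ.natDegree - a₁).toNat = δ.natDegree + (j - a₁).toNat := by omega
          have e4 : (j + δ.natDegree - a₂).toNat = δ.natDegree + (j - a₂).toNat := by omega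
          rw [e1, e2, e3, e4] at hcr
          have := sub_mem (add_mem (h.smul_mem (j := j + δ.natDegree - 1) he₁ (p := r₁)
            (polyLE_mono (by omega) hr₁)) (h.smul_mem (j := j + δ.natDegree - 1) he₂ (p := r₂)
            (polyLE_mono (by omega) hr₂))) (h.smul_mem (j := j + δ.natDegree - 1) hx (p := r)
            (polyLE_mono (by omega) hr))
          convert this using 1
          have hcr' : (Polynomial.C c * 𝕥 ^ δ.natDegree + r) • x = _ := (congrArg (· • x) e.symm).trans hcr
          have f1 := congrArg Prod.fst hcr'
          have f2 := congrArg Prod.snd hcr'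
          simp only [Prod.smul_fst, Prod.smul_snd, Prod.fst_add, Prod.snd_add, smul_eq_mul] at f1 f2
          ext1
          · simp only [Prod.smul_fst, Prod.fst_add, Prod.fst_sub, smul_eq_mul]
            linear_combination f1
          · simp only [Prod.smul_snd, Prod.snd_add, Prod.snd_sub, smul_eq_mul]
            linear_combination f2)
        obtain ⟨p₁, hp₁, p₂, hp₂, ey⟩ := ih (j - 1) (by push_cast at hj; omega) _ hy'
        refine ⟨Polynomial.C c⁻¹ * (p₁ + Polynomial.C c₁ * 𝕥 ^ (j - a₁).toNat),
          C_mul_mem_polyLE _ (add_mem (polyLE_mono (by omega) hp₁)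
            (C_mul_mem_polyLE _ (X_pow_mem_polyLE _ (by omega)))),
          Polynomial.C c⁻¹ * (p₂ + Polynomial.C c₂ * 𝕥 ^ (j - a₂).toNat),
          C_mul_mem_polyLE _ (add_mem (polyLE_mono (by omega) hp₂)
            (C_mul_mem_polyLE _ (X_pow_mem_polyLE _ (by omega)))), ?_⟩
        have hcc : Polynomial.C c⁻¹ * Polynomial.C c = 1 := by
          rw [← map_mul, inv_mul_cancel₀ hc, map_one]
        have hx1 : x = Polynomial.C c⁻¹ • Polynomial.C c • x := by rw [smul_smul, hcc, one_smul]
        have hx2 : Polynomial.C c • x = (p₁ + Polynomial.C c₁ * 𝕥 ^ (j - a₁).toNat) • e₁ +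
            (p₂ + Polynomial.C c₂ * 𝕥 ^ (j - a₂).toNat) • e₂ := by
          rw [sub_sub, sub_eq_iff_eq_add] at ey
          rw [ey, add_smul, add_smul]
          abel
        rw [mul_smul, mul_smul, ← smul_add, ← hx2]
        exact hx1
    exact key (j - a₂ + 1).toNat j (by omega) x hx
  · rintro ⟨p₁, hp₁, p₂, hp₂, rfl⟩
    exact add_mem (h.smul_mem he₁ hp₁) (h.smul_mem he₂ hp₂)

end

end

section

variable {M : Type v} [AddCommGroup M] [Module (Cone k) M] {𝓜 : ℤ → AddSubgroup M}
  {Φ : M →ₗ[Cone k] Param k × Param k} {F : ℤ → Submodule k (Polynomial k × Polynomial k)}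

/-! ### Change of coordinates -/

/-- The vector with the coordinates `p` with respect to `e₁` and `e₂`. -/
def colMap (e₁ e₂ : Polynomial k × Polynomial k) :
    Polynomial k × Polynomial k →ₗ[Polynomial k] Polynomial k × Polynomial k where
  toFun p := p.1 • e₁ + p.2 • e₂
  map_add' p q := by simp only [Prod.fst_add, Prod.snd_add, add_smul]; abel
  map_smul' c p := by simp [mul_smul]

lemma colMap_apply (e₁ e₂ p : Polynomial k × Polynomial k) : colMap e₁ e₂ p = p.1 • e₁ + p.2 • e₂ := rfl

/-- `colMap` with Laurent polynomials as coordinates. -/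
def paramMap (e₁ e₂ : Polynomial k × Polynomial k) : Param k × Param k →ₗ[Cone k] Param k × Param k where
  toFun y := (𝐂 e₁.1 * y.1 + 𝐂 e₂.1 * y.2, 𝐂 e₁.2 * y.1 + 𝐂 e₂.2 * y.2)
  map_add' x y := by ext1 <;> simp only [Prod.fst_add, Prod.snd_add] <;> ring
  map_smul' r x := by
    ext1 <;> simp only [Prod.smul_fst, Prod.smul_snd, cone_smul_def, RingHom.id_apply] <;> ring

lemma paramMap_emb (e₁ e₂ : Polynomial k × Polynomial k) (n : ℤ) (v : Polynomial k × Polynomial k) :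
    paramMap e₁ e₂ (emb n v) = emb n (colMap e₁ e₂ v) := by
  ext1 <;> simp only [paramMap, emb, colMap, LinearMap.coe_mk, AddHom.coe_mk, Prod.fst_add, Prod.snd_add,
    Prod.smul_fst, Prod.smul_snd, smul_eq_mul, map_add, map_mul] <;> ring

lemma paramMap_injective {e₁ e₂ : Polynomial k × Polynomial k} (h : e₁.1 * e₂.2 - e₁.2 * e₂.1 ≠ 0) :
    Function.Injective (paramMap e₁ e₂) := by
  rw [injective_iff_map_eq_zero]
  intro y hy
  have h1 : 𝐂 e₁.1 * y.1 + 𝐂 e₂.1 * y.2 = 0 := congrArg Prod.fst hy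
  have h2 : 𝐂 e₁.2 * y.1 + 𝐂 e₂.2 * y.2 = 0 := congrArg Prod.snd hy
  have hd : 𝐂 (e₁.1 * e₂.2 - e₁.2 * e₂.1) ≠ 0 := by
    simpa using C_mul_T_ne_zero h 0
  have e : 𝐂 (e₁.1 * e₂.2 - e₁.2 * e₂.1) = 𝐂 e₁.1 * 𝐂 e₂.2 - 𝐂 e₁.2 * 𝐂 e₂.1 := by simp
  rw [e] at hd
  refine Prod.ext (mul_left_cancel₀ hd ?_) (mul_left_cancel₀ hd ?_)
  · rw [Prod.fst_zero, mul_zero]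
    linear_combination 𝐂 e₂.2 * h1 - 𝐂 e₂.1 * h2
  · rw [Prod.snd_zero, mul_zero]
    linear_combination 𝐂 e₁.1 * h2 - 𝐂 e₁.2 * h1

lemma colMap_injective {e₁ e₂ : Polynomial k × Polynomial k} (h : e₁.1 * e₂.2 - e₁.2 * e₂.1 ≠ 0) :
    Function.Injective (colMap e₁ e₂) := fun v w hvw =>
  emb_injective 0 (paramMap_injective h (by rw [paramMap_emb, paramMap_emb, hvw]))

lemma emb_smul (s : Polynomial k) (n : ℤ) (v : Polynomial k × Polynomial k) :
    mulLeft (𝐂 s) (emb n v) = emb n (s • v) := by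
  ext1 <;> simp [mulLeft, emb, mul_assoc]

/-- The new realization is s·Φ written in the coordinates given by e₁ and e₂; the two hypotheses say
that these coordinates run exactly through F'. -/
lemma Realizes.change (h : Realizes 𝓜 Φ F) (hg : DirectSum.IsInternal 𝓜)
    {e₁ e₂ : Polynomial k × Polynomial k} (hdet : e₁.1 * e₂.2 - e₁.2 * e₂.1 ≠ 0) {s : Polynomial k}
    (hs : s ≠ 0) {F' : ℤ → Submodule k (Polynomial k × Polynomial k)}
    (h₁ : ∀ n, ∀ v ∈ F n, ∃ w ∈ F' n, s • v = colMap e₁ e₂ w)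
    (h₂ : ∀ n, ∀ w ∈ F' n, ∃ v ∈ F n, s • v = colMap e₁ e₂ w) :
    ∃ Φ' : M →ₗ[Cone k] Param k × Param k, Realizes 𝓜 Φ' F' := by
  set L := paramMap e₁ e₂
  have hL : Function.Injective L := paramMap_injective hdet
  set Ψ : M →ₗ[Cone k] Param k × Param k := (mulLeft (𝐂 s)).comp Φ with hΨ
  have hΨn : ∀ n, ∀ x ∈ 𝓜 n, ∃ w ∈ F' n, Ψ x = L (emb n w) := by
    intro n x hx
    obtain ⟨v, hv, e⟩ := h.map_mem n x hx
    obtain ⟨w, hw, e'⟩ := h₁ n v hv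
    exact ⟨w, hw, by rw [hΨ, LinearMap.comp_apply, e, emb_smul, e', paramMap_emb]⟩
  have hr : ∀ x, Ψ x ∈ LinearMap.range L := by
    intro x
    have hx := mem_iSup_of_isInternal hg x
    induction hx using AddSubgroup.iSup_induction' with
    | hp m x hx =>
      obtain ⟨w, -, e⟩ := hΨn m x hx
      exact ⟨_, e.symm⟩
    | h1 => rw [map_zero]; exact zero_mem _
    | hadd x y _ _ hx hy => rw [map_add]; exact add_mem hx hy
  let Φ' : M →ₗ[Cone k] Param k × Param k :=
    (LinearEquiv.ofInjective L hL).symm.toLinearMap.comp (Ψ.codRestrict (LinearMap.range L) hr)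
  have hΦ' : ∀ x, L (Φ' x) = Ψ x := fun x =>
    congrArg Subtype.val ((LinearEquiv.ofInjective L hL).apply_symm_apply ⟨Ψ x, hr x⟩)
  refine ⟨Φ', ?_, ?_, ?_⟩
  · rw [injective_iff_map_eq_zero]
    intro x hx
    have e : Ψ x = 0 := by rw [← hΦ', hx, map_zero]
    have hs' : 𝐂 s ≠ 0 := by simpa using C_mul_T_ne_zero hs 0
    refine h.injective (?_ : Φ x = Φ 0)
    rw [map_zero]
    exact Prod.ext ((mul_eq_zero.1 (congrArg Prod.fst e : 𝐂 s * (Φ x).1 = 0)).resolve_left hs')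
      ((mul_eq_zero.1 (congrArg Prod.snd e : 𝐂 s * (Φ x).2 = 0)).resolve_left hs')
  · intro n x hx
    obtain ⟨w, hw, e⟩ := hΨn n x hx
    exact ⟨w, hw, hL ((hΦ' x).trans e)⟩
  · intro n w hw
    obtain ⟨v, hv, e⟩ := h₂ n w hw
    obtain ⟨x, hx, e'⟩ := h.exists_of_mem n v hv
    refine ⟨x, hx, hL ?_⟩
    rw [hΦ', hΨ, LinearMap.comp_apply, e', emb_smul, e, paramMap_emb]

/-! ### The bundle in a lattice -/

/-- The sections of the largest family of vectors in `F` that is closed under multiplication by `t`. -/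
def core (F : ℤ → Submodule k (Polynomial k × Polynomial k)) (j : ℤ) :
    Submodule k (Polynomial k × Polynomial k) where
  carrier := {x | ∀ n, ∀ w ∈ polyLE k (3 * n - j), w • x ∈ F n}
  add_mem' hx hy n w hw := by rw [smul_add]; exact add_mem (hx n w hw) (hy n w hw)
  zero_mem' n w _ := by rw [smul_zero]; exact zero_mem _
  smul_mem' c x hx n w hw := by rw [smul_comm]; exact Submodule.smul_mem _ _ (hx n w hw)

section Lattice

variable {D : ℤ}

lemma IsLattice.mono (h : IsLattice F D) {n : ℤ} {v} (hv : v ∈ F n) : v ∈ F (n + 1) := by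
  have := h.smul_mem (d := 1) (p := 1) ⟨one_mem_polyLE (by omega), by simp⟩ hv
  rwa [one_smul, add_comm] at this

lemma mem_of_mem_core {n : ℤ} {x} (hx : x ∈ core F (3 * n)) : x ∈ F n := by
  have := hx n 1 (one_mem_polyLE (by omega))
  rwa [one_smul] at this

/-- Every multiple of t² - 1 has equal values at 1 and -1, so (t²-1)w is in the cone for any w of
suitable degree. The shift by 2 is the degree of t² - 1. -/
lemma IsLattice.zz_smul_mem_core (h : IsLattice F D) {n : ℤ} {v} (hv : v ∈ F n) :
    zz k • v ∈ core F (3 * n + 2) := by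
  intro m w hw
  have := h.smul_mem (d := m - n) (p := w * zz k)
    ⟨mul_mem_polyLE' hw (zz_mem_polyLE le_rfl) (by omega), by simp⟩ hv
  rwa [sub_add_cancel, mul_smul] at this

/-- Saturation at infinity is the point that needs depth. For a constant w, which occurs only when
3n = j, membership is lowered from degree n + 1 by the depth condition; for larger degrees w is
split as t w' + c. -/
lemma IsLattice.isBundle_core (h : IsLattice F D) : IsBundle (core F) (D + 2) where
  mono hx n w hw := hx n w (polyLE_mono (by omega) hw)
  X_smul hx n w hw := by
    rw [smul_smul]
    exact hx n _ (mul_mem_polyLE' hw (X_mem_polyLE le_rfl) (by omega))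
  mem_of_X_smul {j x} hx hx' n w hw := by
    rcases lt_trichotomy (3 * n - j) 0 with hn | hn | hn
    · rw [eq_zero_of_mem_polyLE_neg hw hn, zero_smul]
      exact zero_mem _
    · have : w = Polynomial.C (w.coeff 0) :=
        Polynomial.eq_C_of_natDegree_eq_zero (by
          by_cases hw0 : w = 0
          · simp [hw0]
          · rw [mem_polyLE_iff_natDegree hw0] at hw
            omega)
      rw [this, C_smul_eq]
      refine Submodule.smul_mem _ _ (h.mem_of_mul_mem ?_ ?_ ?_)
      · simpa using hx (n + 1) 1 (one_mem_polyLE (by omega))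
      · exact hx (n + 1) _ (zz_mem_polyLE (by omega))
      · rw [mul_comm, mul_smul]
        exact hx' (n + 1) _ (zz_mem_polyLE (by omega))
    · rw [← w.divX_mul_X_add, add_smul, mul_smul]
      refine add_mem (hx' n _ ?_) (hx n _ (C_mem_polyLE _ (by omega)))
      intro i hi
      rw [Polynomial.coeff_divX]
      exact hw _ (by push_cast; omega)
  bound {j x} hx := by
    have := hx ((j + 2) / 3) 1 (one_mem_polyLE (by omega))
    rw [one_smul] at this
    exact ⟨polyLE_mono (by omega) (h.bound this).1, polyLE_mono (by omega) (h.bound this).2⟩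
  exists_fst := by
    obtain ⟨n, g, hg, hm⟩ := h.exists_fst
    exact ⟨_, zz k * g, mul_ne_zero zz_ne_zero hg, by simpa using h.zz_smul_mem_core hm⟩
  exists_snd := by
    obtain ⟨n, g, hg, hm⟩ := h.exists_snd
    exact ⟨_, zz k * g, mul_ne_zero zz_ne_zero hg, by simpa using h.zz_smul_mem_core hm⟩

end Lattice

/-! ### Gluing data at the node -/

/-- The values of a pair of polynomials at `c`. -/
def evalPair (c : k) : Polynomial k × Polynomial k →ₗ[k] k × k :=
  (Polynomial.leval c).prodMap (Polynomial.leval c)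

@[simp] lemma evalPair_apply (c : k) (v : Polynomial k × Polynomial k) :
    evalPair c v = (v.1.eval c, v.2.eval c) := rfl

/-- The values of a pair of polynomials at the two points over the node. -/
def nodeVal (k : Type u) [Field k] : Polynomial k × Polynomial k →ₗ[k] (k × k) × (k × k) :=
  (evalPair 1).prod (evalPair (-1))

@[simp] lemma nodeVal_apply (v : Polynomial k × Polynomial k) :
    nodeVal k v = (evalPair 1 v, evalPair (-1) v) := rfl

/-- The pairs of polynomials of degrees at most `3 n + b₁` and `3 n + b₂` whose values at the points
over the node belong to `W`. -/
def gluedSet (W : Submodule k ((k × k) × (k × k))) (b₁ b₂ n : ℤ) :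
    Submodule k (Polynomial k × Polynomial k) :=
  (polyLE k (3 * n + b₁)).prod (polyLE k (3 * n + b₂)) ⊓ W.comap (nodeVal k)

lemma mem_gluedSet {W : Submodule k ((k × k) × (k × k))} {b₁ b₂ n : ℤ} {v} :
    v ∈ gluedSet W b₁ b₂ n ↔
      v.1 ∈ polyLE k (3 * n + b₁) ∧ v.2 ∈ polyLE k (3 * n + b₂) ∧ nodeVal k v ∈ W := by
  rw [gluedSet, Submodule.mem_inf, Submodule.mem_prod, and_assoc]
  rfl

lemma exists_eq_sub_C_mul {p : Polynomial k} {c : k} {d : ℤ} (hp : p ∈ polyLE k d) (h0 : p.eval c = 0) :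
    ∃ q ∈ polyLE k (d - 1), p = (𝕥 - Polynomial.C c) * q := by
  obtain ⟨q, rfl⟩ := Polynomial.dvd_iff_isRoot.2 h0
  refine ⟨q, mem_polyLE_of_mul_mem (e := 1) (Polynomial.X_sub_C_ne_zero c) (by simp) ?_, rfl⟩
  rwa [sub_add_cancel]

lemma zz_eq_mul {c : k} (hc : c = 1 ∨ c = -1) :
    zz k = (𝕥 - Polynomial.C c) * (𝕥 - Polynomial.C (-c)) := by
  rcases hc with rfl | rfl <;> simp [zz] <;> ring

lemma exists_eq_zz_mul (hk : (2 : k) ≠ 0) {p : Polynomial k} {d : ℤ} (hp : p ∈ polyLE k d)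
    (h1 : p.eval 1 = 0) (h2 : p.eval (-1) = 0) : ∃ q ∈ polyLE k (d - 2), p = zz k * q := by
  obtain ⟨w, e⟩ := exists_eq_add_zz_mul hk p (h1.trans h2.symm)
  rw [h1, map_zero, zero_add] at e
  refine ⟨w, mem_polyLE_of_mul_mem (e := 2) zz_ne_zero (by rw [natDegree_zz]; rfl) ?_, e⟩
  rwa [← e, sub_add_cancel]

/-- Expand (t²-1)x in the splitting basis of the core, and let W collect the values of the
coordinates at 1 and -1. Two coordinate vectors with equal values differ by t² - 1 times coordinates
of a core vector, so W and the degree bounds determine the module. The bounds 2 - aᵢ come from the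
degree of t² - 1. -/
theorem IsGradedMCM.exists_gluedSet (hM : IsGradedMCM k 𝓜) (hk : (2 : k) ≠ 0)
    (hrank : Module.finrank (Cone k) M = 2) :
    ∃ (W : Submodule k ((k × k) × (k × k))) (b₁ b₂ : ℤ) (Φ : M →ₗ[Cone k] Param k × Param k),
      Realizes 𝓜 Φ (gluedSet W b₁ b₂) ∧ (∀ w ∈ W, w.1 = 0 → w = 0) ∧ (∀ w ∈ W, w.2 = 0 → w = 0) := by
  obtain ⟨Φ, F, D, hΦ, hF⟩ := hM.exists_isLattice hk hrank
  have hU := hF.isBundle_core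
  obtain ⟨e₁, e₂, a₁, a₂, hdet, hsplit⟩ := hU.exists_splitting
  have hcore : ∀ {j} {p : Polynomial k × Polynomial k}, p.1 ∈ polyLE k (j - a₁) → p.2 ∈ polyLE k (j - a₂) →
      colMap e₁ e₂ p ∈ core F j := fun h1 h2 => (hsplit _ _).2 ⟨_, h1, _, h2, rfl⟩
  have hcore' : ∀ {j x}, x ∈ core F j → ∃ p : Polynomial k × Polynomial k, p.1 ∈ polyLE k (j - a₁) ∧
      p.2 ∈ polyLE k (j - a₂) ∧ x = colMap e₁ e₂ p := fun hx => by
    obtain ⟨p, hp, q, hq, e⟩ := (hsplit _ _).1 hx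
    exact ⟨(p, q), hp, hq, e⟩
  have hinj := colMap_injective hdet
  have hmono : ∀ {m n : ℤ} {v}, m ≤ n → v ∈ F m → v ∈ F n := by
    intro m n v hmn hv
    obtain ⟨i, rfl⟩ := Int.le.dest hmn
    induction i with
    | zero => simpa using hv
    | succ i ih =>
      have := hF.mono (ih (by omega))
      rwa [add_assoc] at this
  let W : Submodule k ((k × k) × (k × k)) :=
    { carrier := {w | ∃ n, ∃ x ∈ F n, ∃ p, zz k • x = colMap e₁ e₂ p ∧ nodeVal k p = w}
      add_mem' := by
        rintro _ _ ⟨n, x, hx, p, e, rfl⟩ ⟨m, y, hy, q, e', rfl⟩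
        exact ⟨max n m, x + y, add_mem (hmono (le_max_left _ _) hx) (hmono (le_max_right _ _) hy),
          p + q, by rw [smul_add, e, e', map_add], map_add _ _ _⟩
      zero_mem' := ⟨0, 0, zero_mem _, 0, by simp, map_zero _⟩
      smul_mem' := by
        rintro c _ ⟨n, x, hx, p, e, rfl⟩
        refine ⟨n, c • x, Submodule.smul_mem _ _ hx, Polynomial.C c • p, ?_, ?_⟩
        · rw [map_smul, ← e, ← C_smul_eq, smul_comm]
        · rw [C_smul_eq, map_smul] }
  -- If the values vanish at one of the points, x already lies in the core. Its own coordinates are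
  -- then polynomials, and those of (t²-1)x vanish at both points. This makes both projections of W
  -- injective.
  have hW : ∀ c : k, c = 1 ∨ c = -1 → ∀ n, ∀ x ∈ F n, ∀ p, zz k • x = colMap e₁ e₂ p →
      evalPair (-c) p = 0 → evalPair c p = 0 := by
    intro c hc n x hx p e h0
    obtain ⟨p', h1, h2, e'⟩ := hcore' (hF.zz_smul_mem_core hx)
    obtain rfl := hinj (e.symm.trans e')
    obtain ⟨q₁, hq₁, eq₁⟩ := exists_eq_sub_C_mul h1 (congrArg Prod.fst h0)
    obtain ⟨q₂, hq₂, eq₂⟩ := exists_eq_sub_C_mul h2 (congrArg Prod.snd h0)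
    have ep : p = (𝕥 - Polynomial.C (-c)) • (q₁, q₂) := Prod.ext eq₁ eq₂
    have ex : (𝕥 - Polynomial.C c) • x = colMap e₁ e₂ (q₁, q₂) := by
      rw [ep, map_smul, zz_eq_mul hc, mul_comm, mul_smul] at e
      exact smul_right_injective _ (Polynomial.X_sub_C_ne_zero (-c)) e
    -- Write w = (t-c)w' + w(c). The first part multiplies x into the core because (t-c)x has
    -- polynomial coordinates; the second is a scalar.
    have hxU : x ∈ core F (3 * n) := by
      intro m w hw
      by_cases hmn : m < n
      · rw [eq_zero_of_mem_polyLE_neg hw (by omega), zero_smul]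
        exact zero_mem _
      obtain ⟨w', hw', ew⟩ := exists_eq_sub_C_mul (c := c) (p := w - Polynomial.C (w.eval c))
        (d := 3 * m - 3 * n) (sub_mem hw (C_mem_polyLE _ (by omega))) (by simp)
      rw [sub_eq_iff_eq_add] at ew
      rw [ew, add_smul, C_smul_eq, mul_comm, mul_smul, ex, ← map_smul]
      refine add_mem (mem_of_mem_core (hcore ?_ ?_)) (Submodule.smul_mem _ _ (hmono (by omega) hx))
      · exact mul_mem_polyLE' hw' hq₁ (by omega)
      · exact mul_mem_polyLE' hw' hq₂ (by omega)
    obtain ⟨q, -, -, eq⟩ := hcore' hxU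
    rw [eq, ← map_smul] at e
    rw [← hinj e]
    rcases hc with rfl | rfl <;> simp
  refine ⟨W, 2 - a₁, 2 - a₂, ?_⟩
  obtain ⟨Φ', hΦ'⟩ := hΦ.change hM.1.isInternal hdet zz_ne_zero
    (F' := gluedSet W (2 - a₁) (2 - a₂)) (fun n v hv => by
      obtain ⟨p, h1, h2, e⟩ := hcore' (hF.zz_smul_mem_core hv)
      exact ⟨p, mem_gluedSet.2 ⟨polyLE_mono (by omega) h1, polyLE_mono (by omega) h2,
        n, v, hv, p, e, rfl⟩, e⟩) (fun n p hp => by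
      obtain ⟨h1, h2, m, x, hx, q, e, eq⟩ := mem_gluedSet.1 hp
      -- A representative found in a high degree descends to degree n by the depth condition:
      -- (t²-1)x and t(t²-1)x are core vectors because p obeys the bounds of degree n.
      have key : ∀ i : ℕ, (∃ x ∈ F (n + i), zz k • x = colMap e₁ e₂ p) →
          ∃ x ∈ F n, zz k • x = colMap e₁ e₂ p := by
        intro i
        induction i with
        | zero => simp
        | succ i ih =>
          rintro ⟨x, hx, e⟩
          rw [Nat.cast_succ, ← add_assoc] at hx
          refine ih ⟨x, hF.mem_of_mul_mem hx ?_ ?_, e⟩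
          · rw [e]
            exact mem_of_mem_core (hcore (polyLE_mono (by omega) h1) (polyLE_mono (by omega) h2))
          · rw [mul_smul, e, ← map_smul]
            exact mem_of_mem_core (hcore (mul_mem_polyLE' (X_mem_polyLE le_rfl) h1 (by omega))
              (mul_mem_polyLE' (X_mem_polyLE le_rfl) h2 (by omega)))
      obtain ⟨q', g1, g2, e'⟩ := hcore' (hF.zz_smul_mem_core hx)
      obtain rfl := hinj (e.symm.trans e')
      set N := max m n with hN
      have hv := sub_eq_zero.2 eq.symm
      rw [← map_sub] at hv
      obtain ⟨r₁, hr₁, er₁⟩ := exists_eq_zz_mul hk (p := (p - q).1) (d := 3 * N + 2 - a₁)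
        (sub_mem (polyLE_mono (by omega) h1) (polyLE_mono (by omega) g1))
        (congrArg (fun w => w.1.1) hv) (congrArg (fun w => w.2.1) hv)
      obtain ⟨r₂, hr₂, er₂⟩ := exists_eq_zz_mul hk (p := (p - q).2) (d := 3 * N + 2 - a₂)
        (sub_mem (polyLE_mono (by omega) h2) (polyLE_mono (by omega) g2))
        (congrArg (fun w => w.1.2) hv) (congrArg (fun w => w.2.2) hv)
      have er : p = zz k • (r₁, r₂) + q := sub_eq_iff_eq_add.1 (Prod.ext er₁ er₂)
      -- p and q agree at both points, so p - q = (t²-1)(r₁, r₂), and adding the core vector with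
      -- coordinates (r₁, r₂) to x produces a representative of p in degree N.
      refine key (N - n).toNat ⟨colMap e₁ e₂ (r₁, r₂) + x, ?_, ?_⟩
      · have eN : n + ((N - n).toNat : ℤ) = N := by omega
        rw [eN]
        exact add_mem (mem_of_mem_core (hcore (polyLE_mono (by omega) hr₁) (polyLE_mono (by omega) hr₂)))
          (hmono (le_max_left _ _) hx)
      · rw [er, map_add, map_smul, ← e, smul_add])
  refine ⟨Φ', hΦ', ?_, ?_⟩
  · rintro _ ⟨n, x, hx, p, e, rfl⟩ h0
    exact Prod.ext h0 (hW (-1) (Or.inr rfl) n x hx p e (by rw [neg_neg]; exact h0))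
  · rintro _ ⟨n, x, hx, p, e, rfl⟩ h0
    exact Prod.ext (hW 1 (Or.inl rfl) n x hx p e h0) h0

end

section

variable {M : Type v} [AddCommGroup M] [Module (Cone k) M] {𝓜 : ℤ → AddSubgroup M}
  {Φ : M →ₗ[Cone k] Param k × Param k} {F : ℤ → Submodule k (Polynomial k × Polynomial k)}

/-! ### Decomposable lattices -/

lemma isHomogeneousSubmodule_of_comp_mem (hg : DirectSum.IsInternal 𝓜) {N : Submodule (Cone k) M}
    (h : ∀ n, ∀ x ∈ N, comp hg n x ∈ N) : IsHomogeneousSubmodule 𝓜 N := by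
  refine le_antisymm (fun x hx => ?_) (Submodule.span_le.2 fun x hx => hx.1)
  obtain ⟨s, hs, -⟩ := exists_sum_comp hg x
  rw [hs]
  exact Submodule.sum_mem _ fun n _ => Submodule.subset_span ⟨h n x hx, n, comp_mem hg n x⟩

/-- The elements with first coordinate zero. -/
def kerFst (Φ : M →ₗ[Cone k] Param k × Param k) : Submodule (Cone k) M :=
  LinearMap.ker ((LinearMap.fst (Cone k) (Param k) (Param k)).comp Φ)

lemma mem_kerFst {x : M} : x ∈ kerFst Φ ↔ (Φ x).1 = 0 := Iff.rfl

/-- If F is stable under projection to the first coordinate, M is the direct sum of the two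
submodules where one coordinate vanishes; both are nonzero because of g₁ and g₂. -/
lemma Realizes.not_isIndecomposable (h : Realizes 𝓜 Φ F) (hg : DirectSum.IsInternal 𝓜)
    (hF : ∀ n, ∀ v ∈ F n, (v.1, 0) ∈ F n) {n₁ n₂ : ℤ} {g₁ g₂ : Polynomial k} (hg₁ : g₁ ≠ 0)
    (hg₂ : g₂ ≠ 0) (h₁ : (g₁, 0) ∈ F n₁) (h₂ : (0, g₂) ∈ F n₂) : ¬ IsIndecomposable k 𝓜 := by
  intro hind
  have hN := isHomogeneousSubmodule_of_comp_mem hg (N := kerSnd Φ) fun n x hx => h.comp_mem_kerSnd hg n hx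
  have hP := isHomogeneousSubmodule_of_comp_mem hg (N := kerFst Φ) fun n x hx => by
    rw [mem_kerFst, h.map_comp hg]
    simp [emb, cf, mem_kerFst.1 hx]
  have hc : IsCompl (kerSnd Φ) (kerFst Φ) := by
    refine ⟨disjoint_iff_inf_le.2 fun x hx => ?_, codisjoint_iff_le_sup.2 fun x _ => ?_⟩
    · exact (Submodule.mem_bot _).2 (h.injective ((Prod.ext hx.2 hx.1 : Φ x = 0).trans (map_zero Φ).symm))
    · have hx := mem_iSup_of_isInternal hg x
      induction hx using AddSubgroup.iSup_induction' with
      | hp n x hx =>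
        obtain ⟨v, hv, e⟩ := h.map_mem n x hx
        obtain ⟨y, hy, e'⟩ := h.exists_of_mem n _ (hF n v hv)
        rw [← add_sub_cancel y x]
        refine add_mem (Submodule.mem_sup_left ?_) (Submodule.mem_sup_right ?_)
        · rw [mem_kerSnd, e']
          simp [emb]
        · rw [mem_kerFst, map_sub, e, e']
          simp [emb]
      | h1 => exact zero_mem _
      | hadd x y _ _ hx hy => exact add_mem (hx trivial) (hy trivial)
  obtain ⟨x₁, -, e₁⟩ := h.exists_of_mem _ _ h₁
  obtain ⟨x₂, -, e₂⟩ := h.exists_of_mem _ _ h₂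
  rcases hind.2 _ _ hN hP hc with h0 | h0
  · have : x₁ ∈ kerSnd Φ := by rw [mem_kerSnd, e₁]; simp [emb]
    rw [h0, Submodule.mem_bot] at this
    rw [this, map_zero, ← emb_zero n₁] at e₁
    exact hg₁ (congrArg Prod.fst (emb_injective _ e₁)).symm
  · have : x₂ ∈ kerFst Φ := by rw [mem_kerFst, e₂]; simp [emb]
    rw [h0, Submodule.mem_bot] at this
    rw [this, map_zero, ← emb_zero n₂] at e₂
    exact hg₂ (congrArg Prod.snd (emb_injective _ e₂)).symm

section Glued

variable {W : Submodule k ((k × k) × (k × k))} {b₁ b₂ : ℤ}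

lemma mem_gluedSet_of_nodeVal_eq_zero {n : ℤ} {v : Polynomial k × Polynomial k}
    (h₁ : v.1 ∈ polyLE k (3 * n + b₁)) (h₂ : v.2 ∈ polyLE k (3 * n + b₂)) (h : nodeVal k v = 0) :
    v ∈ gluedSet W b₁ b₂ n :=
  mem_gluedSet.2 ⟨h₁, h₂, by rw [h]; exact zero_mem _⟩

lemma zz_fst_mem_gluedSet {n : ℤ} (hn : 2 ≤ 3 * n + b₁) : (zz k, 0) ∈ gluedSet W b₁ b₂ n :=
  mem_gluedSet_of_nodeVal_eq_zero (zz_mem_polyLE hn) (zero_mem _) (by simp)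

lemma zz_snd_mem_gluedSet {n : ℤ} (hn : 2 ≤ 3 * n + b₂) : (0, zz k) ∈ gluedSet W b₁ b₂ n :=
  mem_gluedSet_of_nodeVal_eq_zero (zero_mem _) (zz_mem_polyLE hn) (by simp)

lemma Realizes.not_isIndecomposable_of_glued (h : Realizes 𝓜 Φ (gluedSet W b₁ b₂))
    (hg : DirectSum.IsInternal 𝓜) (hW : ∀ w ∈ W, ((w.1.1, 0), (w.2.1, 0)) ∈ W) :
    ¬ IsIndecomposable k 𝓜 := by
  refine h.not_isIndecomposable hg (fun n v hv => ?_) zz_ne_zero zz_ne_zero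
    (zz_fst_mem_gluedSet (n := |b₁| + 1) (by have := neg_abs_le b₁; have := abs_nonneg b₁; omega))
    (zz_snd_mem_gluedSet (n := |b₂| + 1) (by have := neg_abs_le b₂; have := abs_nonneg b₂; omega))
  obtain ⟨h₁, h₂, h₃⟩ := mem_gluedSet.1 hv
  refine mem_gluedSet.2 ⟨h₁, zero_mem _, ?_⟩
  have := hW _ h₃
  simpa using this

end Glued

/-! ### Locally free lattices -/

lemma Realizes.free_localizedModule (h : Realizes 𝓜 Φ F) (hk : (2 : k) ≠ 0)
    (hg : DirectSum.IsInternal 𝓜) (p : Ideal (Cone k)) [p.IsPrime] {m₁ m₂ : ℤ}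
    {w₁ w₂ : Polynomial k × Polynomial k} (hw₁ : w₁ ∈ F m₁) (hw₂ : w₂ ∈ F m₂)
    (hdet : w₁.1 * w₂.2 - w₁.2 * w₂.1 ≠ 0) {r : Cone k} (hr : r ∉ p) {ρ : Polynomial k} {d : ℤ}
    (er : toParam k r = 𝐂 ρ * 𝐓 d)
    (hspan : ∀ n, ∀ v ∈ F n, ∃ q₁ ∈ nodeLE k (d + n - m₁), ∃ q₂ ∈ nodeLE k (d + n - m₂),
      ρ • v = q₁ • w₁ + q₂ • w₂) :
    Module.Free (Localization.AtPrime p) (LocalizedModule p.primeCompl M) := by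
  obtain ⟨x₁, -, e₁⟩ := h.exists_of_mem _ _ hw₁
  obtain ⟨x₂, -, e₂⟩ := h.exists_of_mem _ _ hw₂
  refine free_localizedModule_of_span p ![x₁, x₂] ?_ hr fun x => ?_
  · rw [LinearIndependent.pair_iff]
    intro s t hst
    have h0 := congrArg Φ hst
    rw [map_add, map_smul, map_smul, e₁, e₂, map_zero] at h0
    have h1 : paramMap w₁ w₂ (toParam k s * 𝐓 m₁, toParam k t * 𝐓 m₂) = paramMap w₁ w₂ 0 := by
      rw [map_zero, ← h0]
      ext1 <;> simp only [paramMap, emb, cone_smul_def, LinearMap.coe_mk, AddHom.coe_mk, Prod.fst_add,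
        Prod.snd_add, Prod.smul_fst, Prod.smul_snd] <;> ring
    have h2 := paramMap_injective hdet h1
    rw [Prod.mk_eq_zero, (LaurentPolynomial.isUnit_T m₁).mul_left_eq_zero,
      (LaurentPolynomial.isUnit_T m₂).mul_left_eq_zero, toParam_eq_zero, toParam_eq_zero] at h2
    exact h2
  · have hx := mem_iSup_of_isInternal hg x
    induction hx using AddSubgroup.iSup_induction' with
    | hp n x hx =>
      obtain ⟨v, hv, e⟩ := h.map_mem n x hx
      obtain ⟨q₁, hq₁, q₂, hq₂, eq⟩ := hspan n v hv
      obtain ⟨s₁, -, es₁⟩ := exists_coneDeg_of_mem_nodeLE hk hq₁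
      obtain ⟨s₂, -, es₂⟩ := exists_coneDeg_of_mem_nodeLE hk hq₂
      have : r • x = s₁ • x₁ + s₂ • x₂ := by
        apply h.injective
        rw [map_add, map_smul, map_smul, map_smul, e, e₁, e₂, smul_emb er, smul_emb es₁, smul_emb es₂, eq,
          emb_add, sub_add_cancel, sub_add_cancel]
      rw [this]
      exact add_mem (Submodule.smul_mem _ _ (Submodule.subset_span ⟨0, rfl⟩))
        (Submodule.smul_mem _ _ (Submodule.subset_span ⟨1, rfl⟩))
    | h1 => rw [smul_zero]; exact zero_mem _
    | hadd x y _ _ hx hy => rw [smul_add]; exact add_mem hx hy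

section Glued

variable {W : Submodule k ((k × k) × (k × k))} {b₁ b₂ : ℤ}

lemma toParam_X_pow (i : Fin 3) (n : ℕ) {q : Polynomial k} (h : toParam k (toCone k (X i)) = 𝐂 q * 𝐓 1) :
    toParam k (toCone k (X i) ^ n) = 𝐂 (q ^ n) * 𝐓 n := by
  rw [map_pow, h, mul_pow, ← map_pow, LaurentPolynomial.T_pow, mul_one]

/-- The module of a glued lattice is locally free away from the node and the point at infinity. -/
lemma Realizes.free_of_X0_notMem (h : Realizes 𝓜 Φ (gluedSet W b₁ b₂)) (hk : (2 : k) ≠ 0)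
    (hg : DirectSum.IsInternal 𝓜) (p : Ideal (Cone k)) [p.IsPrime] (h0 : toCone k (X 0) ∉ p)
    (h2 : toCone k (X 2) ∉ p) :
    Module.Free (Localization.AtPrime p) (LocalizedModule p.primeCompl M) := by
  set m := |b₁| + |b₂| + 1 with hm
  have hb₁ := neg_abs_le b₁
  have hb₂ := neg_abs_le b₂
  have hb₁' := le_abs_self b₁
  have hb₂' := le_abs_self b₂
  have hmn : (m.toNat : ℤ) = m := Int.toNat_of_nonneg (by omega)
  have hp : p.IsPrime := inferInstance
  -- Where y₁ and y₃ are invertible, (t²-1, 0) and (0, t²-1) form a basis. Of the two factors t² - 1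
  -- in the multiplier, one is absorbed by the basis and one brings the coefficient into the cone;
  -- the power of y₃ makes room for the degrees.
  refine h.free_localizedModule hk hg p (zz_fst_mem_gluedSet (n := m) (by omega))
    (zz_snd_mem_gluedSet (n := m) (by omega)) (by simp [zz_ne_zero])
    (r := toCone k (X 0) ^ 2 * toCone k (X 2) ^ (2 * m.toNat)) (ρ := zz k ^ 2) (d := 2 + 2 * m) ?_ ?_ ?_
  · exact hp.mul_notMem (fun h => h0 (hp.mem_of_pow_mem _ h)) (fun h => h2 (hp.mem_of_pow_mem _ h))
  · rw [map_mul, toParam_X_pow 0 2 (q := zz k) (by simp), toParam_X_pow 2 _ (q := 1) (by simp), one_pow,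
      map_one, one_mul, mul_assoc, ← LaurentPolynomial.T_add]
    congr 2
    push_cast
    omega
  · intro n v hv
    obtain ⟨h₁, h₂, -⟩ := mem_gluedSet.1 hv
    refine ⟨zz k * v.1, ⟨mul_mem_polyLE' (zz_mem_polyLE le_rfl) h₁ (by omega), by simp⟩, zz k * v.2,
      ⟨mul_mem_polyLE' (zz_mem_polyLE le_rfl) h₂ (by omega), by simp⟩, ?_⟩
    ext1 <;> simp <;> ring

/-- The module of a glued lattice is free at the point at infinity. -/
lemma Realizes.free_of_X1_notMem (h : Realizes 𝓜 Φ (gluedSet W b₁ b₂)) (hk : (2 : k) ≠ 0)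
    (hg : DirectSum.IsInternal 𝓜) (p : Ideal (Cone k)) [p.IsPrime] (h1 : toCone k (X 1) ∉ p) :
    Module.Free (Localization.AtPrime p) (LocalizedModule p.primeCompl M) := by
  set m := |b₁| + |b₂| + 1 with hm
  have hb₁ := neg_abs_le b₁
  have hb₂ := neg_abs_le b₂
  have hb₁' := le_abs_self b₁
  have hb₂' := le_abs_self b₂
  have hp : p.IsPrime := inferInstance
  have hz : ∀ j : ℕ, (𝕥 ^ j * zz k : Polynomial k) ≠ 0 := fun j =>
    mul_ne_zero (pow_ne_zero _ Polynomial.X_ne_zero) zz_ne_zero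
  have hzle : ∀ (j : ℕ) (d : ℤ), (j : ℤ) + 2 ≤ d → 𝕥 ^ j * zz k ∈ polyLE k d := fun j d hd =>
    mul_mem_polyLE' (X_pow_mem_polyLE j le_rfl) (zz_mem_polyLE le_rfl) hd
  -- The exponents give t^(jᵢ)(t²-1) the full degree 3m + bᵢ, so the basis does not vanish at
  -- infinity. Its zeros 0, 1, -1 lie on y₂ = 0, which is excluded.
  obtain ⟨j₁, hj₁⟩ := Int.eq_ofNat_of_zero_le (a := 3 * m + b₁ - 2) (by omega)
  obtain ⟨j₂, hj₂⟩ := Int.eq_ofNat_of_zero_le (a := 3 * m + b₂ - 2) (by omega)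
  set L := j₁ + j₂ with hL
  have hzn : (zz k).natDegree = 2 := natDegree_zz
  have hzp : ∀ i : ℕ, zz k ^ i ∈ polyLE k (2 * i) := fun i =>
    mem_polyLE_of_natDegree_le (by rw [Polynomial.natDegree_pow, hzn]; push_cast; omega)
  refine h.free_localizedModule hk hg p (w₁ := (𝕥 ^ j₁ * zz k, 0)) (w₂ := (0, 𝕥 ^ j₂ * zz k))
    (m₁ := m) (m₂ := m)
    (mem_gluedSet_of_nodeVal_eq_zero (hzle _ _ (by omega)) (zero_mem _) (by simp))
    (mem_gluedSet_of_nodeVal_eq_zero (zero_mem _) (hzle _ _ (by omega)) (by simp))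
    (by simp [zz_ne_zero]) (r := toCone k (X 1) ^ (L + 2)) (ρ := (𝕥 * zz k) ^ (L + 2))
    (d := (L + 2 : ℕ)) (fun h => h1 (hp.mem_of_pow_mem _ h)) (toParam_X_pow 1 _ (by simp)) ?_
  intro n v hv
  obtain ⟨h₁, h₂, -⟩ := mem_gluedSet.1 hv
  refine ⟨𝕥 ^ (j₂ + 2) * (zz k ^ (L + 1) * v.1), ⟨mul_mem_polyLE' (X_pow_mem_polyLE _ le_rfl)
      (mul_mem_polyLE (hzp _) h₁) (by push_cast; omega), by simp⟩, 𝕥 ^ (j₁ + 2) * (zz k ^ (L + 1) * v.2),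
    ⟨mul_mem_polyLE' (X_pow_mem_polyLE _ le_rfl) (mul_mem_polyLE (hzp _) h₂) (by push_cast; omega),
      by simp⟩, ?_⟩
  ext1 <;> simp [hL] <;> ring

/-- The module of a lattice that is glued along an isomorphism is free at the node. -/
lemma Realizes.free_of_X0_mem (h : Realizes 𝓜 Φ (gluedSet W b₁ b₂)) (hk : (2 : k) ≠ 0)
    (hg : DirectSum.IsInternal 𝓜) (p : Ideal (Cone k)) [p.IsPrime] (h0 : toCone k (X 0) ∈ p)
    (h1 : toCone k (X 1) ∈ p) (h2 : toCone k (X 2) ∉ p) {g₁ g₂ : k × k}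
    (hdet : g₁.1 * g₂.2 - g₁.2 * g₂.1 ≠ 0) (hW : ∀ w, w ∈ W ↔ w.2 = w.1.1 • g₁ + w.1.2 • g₂) :
    Module.Free (Localization.AtPrime p) (LocalizedModule p.primeCompl M) := by
  set m := |b₁| + |b₂| + 1 with hm
  have hb₁ := neg_abs_le b₁
  have hb₂ := neg_abs_le b₂
  have hb₁' := le_abs_self b₁
  have hb₂' := le_abs_self b₂
  have hmn : (m.toNat : ℤ) = m := Int.toNat_of_nonneg (by omega)
  have hp : p.IsPrime := inferInstance
  -- `l c` is linear with the values `1` at `1` and `c` at `-1`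
  let l : k → k → Polynomial k := fun a c => Polynomial.C ((a + c) / 2) + Polynomial.C ((a - c) / 2) * 𝕥
  have l1 : ∀ a c, (l a c).eval 1 = a := fun a c => by simp [l]; field_simp; ring
  have l2 : ∀ a c, (l a c).eval (-1) = c := fun a c => by simp [l]; field_simp; ring
  have ld : ∀ a c (d : ℤ), 1 ≤ d → l a c ∈ polyLE k d := fun a c d hd =>
    add_mem (C_mem_polyLE _ (by omega)) (C_mul_mem_polyLE _ (X_mem_polyLE hd))
  set γ := g₁.1 * g₂.2 - g₁.2 * g₂.1 with hγ
  -- w₁ and w₂ are linear interpolations with the values (1,0), (0,1) at 1 and g₁, g₂ at -1, so they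
  -- respect the gluing and form a basis at both points over the node.
  set w₁ : Polynomial k × Polynomial k := (l 1 g₁.1, l 0 g₁.2) with hw₁
  set w₂ : Polynomial k × Polynomial k := (l 0 g₂.1, l 1 g₂.2) with hw₂
  set δ := w₁.1 * w₂.2 - w₁.2 * w₂.1 with hδ
  -- δ has the value 1 at 1 and γ at -1. The linear factor balances them, so that ρ has the value γ
  -- at both points and comes from the linear form r₀, which is γy₃ modulo y₁ and y₂ and hence not
  -- in p.
  set ρ := l γ 1 * δ with hρ
  have hδ2 : δ ∈ polyLE k 2 := sub_mem (mul_mem_polyLE' (ld _ _ 1 le_rfl) (ld _ _ 1 le_rfl) le_rfl)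
    (mul_mem_polyLE' (ld _ _ 1 le_rfl) (ld _ _ 1 le_rfl) le_rfl)
  have hδ1 : δ.eval 1 = 1 := by simp [hδ, hw₁, hw₂, l1]
  have hδ1' : δ.eval (-1) = γ := by simp [hδ, hw₁, hw₂, l2, hγ]
  have hρ1 : ρ.eval 1 = γ := by simp [hρ, l1, hδ1]
  have hρ1' : ρ.eval (-1) = γ := by simp [hρ, l2, hδ1']
  obtain ⟨q, hq, eq⟩ := exists_eq_zz_mul hk (p := ρ - Polynomial.C γ) (d := 3)
    (sub_mem (mul_mem_polyLE' (ld _ _ 1 le_rfl) hδ2 (by omega)) (C_mem_polyLE _ (by omega)))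
    (by simp [hρ1]) (by simp [hρ1'])
  have eq' : q = Polynomial.C (q.coeff 1) * 𝕥 + Polynomial.C (q.coeff 0) :=
    Polynomial.eq_X_add_C_of_natDegree_le_one (by
      by_cases hq0 : q = 0
      · simp [hq0]
      · rw [mem_polyLE_iff_natDegree hq0] at hq
        omega)
  set r₀ := toCone k (C γ) * toCone k (X 2) + (toCone k (C (q.coeff 0)) * toCone k (X 0) +
    toCone k (C (q.coeff 1)) * toCone k (X 1)) with hr₀
  have er₀ : toParam k r₀ = 𝐂 ρ * 𝐓 1 := by
    rw [sub_eq_iff_eq_add] at eq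
    rw [eq, eq', hr₀]
    simp
    ring
  have hr₀p : r₀ ∉ p := by
    intro hmem
    have hmem' := (p.add_mem_iff_left (add_mem (p.mul_mem_left _ h0) (p.mul_mem_left _ h1))).1 hmem
    refine h2 ((hp.mem_or_mem hmem').resolve_left fun hC => hp.ne_top (p.eq_top_of_isUnit_mem hC ?_))
    exact (isUnit_iff_ne_zero.2 hdet).map ((toCone k).comp C)
  have hmem : ∀ n, ∀ v ∈ gluedSet W b₁ b₂ n, ∀ a : k, (a = 1 ∨ a = -1) →
      evalPair a v = v.1.eval 1 • evalPair a w₁ + v.2.eval 1 • evalPair a w₂ := by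
    rintro n v hv a (rfl | rfl)
    · ext1 <;> simp [hw₁, hw₂, l1]
    · have := (hW _).1 (mem_gluedSet.1 hv).2.2
      rw [nodeVal_apply] at this
      simp only [evalPair_apply] at this ⊢
      rw [this]
      ext1 <;> simp [hw₁, hw₂, l2]
  refine h.free_localizedModule hk hg p (w₁ := w₁) (w₂ := w₂) (m₁ := m) (m₂ := m) ?_ ?_ ?_
    (r := r₀ * toCone k (X 2) ^ (2 * m.toNat)) (ρ := ρ) (d := 1 + 2 * m) ?_ ?_ ?_
  · refine mem_gluedSet.2 ⟨ld _ _ _ (by omega), ld _ _ _ (by omega), (hW _).2 ?_⟩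
    ext1 <;> simp [hw₁, l1, l2]
  · refine mem_gluedSet.2 ⟨ld _ _ _ (by omega), ld _ _ _ (by omega), (hW _).2 ?_⟩
    ext1 <;> simp [hw₂, l1, l2]
  · intro h
    rw [← hδ] at h
    simp [h] at hδ1
  · exact hp.mul_notMem hr₀p (fun h => h2 (hp.mem_of_pow_mem _ h))
  · rw [map_mul, er₀, toParam_X_pow 2 _ (q := 1) (by simp), one_pow, map_one, one_mul, mul_assoc,
      ← LaurentPolynomial.T_add]
    congr 2
    push_cast
    omega
  · intro n v hv
    obtain ⟨h₁, h₂, -⟩ := mem_gluedSet.1 hv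
    have v1 := hmem n v hv 1 (Or.inl rfl)
    have v2 := hmem n v hv (-1) (Or.inr rfl)
    simp only [evalPair_apply, Prod.smul_mk, Prod.mk_add_mk, Prod.mk.injEq, smul_eq_mul] at v1 v2
    refine ⟨l γ 1 * (v.1 * w₂.2 - v.2 * w₂.1), ⟨mul_mem_polyLE' (a := 1) (b := 1 + 3 * n + |b₁| + |b₂|)
      (ld _ _ _ le_rfl) (sub_mem (mul_mem_polyLE' h₁ (ld _ _ 1 le_rfl) (by omega))
      (mul_mem_polyLE' h₂ (ld _ _ 1 le_rfl) (by omega))) (by omega), ?_⟩,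
      l γ 1 * (w₁.1 * v.2 - w₁.2 * v.1), ⟨mul_mem_polyLE' (a := 1) (b := 1 + 3 * n + |b₁| + |b₂|)
      (ld _ _ _ le_rfl) (sub_mem (mul_mem_polyLE' (ld _ _ 1 le_rfl) h₂ (by omega))
      (mul_mem_polyLE' (ld _ _ 1 le_rfl) h₁ (by omega))) (by omega), ?_⟩, ?_⟩
    · simp only [Polynomial.eval_mul, Polynomial.eval_sub, l1, l2, hw₁, hw₂] at v2 ⊢
      rw [v2.1, v2.2]
      ring
    · simp only [Polynomial.eval_mul, Polynomial.eval_sub, l1, l2, hw₁, hw₂] at v2 ⊢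
      rw [v2.1, v2.2]
      ring
    · ext1 <;> simp [hρ, hδ] <;> ring

/-- The charts cover all relevant primes: either y₂ is outside p, or y₁ and y₂ are in p and y₃ is
not, or y₂ is in p and y₁ is not. In the last case y₃ is outside p too, because y₁³ is a multiple of
y₃. -/
lemma Realizes.isLocallyFree (h : Realizes 𝓜 Φ (gluedSet W b₁ b₂)) (hk : (2 : k) ≠ 0)
    (hg : DirectSum.IsInternal 𝓜) {g₁ g₂ : k × k} (hdet : g₁.1 * g₂.2 - g₁.2 * g₂.1 ≠ 0)
    (hW : ∀ w, w ∈ W ↔ w.2 = w.1.1 • g₁ + w.1.2 • g₂) : IsLocallyFree k M := by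
  intro p hp _ hirr
  by_cases h1 : toCone k (X 1) ∈ p
  · by_cases h0 : toCone k (X 0) ∈ p
    · refine h.free_of_X0_mem hk hg p h0 h1 (fun h2 => hirr ?_) hdet hW
      rw [irrelevant, Ideal.span_le]
      rintro _ ⟨i, rfl⟩
      fin_cases i
      exacts [h0, h1, h2]
    · refine h.free_of_X0_notMem hk hg p h0 fun h2 => h0 (hp.mem_of_pow_mem 3 ?_)
      rw [toCone_X0_pow_three]
      exact sub_mem (p.mul_mem_left _ h2) (p.mul_mem_left _ h2)
  · exact h.free_of_X1_notMem hk hg p h1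

end Glued

end

section

variable {M : Type v} [AddCommGroup M] [Module (Cone k) M] {𝓜 : ℤ → AddSubgroup M}
  {Φ : M →ₗ[Cone k] Param k × Param k} {b₁ b₂ : ℤ}

/-! ### Lattices glued along a line -/

lemma mem_gluedSet_span {w : (k × k) × (k × k)} {n : ℤ} {v : Polynomial k × Polynomial k} :
    v ∈ gluedSet (Submodule.span k {w}) b₁ b₂ n ↔ v.1 ∈ polyLE k (3 * n + b₁) ∧
      v.2 ∈ polyLE k (3 * n + b₂) ∧ ∃ c : k, v.1.eval 1 = c * w.1.1 ∧ v.2.eval 1 = c * w.1.2 ∧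
        v.1.eval (-1) = c * w.2.1 ∧ v.2.eval (-1) = c * w.2.2 := by
  rw [mem_gluedSet, Submodule.mem_span_singleton]
  simp only [nodeVal_apply, evalPair_apply, Prod.ext_iff, Prod.smul_fst, Prod.smul_snd, smul_eq_mul,
    and_assoc, eq_comm]

lemma Realizes.swap {w : (k × k) × (k × k)}
    (h : Realizes 𝓜 Φ (gluedSet (Submodule.span k {w}) b₁ b₂)) (hg : DirectSum.IsInternal 𝓜) :
    ∃ Φ' : M →ₗ[Cone k] Param k × Param k,
      Realizes 𝓜 Φ' (gluedSet (Submodule.span k {(w.1.swap, w.2.swap)}) b₂ b₁) := by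
  refine h.change hg (e₁ := (0, 1)) (e₂ := (1, 0)) (by simp) (s := 1) one_ne_zero (fun n v hv => ?_)
    fun n v hv => ?_
  · obtain ⟨h₁, h₂, c, h₃, h₄, h₅, h₆⟩ := mem_gluedSet_span.1 hv
    exact ⟨v.swap, mem_gluedSet_span.2 ⟨h₂, h₁, c, h₄, h₃, h₆, h₅⟩, by ext1 <;> simp [colMap_apply]⟩
  · obtain ⟨h₁, h₂, c, h₃, h₄, h₅, h₆⟩ := mem_gluedSet_span.1 hv
    exact ⟨v.swap, mem_gluedSet_span.2 ⟨h₂, h₁, c, h₄, h₃, h₆, h₅⟩, by ext1 <;> simp [colMap_apply]⟩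

/-- Subtracting q times the second coordinate from the first is an automorphism of the bundle when
deg q ≤ b₁ - b₂; its effect on the gluing line involves only q(1) and q(-1). -/
lemma Realizes.shear {w : (k × k) × (k × k)}
    (h : Realizes 𝓜 Φ (gluedSet (Submodule.span k {w}) b₁ b₂)) (hg : DirectSum.IsInternal 𝓜)
    {q : Polynomial k} (hq : q ∈ polyLE k (b₁ - b₂)) :
    ∃ Φ' : M →ₗ[Cone k] Param k × Param k, Realizes 𝓜 Φ' (gluedSet (Submodule.span k
      {((w.1.1 - q.eval 1 * w.1.2, w.1.2), (w.2.1 - q.eval (-1) * w.2.2, w.2.2))}) b₁ b₂) := by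
  refine h.change hg (e₁ := (1, 0)) (e₂ := (q, 1)) (by simp) (s := 1) one_ne_zero (fun n v hv => ?_)
    fun n v hv => ?_
  · obtain ⟨h₁, h₂, c, h₃, h₄, h₅, h₆⟩ := mem_gluedSet_span.1 hv
    refine ⟨(v.1 - q * v.2, v.2), mem_gluedSet_span.2 ⟨sub_mem h₁ (mul_mem_polyLE' hq h₂ (by omega)), h₂,
      c, ?_, h₄, ?_, h₆⟩, by ext1 <;> simp [colMap_apply]; ring⟩
    · simp only [Polynomial.eval_sub, Polynomial.eval_mul, h₃, h₄]
      ring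
    · simp only [Polynomial.eval_sub, Polynomial.eval_mul, h₅, h₆]
      ring
  · obtain ⟨h₁, h₂, c, h₃, h₄, h₅, h₆⟩ := mem_gluedSet_span.1 hv
    refine ⟨(v.1 + q * v.2, v.2), mem_gluedSet_span.2 ⟨add_mem h₁ (mul_mem_polyLE' hq h₂ (by omega)), h₂,
      c, ?_, h₄, ?_, h₆⟩, by ext1 <;> simp [colMap_apply]; ring⟩
    · simp only [Polynomial.eval_add, Polynomial.eval_mul, h₃, h₄]
      ring
    · simp only [Polynomial.eval_add, Polynomial.eval_mul, h₅, h₆]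
      ring

/-- A lattice that is glued along the line `v₁(c) = v₂(-c) = 0`, `α v₁(-c) = β v₂(c)` is a string. -/
lemma Realizes.isString {F : ℤ → Submodule k (Polynomial k × Polynomial k)} (h : Realizes 𝓜 Φ F)
    (hk : (2 : k) ≠ 0) (hg : IsGradedModule (k := k) 𝓜) {α β c : k} (hα : α ≠ 0) (hβ : β ≠ 0)
    (hc : c = 1 ∨ c = -1) (hF : ∀ n v, v ∈ F n ↔ v.1 ∈ polyLE k (3 * n + b₁) ∧
      v.2 ∈ polyLE k (3 * n + b₂) ∧ v.1.eval c = 0 ∧ v.2.eval (-c) = 0 ∧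
      α * v.1.eval (-c) = β * v.2.eval c) :
    IsString 𝓜 (-c) (b₁ - 1) (b₂ - 1) := by
  have hc0 : c ≠ 0 := by
    rcases hc with rfl | rfl
    · exact one_ne_zero
    · exact neg_ne_zero.2 one_ne_zero
  have hX : ∀ a : k, (𝕥 - Polynomial.C a : Polynomial k) ≠ 0 := Polynomial.X_sub_C_ne_zero
  have hCa : ∀ {a : k}, a ≠ 0 → Polynomial.C a ≠ 0 := fun ha => Polynomial.C_ne_zero.2 ha
  -- Dividing out the forced zeros at c and -c lowers both bounds by one. The constants -β and α are
  -- chosen so that the remaining proportionality of values at -c and c becomes an equality.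
  refine ⟨hg, h.change hg.isInternal (s := 1) (e₁ := (Polynomial.C (-β) * (𝕥 - Polynomial.C c), 0))
    (e₂ := (0, Polynomial.C α * (𝕥 - Polynomial.C (-c)))) ?_ one_ne_zero (fun n v hv => ?_)
    fun n v hv => ?_⟩
  · rw [zero_mul, sub_zero]
    exact mul_ne_zero (mul_ne_zero (hCa (neg_ne_zero.2 hβ)) (hX _)) (mul_ne_zero (hCa hα) (hX _))
  · obtain ⟨h₁, h₂, h₃, h₄, h₅⟩ := (hF n v).1 hv
    obtain ⟨g, hg, eg⟩ := exists_eq_sub_C_mul h₁ h₃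
    obtain ⟨f, hf, ef⟩ := exists_eq_sub_C_mul h₂ h₄
    refine ⟨(Polynomial.C (-β)⁻¹ * g, Polynomial.C α⁻¹ * f), mem_stringSet.2
      ⟨C_mul_mem_polyLE _ (polyLE_mono (by omega) hg), C_mul_mem_polyLE _ (polyLE_mono (by omega) hf), ?_⟩, ?_⟩
    · rw [eg, ef] at h₅
      simp only [Polynomial.eval_mul, Polynomial.eval_sub, Polynomial.eval_X, Polynomial.eval_C,
        neg_neg] at h₅ ⊢
      have : 2 * c * (α * g.eval (-c) + β * f.eval c) = 0 := by linear_combination -h₅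
      have := (mul_eq_zero.1 this).resolve_left (mul_ne_zero hk hc0)
      field_simp
      linear_combination -this
    · have e₁ : Polynomial.C (-β)⁻¹ * Polynomial.C (-β) = 1 := by
        rw [← map_mul, inv_mul_cancel₀ (neg_ne_zero.2 hβ), map_one]
      have e₂ : Polynomial.C α⁻¹ * Polynomial.C α = 1 := by
        rw [← map_mul, inv_mul_cancel₀ hα, map_one]
      rw [one_smul, colMap_apply]
      refine Prod.ext ?_ ?_
      · simp only [Prod.fst_add, Prod.smul_fst, smul_eq_mul, mul_zero, add_zero]
        linear_combination eg - ((𝕥 : Polynomial k) - Polynomial.C c) * g * e₁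
      · simp only [Prod.snd_add, Prod.smul_snd, smul_eq_mul, mul_zero, zero_add]
        linear_combination ef - ((𝕥 : Polynomial k) - Polynomial.C (-c)) * f * e₂
  · obtain ⟨h₁, h₂, h₃⟩ := mem_stringSet.1 hv
    have hd : ∀ a : k, (𝕥 - Polynomial.C a : Polynomial k) ∈ polyLE k 1 := fun a =>
      sub_mem (X_mem_polyLE le_rfl) (C_mem_polyLE _ (by omega))
    refine ⟨colMap (Polynomial.C (-β) * (𝕥 - Polynomial.C c), 0)
      (0, Polynomial.C α * (𝕥 - Polynomial.C (-c))) v, (hF n _).2 ⟨?_, ?_, ?_, ?_, ?_⟩, one_smul _ _⟩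
    · simpa [colMap_apply] using mul_mem_polyLE' h₁ (C_mul_mem_polyLE (-β) (hd c)) (by omega)
    · simpa [colMap_apply] using mul_mem_polyLE' h₂ (C_mul_mem_polyLE α (hd (-c))) (by omega)
    · simp [colMap_apply]
    · simp [colMap_apply]
    · rw [neg_neg] at h₃
      simp [colMap_apply, h₃]
      ring

lemma Realizes.isString_of_span {α β : k}
    (h : Realizes 𝓜 Φ (gluedSet (Submodule.span k {((0, α), (β, 0))}) b₁ b₂))
    (hk : (2 : k) ≠ 0) (hg : IsGradedModule (k := k) 𝓜) (hα : α ≠ 0) (hβ : β ≠ 0) :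
    IsString 𝓜 (-1 : k) (b₁ - 1) (b₂ - 1) := by
  refine h.isString hk hg hα hβ (Or.inl rfl) fun n v => ?_
  rw [mem_gluedSet_span]
  refine and_congr_right fun _ => and_congr_right fun _ => ⟨?_, ?_⟩
  · rintro ⟨c, h1, h2, h3, h4⟩
    simp only [mul_zero] at h1 h2 h3 h4
    exact ⟨h1, h4, by rw [h2, h3]; ring⟩
  · rintro ⟨h1, h2, h3⟩
    refine ⟨v.2.eval 1 / α, by simp [h1], by field_simp, ?_, by simp [h2]⟩
    field_simp
    linear_combination h3

lemma Realizes.isString_of_span' {α β : k}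
    (h : Realizes 𝓜 Φ (gluedSet (Submodule.span k {((α, 0), (0, β))}) b₁ b₂))
    (hk : (2 : k) ≠ 0) (hg : IsGradedModule (k := k) 𝓜) (hα : α ≠ 0) (hβ : β ≠ 0) :
    IsString 𝓜 (1 : k) (b₁ - 1) (b₂ - 1) := by
  have := h.isString hk hg hβ hα (Or.inr rfl) (c := -1) (b₁ := b₁) (b₂ := b₂) fun n v => ?_
  · rwa [neg_neg] at this
  rw [mem_gluedSet_span, neg_neg]
  refine and_congr_right fun _ => and_congr_right fun _ => ⟨?_, ?_⟩
  · rintro ⟨c, h1, h2, h3, h4⟩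
    simp only [mul_zero] at h1 h2 h3 h4
    exact ⟨h3, h2, by rw [h1, h4]; ring⟩
  · rintro ⟨h1, h2, h3⟩
    refine ⟨v.1.eval 1 / α, by field_simp, by simp [h2], by simp [h1], ?_⟩
    field_simp
    linear_combination -h3

lemma Realizes.not_isIndecomposable_of_span {w : (k × k) × (k × k)}
    (h : Realizes 𝓜 Φ (gluedSet (Submodule.span k {w}) b₁ b₂)) (hg : DirectSum.IsInternal 𝓜)
    (hw : (w.1.1 = 0 ∧ w.2.1 = 0) ∨ (w.1.2 = 0 ∧ w.2.2 = 0)) : ¬ IsIndecomposable k 𝓜 := by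
  refine h.not_isIndecomposable_of_glued hg fun v hv => ?_
  obtain ⟨c, rfl⟩ := Submodule.mem_span_singleton.1 hv
  rcases hw with ⟨h1, h2⟩ | ⟨h1, h2⟩
  · simp only [Prod.smul_fst, h1, smul_zero, Prod.smul_snd, h2]
    exact zero_mem _
  · convert hv
    · simp [h1]
    · simp [h2]

/-- Automorphisms of the bundle normalize the line W. If one of the second entries is zero, a
constant shear gives a string, or the module decomposes when both are. If neither is, a linear shear
for b₂ < b₁, or constant shears and a swap for b₁ = b₂, finish the reduction. -/
lemma Realizes.exists_isString_of_le (hle : b₂ ≤ b₁) {w : (k × k) × (k × k)}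
    (h : Realizes 𝓜 Φ (gluedSet (Submodule.span k {w}) b₁ b₂)) (hk : (2 : k) ≠ 0)
    (hg : IsGradedModule (k := k) 𝓜) (hw₁ : w.1 ≠ 0) (hw₂ : w.2 ≠ 0) (hind : IsIndecomposable k 𝓜) :
    ∃ ε : k, (ε = 1 ∨ ε = -1) ∧ ∃ d₁ d₂, IsString 𝓜 ε d₁ d₂ := by
  obtain ⟨⟨α₁, α₂⟩, ⟨β₁, β₂⟩⟩ := w
  have hgi := hg.isInternal
  have hC : ∀ c : k, Polynomial.C c ∈ polyLE k (b₁ - b₂) := fun c => C_mem_polyLE c (by omega)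
  by_cases hα : α₂ = 0
  · subst hα
    have hα₁ : α₁ ≠ 0 := fun h0 => hw₁ (Prod.ext h0 rfl)
    by_cases hβ : β₂ = 0
    · exact absurd hind (h.not_isIndecomposable_of_span hgi (Or.inr ⟨rfl, hβ⟩))
    · obtain ⟨Φ', h'⟩ := h.shear hgi (hC (β₁ / β₂))
      simp only [Polynomial.eval_C, mul_zero, sub_zero, div_mul_cancel₀ _ hβ, sub_self] at h'
      exact ⟨1, Or.inl rfl, _, _, h'.isString_of_span' hk hg hα₁ hβ⟩
  by_cases hβ : β₂ = 0
  · subst hβ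
    have hβ₁ : β₁ ≠ 0 := fun h0 => hw₂ (Prod.ext h0 rfl)
    obtain ⟨Φ', h'⟩ := h.shear hgi (hC (α₁ / α₂))
    simp only [Polynomial.eval_C, mul_zero, sub_zero, div_mul_cancel₀ _ hα, sub_self] at h'
    exact ⟨-1, Or.inr rfl, _, _, h'.isString_of_span hk hg hα hβ₁⟩
  rcases hle.lt_or_eq with hlt | rfl
  -- Since b₂ < b₁, a linear q is allowed, and the one with values α₁/α₂ at 1 and β₁/β₂ at -1 clears
  -- both first entries at once; the module then decomposes.
  · obtain ⟨Φ', h'⟩ := h.shear hgi (q := Polynomial.C ((α₁ / α₂ + β₁ / β₂) / 2) +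
      Polynomial.C ((α₁ / α₂ - β₁ / β₂) / 2) * 𝕥) (add_mem (hC _) (C_mul_mem_polyLE _
        (X_mem_polyLE (by omega))))
    refine absurd hind (h'.not_isIndecomposable_of_span hgi (Or.inl ⟨?_, ?_⟩)) <;>
    · simp
      field_simp
      ring
  · obtain ⟨Φ', h'⟩ := h.shear hgi (hC (α₁ / α₂))
    simp only [Polynomial.eval_C, div_mul_cancel₀ _ hα, sub_self] at h'
    by_cases hβ' : β₁ - α₁ / α₂ * β₂ = 0
    · exact absurd hind (h'.not_isIndecomposable_of_span hgi (Or.inl ⟨rfl, hβ'⟩))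
    obtain ⟨Φ₁, h₁⟩ := h'.swap hgi
    obtain ⟨Φ₂, h₂⟩ := h₁.shear hgi (hC (β₂ / (β₁ - α₁ / α₂ * β₂)))
    simp only [Prod.fst_swap, Prod.snd_swap, Polynomial.eval_C, div_mul_cancel₀ _ hβ', sub_self, mul_zero,
      sub_zero] at h₂
    exact ⟨1, Or.inl rfl, _, _, h₂.isString_of_span' hk hg hα hβ'⟩

lemma Realizes.exists_isString {w : (k × k) × (k × k)}
    (h : Realizes 𝓜 Φ (gluedSet (Submodule.span k {w}) b₁ b₂)) (hk : (2 : k) ≠ 0)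
    (hg : IsGradedModule (k := k) 𝓜) (hw₁ : w.1 ≠ 0) (hw₂ : w.2 ≠ 0) (hind : IsIndecomposable k 𝓜) :
    ∃ ε : k, (ε = 1 ∨ ε = -1) ∧ ∃ d₁ d₂, IsString 𝓜 ε d₁ d₂ := by
  rcases le_total b₂ b₁ with hle | hle
  · exact h.exists_isString_of_le hle hk hg hw₁ hw₂ hind
  · obtain ⟨Φ', h'⟩ := h.swap hg.isInternal
    have hs : ∀ {a : k × k}, a ≠ 0 → a.swap ≠ 0 := fun ha h0 =>
      ha (Prod.ext (congrArg Prod.snd h0) (congrArg Prod.fst h0))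
    exact h'.exists_isString_of_le hle hk hg (hs hw₁) (hs hw₂) hind

/-- A graded, indecomposable MCM module of rank two that is not locally free is a string module. -/
theorem IsTarget.exists_isString (h : IsTarget k 𝓜) (hk : (2 : k) ≠ 0) :
    ∃ ε : k, (ε = 1 ∨ ε = -1) ∧ ∃ d₁ d₂, IsString 𝓜 ε d₁ d₂ := by
  have hg := h.gradedMCM.1
  obtain ⟨W, b₁, b₂, Φ, hΦ, hW₁, hW₂⟩ := h.gradedMCM.exists_gluedSet hk h.rank_eq
  let f : W →ₗ[k] k × k := (LinearMap.fst k (k × k) (k × k)).comp W.subtype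
  let g : W →ₗ[k] k × k := (LinearMap.snd k (k × k) (k × k)).comp W.subtype
  have hf : Function.Injective f := (injective_iff_map_eq_zero f).2 fun w hw => Subtype.ext (hW₁ w w.2 hw)
  have hgi : Function.Injective g := (injective_iff_map_eq_zero g).2 fun w hw => Subtype.ext (hW₂ w w.2 hw)
  have h2 : Module.finrank k (k × k) = 2 := by simp
  have hle : Module.finrank k W ≤ 2 := h2 ▸ LinearMap.finrank_le_finrank_of_injective hf
  -- The dimension of W separates the three kinds of module: decomposable when it is 0, string or
  -- decomposable when it is 1, locally free when it is 2.
  interval_cases hr : Module.finrank k W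
  · refine absurd h.indecomposable (hΦ.not_isIndecomposable_of_glued hg.isInternal fun w hw => ?_)
    rw [Submodule.finrank_eq_zero.1 hr, Submodule.mem_bot] at hw ⊢
    simp [hw]
  · obtain ⟨⟨w, hw⟩, hw0, hspan⟩ := finrank_eq_one_iff'.1 hr
    have hw0' : w ≠ 0 := fun h0 => hw0 (Subtype.ext h0)
    have hWs : W = Submodule.span k {w} := by
      refine le_antisymm (fun x hx => ?_) ((Submodule.span_singleton_le_iff_mem _ _).2 hw)
      obtain ⟨c, hc⟩ := hspan ⟨x, hx⟩
      exact Submodule.mem_span_singleton.2 ⟨c, congrArg Subtype.val hc⟩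
    rw [hWs] at hΦ
    exact hΦ.exists_isString hk hg (fun h0 => hw0' (hW₁ w hw h0)) (fun h0 => hw0' (hW₂ w hw h0))
      h.indecomposable
  -- Both projections of W to k² are now isomorphisms, so W is the graph of an invertible map whose
  -- columns are the values at -1 of the elements over (1, 0) and (0, 1).
  · have hfs : Function.Surjective f :=
      (LinearMap.injective_iff_surjective_of_finrank_eq_finrank (hr.trans h2.symm)).1 hf
    obtain ⟨u, hu⟩ := hfs (1, 0)
    obtain ⟨v, hv⟩ := hfs (0, 1)
    have hu' : u.1.1 = (1, 0) := hu
    have hv' : v.1.1 = (0, 1) := hv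
    have huv : ∀ w : W, w = w.1.1.1 • u + w.1.1.2 • v := by
      intro w
      apply hf
      rw [map_add, map_smul, map_smul, hu, hv]
      ext1 <;> simp [f]
    refine absurd (hΦ.isLocallyFree hk hg.isInternal (g₁ := u.1.2) (g₂ := v.1.2) ?_ fun w => ⟨?_, ?_⟩)
      h.not_locallyFree
    · intro h0
      have key : ∀ a b : k, g (a • u + b • v) = 0 → a = 0 ∧ b = 0 := by
        intro a b hab
        have e : f (a • u + b • v) = 0 := by
          rw [(map_eq_zero_iff g hgi).1 hab, map_zero]
        rw [map_add, map_smul, map_smul, hu, hv] at e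
        simpa using e
      have e1 := key v.1.2.1 (-u.1.2.1) (Prod.ext (by simp [g]; ring)
        (by simp [g]; linear_combination -h0))
      have e2 := key v.1.2.2 (-u.1.2.2) (Prod.ext (by simp [g]; linear_combination h0)
        (by simp [g]; ring))
      have e3 := key 1 0 (Prod.ext (by simpa [g] using e1.2) (by simpa [g] using e2.2))
      exact one_ne_zero e3.1
    · intro hw
      exact congrArg (fun x : W => x.1.2) (huv ⟨w, hw⟩)
    · intro hw
      have : w = w.1.1 • u.1 + w.1.2 • v.1 := Prod.ext (by ext1 <;> simp [hu', hv']) hw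
      rw [this]
      exact add_mem (W.smul_mem _ u.2) (W.smul_mem _ v.2)

end

end

end NodalCone

theorem mainTheorem2 {k : Type u} [Field k] (hk : (2 : k) ≠ 0) :
    (∀ A : NodalCone.DegMatrix k, NodalCone.IsListedOrTranspose A →
      A.IsHomogeneous ∧ NodalCone.IsTarget k A.cokerGrading ∧
        NodalCone.IsExtensionOfRankOne k A.cokerGrading) ∧
    (∀ (M : Type v) [AddCommGroup M] [Module (NodalCone.Cone k) M] (𝓜 : ℤ → AddSubgroup M),
      NodalCone.IsTarget k 𝓜 →
        ∃ A : NodalCone.DegMatrix k, NodalCone.IsListedOrTranspose A ∧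
          NodalCone.IsIsoUpToShift k 𝓜 A.cokerGrading) := by
  refine ⟨fun A hA => hA.isTarget hk, fun M _ _ 𝓜 h => ?_⟩
  have : Module.Finite (NodalCone.Cone k) M := h.gradedMCM.2.1
  obtain ⟨ε, hε, d₁, d₂, hs⟩ := h.exists_isString hk
  exact hs.exists_isListedOrTranspose hk hε h.minGenerators
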